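/- Let $n\ge 3$, $\alpha_n=\frac{n-1}{n-2}$, and let $(M,g)$ be an $n$-dimensional complete Riemannian manifold with bounded geometry: its injectivity radius is bounded below by some $\eta>0$, and for every integer $j\ge 0$ there is $C_j>0$ with $|\nabla_g^j\mathrm{Rm}_g|_g<C_j$ on $M$. Let $T>0$, $w,f\in C^\infty(M)$, and let $(\psi_t)_{t<T}$ be a smooth one-parameter family of diffeomorphisms of $M$ with $\partial_t\psi_t=\frac{1}{T-t}(\nabla_g f)\circ\psi_t$ and $\psi_{T-1}=\mathrm{id}$. Suppose that $\overline g(t)=(T-t)\psi_t^*g$, $\overline w(t)=\psi_t^*w$ is a (shrinking self-similar) solution of the extended Ricci flow $$\partial_t\overline g=-2\,\mathrm{Ric}_{\overline g}+2\alpha_n\,d\overline w\otimes d\overline w,\qquad \partial_t\overline w=\Delta_{\overline g}\overline w\qquad\text{on } M\times(-\infty,T),$$ with potential function $\overline f(t)=\psi_t^*f$, and that for every integer $j\ge 0$ there is $C_j'>0$ with $|\nabla_g^j(dw\otimes dw)|_g\le C_j'$ on $M$. Let $\Sigma$ be an $(n-1)$-dimensional compact smooth manifold without boundary, and let $x_t:\Sigma\to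 M$, $t\in[0,T)$, be a smooth one-parameter family of immersions that evolves by the mean curvature flow $\partial_t x_t=H e$ in $(M,\overline g(t))$, where $H$ and $e$ are the mean curvature and the unit normal of $\Sigma_t=(\Sigma,x_t^*\overline g(t))$. Suppose that the flow develops a singularity of type I: there is a constant $C>1$ such that $\max_{p\in\Sigma}|\mathcal A(p,t)|\le \frac{C}{\sqrt{T-t}}$ for all $t\in[0,T)$, where $\mathcal A(\cdot,t)$ is the second fundamental form of $\Sigma_t$. Consider the normalized flow $\widetilde x_s=\psi_t\circ x_t$, $s=-\log(T-t)\in[-\log T,\infty)$. Then for every integer $k\ge 0$ there is a constant $C_k>0$, independent of $s$, such that $$|\widehat\nabla_g^k\mathcal A(\widetilde x_s)|_g\le C_k\quad\text{on }\Sigma\times[-\log T,\infty),$$ where $\mathcal A(\widetilde x_s)$ is the second fundamental form of $\widetilde x_s:\Sigma\to(M,g)$ and $\widehat\nabla_g$ is defined from the Levi-Civita connection of $(\Sigma,\widetilde x_s^*g)$. -/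

import Mathlib

open Set Filter
open scoped Manifold ContDiff Topology ENNReal

noncomputable section

namespace ExtRicciMCF

/-! ### Tensor calculus in local coordinates

A metric on a coordinate domain is given by its matrix of components `G y i j`, a covariant tensor
field of rank `r` by its components `T y I`, where `I : Fin r → Fin n` is a multi-index. -/

/-- Partial derivative in the `i`-th coordinate direction. -/
def pd {n : ℕ} {F : Type*} [NormedAddCommGroup F] [NormedSpace ℝ F] (i : Fin n)
    (u : EuclideanSpace ℝ (Fin n) → F) (y : EuclideanSpace ℝ (Fin n)) : F :=
  fderiv ℝ u y (EuclideanSpace.single i 1)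

/-- Christoffel symbols `Γ^k_{ij}` of the Levi-Civita connection of `G`. -/
def christoffel {n : ℕ} (G : EuclideanSpace ℝ (Fin n) → Matrix (Fin n) (Fin n) ℝ)
    (y : EuclideanSpace ℝ (Fin n)) (k i j : Fin n) : ℝ :=
  (1 / 2) * ∑ l, (G y)⁻¹ k l *
    (pd i (fun z => G z j l) y + pd j (fun z => G z i l) y - pd l (fun z => G z i j) y)

/-- Components of the covariant derivative `∇T` of a covariant tensor field; the new
(differentiation) index is the first one. -/
def covDeriv {n r : ℕ} (G : EuclideanSpace ℝ (Fin n) → Matrix (Fin n) (Fin n) ℝ)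
    (T : EuclideanSpace ℝ (Fin n) → (Fin r → Fin n) → ℝ) :
    EuclideanSpace ℝ (Fin n) → (Fin (r + 1) → Fin n) → ℝ :=
  fun y I => pd (I 0) (fun z => T z (Fin.tail I)) y -
    ∑ s : Fin r, ∑ l : Fin n,
      christoffel G y l (I 0) (I s.succ) * T y (Function.update (Fin.tail I) s l)

/-- The iterated covariant derivative `∇^k T`. -/
def iterCovDeriv {n r : ℕ} (G : EuclideanSpace ℝ (Fin n) → Matrix (Fin n) (Fin n) ℝ)
    (T : EuclideanSpace ℝ (Fin n) → (Fin r → Fin n) → ℝ) :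
    (k : ℕ) → EuclideanSpace ℝ (Fin n) → (Fin (r + k) → Fin n) → ℝ
  | 0 => T
  | k + 1 => covDeriv G (iterCovDeriv G T k)

/-- Norm of a covariant tensor `T` with respect to the inner product with matrix `A`:
`|T|² = A^{i₁j₁} ⋯ A^{iᵣjᵣ} T_{i₁…iᵣ} T_{j₁…jᵣ}`. -/
def tensorNorm {n r : ℕ} (A : Matrix (Fin n) (Fin n) ℝ) (T : (Fin r → Fin n) → ℝ) : ℝ :=
  Real.sqrt (∑ I : Fin r → Fin n, ∑ J : Fin r → Fin n, (∏ s, A⁻¹ (I s) (J s)) * T I * T J)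

/-- Components `R^l_{ijk}` of the curvature `R(∂ᵢ, ∂ⱼ)∂ₖ = ∇ᵢ∇ⱼ∂ₖ - ∇ⱼ∇ᵢ∂ₖ = R^l_{ijk} ∂ₗ`. -/
def curv {n : ℕ} (G : EuclideanSpace ℝ (Fin n) → Matrix (Fin n) (Fin n) ℝ)
    (y : EuclideanSpace ℝ (Fin n)) (l i j k : Fin n) : ℝ :=
  pd i (fun z => christoffel G z l j k) y - pd j (fun z => christoffel G z l i k) y +
    ∑ p, (christoffel G y p j k * christoffel G y l i p -
      christoffel G y p i k * christoffel G y l j p)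

/-- The Riemann curvature tensor `Rm`, as a covariant tensor of rank four. -/
def riemann {n : ℕ} (G : EuclideanSpace ℝ (Fin n) → Matrix (Fin n) (Fin n) ℝ)
    (y : EuclideanSpace ℝ (Fin n)) (I : Fin 4 → Fin n) : ℝ :=
  ∑ p, G y p (I 3) * curv G y p (I 0) (I 1) (I 2)

/-- The Ricci tensor (positive on round spheres). -/
def ricci {n : ℕ} (G : EuclideanSpace ℝ (Fin n) → Matrix (Fin n) (Fin n) ℝ)
    (y : EuclideanSpace ℝ (Fin n)) (j k : Fin n) : ℝ :=
  ∑ i, curv G y i i j k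

/-- The differential of a function, as a tensor of rank one. -/
def diff1 {n : ℕ} (w : EuclideanSpace ℝ (Fin n) → ℝ)
    (y : EuclideanSpace ℝ (Fin n)) (I : Fin 1 → Fin n) : ℝ :=
  pd (I 0) w y

/-- The tensor `dw ⊗ dw`. -/
def diffSq {n : ℕ} (w : EuclideanSpace ℝ (Fin n) → ℝ)
    (y : EuclideanSpace ℝ (Fin n)) (I : Fin 2 → Fin n) : ℝ :=
  pd (I 0) w y * pd (I 1) w y

/-- The Laplacian: trace of the Hessian `∇dw`. -/
def laplacian {n : ℕ} (G : EuclideanSpace ℝ (Fin n) → Matrix (Fin n) (Fin n) ℝ)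
    (w : EuclideanSpace ℝ (Fin n) → ℝ) (y : EuclideanSpace ℝ (Fin n)) : ℝ :=
  ∑ i, ∑ j, (G y)⁻¹ i j * covDeriv G (diff1 w) y ![i, j]

/-! ### Hypersurfaces in local coordinates

`u` is a parametrized hypersurface of the coordinate domain on which `G` lives. -/

/-- The induced metric `u^* G`. -/
def inducedMetric {m : ℕ}
    (G : EuclideanSpace ℝ (Fin (m + 1)) → Matrix (Fin (m + 1)) (Fin (m + 1)) ℝ)
    (u : EuclideanSpace ℝ (Fin m) → EuclideanSpace ℝ (Fin (m + 1)))
    (y : EuclideanSpace ℝ (Fin m)) : Matrix (Fin m) (Fin m) ℝ :=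
  Matrix.of fun i j => ∑ a, ∑ b, G (u y) a b * pd i u y a * pd j u y b

/-- The conormal covector `v ↦ det (v, ∂₁u, …, ∂ₘu)` (it annihilates the tangent space). -/
def conormal {m : ℕ}
    (u : EuclideanSpace ℝ (Fin m) → EuclideanSpace ℝ (Fin (m + 1)))
    (y : EuclideanSpace ℝ (Fin m)) (b : Fin (m + 1)) : ℝ :=
  Matrix.det (Matrix.of (Fin.cons (Pi.single b 1) (fun (i : Fin m) (a : Fin (m + 1)) => pd i u y a) :
    Fin (m + 1) → Fin (m + 1) → ℝ))

/-- The unit normal of `u` with respect to `G`, with the sign fixed by the coordinates: the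
metric dual of the conormal, normalized. -/
def unitNormal {m : ℕ}
    (G : EuclideanSpace ℝ (Fin (m + 1)) → Matrix (Fin (m + 1)) (Fin (m + 1)) ℝ)
    (u : EuclideanSpace ℝ (Fin m) → EuclideanSpace ℝ (Fin (m + 1)))
    (y : EuclideanSpace ℝ (Fin m)) : EuclideanSpace ℝ (Fin (m + 1)) :=
  WithLp.toLp 2 fun a => (∑ b, (G (u y))⁻¹ a b * conormal u y b) /
    Real.sqrt (∑ c, ∑ d, (G (u y))⁻¹ c d * conormal u y c * conormal u y d)

/-- The second fundamental form `𝒜(∂ᵢ, ∂ⱼ) = ⟨∇_{∂ᵢu} ∂ⱼu, e⟩`, with `e` the unit normal. -/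
def secondFund {m : ℕ}
    (G : EuclideanSpace ℝ (Fin (m + 1)) → Matrix (Fin (m + 1)) (Fin (m + 1)) ℝ)
    (u : EuclideanSpace ℝ (Fin m) → EuclideanSpace ℝ (Fin (m + 1)))
    (y : EuclideanSpace ℝ (Fin m)) (I : Fin 2 → Fin m) : ℝ :=
  ∑ a, ∑ b, G (u y) a b *
    (pd (I 0) (pd (I 1) u) y a +
      ∑ c, ∑ d, christoffel G (u y) a c d * pd (I 0) u y c * pd (I 1) u y d) *
    unitNormal G u y b

/-- The mean curvature: trace of the second fundamental form in the induced metric. -/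
def meanCurv {m : ℕ}
    (G : EuclideanSpace ℝ (Fin (m + 1)) → Matrix (Fin (m + 1)) (Fin (m + 1)) ℝ)
    (u : EuclideanSpace ℝ (Fin m) → EuclideanSpace ℝ (Fin (m + 1)))
    (y : EuclideanSpace ℝ (Fin m)) : ℝ :=
  ∑ i, ∑ j, (inducedMetric G u y)⁻¹ i j * secondFund G u y ![i, j]

/-! ### Riemannian manifolds

Every quantity below at a point `p` is computed in the preferred chart at `p`; it does not depend
on the chart. -/

/-- Smooth Riemannian metrics on the `n`-dimensional manifold `M`. -/
abbrev RMetric (n : ℕ) (M : Type*) [TopologicalSpace M]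
    [ChartedSpace (EuclideanSpace ℝ (Fin n)) M] [IsManifold (𝓡 n) ∞ M] :=
  Bundle.ContMDiffRiemannianMetric (𝓡 n) ∞ (EuclideanSpace ℝ (Fin n))
    (fun p : M => TangentSpace (𝓡 n) p)

section Manifold

variable {n : ℕ} {M : Type*} [TopologicalSpace M] [ChartedSpace (EuclideanSpace ℝ (Fin n)) M]

/-- Coordinates of `p` in the preferred chart at `p`. -/
def ctr (n : ℕ) {M : Type*} [TopologicalSpace M] [ChartedSpace (EuclideanSpace ℝ (Fin n)) M]
    (p : M) : EuclideanSpace ℝ (Fin n) :=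
  chartAt (EuclideanSpace ℝ (Fin n)) p p

/-- A function on `M` written in the chart at `p`. -/
def chartFun (w : M → ℝ) (p : M) (y : EuclideanSpace ℝ (Fin n)) : ℝ :=
  w ((chartAt (EuclideanSpace ℝ (Fin n)) p).symm y)

variable [IsManifold (𝓡 n) ∞ M]

/-- Components `g(∂ᵢ, ∂ⱼ)` of the metric in the chart at `p`. -/
def chartMetric (g : RMetric n M) (p : M) (y : EuclideanSpace ℝ (Fin n)) :
    Matrix (Fin n) (Fin n) ℝ :=
  Matrix.of fun i j =>
    g.inner ((chartAt (EuclideanSpace ℝ (Fin n)) p).symm y)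
      (mfderiv (𝓡 n) (𝓡 n) (chartAt (EuclideanSpace ℝ (Fin n)) p).symm y
        (EuclideanSpace.single i (1 : ℝ) : EuclideanSpace ℝ (Fin n)))
      (mfderiv (𝓡 n) (𝓡 n) (chartAt (EuclideanSpace ℝ (Fin n)) p).symm y
        (EuclideanSpace.single j (1 : ℝ) : EuclideanSpace ℝ (Fin n)))

/-- `|∇^k Rm|` at `p`. -/
def normCovRm (g : RMetric n M) (k : ℕ) (p : M) : ℝ :=
  tensorNorm (chartMetric g p (ctr n p))
    (iterCovDeriv (chartMetric g p) (riemann (chartMetric g p)) k (ctr n p))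

/-- `|∇^k (dw ⊗ dw)|` at `p`. -/
def normCovDiffSq (g : RMetric n M) (w : M → ℝ) (k : ℕ) (p : M) : ℝ :=
  tensorNorm (chartMetric g p (ctr n p))
    (iterCovDeriv (chartMetric g p) (diffSq (chartFun w p)) k (ctr n p))

/-- `γ` is a geodesic, defined on the whole real line. -/
def IsGeodesic (g : RMetric n M) (γ : ℝ → M) : Prop :=
  ContMDiff 𝓘(ℝ, ℝ) (𝓡 n) ∞ γ ∧
  ∀ (t : ℝ) (k : Fin n),
    let c : ℝ → EuclideanSpace ℝ (Fin n) :=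
      fun τ => chartAt (EuclideanSpace ℝ (Fin n)) (γ t) (γ τ)
    deriv (deriv c) t k +
      ∑ i, ∑ j, christoffel (chartMetric g (γ t)) (c t) k i j * deriv c t i * deriv c t j = 0

/-- `γ` is the geodesic issuing from `p` with velocity `v`; the tangent space at `p` is
identified with Euclidean space by the chart at `p`, as everywhere in Mathlib. -/
def IsGeodesicFrom (g : RMetric n M) (p : M) (v : EuclideanSpace ℝ (Fin n)) (γ : ℝ → M) : Prop :=
  IsGeodesic g γ ∧ γ 0 = p ∧
    HasDerivAt (fun τ => chartAt (EuclideanSpace ℝ (Fin n)) p (γ τ)) v 0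

/-- (Geodesic) completeness: the exponential map is defined on the whole tangent bundle. -/
def IsComplete (g : RMetric n M) : Prop :=
  ∀ (p : M) (v : EuclideanSpace ℝ (Fin n)), ∃ γ : ℝ → M, IsGeodesicFrom g p v γ

open Classical in
/-- The exponential map `exp_p v = γ_v(1)` (with a dummy value if `γ_v` is not defined on `ℝ`,
which does not occur on complete manifolds). -/
def expMap (g : RMetric n M) (p : M) (v : EuclideanSpace ℝ (Fin n)) : M :=
  if h : ∃ γ : ℝ → M, IsGeodesicFrom g p v γ then h.choose 1 else p

/-- The ball of radius `r` about the origin of `T_p M`. -/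
def tangentBall (g : RMetric n M) (p : M) (r : ℝ) : Set (EuclideanSpace ℝ (Fin n)) :=
  {v | g.inner p (v : TangentSpace (𝓡 n) p) (v : TangentSpace (𝓡 n) p) < r ^ 2}

/-- The injectivity radius at `p`: the supremum of the radii `r` such that `exp_p` is a
diffeomorphism from the ball of radius `r` onto its image. -/
def injRadiusAt (g : RMetric n M) (p : M) : ℝ≥0∞ :=
  ⨆ (r : ℝ) (_ : 0 < r ∧ Set.InjOn (expMap g p) (tangentBall g p r) ∧
    IsLocalDiffeomorphOn (𝓡 n) (𝓡 n) ∞ (expMap g p) (tangentBall g p r)), ENNReal.ofReal r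

/-- The injectivity radius of `(M, g)`. -/
def injRadius (g : RMetric n M) : ℝ≥0∞ := ⨅ p : M, injRadiusAt g p

/-- Bounded geometry. -/
structure HasBoundedGeometry (g : RMetric n M) : Prop where
  complete : IsComplete g
  curvature_bound : ∀ j : ℕ, ∃ C : ℝ, 0 < C ∧ ∀ p : M, normCovRm g j p < C
  inj_bound : ∃ η : ℝ, 0 < η ∧ ENNReal.ofReal η ≤ injRadius g

/-- The constant `αₙ = (n - 1) / (n - 2)`. -/
def alpha (n : ℕ) : ℝ := ((n : ℝ) - 1) / ((n : ℝ) - 2)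

/-- The equations of the extended Ricci flow on `M × J`:
`∂g/∂t = -2 Ric + 2 αₙ dw ⊗ dw`, `∂w/∂t = Δ w`. -/
def SolvesExtendedRicciFlow (J : Set ℝ) (g : ℝ → RMetric n M) (w : ℝ → M → ℝ) : Prop :=
  ∀ t ∈ J, ∀ p : M,
    (∀ i j : Fin n, HasDerivAt (fun τ => chartMetric (g τ) p (ctr n p) i j)
      (-2 * ricci (chartMetric (g t) p) (ctr n p) i j +
        2 * alpha n * diffSq (chartFun (w t) p) (ctr n p) ![i, j]) t) ∧
    HasDerivAt (fun τ => w τ p)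
      (laplacian (chartMetric (g t) p) (chartFun (w t) p) (ctr n p)) t

/-- `(gbar, wbar)` is the shrinking self-similar solution, on the time interval `(-∞, T)`, of the
extended Ricci flow with initial value `(g, w)` and potential function `fbar t = f ∘ ψ t`:
`gbar t = (T - t) ψ_t^* g`, `wbar t = ψ_t^* w`, where `ψ_t` is the smooth one-parameter family of
diffeomorphisms generated by `∇_g f / (T - t)`, with `ψ_{T - 1} = id`. Values of `ψ`, `gbar`,
`wbar` at times `t ≥ T` are irrelevant. -/
structure IsShrinkingSelfSimilar (T : ℝ) (g : RMetric n M) (w f : M → ℝ)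
    (ψ : ℝ → M ≃ₘ^∞⟮𝓡 n, 𝓡 n⟯ M) (gbar : ℝ → RMetric n M) (wbar : ℝ → M → ℝ) : Prop where
  smooth_w : ContMDiff (𝓡 n) 𝓘(ℝ, ℝ) ∞ w
  smooth_f : ContMDiff (𝓡 n) 𝓘(ℝ, ℝ) ∞ f
  smooth_ψ : ContMDiffOn (𝓘(ℝ, ℝ).prod (𝓡 n)) (𝓡 n) ∞
    (fun q : ℝ × M => ψ q.1 q.2) (Iio T ×ˢ univ)
  ψ_init : ∀ p : M, ψ (T - 1) p = p
  ψ_flow : ∀ t < T, ∀ (p : M) (v : TangentSpace (𝓡 n) (ψ t p)),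
    (T - t) * g.inner (ψ t p) (mfderiv 𝓘(ℝ, ℝ) (𝓡 n) (fun τ => ψ τ p) t (1 : ℝ)) v =
      mfderiv (𝓡 n) 𝓘(ℝ, ℝ) f (ψ t p) v
  gbar_eq : ∀ t < T, ∀ (p : M) (v v' : TangentSpace (𝓡 n) p),
    (gbar t).inner p v v' = (T - t) *
      g.inner (ψ t p) (mfderiv (𝓡 n) (𝓡 n) (ψ t) p v) (mfderiv (𝓡 n) (𝓡 n) (ψ t) p v')
  wbar_eq : ∀ t < T, ∀ p : M, wbar t p = w (ψ t p)
  flow : SolvesExtendedRicciFlow (Iio T) gbar wbar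

end Manifold

/-! ### Immersed hypersurfaces and mean curvature flow -/

section Hypersurface

variable {m : ℕ} {M : Type*} [TopologicalSpace M]
  [ChartedSpace (EuclideanSpace ℝ (Fin (m + 1))) M]
  {S : Type*} [TopologicalSpace S] [ChartedSpace (EuclideanSpace ℝ (Fin m)) S]

/-- The map `x : S → M` in the charts at `p` and at `x p`. -/
def localRep (x : S → M) (p : S) (y : EuclideanSpace ℝ (Fin m)) :
    EuclideanSpace ℝ (Fin (m + 1)) :=
  chartAt (EuclideanSpace ℝ (Fin (m + 1))) (x p)
    (x ((chartAt (EuclideanSpace ℝ (Fin m)) p).symm y))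

variable [IsManifold (𝓡 (m + 1)) ∞ M]

/-- `|∇̂^k 𝒜(x)|` at `p`, where `𝒜(x)` is the second fundamental form of the immersion
`x : S → (M, g)`; the connection `∇̂` and the norm are those of `(S, x^* g)`. -/
def normCovSecondFund (g : RMetric (m + 1) M) (x : S → M) (k : ℕ) (p : S) : ℝ :=
  tensorNorm (inducedMetric (chartMetric g (x p)) (localRep x p) (ctr m p))
    (iterCovDeriv (inducedMetric (chartMetric g (x p)) (localRep x p))
      (secondFund (chartMetric g (x p)) (localRep x p)) k (ctr m p))

/-- `x t`, `t ∈ [0, T)`, is a smooth family of immersions evolving by the mean curvature flow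
`∂x/∂t = H e` in the ambient manifold `M` with the time-dependent metric `gbar t`. (The product
`H e` does not depend on the sign of the unit normal `e`.) -/
structure IsMCF (T : ℝ) (gbar : ℝ → RMetric (m + 1) M) (x : ℝ → S → M) : Prop where
  smooth : ContMDiffOn (𝓘(ℝ, ℝ).prod (𝓡 m)) (𝓡 (m + 1)) ∞
    (fun q : ℝ × S => x q.1 q.2) (Ico 0 T ×ˢ univ)
  immersion : ∀ t ∈ Ico 0 T, ∀ p : S,
    Function.Injective (mfderiv (𝓡 m) (𝓡 (m + 1)) (x t) p)
  evolution : ∀ t ∈ Ico 0 T, ∀ p : S,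
    HasDerivWithinAt (fun τ => chartAt (EuclideanSpace ℝ (Fin (m + 1))) (x t p) (x τ p))
      (meanCurv (chartMetric (gbar t) (x t p)) (localRep (x t) p) (ctr m p) •
        unitNormal (chartMetric (gbar t) (x t p)) (localRep (x t) p) (ctr m p))
      (Ico 0 T) t

/-- The flow develops a singularity of type I (at time `T`). -/
def IsTypeI (T : ℝ) (gbar : ℝ → RMetric (m + 1) M) (x : ℝ → S → M) : Prop :=
  ∃ C : ℝ, 1 < C ∧ ∀ t ∈ Ico 0 T, ∀ p : S,
    normCovSecondFund (gbar t) (x t) 0 p ≤ C / Real.sqrt (T - t)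

/-- The normalized flow `x̃_s = ψ_t ∘ x_t`, `s = -log (T - t)`, i.e. `t = T - e^{-s}`. -/
def normalizedFlow (T : ℝ) (ψ : ℝ → M ≃ₘ^∞⟮𝓡 (m + 1), 𝓡 (m + 1)⟯ M) (x : ℝ → S → M) (s : ℝ) :
    S → M :=
  fun p => ψ (T - Real.exp (-s)) (x (T - Real.exp (-s)) p)

end Hypersurface

end ExtRicciMCF

end

open ExtRicciMCF

open Set Filter
open scoped Manifold ContDiff Topology ENNReal

set_option linter.unusedSectionVars false

noncomputable section

/-! The normalized flow is not studied in the fixed metric `g`, where it would move by its mean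
curvature together with a drift along `∇f`. With `t = T - e^{-s}` one has `e^s ḡ(t) = ψ_t^* g`, so
`|∇^k 𝒜|` of `ψ_t ∘ x_t` in `g` equals `|∇^k 𝒜|` of `x_t` in the moving metric `e^s ḡ(t)`
(`amet_isom`, `normCov_sq`). In the time `s` the maps `x_t` evolve by mean curvature in this moving
metric, with no drift (`flow_eq`), and the extended Ricci flow gives the velocity of the metric as
the metric itself `- 2 Ric + 2 αₙ dw ⊗ dw` (`amet_fderiv`). All these metrics are isometric to `g`,
so the assumptions on `g` and `w` bound every covariant derivative of the ambient curvature and of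
the ambient velocity uniformly in `s` (`UL.amb_rm`, `UL.avel`).

Order zero is the type I condition: multiplying the metric by `e^s` multiplies `|𝒜|²` by `e^{-s} = T
- t` (`normCov_zero_le`). Higher orders follow by induction. By Simons' identity `𝒜` solves a heat
equation with a source (`Imm.Flow.heat`), and so do its covariant derivatives (`Heat.nab`). If the
derivatives of order at most `k` are bounded, then the source of `∇^k 𝒜` is bounded and that of
`∇^{k+1} 𝒜` is at most linear in `∇^{k+1} 𝒜`. By Bochner's formula `(∂_s - Δ)|∇^{k+1} 𝒜|² ≤ C (1 +
|∇^{k+1} 𝒜|²)`, while `(∂_s - Δ)|∇^k 𝒜|² ≤ C - 2 |∇^{k+1} 𝒜|²`. Hence for large `N` the function `Φ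
= |∇^{k+1} 𝒜|² + N |∇^k 𝒜|²` satisfies `(∂_s - Δ)Φ ≤ C - |∇^{k+1} 𝒜|²` (`Imm.exists_heat_bound`). At
a maximum of `Φ` over a time interval times the compact hypersurface, attained after the initial
time, the left side is nonnegative; this bounds `∇^{k+1} 𝒜` there and hence `Φ` everywhere. At the
initial time `Φ` is bounded by compactness (`exists_normCov_succ_le`).

The dependence of the sources on the highest derivative is tracked by the predicate `UL` with weight
`b = 1 + |∇^{k+1} 𝒜|`: covariant derivatives below the top order are bounded, and the top one is at
most a multiple of `b`. This class is stable under sums, contractions and, from order one on,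
products. Ambient tensors enter through their components in the frame formed by the tangent vectors
and the normal; the frame rotates by `𝒜` itself, so these components are controlled to one order
more than `𝒜` (`UL.frame`).

The calculus is done for components over arbitrary finite index types, on open sets with constant
directions of differentiation that need not span. This allows a moving hypersurface to be treated as
one map of space-time, differentiated covariantly in the spatial directions only, with time as one
more constant direction. Since every quantity on the manifold is defined in the preferred chart at a
point, naturality under isometries and changes of charts (`hyp_iso`) links the coordinate
expressions. -/

namespace ExtRicciMCF

/-! ### Covariant tensors with slots and indices in finite types: pullback, norm, contraction -/

section Algebra

variable {D D' D'' : Type} [Fintype D] [DecidableEq D] [Fintype D'] [DecidableEq D']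
  [Fintype D''] [DecidableEq D'']
  {ι κ : Type} [Fintype ι] [DecidableEq ι] [Fintype κ] [DecidableEq κ]

/-- Multi-index with a new first entry. -/
def ocons (j : D) (I : ι → D) : Option ι → D := fun o => o.elim j I

@[simp] lemma ocons_none (j : D) (I : ι → D) : ocons j I none = j := rfl
@[simp] lemma ocons_some (j : D) (I : ι → D) (s : ι) : ocons j I (some s) = I s := rfl
@[simp] lemma ocons_comp_some (j : D) (I : ι → D) : ocons j I ∘ some = I := rfl
lemma ocons_eta (J : Option ι → D) : ocons (J none) (J ∘ some) = J := by
  ext o; cases o <;> rfl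
lemma update_ocons_some (j : D) (I : ι → D) (s : ι) (p : D) :
    Function.update (ocons j I) (some s) p = ocons j (Function.update I s p) := by
  ext o; cases o with
  | none => simp [Function.update]
  | some t => simp [Function.update, ocons]
lemma update_ocons_none (j : D) (I : ι → D) (p : D) :
    Function.update (ocons j I) none p = ocons p I := by
  ext o; cases o with
  | none => simp
  | some t => simp [Function.update, ocons]

lemma sum_option_fun {R : Type*} [AddCommMonoid R] (f : (Option ι → D) → R) :
    ∑ J, f J = ∑ j : D, ∑ I : ι → D, f (ocons j I) := by
  rw [← Fintype.sum_prod_type' (fun j I => f (ocons j I))]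
  refine (Fintype.sum_equiv
    ⟨fun x : D × (ι → D) => ocons x.1 x.2, fun J => (J none, J ∘ some), fun x => rfl,
      fun J => ocons_eta J⟩ _ _ fun x => rfl).symm

lemma sum_sum_fun {R : Type*} [AddCommMonoid R] (f : (ι ⊕ κ → D) → R) :
    ∑ J, f J = ∑ I : ι → D, ∑ K : κ → D, f (Sum.elim I K) := by
  rw [← Fintype.sum_prod_type' (fun I K => f (Sum.elim I K))]
  exact (Fintype.sum_equiv (Equiv.sumArrowEquivProdArrow ι κ D).symm _ _ fun x => rfl).symm

/-- Reindexing of a multi-index sum under a change of one entry. -/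
lemma sum_update_swap (s : ι) (f : (ι → D) → (ι → D) → ℝ) :
    ∑ I : ι → D, ∑ p : D, f I (Function.update I s p) =
      ∑ I : ι → D, ∑ p : D, f (Function.update I s p) I := by
  rw [← Fintype.sum_prod_type' (fun I p => f I (Function.update I s p)),
    ← Fintype.sum_prod_type' (fun I p => f (Function.update I s p) I)]
  -- The reindexing is the involution that exchanges the entry of `I` at `s` with `p`.
  refine Fintype.sum_equiv
    ⟨fun x : (ι → D) × D => (Function.update x.1 s x.2, x.1 s),
      fun x => (Function.update x.1 s x.2, x.1 s), fun x => by simp, fun x => by simp⟩ _ _ ?_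
  intro x; simp

/-- Reindexing of a multi-index sum under a change of one entry, with the two entries involved
made explicit. -/
lemma sum_update_swap' (s : ι) (f : (ι → D) → D → D → (ι → D) → ℝ) :
    ∑ I : ι → D, ∑ p : D, f I (I s) p (Function.update I s p) =
      ∑ I : ι → D, ∑ p : D, f (Function.update I s p) p (I s) I := by
  have := sum_update_swap s (fun I J => f I (I s) (J s) J)
  simpa using this

/-- The transformation of covariant tensors by a matrix. -/
def pull (P : Matrix D D' ℝ) (T : (ι → D) → ℝ) : (ι → D') → ℝ :=
  fun K => ∑ I : ι → D, (∏ s, P (I s) (K s)) * T I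

lemma pull_pull (P : Matrix D D' ℝ) (Q : Matrix D' D'' ℝ) (T : (ι → D) → ℝ) :
    pull Q (pull P T) = pull (P * Q) T := by
  ext L
  simp only [pull, Matrix.mul_apply, Finset.mul_sum, Finset.prod_univ_sum, Fintype.piFinset_univ,
    Finset.sum_mul]
  rw [Finset.sum_comm]
  refine Finset.sum_congr rfl fun I _ => Finset.sum_congr rfl fun K _ => ?_
  rw [Finset.prod_mul_distrib]; ring

lemma pull_one (T : (ι → D) → ℝ) : pull (1 : Matrix D D ℝ) T = T := by
  ext K
  rw [pull, Finset.sum_eq_single K]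
  · simp
  · intro I _ hI
    obtain ⟨s, hs⟩ := Function.ne_iff.1 hI
    rw [Finset.prod_eq_zero (Finset.mem_univ s) (by simp [hs]), zero_mul]
  · simp

lemma pull_add (P : Matrix D D' ℝ) (T S : (ι → D) → ℝ) : pull P (T + S) = pull P T + pull P S := by
  ext K; simp [pull, mul_add, Finset.sum_add_distrib]

lemma pull_smul (P : Matrix D D' ℝ) (c : ℝ) (T : (ι → D) → ℝ) :
    pull P (c • T) = c • pull P T := by
  ext K; simp [pull, Finset.mul_sum, mul_left_comm]

/-- Pullback by a matrix and by its transpose are adjoint for the componentwise pairing; in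
`ip_pull` this moves a change of frame from the tensors into the inverse metric. -/
lemma pull_dual (P : Matrix D D' ℝ) (T : (ι → D) → ℝ) (S : (ι → D') → ℝ) :
    ∑ K, pull P T K * S K = ∑ I, T I * pull P.transpose S I := by
  simp only [pull, Finset.sum_mul, Finset.mul_sum, Matrix.transpose_apply]
  rw [Finset.sum_comm]
  refine Finset.sum_congr rfl fun I _ => Finset.sum_congr rfl fun K _ => ?_
  ring

lemma pull_ocons (P : Matrix D D' ℝ) (T : (Option ι → D) → ℝ) (k : D') (K : ι → D') :
    pull P T (ocons k K) = ∑ j, P j k * pull P (fun I => T (ocons j I)) K := by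
  simp only [pull, sum_option_fun, Fintype.prod_option, ocons_none, ocons_some, Finset.mul_sum,
    mul_assoc]

/-- The pairing of covariant tensors by an inverse metric `B`. -/
def ip (B : Matrix D D ℝ) (T S : (ι → D) → ℝ) : ℝ :=
  ∑ I : ι → D, ∑ J : ι → D, (∏ s, B (I s) (J s)) * T I * S J

/-- The norm of a covariant tensor with respect to an inverse metric `B`. -/
def nrm (B : Matrix D D ℝ) (T : (ι → D) → ℝ) : ℝ := Real.sqrt (ip B T T)

lemma tensorNorm_eq_nrm {n r : ℕ} (A : Matrix (Fin n) (Fin n) ℝ) (T : (Fin r → Fin n) → ℝ) :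
    tensorNorm A T = nrm A⁻¹ T := rfl

lemma ip_eq_pull (B : Matrix D D ℝ) (T S : (ι → D) → ℝ) : ip B T S = ∑ J, pull B T J * S J := by
  simp only [ip, pull, Finset.sum_mul]
  rw [Finset.sum_comm]

lemma ip_pull (B : Matrix D' D' ℝ) (P : Matrix D D' ℝ) (T S : (ι → D) → ℝ) :
    ip B (pull P T) (pull P S) = ip (P * B * P.transpose) T S := by
  rw [ip_eq_pull, ip_eq_pull, pull_pull, ← pull_pull (P * B) P.transpose T]
  have := pull_dual P.transpose (pull (P * B) T) S
  rw [this, Matrix.transpose_transpose]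

lemma nrm_pull (B : Matrix D' D' ℝ) (P : Matrix D D' ℝ) (T : (ι → D) → ℝ) :
    nrm B (pull P T) = nrm (P * B * P.transpose) T := by rw [nrm, ip_pull, nrm]

lemma ip_one (T S : (ι → D) → ℝ) : ip 1 T S = ∑ I, T I * S I := by
  rw [ip_eq_pull, pull_one]

/-- `Q` plays the part of an orthonormal frame: after transformation by it the pairing is the sum of
products of components. The norm estimates below reduce to this form. -/
lemma ip_factor {B : Matrix D D ℝ} {Q : Matrix D D' ℝ} (h : B = Q * Q.transpose)
    (T S : (ι → D) → ℝ) : ip B T S = ∑ I, pull Q T I * pull Q S I := by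
  rw [← ip_one, ip_pull, Matrix.mul_one, h]

open scoped MatrixOrder in
lemma exists_factor {B : Matrix D D ℝ} (h : B.PosSemidef) :
    ∃ Q : Matrix D D ℝ, B = Q * Q.transpose := by
  obtain ⟨Q, hQ⟩ := CStarAlgebra.nonneg_iff_eq_star_mul_self.mp h.nonneg
  refine ⟨Q.transpose, ?_⟩
  rw [hQ, Matrix.transpose_transpose]; rfl


lemma ip_comm {B : Matrix D D ℝ} (hB : B.PosSemidef) (T S : (ι → D) → ℝ) : ip B T S = ip B S T := by
  obtain ⟨Q, hQ⟩ := exists_factor hB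
  simp only [ip_factor hQ, mul_comm]

lemma ip_add_left (B : Matrix D D ℝ) (T T' S : (ι → D) → ℝ) :
    ip B (T + T') S = ip B T S + ip B T' S := by
  simp only [ip_eq_pull, pull_add, Pi.add_apply, add_mul, Finset.sum_add_distrib]

lemma ip_smul_left (B : Matrix D D ℝ) (c : ℝ) (T S : (ι → D) → ℝ) :
    ip B (c • T) S = c * ip B T S := by
  simp only [ip_eq_pull, pull_smul, Pi.smul_apply, smul_eq_mul, Finset.mul_sum, mul_assoc]

lemma ip_sum_left {α : Type*} (B : Matrix D D ℝ) (A : Finset α) (T : α → (ι → D) → ℝ)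
    (S : (ι → D) → ℝ) : ip B (∑ a ∈ A, T a) S = ∑ a ∈ A, ip B (T a) S := by
  classical
  induction A using Finset.induction_on with
  | empty => simp [ip]
  | insert a A ha ih => rw [Finset.sum_insert ha, Finset.sum_insert ha, ip_add_left, ih]

lemma ip_self_nonneg {B : Matrix D D ℝ} (hB : B.PosSemidef) (T : (ι → D) → ℝ) : 0 ≤ ip B T T := by
  obtain ⟨Q, hQ⟩ := exists_factor hB
  rw [ip_factor hQ]
  exact Finset.sum_nonneg fun I _ => mul_self_nonneg _

lemma nrm_nonneg (B : Matrix D D ℝ) (T : (ι → D) → ℝ) : 0 ≤ nrm B T := Real.sqrt_nonneg _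

lemma nrm_sq {B : Matrix D D ℝ} (hB : B.PosSemidef) (T : (ι → D) → ℝ) :
    nrm B T ^ 2 = ip B T T := Real.sq_sqrt (ip_self_nonneg hB T)

lemma nrm_eq_norm {B : Matrix D D ℝ} {Q : Matrix D D' ℝ} (h : B = Q * Q.transpose)
    (T : (ι → D) → ℝ) : nrm B T = ‖WithLp.toLp 2 (pull Q T)‖ := by
  rw [nrm, ip_factor h, EuclideanSpace.norm_eq]
  simp [sq]

lemma nrm_add_le {B : Matrix D D ℝ} (hB : B.PosSemidef) (T S : (ι → D) → ℝ) :
    nrm B (T + S) ≤ nrm B T + nrm B S := by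
  obtain ⟨Q, hQ⟩ := exists_factor hB
  rw [nrm_eq_norm hQ, nrm_eq_norm hQ, nrm_eq_norm hQ, pull_add, WithLp.toLp_add]
  exact norm_add_le _ _

lemma nrm_smul {B : Matrix D D ℝ} (hB : B.PosSemidef) (c : ℝ) (T : (ι → D) → ℝ) :
    nrm B (c • T) = |c| * nrm B T := by
  obtain ⟨Q, hQ⟩ := exists_factor hB
  rw [nrm_eq_norm hQ, nrm_eq_norm hQ, pull_smul, WithLp.toLp_smul, norm_smul, Real.norm_eq_abs]

lemma abs_ip_le {B : Matrix D D ℝ} (hB : B.PosSemidef) (T S : (ι → D) → ℝ) :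
    |ip B T S| ≤ nrm B T * nrm B S := by
  obtain ⟨Q, hQ⟩ := exists_factor hB
  rw [nrm_eq_norm hQ, nrm_eq_norm hQ, ip_factor hQ, mul_comm]
  have := abs_real_inner_le_norm (WithLp.toLp 2 (pull Q S)) (WithLp.toLp 2 (pull Q T))
  simpa [PiLp.inner_apply] using this

/-- Relabelling of the slots of a tensor. -/
def rl (f : ι ≃ κ) (T : (ι → D) → ℝ) : (κ → D) → ℝ := fun K => T (K ∘ f)

/-- Tensor product. -/
def tprod (T : (ι → D) → ℝ) (S : (κ → D) → ℝ) : (ι ⊕ κ → D) → ℝ :=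
  fun J => T (J ∘ Sum.inl) * S (J ∘ Sum.inr)

/-- Contraction of the first two slots. -/
def contr (B : Matrix D D ℝ) (T : (Option (Option ι) → D) → ℝ) : (ι → D) → ℝ :=
  fun I => ∑ i, ∑ j, B i j * T (ocons i (ocons j I))

lemma pull_rl (Q : Matrix D D' ℝ) (f : ι ≃ κ) (T : (ι → D) → ℝ) :
    pull Q (rl f T) = rl f (pull Q T) := by
  ext K
  simp only [pull, rl]
  refine Fintype.sum_equiv (f.symm.arrowCongr (Equiv.refl D)) _ _ fun I => ?_
  have : (f.symm.arrowCongr (Equiv.refl D)) I = I ∘ f := by ext; simp [Equiv.arrowCongr]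
  rw [this]
  congr 1
  exact (Fintype.prod_equiv f _ _ fun s => by simp).symm

lemma ip_rl (B : Matrix D D ℝ) (f : ι ≃ κ) (T S : (ι → D) → ℝ) :
    ip B (rl f T) (rl f S) = ip B T S := by
  rw [ip_eq_pull, ip_eq_pull, pull_rl]
  simp only [rl]
  refine Fintype.sum_equiv (f.symm.arrowCongr (Equiv.refl D)) _ _ fun I => ?_
  have : (f.symm.arrowCongr (Equiv.refl D)) I = I ∘ f := by ext; simp [Equiv.arrowCongr]
  rw [this]

lemma nrm_rl (B : Matrix D D ℝ) (f : ι ≃ κ) (T : (ι → D) → ℝ) : nrm B (rl f T) = nrm B T := by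
  rw [nrm, ip_rl, nrm]

lemma pull_tprod (Q : Matrix D D' ℝ) (T : (ι → D) → ℝ) (S : (κ → D) → ℝ) :
    pull Q (tprod T S) = tprod (pull Q T) (pull Q S) := by
  ext J
  simp only [pull, tprod, sum_sum_fun, Fintype.prod_sum_type, Finset.sum_mul_sum]
  refine Finset.sum_congr rfl fun I _ => Finset.sum_congr rfl fun K _ => ?_
  simp only [Sum.elim_inl, Sum.elim_inr, Sum.elim_comp_inl, Sum.elim_comp_inr, Function.comp]
  ring

lemma ip_tprod (B : Matrix D D ℝ) (T T' : (ι → D) → ℝ) (S S' : (κ → D) → ℝ) :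
    ip B (tprod T S) (tprod T' S') = ip B T T' * ip B S S' := by
  rw [ip_eq_pull, ip_eq_pull, ip_eq_pull, pull_tprod, sum_sum_fun, Finset.sum_mul_sum]
  refine Finset.sum_congr rfl fun I _ => Finset.sum_congr rfl fun K _ => ?_
  simp only [tprod, Sum.elim_comp_inl, Sum.elim_comp_inr]
  ring

lemma nrm_tprod {B : Matrix D D ℝ} (hB : B.PosSemidef) (T : (ι → D) → ℝ) (S : (κ → D) → ℝ) :
    nrm B (tprod T S) = nrm B T * nrm B S := by
  rw [nrm, ip_tprod, Real.sqrt_mul (ip_self_nonneg hB T), nrm, nrm]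


lemma pull_sum {α : Type*} (P : Matrix D D' ℝ) (A : Finset α) (T : α → (ι → D) → ℝ) :
    pull P (∑ a ∈ A, T a) = ∑ a ∈ A, pull P (T a) := by
  ext K
  simp only [pull, Finset.sum_apply, Finset.mul_sum]
  rw [Finset.sum_comm]

lemma contr_eq_sum (B : Matrix D D ℝ) (T : (Option (Option ι) → D) → ℝ) :
    contr B T = ∑ i, ∑ j, B i j • fun I => T (ocons i (ocons j I)) := by
  ext I; simp [contr, Finset.sum_apply]

/-- In an orthonormal frame a contraction is a plain trace, which is what `nrm_contr_le` estimates.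
-/
lemma pull_contr (Q : Matrix D D' ℝ) (T : (Option (Option ι) → D) → ℝ) :
    pull Q (contr (Q * Q.transpose) T) = fun K => ∑ a, pull Q T (ocons a (ocons a K)) := by
  ext K
  simp only [contr_eq_sum, pull_sum, pull_smul, pull_ocons, Finset.sum_apply, Pi.smul_apply,
    Matrix.mul_apply, Matrix.transpose_apply, smul_eq_mul, Finset.sum_mul, Finset.mul_sum]
  rw [Finset.sum_comm_cycle]
  refine Finset.sum_congr rfl fun a _ => Finset.sum_congr rfl fun i _ =>
    Finset.sum_congr rfl fun j _ => by ring

lemma nrm_contr_le {B : Matrix D D ℝ} (hB : B.PosSemidef) (T : (Option (Option ι) → D) → ℝ) :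
    nrm B (contr B T) ≤ Fintype.card D * nrm B T := by
  obtain ⟨Q, hQ⟩ := exists_factor hB
  rw [nrm, nrm, ip_factor hQ, ip_factor hQ]
  nth_rewrite 1 2 [hQ]
  rw [pull_contr]
  refine Real.sqrt_le_iff.2 ⟨by positivity, ?_⟩
  rw [mul_pow, Real.sq_sqrt (Finset.sum_nonneg fun I _ => mul_self_nonneg _)]
  set X := pull Q T
  -- Cauchy–Schwarz for the trace, then the diagonal terms are bounded by the full sum of squares.
  have h1 : ∀ K : ι → D, (∑ a, X (ocons a (ocons a K))) * (∑ a, X (ocons a (ocons a K))) ≤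
      Fintype.card D * ∑ a, ∑ b, X (ocons a (ocons b K)) * X (ocons a (ocons b K)) := by
    intro K
    have h2 := sq_sum_le_card_mul_sum_sq (s := Finset.univ) (f := fun a => X (ocons a (ocons a K)))
    rw [← sq]
    refine h2.trans (mul_le_mul_of_nonneg_left (Finset.sum_le_sum fun a _ => ?_) (by positivity))
    rw [sq]
    exact Finset.single_le_sum (f := fun b => X (ocons a (ocons b K)) * X (ocons a (ocons b K)))
      (fun b _ => mul_self_nonneg _) (Finset.mem_univ a)
  have h3 : ∑ J, X J * X J =
      ∑ K : ι → D, ∑ a, ∑ b, X (ocons a (ocons b K)) * X (ocons a (ocons b K)) := by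
    simp only [sum_option_fun]
    rw [Finset.sum_comm_cycle]
  rw [h3]
  refine (Finset.sum_le_sum fun K _ => h1 K).trans ?_
  rw [← Finset.mul_sum]
  refine mul_le_mul_of_nonneg_right ?_ (Finset.sum_nonneg fun K _ => Finset.sum_nonneg fun a _ =>
    Finset.sum_nonneg fun b _ => mul_self_nonneg _)
  -- Cauchy–Schwarz gives the square root of the dimension; the stated constant is weaker and uses
  -- `card D ≤ card D ^ 2`.
  rw [← Nat.cast_pow]
  exact_mod_cast Nat.le_self_pow two_ne_zero _

lemma ip_option (B : Matrix D D ℝ) (T S : (Option ι → D) → ℝ) :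
    ip B T S = ∑ i, ∑ j, B i j *
      ip B (fun I => T (ocons i I)) (fun I => S (ocons j I)) := by
  simp only [ip, sum_option_fun, Fintype.prod_option, ocons_none, ocons_some, Finset.mul_sum]
  refine Finset.sum_congr rfl fun i _ => ?_
  rw [Finset.sum_comm]
  refine Finset.sum_congr rfl fun j _ => Finset.sum_congr rfl fun I _ =>
    Finset.sum_congr rfl fun J _ => by ring

/-! ### Adapted frames: an additional index, orthogonal to the others. -/

/-- Extension of an inverse metric by a unit vector. -/
def oB (B : Matrix D D' ℝ) : Matrix (Option D) (Option D') ℝ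
  | none, none => 1
  | some i, some j => B i j
  | _, _ => 0

@[simp] lemma oB_none_none (B : Matrix D D' ℝ) : oB B none none = 1 := rfl
@[simp] lemma oB_some_some (B : Matrix D D' ℝ) (i : D) (j : D') : oB B (some i) (some j) = B i j :=
  rfl
@[simp] lemma oB_none_some (B : Matrix D D' ℝ) (j : D') : oB B none (some j) = 0 := rfl
@[simp] lemma oB_some_none (B : Matrix D D' ℝ) (j : D) : oB B (some j) none = 0 := rfl

lemma oB_mul (B : Matrix D D' ℝ) (C : Matrix D' D'' ℝ) : oB B * oB C = oB (B * C) := by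
  ext i j
  cases i <;> cases j <;> simp [Matrix.mul_apply, Fintype.sum_option]

lemma oB_transpose (B : Matrix D D' ℝ) : (oB B).transpose = oB B.transpose := by
  ext i j
  cases i <;> cases j <;> simp [Matrix.transpose_apply]

lemma oB_one : oB (1 : Matrix D D ℝ) = 1 := by
  ext i j
  cases i <;> cases j <;> simp [Matrix.one_apply]

lemma oB_factor {B : Matrix D D ℝ} {Q : Matrix D D' ℝ} (h : B = Q * Q.transpose) :
    oB B = oB Q * (oB Q).transpose := by rw [oB_transpose, oB_mul, h]

lemma oB_posSemidef {B : Matrix D D ℝ} (h : B.PosSemidef) : (oB B).PosSemidef := by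
  obtain ⟨Q, hQ⟩ := exists_factor h
  rw [oB_factor hQ]
  exact Matrix.posSemidef_self_mul_conjTranspose (oB Q)

/-- Restriction to the old indices. -/
def restr (T : (ι → Option D) → ℝ) : (ι → D) → ℝ := fun I => T (some ∘ I)

lemma pull_restr (Q : Matrix D D' ℝ) (T : (ι → Option D) → ℝ) :
    pull Q (restr T) = restr (pull (oB Q) T) := by
  ext K
  simp only [pull, restr]
  refine Fintype.sum_of_injective (fun I : ι → D => some ∘ I)
    (Function.Injective.comp_left (Option.some_injective _)) _ _ ?_ ?_
  -- A multi-index that is not made of old indices has an entry `none`, and there the matrix `oB Q`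
  -- vanishes against the old indices of `K`.
  · intro J hJ
    have : ∃ s, J s = none := by
      by_contra! h
      refine hJ ⟨fun s => (J s).get (Option.ne_none_iff_isSome.1 (h s)), ?_⟩
      ext s; simp
    obtain ⟨s, hs⟩ := this
    rw [Finset.prod_eq_zero (Finset.mem_univ s) (by simp [hs]), zero_mul]
  · intro I; simp

/-- In the orthonormal frame `oB Q` the restriction keeps a subset of the components, so the sum of
squares can only decrease. -/
lemma nrm_restr_le {B : Matrix D D ℝ} (hB : B.PosSemidef) (T : (ι → Option D) → ℝ) :
    nrm B (restr T) ≤ nrm (oB B) T := by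
  obtain ⟨Q, hQ⟩ := exists_factor hB
  rw [nrm, nrm, ip_factor hQ, ip_factor (oB_factor hQ), pull_restr]
  refine Real.sqrt_le_sqrt ?_
  set X := pull (oB Q) T
  refine (Finset.sum_image (s := Finset.univ) (g := fun I : ι → D => some ∘ I)
    (f := fun J => X J * X J) ?_).symm.trans_le ?_
  · exact (Function.Injective.comp_left (Option.some_injective _)).injOn
  · exact Finset.sum_le_sum_of_subset_of_nonneg (Finset.subset_univ _)
      fun _ _ _ => mul_self_nonneg _

/-- The part of a tensor for which the first index is an old one. -/
def msk (T : (Option ι → Option D) → ℝ) : (Option ι → Option D) → ℝ :=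
  fun J => if J none = none then 0 else T J

lemma nrm_msk_le {B : Matrix D D ℝ} (hB : B.PosSemidef) (T : (Option ι → Option D) → ℝ) :
    nrm (oB B) (msk T) ≤ nrm (oB B) T := by
  obtain ⟨Q, hQ⟩ := exists_factor hB
  rw [nrm, nrm, ip_factor (oB_factor hQ), ip_factor (oB_factor hQ)]
  have : pull (oB Q) (msk T) = msk (pull (oB Q) T) := by
    ext K
    rw [← ocons_eta K, pull_ocons]
    cases h : K none with
    | none =>
      simp only [Fintype.sum_option, oB_none_none, oB_some_none, zero_mul, Finset.sum_const_zero,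
        add_zero, msk, ocons_none, if_true]
      simp [pull]
    | some k => simp [Fintype.sum_option, msk, pull_ocons]
  rw [this]
  refine Real.sqrt_le_sqrt (Finset.sum_le_sum fun J _ => ?_)
  simp only [msk]
  split_ifs
  · simpa using mul_self_nonneg _
  · exact le_rfl

end Algebra

/-! ### Covariant derivatives for a given connection matrix and their product rules -/

section Calculus

variable {D D' : Type} [Fintype D] [DecidableEq D] [Fintype D'] [DecidableEq D']
  {ι κ : Type} [Fintype ι] [DecidableEq ι] [Fintype κ] [DecidableEq κ]
  {E E' : Type*} [NormedAddCommGroup E] [NormedSpace ℝ E] [NormedAddCommGroup E'] [NormedSpace ℝ E']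

/-- Covariant derivative of a tensor field in the direction `v`, when the connection matrix in this
direction is `Υ`. -/
def der (v : E) (Υ : D → D → ℝ) (T : E → (ι → D) → ℝ) (y : E) (I : ι → D) : ℝ :=
  fderiv ℝ (fun z => T z I) y v - ∑ s, ∑ l, Υ l (I s) * T y (Function.update I s l)

/-- Covariant derivative of a tensor field with respect to a connection with coefficients `Γ`; the
index `j` is differentiated in the direction `d j`. -/
def nab (d : D → E) (Γ : E → D → D → D → ℝ) (T : E → (ι → D) → ℝ) (y : E) (J : Option ι → D) : ℝ :=
  der (d (J none)) (fun l k => Γ y l (J none) k) T y (J ∘ some)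

lemma nab_ocons (d : D → E) (Γ : E → D → D → D → ℝ) (T : E → (ι → D) → ℝ) (y : E) (j : D)
    (I : ι → D) :
    nab d Γ T y (ocons j I) = der (d j) (fun l k => Γ y l j k) T y I := rfl

lemma der_congr {v : E} {Υ : D → D → ℝ} {T T' : E → (ι → D) → ℝ} {y : E} (h : T =ᶠ[𝓝 y] T') :
    der v Υ T y = der v Υ T' y := by
  ext I
  have h1 : (fun z => T z I) =ᶠ[𝓝 y] fun z => T' z I := h.mono fun z hz => congrFun hz I
  rw [der, der, h1.fderiv_eq, h.eq_of_nhds]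

lemma der_add {v : E} {Υ : D → D → ℝ} {T S : E → (ι → D) → ℝ} {y : E}
    (hT : ∀ I, DifferentiableAt ℝ (fun z => T z I) y)
    (hS : ∀ I, DifferentiableAt ℝ (fun z => S z I) y) :
    der v Υ (fun z => T z + S z) y = der v Υ T y + der v Υ S y := by
  ext I
  simp only [der, Pi.add_apply, mul_add, Finset.sum_add_distrib]
  rw [fderiv_fun_add (hT I) (hS I), add_apply]
  ring

lemma der_smul {v : E} {Υ : D → D → ℝ} {T : E → (ι → D) → ℝ} {y : E} (c : ℝ)
    (hT : ∀ I, DifferentiableAt ℝ (fun z => T z I) y) :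
    der v Υ (fun z => c • T z) y = c • der v Υ T y := by
  ext I
  simp only [der, Pi.smul_apply, smul_eq_mul, mul_left_comm _ c, ← Finset.mul_sum]
  rw [fderiv_const_mul (hT I), smul_apply, smul_eq_mul]
  ring

lemma der_rl {v : E} {Υ : D → D → ℝ} {T : E → (ι → D) → ℝ} {y : E} (f : ι ≃ κ) :
    der v Υ (fun z => rl f (T z)) y = rl f (der v Υ T y) := by
  ext K
  simp only [der, rl]
  congr 1
  refine (Fintype.sum_equiv f _ _ fun s => Finset.sum_congr rfl fun l _ => ?_).symm
  rw [Function.update_comp_eq_of_injective _ f.injective]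
  rfl

lemma der_tprod {v : E} {Υ : D → D → ℝ} {T : E → (ι → D) → ℝ} {S : E → (κ → D) → ℝ} {y : E}
    (hT : ∀ I, DifferentiableAt ℝ (fun z => T z I) y)
    (hS : ∀ I, DifferentiableAt ℝ (fun z => S z I) y) :
    der v Υ (fun z => tprod (T z) (S z)) y =
      tprod (der v Υ T y) (S y) + tprod (T y) (der v Υ S y) := by
  ext J
  simp only [der, tprod, Pi.add_apply, Fintype.sum_sum_type]
  rw [fderiv_fun_mul (hT _) (hS _)]
  have h1 : ∀ s l, Function.update J (Sum.inl s) l ∘ Sum.inl = Function.update (J ∘ Sum.inl) s l :=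
    fun s l => Function.update_comp_eq_of_injective _ Sum.inl_injective s l
  have h2 : ∀ s l, Function.update J (Sum.inr s) l ∘ Sum.inr = Function.update (J ∘ Sum.inr) s l :=
    fun s l => Function.update_comp_eq_of_injective _ Sum.inr_injective s l
  have h3 : ∀ (s : ι) l, Function.update J (Sum.inl s) l ∘ Sum.inr = J ∘ Sum.inr :=
    fun s l => Function.update_comp_eq_of_forall_ne _ _ (by simp)
  have h4 : ∀ (s : κ) l, Function.update J (Sum.inr s) l ∘ Sum.inl = J ∘ Sum.inl :=
    fun s l => Function.update_comp_eq_of_forall_ne _ _ (by simp)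
  simp only [h1, h2, h3, h4, sub_mul, mul_sub, Finset.sum_mul, Finset.mul_sum,
    add_apply, smul_apply, smul_eq_mul, Function.comp_apply]
  have h5 : ∀ s l, Υ l (J (Sum.inr s)) * (T y (J ∘ Sum.inl) * S y (Function.update (J ∘ Sum.inr) s l))
    = T y (J ∘ Sum.inl) * (Υ l (J (Sum.inr s)) * S y (Function.update (J ∘ Sum.inr) s l)) :=
    fun s l => by ring
  simp only [h5, ← mul_assoc]
  ring

/-- The inverse metric `B` is parallel in the direction `v`, when the connection matrix is `Υ`. -/
def Compat (v : E) (Υ : D → D → ℝ) (B : E → Matrix D D ℝ) (y : E) : Prop :=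
  ∀ i j, HasFDerivAt (fun z => B z i j) (fderiv ℝ (fun z => B z i j) y) y ∧
    fderiv ℝ (fun z => B z i j) y v = -∑ p, Υ i p * B y p j - ∑ p, Υ j p * B y i p

/-- The inverse metric is parallel: the terms from differentiating `B` cancel those which the
connection contributes in the two contracted slots. -/
lemma der_contr {v : E} {Υ : D → D → ℝ} {B : E → Matrix D D ℝ}
    {T : E → (Option (Option ι) → D) → ℝ} {y : E}
    (hB : Compat v Υ B y) (hT : ∀ I, DifferentiableAt ℝ (fun z => T z I) y) :
    der v Υ (fun z => contr (B z) (T z)) y = contr (B y) (der v Υ T y) := by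
  ext I
  simp only [der, contr, Fintype.sum_option, ocons_none, ocons_some, update_ocons_some,
    update_ocons_none]
  have h1 : HasFDerivAt (fun z => ∑ i, ∑ j, B z i j * T z (ocons i (ocons j I)))
      (∑ i, ∑ j, (B y i j • fderiv ℝ (fun z => T z (ocons i (ocons j I))) y +
        T y (ocons i (ocons j I)) • fderiv ℝ (fun z => B z i j) y)) y := by
    refine HasFDerivAt.fun_sum fun i _ => HasFDerivAt.fun_sum fun j _ => ?_
    exact (hB i j).1.mul (hT _).hasFDerivAt
  rw [h1.fderiv]
  simp only [sum_apply, add_apply, smul_apply, smul_eq_mul, (hB _ _).2, mul_add, mul_sub,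
    Finset.sum_add_distrib, Finset.sum_sub_distrib, Finset.mul_sum, mul_neg, Finset.sum_neg_distrib]
  have e1 : ∑ i, ∑ j, ∑ p, T y (ocons i (ocons j I)) * (Υ i p * B y p j) =
      ∑ i, ∑ j, ∑ p, B y i j * (Υ p i * T y (ocons p (ocons j I))) := by
    calc _ = ∑ i, ∑ p, ∑ j, T y (ocons i (ocons j I)) * (Υ i p * B y p j) :=
          Finset.sum_congr rfl fun i _ => Finset.sum_comm
      _ = ∑ p, ∑ i, ∑ j, T y (ocons i (ocons j I)) * (Υ i p * B y p j) := Finset.sum_comm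
      _ = ∑ p, ∑ j, ∑ i, T y (ocons i (ocons j I)) * (Υ i p * B y p j) :=
          Finset.sum_congr rfl fun i _ => Finset.sum_comm
      _ = _ := Finset.sum_congr rfl fun i _ => Finset.sum_congr rfl fun j _ =>
          Finset.sum_congr rfl fun p _ => by ring
  have e2 : ∑ i, ∑ j, ∑ p, T y (ocons i (ocons j I)) * (Υ j p * B y i p) =
      ∑ i, ∑ j, ∑ p, B y i j * (Υ p j * T y (ocons i (ocons p I))) := by
    calc _ = ∑ i, ∑ p, ∑ j, T y (ocons i (ocons j I)) * (Υ j p * B y i p) :=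
          Finset.sum_congr rfl fun i _ => Finset.sum_comm
      _ = _ := Finset.sum_congr rfl fun i _ => Finset.sum_congr rfl fun j _ =>
          Finset.sum_congr rfl fun p _ => by ring
  have e3 : ∑ s, ∑ l, ∑ i, ∑ j, Υ l (I s) * (B y i j * T y (ocons i (ocons j (Function.update I s l))))
      = ∑ i, ∑ j, ∑ s, ∑ l, B y i j * (Υ l (I s) * T y (ocons i (ocons j (Function.update I s l)))) := by
    have : ∀ F : ι → D → D → D → ℝ, ∑ s, ∑ l, ∑ i, ∑ j, F s l i j = ∑ i, ∑ j, ∑ s, ∑ l, F s l i j := by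
      intro F
      simp only [← Fintype.sum_prod_type']
      refine Fintype.sum_equiv ⟨fun x => (x.2.2.1, x.2.2.2, x.1, x.2.1),
        fun x => (x.2.2.1, x.2.2.2, x.1, x.2.1), fun x => rfl, fun x => rfl⟩ _ _ fun x => rfl
    rw [this]
    simp only [mul_left_comm (B y _ _)]
  rw [e1, e2, e3]
  ring

lemma prod_update_left {α : Type*} (s : ι) (P : Matrix α D ℝ) (I : ι → α) (K : ι → D) (p : α) :
    ∏ t, P (Function.update I s p t) (K t) =
      P p (K s) * ∏ t ∈ Finset.univ.erase s, P (I t) (K t) := by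
  rw [← Finset.mul_prod_erase _ _ (Finset.mem_univ s)]
  congr 1
  · simp
  · exact Finset.prod_congr rfl fun t ht => by
      rw [Function.update_of_ne (Finset.ne_of_mem_erase ht)]

lemma prod_update_right {α : Type*} (s : ι) (P : Matrix α D ℝ) (I : ι → α) (K : ι → D) (p : D) :
    ∏ t, P (I t) (Function.update K s p t) =
      P (I s) p * ∏ t ∈ Finset.univ.erase s, P (I t) (K t) := by
  rw [← Finset.mul_prod_erase _ _ (Finset.mem_univ s)]
  congr 1
  · simp
  · exact Finset.prod_congr rfl fun t ht => by
      rw [Function.update_of_ne (Finset.ne_of_mem_erase ht)]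

/-- Pulling back by a parallel matrix field commutes with covariant differentiation. -/
lemma der_pull {v : E} {Υ : D → D → ℝ} {Υ' : D' → D' → ℝ} {P : E → Matrix D' D ℝ} {u : E → E'}
    {T : E' → (ι → D') → ℝ} {y : E} (hu : DifferentiableAt ℝ u y)
    (hT : ∀ I, DifferentiableAt ℝ (fun z => T z I) (u y))
    (hP : ∀ a k, DifferentiableAt ℝ (fun z => P z a k) y)
    (hpar : ∀ a k, fderiv ℝ (fun z => P z a k) y v = ∑ l, P y a l * Υ l k - ∑ b, Υ' a b * P y b k) :
    der v Υ (fun z => pull (P z) (T (u z))) y =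
      pull (P y) (der (fderiv ℝ u y v) Υ' T (u y)) := by
  ext K
  have h1 : HasFDerivAt (fun z => ∑ I : ι → D', (∏ s, P z (I s) (K s)) * T (u z) I)
      (∑ I : ι → D', ((∏ s, P y (I s) (K s)) • (fderiv ℝ (fun z => T z I) (u y)).comp (fderiv ℝ u y) +
        T (u y) I • ∑ s, (∏ t ∈ Finset.univ.erase s, P y (I t) (K t)) •
          fderiv ℝ (fun z => P z (I s) (K s)) y)) y := by
    refine HasFDerivAt.fun_sum fun I _ => HasFDerivAt.mul ?_ ?_
    · exact HasFDerivAt.finsetProd fun s _ => (hP (I s) (K s)).hasFDerivAt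
    · exact (hT I).hasFDerivAt.comp y hu.hasFDerivAt
  simp only [der, pull]
  rw [h1.fderiv]
  simp only [sum_apply, add_apply, smul_apply, smul_eq_mul, hpar, ContinuousLinearMap.comp_apply,
    mul_sub, Finset.sum_add_distrib, Finset.sum_sub_distrib, Finset.mul_sum]
  -- The part of `hpar` with `Υ` is the action of the source connection on the slots of the pulled
  -- back tensor.
  have e1 : ∑ I : ι → D', ∑ s, ∑ l, T (u y) I * ((∏ t ∈ Finset.univ.erase s, P y (I t) (K t)) *
      (P y (I s) l * Υ l (K s))) =
      ∑ s, ∑ l, ∑ I : ι → D', Υ l (K s) * ((∏ t, P y (I t) (Function.update K s l t)) * T (u y) I) := by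
    rw [Finset.sum_comm]
    refine Finset.sum_congr rfl fun s _ => ?_
    rw [Finset.sum_comm]
    refine Finset.sum_congr rfl fun l _ => Finset.sum_congr rfl fun I _ => ?_
    rw [prod_update_right]; ring
  -- In the part with `Υ'` the changed entry is moved from the product of matrix entries to `T`,
  -- where it becomes the action of the target connection.
  have e2 : ∑ I : ι → D', ∑ s, ∑ b, T (u y) I * ((∏ t ∈ Finset.univ.erase s, P y (I t) (K t)) *
      (Υ' (I s) b * P y b (K s))) =
      ∑ I : ι → D', ∑ s, ∑ b, (∏ t, P y (I t) (K t)) * (Υ' b (I s) * T (u y) (Function.update I s b)) := by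
    refine Eq.trans Finset.sum_comm (Eq.trans ?_ Finset.sum_comm)
    refine Finset.sum_congr rfl fun s _ => ?_
    have := sum_update_swap' (D := D') s (fun I a b J => T (u y) I * (Υ' a b * ∏ t, P y (J t) (K t)))
    refine Eq.trans (Finset.sum_congr rfl fun I _ => Finset.sum_congr rfl fun b _ => ?_)
      (this.trans (Finset.sum_congr rfl fun I _ => Finset.sum_congr rfl fun b _ => ?_))
    · rw [prod_update_left]; ring
    · ring
  rw [e1, e2]
  ring

/-- Product rule without a term for the derivative of `B`, which is parallel along `v`. It serves
for the spatial directions and, through `IsMetVar`, for the time direction. -/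
lemma fderiv_ip {v : E} {Υ : D → D → ℝ} {B : E → Matrix D D ℝ} {T S : E → (ι → D) → ℝ} {y : E}
    (hB : Compat v Υ B y) (hT : ∀ I, DifferentiableAt ℝ (fun z => T z I) y)
    (hS : ∀ I, DifferentiableAt ℝ (fun z => S z I) y) :
    fderiv ℝ (fun z => ip (B z) (T z) (S z)) y v =
      ip (B y) (der v Υ T y) (S y) + ip (B y) (T y) (der v Υ S y) := by
  have h1 : HasFDerivAt (fun z => ∑ I : ι → D, ∑ J : ι → D, (∏ s, B z (I s) (J s)) * T z I * S z J)
      (∑ I : ι → D, ∑ J : ι → D, (((∏ s, B y (I s) (J s)) * T y I) • fderiv ℝ (fun z => S z J) y +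
        S y J • ((∏ s, B y (I s) (J s)) • fderiv ℝ (fun z => T z I) y + T y I •
          ∑ s, (∏ t ∈ Finset.univ.erase s, B y (I t) (J t)) •
            fderiv ℝ (fun z => B z (I s) (J s)) y))) y := by
    refine HasFDerivAt.fun_sum fun I _ => HasFDerivAt.fun_sum fun J _ => HasFDerivAt.mul
      (HasFDerivAt.mul ?_ (hT I).hasFDerivAt) (hS J).hasFDerivAt
    exact HasFDerivAt.finsetProd fun s _ => (hB (I s) (J s)).1
  simp only [der, ip]
  rw [h1.fderiv]
  simp only [sum_apply, add_apply, smul_apply, smul_eq_mul, (hB _ _).2, mul_add, mul_sub, mul_neg,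
    sub_mul, Finset.sum_add_distrib, Finset.sum_sub_distrib, Finset.mul_sum, Finset.sum_mul,
    Finset.sum_neg_distrib]
  have e1 : ∑ I : ι → D, ∑ J : ι → D, ∑ s, ∑ p, S y J * (T y I *
      ((∏ t ∈ Finset.univ.erase s, B y (I t) (J t)) * (Υ (I s) p * B y p (J s)))) =
      ∑ I : ι → D, ∑ J : ι → D, ∑ s, ∑ p, (∏ t, B y (I t) (J t)) *
        (Υ p (I s) * T y (Function.update I s p)) * S y J := by
    refine Eq.trans Finset.sum_comm (Eq.trans ?_ Finset.sum_comm)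
    refine Finset.sum_congr rfl fun J _ => ?_
    refine Eq.trans Finset.sum_comm (Eq.trans ?_ Finset.sum_comm)
    refine Finset.sum_congr rfl fun s _ => ?_
    have := sum_update_swap' (D := D) s (fun I a b J' => T y I * (Υ a b * ∏ t, B y (J' t) (J t)) * S y J)
    refine Eq.trans (Finset.sum_congr rfl fun I _ => Finset.sum_congr rfl fun b _ => ?_)
      (this.trans (Finset.sum_congr rfl fun I _ => Finset.sum_congr rfl fun b _ => ?_))
    · rw [prod_update_left]; ring
    · ring
  have e2 : ∑ I : ι → D, ∑ J : ι → D, ∑ s, ∑ p, S y J * (T y I *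
      ((∏ t ∈ Finset.univ.erase s, B y (I t) (J t)) * (Υ (J s) p * B y (I s) p))) =
      ∑ I : ι → D, ∑ J : ι → D, ∑ s, ∑ p, (∏ t, B y (I t) (J t)) * T y I *
        (Υ p (J s) * S y (Function.update J s p)) := by
    refine Finset.sum_congr rfl fun I _ => ?_
    refine Eq.trans Finset.sum_comm (Eq.trans ?_ Finset.sum_comm)
    refine Finset.sum_congr rfl fun s _ => ?_
    have := sum_update_swap' (D := D) s (fun J a b J' => T y I * (Υ a b * ∏ t, B y (I t) (J' t)) * S y J)
    refine Eq.trans (Finset.sum_congr rfl fun J _ => Finset.sum_congr rfl fun b _ => ?_)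
      (this.trans (Finset.sum_congr rfl fun J _ => Finset.sum_congr rfl fun b _ => ?_))
    · rw [prod_update_right]; ring
    · ring
  rw [e1, e2]
  have e3 : ∀ I J, S y J * ((∏ s, B y (I s) (J s)) * fderiv ℝ (fun z => T z I) y v) =
    (∏ s, B y (I s) (J s)) * fderiv ℝ (fun z => T z I) y v * S y J := fun I J => by ring
  simp only [e3]
  ring

end Calculus

/-! ### Smooth tensor fields -/

section Smooth

variable {D D' : Type} [Fintype D] [DecidableEq D] [Fintype D'] [DecidableEq D']
  {ι κ : Type} [Fintype ι] [DecidableEq ι] [Fintype κ] [DecidableEq κ]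
  {E E' : Type*} [NormedAddCommGroup E] [NormedSpace ℝ E] [NormedAddCommGroup E'] [NormedSpace ℝ E']

lemma two_le_infty : (2 : WithTop ℕ∞) ≤ (∞ : WithTop ℕ∞) :=
  WithTop.coe_le_coe.2 (le_top : (2 : ℕ∞) ≤ ⊤)

/-- Smoothness of a tensor field on `Ω`. -/
def Sm (Ω : Set E) (T : E → (ι → D) → ℝ) : Prop := ∀ I, ContDiffOn ℝ ∞ (fun z => T z I) Ω

lemma Sm.differentiableAt {Ω : Set E} (hΩ : IsOpen Ω) {T : E → (ι → D) → ℝ} (h : Sm Ω T) {y : E}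
    (hy : y ∈ Ω) (I : ι → D) : DifferentiableAt ℝ (fun z => T z I) y :=
  ((h I).contDiffAt (hΩ.mem_nhds hy)).differentiableAt (by simp)

lemma contDiffOn_fderiv_apply {F : Type*} [NormedAddCommGroup F] [NormedSpace ℝ F] {Ω : Set E}
    (hΩ : IsOpen Ω) {f : E → F} (h : ContDiffOn ℝ ∞ f Ω) (v : E) :
    ContDiffOn ℝ ∞ (fun y => fderiv ℝ f y v) Ω :=
  (h.fderiv_of_isOpen hΩ (m := ∞) (by simp)).clm_apply contDiffOn_const

lemma Sm.congr {Ω : Set E} {T S : E → (ι → D) → ℝ} (h : Sm Ω T) (e : EqOn S T Ω) : Sm Ω S :=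
  fun I => (h I).congr fun y hy => by rw [e hy]

lemma Sm.add {Ω : Set E} {T S : E → (ι → D) → ℝ} (hT : Sm Ω T) (hS : Sm Ω S) :
    Sm Ω (fun z => T z + S z) := fun I => (hT I).add (hS I)

lemma Sm.smul {Ω : Set E} {T : E → (ι → D) → ℝ} (c : ℝ) (hT : Sm Ω T) :
    Sm Ω (fun z => c • T z) := fun I => contDiffOn_const.smul (hT I)

lemma Sm.rl {Ω : Set E} {T : E → (ι → D) → ℝ} (f : ι ≃ κ) (hT : Sm Ω T) :
    Sm Ω (fun z => rl f (T z)) := fun I => hT (I ∘ f)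

lemma Sm.tprod {Ω : Set E} {T : E → (ι → D) → ℝ} {S : E → (κ → D) → ℝ} (hT : Sm Ω T)
    (hS : Sm Ω S) : Sm Ω (fun z => tprod (T z) (S z)) := fun _ => (hT _).mul (hS _)

lemma Sm.contr {Ω : Set E} {B : E → Matrix D D ℝ} {T : E → (Option (Option ι) → D) → ℝ}
    (hB : ∀ i j, ContDiffOn ℝ ∞ (fun z => B z i j) Ω) (hT : Sm Ω T) :
    Sm Ω (fun z => contr (B z) (T z)) := fun _ =>
  ContDiffOn.sum fun i _ => ContDiffOn.sum fun j _ => (hB i j).mul (hT _)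

lemma Sm.nab {Ω : Set E} (hΩ : IsOpen Ω) {d : D → E} {Γ : E → D → D → D → ℝ}
    {T : E → (ι → D) → ℝ} (hΓ : ∀ l j k, ContDiffOn ℝ ∞ (fun z => Γ z l j k) Ω) (hT : Sm Ω T) :
    Sm Ω (nab d Γ T) := fun _ => (contDiffOn_fderiv_apply hΩ (hT _) _).sub <|
  ContDiffOn.sum fun _ _ => ContDiffOn.sum fun _ _ => (hΓ _ _ _).mul (hT _)

lemma Sm.pull {Ω : Set E} {P : E → Matrix D' D ℝ} {T : E → (ι → D') → ℝ}
    (hP : ∀ a k, ContDiffOn ℝ ∞ (fun z => P z a k) Ω) (hT : Sm Ω T) :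
    Sm Ω (fun z => pull (P z) (T z)) := fun _ =>
  ContDiffOn.sum fun _ _ => (contDiffOn_prod fun _ _ => hP _ _).mul (hT _)

lemma Sm.sum {α : Type*} {Ω : Set E} (A : Finset α) {T : α → E → (ι → D) → ℝ}
    (h : ∀ a ∈ A, Sm Ω (T a)) : Sm Ω (fun z => ∑ a ∈ A, T a z) := fun I =>
  (ContDiffOn.sum fun a ha => h a ha I).congr fun y _ => by simp

lemma nab_congr {Ω : Set E} (hΩ : IsOpen Ω) {d : D → E} {Γ : E → D → D → D → ℝ}
    {T S : E → (ι → D) → ℝ} (e : EqOn T S Ω) : EqOn (nab d Γ T) (nab d Γ S) Ω := by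
  intro y hy
  ext J
  simp only [nab]
  rw [der_congr (e.eventuallyEq_of_mem (hΩ.mem_nhds hy))]

end Smooth

/-! ### Permutations of slots needed to state the product rules -/

section Equivs

variable {ι κ : Type} [DecidableEq ι]

/-- The derivative slot of the left factor becomes the first slot. -/
def eqvL (ι κ : Type) : Option ι ⊕ κ ≃ Option (ι ⊕ κ) where
  toFun := Sum.elim (fun o => o.map Sum.inl) (fun k => some (Sum.inr k))
  invFun := fun o => o.elim (Sum.inl none) (Sum.elim (fun i => Sum.inl (some i)) Sum.inr)
  left_inv := by rintro ((_ | _) | _) <;> rfl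
  right_inv := by rintro (_ | _ | _) <;> rfl

/-- The derivative slot of the right factor becomes the first slot. -/
def eqvR (ι κ : Type) : ι ⊕ Option κ ≃ Option (ι ⊕ κ) where
  toFun := Sum.elim (fun k => some (Sum.inl k)) (fun o => o.map Sum.inr)
  invFun := fun o => o.elim (Sum.inr none) (Sum.elim Sum.inl (fun i => Sum.inr (some i)))
  left_inv := by rintro (_ | _ | _) <;> rfl
  right_inv := by rintro (_ | _ | _) <;> rfl

/-- The first slot becomes the third one. -/
def eqvC (ι : Type) : Option (Option (Option ι)) ≃ Option (Option (Option ι)) where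
  toFun
    | none => some (some none)
    | some none => none
    | some (some none) => some none
    | some (some (some i)) => some (some (some i))
  invFun
    | none => some none
    | some none => some (some none)
    | some (some none) => none
    | some (some (some i)) => some (some (some i))
  left_inv := by rintro (_ | _ | _ | _) <;> rfl
  right_inv := by rintro (_ | _ | _ | _) <;> rfl

/-- The first two slots are exchanged. -/
def eqvS (ι : Type) : Option (Option ι) ≃ Option (Option ι) where
  toFun
    | none => some none
    | some none => none
    | some (some i) => some (some i)
  invFun
    | none => some none
    | some none => none
    | some (some i) => some (some i)
  left_inv := by rintro (_ | _ | _) <;> rfl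
  right_inv := by rintro (_ | _ | _) <;> rfl

/-- The slots to be contracted in the action of a tensor on the slot `s` of another one. -/
def eqvA (κ : Type) (s : ι) : Option (Option κ) ⊕ ι ≃ Option (Option (κ ⊕ ι)) where
  toFun
    | Sum.inl none => none
    | Sum.inl (some none) => some (some (Sum.inr s))
    | Sum.inl (some (some c)) => some (some (Sum.inl c))
    | Sum.inr t => if t = s then some none else some (some (Sum.inr t))
  invFun
    | none => Sum.inl none
    | some none => Sum.inr s
    | some (some (Sum.inl c)) => Sum.inl (some (some c))
    | some (some (Sum.inr t)) => if t = s then Sum.inl (some none) else Sum.inr t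
  left_inv := by
    rintro ((_ | _ | _) | t)
    · rfl
    · simp
    · rfl
    · by_cases h : t = s <;> simp [h]
  right_inv := by
    rintro (_ | _ | _ | t)
    · rfl
    · simp
    · rfl
    · by_cases h : t = s <;> simp [h]

end Equivs

/-! ### Rules for the full covariant derivative; the Ricci identity -/

section Nabla

variable {D : Type} [Fintype D] [DecidableEq D]
  {ι κ : Type} [Fintype ι] [DecidableEq ι] [Fintype κ] [DecidableEq κ]
  {E : Type*} [NormedAddCommGroup E] [NormedSpace ℝ E]
  {d : D → E} {Γ : E → D → D → D → ℝ} {y : E}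

lemma nab_add {T S : E → (ι → D) → ℝ} (hT : ∀ I, DifferentiableAt ℝ (fun z => T z I) y)
    (hS : ∀ I, DifferentiableAt ℝ (fun z => S z I) y) :
    nab d Γ (fun z => T z + S z) y = nab d Γ T y + nab d Γ S y := by
  ext J; simp only [nab, der_add hT hS, Pi.add_apply]

lemma nab_smul {T : E → (ι → D) → ℝ} (c : ℝ) (hT : ∀ I, DifferentiableAt ℝ (fun z => T z I) y) :
    nab d Γ (fun z => c • T z) y = c • nab d Γ T y := by
  ext J; simp only [nab, der_smul c hT, Pi.smul_apply]

lemma nab_rl {T : E → (ι → D) → ℝ} (f : ι ≃ κ) :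
    nab d Γ (fun z => rl f (T z)) y = rl f.optionCongr (nab d Γ T y) := by
  ext J; simp only [nab, der_rl]; rfl

lemma nab_tprod {T : E → (ι → D) → ℝ} {S : E → (κ → D) → ℝ}
    (hT : ∀ I, DifferentiableAt ℝ (fun z => T z I) y)
    (hS : ∀ I, DifferentiableAt ℝ (fun z => S z I) y) :
    nab d Γ (fun z => tprod (T z) (S z)) y =
      rl (eqvL ι κ) (tprod (nab d Γ T y) (S y)) + rl (eqvR ι κ) (tprod (T y) (nab d Γ S y)) := by
  ext J; simp only [nab, der_tprod hT hS]; rfl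

lemma nab_contr {B : E → Matrix D D ℝ} {T : E → (Option (Option ι) → D) → ℝ}
    (hB : ∀ j, Compat (d j) (fun l k => Γ y l j k) B y)
    (hT : ∀ I, DifferentiableAt ℝ (fun z => T z I) y) :
    nab d Γ (fun z => contr (B z) (T z)) y = contr (B y) (rl (eqvC ι) (nab d Γ T y)) := by
  ext J
  simp only [nab, der_contr (hB _) hT, contr, rl]
  refine Finset.sum_congr rfl fun i _ => Finset.sum_congr rfl fun j _ => ?_
  congr 2
  ext o
  rcases o with _ | _ | _ <;> rfl

/-- The derivation action of the (lowered) endomorphisms given by the first two slots of `Z` on the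
slot `s` of `T`. -/
def act1 (B : Matrix D D ℝ) (s : ι) (Z : (Option (Option κ) → D) → ℝ) (T : (ι → D) → ℝ) :
    (κ ⊕ ι → D) → ℝ :=
  fun L => ∑ q, ∑ p, B q p * (Z (ocons q (ocons (L (Sum.inr s)) (L ∘ Sum.inl))) *
    T (Function.update (L ∘ Sum.inr) s p))

/-- The derivation action of the (lowered) endomorphisms given by the first two slots of `Z`. -/
def act (B : Matrix D D ℝ) (Z : (Option (Option κ) → D) → ℝ) (T : (ι → D) → ℝ) :
    (κ ⊕ ι → D) → ℝ := ∑ s, act1 B s Z T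

/-- Exhibits the action as a contraction of a tensor product, so that norm estimates, smoothness and
`UL` bounds for those two operations carry over. -/
lemma act1_eq (B : Matrix D D ℝ) (s : ι) (Z : (Option (Option κ) → D) → ℝ) (T : (ι → D) → ℝ) :
    act1 B s Z T = contr B (rl (eqvA κ s) (tprod Z T)) := by
  ext L
  simp only [act1, contr, rl, tprod]
  refine Finset.sum_congr rfl fun q _ => Finset.sum_congr rfl fun p _ => ?_
  congr 2
  · congr 1; ext o; rcases o with _ | _ | _ <;> rfl
  · congr 1; ext t
    by_cases h : t = s
    · subst h; simp [eqvA]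
    · simp [eqvA, h]

/-- The Riemannian curvature of a connection, `R^l_{ijk}`. -/
def curvC (d : D → E) (Γ : E → D → D → D → ℝ) (y : E) (l i j k : D) : ℝ :=
  fderiv ℝ (fun z => Γ z l j k) y (d i) - fderiv ℝ (fun z => Γ z l i k) y (d j) +
    ∑ p, (Γ y p j k * Γ y l i p - Γ y p i k * Γ y l j p)

/-- The Ricci identity. -/
lemma nab_nab_comm {Ω : Set E} (hΩ : IsOpen Ω) {T : E → (ι → D) → ℝ}
    (hΓ : ∀ l j k, ContDiffOn ℝ ∞ (fun z => Γ z l j k) Ω) (hT : Sm Ω T) (hy : y ∈ Ω) {i j : D}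
    (hsymm : ∀ p, Γ y p i j = Γ y p j i) (I : ι → D) :
    nab d Γ (nab d Γ T) y (ocons i (ocons j I)) - nab d Γ (nab d Γ T) y (ocons j (ocons i I)) =
      -∑ s, ∑ l, curvC d Γ y l i j (I s) * T y (Function.update I s l) := by
  have hTd : ∀ I, DifferentiableAt ℝ (fun z => T z I) y := hT.differentiableAt hΩ hy
  have hΓd : ∀ l j k, DifferentiableAt ℝ (fun z => Γ z l j k) y := fun l j k =>
    ((hΓ l j k).contDiffAt (hΩ.mem_nhds hy)).differentiableAt (by simp)
  have key : ∀ i j, nab d Γ (nab d Γ T) y (ocons i (ocons j I)) =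
      fderiv ℝ (fun z => fderiv ℝ (fun z => T z I) z (d j)) y (d i)
      - ∑ p, Γ y p i j * nab d Γ T y (ocons p I)
      - ∑ s, ∑ l, (Γ y l i (I s) * fderiv ℝ (fun z => T z (Function.update I s l)) y (d j) +
          Γ y l j (I s) * fderiv ℝ (fun z => T z (Function.update I s l)) y (d i))
      - ∑ s, ∑ l, (fderiv ℝ (fun z => Γ z l j (I s)) y (d i)) * T y (Function.update I s l)
      + ∑ s, ∑ p, ∑ t, ∑ l, Γ y p i (I s) * (Γ y l j (Function.update I s p t) *
          T y (Function.update (Function.update I s p) t l)) := by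
    intro i j
    rw [nab_ocons, der]
    simp only [Fintype.sum_option, ocons_none, ocons_some, update_ocons_some, update_ocons_none]
    have h1 : HasFDerivAt (fun z => nab d Γ T z (ocons j I))
        (fderiv ℝ (fun z => fderiv ℝ (fun z => T z I) z (d j)) y - ∑ s, ∑ l,
          (Γ y l j (I s) • fderiv ℝ (fun z => T z (Function.update I s l)) y +
            T y (Function.update I s l) • fderiv ℝ (fun z => Γ z l j (I s)) y)) y := by
      simp only [nab_ocons, der]
      refine HasFDerivAt.fun_sub ?_ (HasFDerivAt.fun_sum fun s _ => HasFDerivAt.fun_sum fun l _ =>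
        (hΓd _ _ _).hasFDerivAt.mul (hTd _).hasFDerivAt)
      exact (((contDiffOn_fderiv_apply hΩ (hT I) (d j)).contDiffAt
        (hΩ.mem_nhds hy)).differentiableAt (by simp)).hasFDerivAt
    rw [h1.fderiv]
    simp only [nab_ocons, der, sub_apply, sum_apply, add_apply, smul_apply, smul_eq_mul, mul_sub,
      Finset.sum_sub_distrib, Finset.sum_add_distrib, Finset.mul_sum]
    simp only [mul_comm (T y _)]
    ring
  have hschw : fderiv ℝ (fun z => fderiv ℝ (fun z => T z I) z (d j)) y (d i) =
      fderiv ℝ (fun z => fderiv ℝ (fun z => T z I) z (d i)) y (d j) := by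
    have hc : ContDiffAt ℝ ∞ (fun z => T z I) y := (hT I).contDiffAt (hΩ.mem_nhds hy)
    have hs := (hc.isSymmSndFDerivAt (by simpa using two_le_infty)) (d i) (d j)
    have hd : DifferentiableAt ℝ (fderiv ℝ fun z => T z I) y :=
      (hc.fderiv_right (m := 1) (by rw [one_add_one_eq_two]; try exact two_le_infty)).differentiableAt (by simp)
    rw [fderiv_clm_apply hd (differentiableAt_const _), fderiv_clm_apply hd (differentiableAt_const _)]
    simpa using hs
  have e1 : ∑ s, ∑ l, (Γ y l i (I s) * fderiv ℝ (fun z => T z (Function.update I s l)) y (d j) +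
          Γ y l j (I s) * fderiv ℝ (fun z => T z (Function.update I s l)) y (d i)) =
      ∑ s, ∑ l, (Γ y l j (I s) * fderiv ℝ (fun z => T z (Function.update I s l)) y (d i) +
          Γ y l i (I s) * fderiv ℝ (fun z => T z (Function.update I s l)) y (d j)) :=
    Finset.sum_congr rfl fun s _ => Finset.sum_congr rfl fun l _ => add_comm _ _
  -- Quadratic terms in the connection: those acting twice on one slot are the quadratic part of the
  -- curvature, those acting on two different slots are symmetric in `i, j` by `e3` and cancel.
  have e2 : ∀ i j : D, ∑ s, ∑ p, ∑ t, ∑ l, Γ y p i (I s) * (Γ y l j (Function.update I s p t) *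
          T y (Function.update (Function.update I s p) t l)) =
      ∑ s, ∑ l, (∑ p, Γ y p i (I s) * Γ y l j p) * T y (Function.update I s l) +
      ∑ s, ∑ t ∈ Finset.univ.erase s, ∑ p, ∑ l, Γ y p i (I s) * Γ y l j (I t) *
        T y (Function.update (Function.update I s p) t l) := by
    intro i j
    rw [← Finset.sum_add_distrib]
    refine Finset.sum_congr rfl fun s _ => ?_
    rw [Finset.sum_comm (s := Finset.univ) (t := Finset.univ), ← Finset.add_sum_erase _ _ (Finset.mem_univ s)]
    congr 1
    · rw [Finset.sum_comm]
      refine Finset.sum_congr rfl fun l _ => ?_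
      rw [Finset.sum_mul]
      refine Finset.sum_congr rfl fun p _ => ?_
      simp [mul_assoc]
    · refine Finset.sum_congr rfl fun t ht => Finset.sum_congr rfl fun p _ =>
        Finset.sum_congr rfl fun l _ => ?_
      rw [Function.update_of_ne (Finset.ne_of_mem_erase ht), mul_assoc]
  have e3 : ∑ s, ∑ t ∈ Finset.univ.erase s, ∑ p, ∑ l, Γ y p i (I s) * Γ y l j (I t) *
        T y (Function.update (Function.update I s p) t l) =
      ∑ s, ∑ t ∈ Finset.univ.erase s, ∑ p, ∑ l, Γ y p j (I s) * Γ y l i (I t) *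
        T y (Function.update (Function.update I s p) t l) := by
    rw [Finset.sum_comm' (s' := fun t => Finset.univ.erase t) (t' := Finset.univ)
      (by intro a b; simp [ne_comm])]
    refine Finset.sum_congr rfl fun s _ => Finset.sum_congr rfl fun t ht => ?_
    rw [Finset.sum_comm]
    refine Finset.sum_congr rfl fun p _ => Finset.sum_congr rfl fun l _ => ?_
    rw [Function.update_comm (Finset.ne_of_mem_erase ht)]
    ring
  rw [key i j, key j i, hschw, e1, e2 i j, e2 j i, e3]
  simp only [hsymm, curvC]
  simp only [add_mul, sub_mul, Finset.sum_add_distrib, Finset.sum_sub_distrib]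
  ring

end Nabla

/-! ### Metric connections on open sets; Bochner's formula -/

/-- An open set with a base point, a metric connection (coefficients `Γ`, inverse metric `B`) and
constant directions of differentiation. -/
structure Geo (E D : Type*) where
  Ω : Set E
  pt : E
  d : D → E
  Γ : E → D → D → D → ℝ
  B : E → Matrix D D ℝ

section

variable {D : Type} [Fintype D] [DecidableEq D]
  {ι κ : Type} [Fintype ι] [DecidableEq ι] [Fintype κ] [DecidableEq κ]
  {E : Type*} [NormedAddCommGroup E] [NormedSpace ℝ E]

/-- The properties of a metric connection. -/
structure Geo.Good (G : Geo E D) : Prop where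
  isOpen : IsOpen G.Ω
  mem : G.pt ∈ G.Ω
  smΓ : ∀ l j k, ContDiffOn ℝ ∞ (fun z => G.Γ z l j k) G.Ω
  smB : ∀ i j, ContDiffOn ℝ ∞ (fun z => G.B z i j) G.Ω
  psd : ∀ y ∈ G.Ω, (G.B y).PosSemidef
  compat : ∀ y ∈ G.Ω, ∀ j, Compat (G.d j) (fun l k => G.Γ y l j k) G.B y

/-- Covariant derivative. -/
abbrev Geo.nab (G : Geo E D) (T : E → (ι → D) → ℝ) : E → (Option ι → D) → ℝ :=
  ExtRicciMCF.nab G.d G.Γ T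

/-- The norm at the base point. -/
def Geo.nm (G : Geo E D) (T : E → (ι → D) → ℝ) : ℝ := nrm (G.B G.pt) (T G.pt)

/-- The Laplacian of a tensor field. -/
def Geo.lap (G : Geo E D) (T : E → (ι → D) → ℝ) : E → (ι → D) → ℝ :=
  fun z => contr (G.B z) (G.nab (G.nab T) z)

/-- The Laplacian of a function. -/
def Geo.lapFun (G : Geo E D) (φ : E → ℝ) (y : E) : ℝ :=
  ∑ i, ∑ j, G.B y i j * (fderiv ℝ (fun z => fderiv ℝ φ z (G.d j)) y (G.d i) -
    ∑ l, G.Γ y l i j * fderiv ℝ φ y (G.d l))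

lemma Geo.Good.sm_nab {G : Geo E D} (hG : G.Good) {T : E → (ι → D) → ℝ} (hT : Sm G.Ω T) :
    Sm G.Ω (G.nab T) := hT.nab hG.isOpen hG.smΓ

lemma Geo.Good.sm_lap {G : Geo E D} (hG : G.Good) {T : E → (ι → D) → ℝ} (hT : Sm G.Ω T) :
    Sm G.Ω (G.lap T) := (hG.sm_nab (hG.sm_nab hT)).contr hG.smB

lemma Geo.Good.sm_act1 {G : Geo E D} (hG : G.Good) {Z : E → (Option (Option κ) → D) → ℝ}
    {T : E → (ι → D) → ℝ} (hZ : Sm G.Ω Z) (hT : Sm G.Ω T) (s : ι) :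
    Sm G.Ω (fun z => act1 (G.B z) s (Z z) (T z)) := by
  simp only [act1_eq]
  exact ((hZ.tprod hT).rl _).contr hG.smB

lemma Geo.Good.sm_act {G : Geo E D} (hG : G.Good) {Z : E → (Option (Option κ) → D) → ℝ}
    {T : E → (ι → D) → ℝ} (hZ : Sm G.Ω Z) (hT : Sm G.Ω T) :
    Sm G.Ω (fun z => act (G.B z) (Z z) (T z)) :=
  Sm.sum Finset.univ fun s _ => hG.sm_act1 hZ hT s

/-- Bochner's formula. -/
lemma Geo.Good.bochner {G : Geo E D} (hG : G.Good) {T : E → (ι → D) → ℝ} (hT : Sm G.Ω T)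
    {y : E} (hy : y ∈ G.Ω) :
    G.lapFun (fun z => ip (G.B z) (T z) (T z)) y =
      2 * ip (G.B y) (G.lap T y) (T y) + 2 * ip (G.B y) (G.nab T y) (G.nab T y) := by
  have hnT := hG.sm_nab hT
  have h1 : ∀ z ∈ G.Ω, ∀ j, fderiv ℝ (fun z => ip (G.B z) (T z) (T z)) z (G.d j) =
      2 * ip (G.B z) (fun I => G.nab T z (ocons j I)) (T z) := by
    intro z hz j
    rw [fderiv_ip (hG.compat z hz j) (hT.differentiableAt hG.isOpen hz)
      (hT.differentiableAt hG.isOpen hz), ip_comm (hG.psd z hz) (T z), two_mul]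
    rfl
  have h2 : ∀ i j, fderiv ℝ (fun z => fderiv ℝ (fun z => ip (G.B z) (T z) (T z)) z (G.d j)) y (G.d i)
      - ∑ l, G.Γ y l i j * fderiv ℝ (fun z => ip (G.B z) (T z) (T z)) y (G.d l) =
      2 * ip (G.B y) (fun I => G.nab (G.nab T) y (ocons i (ocons j I))) (T y) +
      2 * ip (G.B y) (fun I => G.nab T y (ocons j I)) (fun I => G.nab T y (ocons i I)) := by
    intro i j
    have e1 : (fun z => fderiv ℝ (fun z => ip (G.B z) (T z) (T z)) z (G.d j)) =ᶠ[𝓝 y]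
        fun z => 2 * ip (G.B z) (fun I => G.nab T z (ocons j I)) (T z) := by
      filter_upwards [hG.isOpen.mem_nhds hy] with z hz using h1 z hz j
    have hd : ∀ I, DifferentiableAt ℝ (fun z => (fun z I => G.nab T z (ocons j I)) z I) y :=
      fun I => hnT.differentiableAt hG.isOpen hy _
    -- Differentiating with the first slot frozen at `j` omits the connection term of that slot. The
    -- omitted term is exactly the Christoffel term in the Hessian of the function, so the two
    -- cancel.
    have e3 : der (G.d i) (fun l k => G.Γ y l i k) (fun z I => G.nab T z (ocons j I)) y =
        (fun I => G.nab (G.nab T) y (ocons i (ocons j I))) +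
          ∑ l, G.Γ y l i j • fun I => G.nab T y (ocons l I) := by
      ext I
      simp only [Pi.add_apply, Finset.sum_apply, Pi.smul_apply, smul_eq_mul]
      have e0 : ∀ T' : E → (Option ι → D) → ℝ, G.nab T' y (ocons i (ocons j I)) =
        der (G.d i) (fun l k => G.Γ y l i k) T' y (ocons j I) := fun _ => rfl
      rw [e0]
      simp only [der, Fintype.sum_option, ocons_none, ocons_some, update_ocons_none,
        update_ocons_some]
      ring
    rw [e1.fderiv_eq]
    have e2 : fderiv ℝ (fun z => 2 * ip (G.B z) (fun I => G.nab T z (ocons j I)) (T z)) y (G.d i)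
        = 2 * fderiv ℝ (fun z => ip (G.B z) (fun I => G.nab T z (ocons j I)) (T z)) y (G.d i) := by
      have hdd : DifferentiableAt ℝ (fun z => ip (G.B z) (fun I => G.nab T z (ocons j I)) (T z)) y := by
        unfold ip
        refine DifferentiableAt.fun_sum fun I _ => DifferentiableAt.fun_sum fun J _ =>
          DifferentiableAt.mul (DifferentiableAt.mul ?_ (hd I)) (hT.differentiableAt hG.isOpen hy J)
        exact (HasFDerivAt.finsetProd (u := Finset.univ) (g := fun s z => G.B z (I s) (J s))
          fun s _ => (hG.compat y hy i (I s) (J s)).1).differentiableAt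
      rw [fderiv_const_mul hdd]; rfl
    rw [e2, fderiv_ip (hG.compat y hy i) hd (hT.differentiableAt hG.isOpen hy), e3,
      ip_add_left, ip_sum_left]
    simp only [ip_smul_left, h1 y hy]
    have e4 : der (G.d i) (fun l k => G.Γ y l i k) T y = fun I => G.nab T y (ocons i I) := rfl
    rw [e4]
    have e5 : ∑ l, G.Γ y l i j * (2 * ip (G.B y) (fun I => G.nab T y (ocons l I)) (T y)) =
      2 * ∑ l, G.Γ y l i j * ip (G.B y) (fun I => G.nab T y (ocons l I)) (T y) := by
      rw [Finset.mul_sum]; exact Finset.sum_congr rfl fun l _ => by ring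
    rw [e5]; ring
  simp only [Geo.lapFun, h2]
  rw [ip_option, Geo.lap, contr_eq_sum]
  simp only [ip_sum_left, ip_smul_left, Finset.mul_sum, ← Finset.sum_add_distrib]
  refine Finset.sum_congr rfl fun i _ => Finset.sum_congr rfl fun j _ => ?_
  rw [ip_comm (hG.psd y hy) (fun I => G.nab T y (ocons i I))]
  ring

end

/-! ### Families of tensor fields with controlled covariant derivatives -/

section UL

variable {Θ : Type*} {D : Type} [Fintype D] [DecidableEq D]
  {ι κ : Type} [Fintype ι] [DecidableEq ι] [Fintype κ] [DecidableEq κ]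
  {E : Type*} [NormedAddCommGroup E] [NormedSpace ℝ E] {G : Θ → Geo E D} {b : Θ → ℝ}

/-- A family of tensor fields whose covariant derivatives of order less than `n` are bounded at the
base points, and whose covariant derivative of order `n` is bounded by a multiple of `b`. -/
def UL (G : Θ → Geo E D) (b : Θ → ℝ) : ℕ → ∀ {ι : Type} [Fintype ι] [DecidableEq ι],
    (Θ → E → (ι → D) → ℝ) → Prop
  | 0, _, _, _, T => (∀ θ, Sm (G θ).Ω (T θ)) ∧ ∃ C, ∀ θ, (G θ).nm (T θ) ≤ C * b θ
  | n + 1, _, _, _, T => (∀ θ, Sm (G θ).Ω (T θ)) ∧ (∃ C, ∀ θ, (G θ).nm (T θ) ≤ C) ∧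
      UL G b n fun θ => (G θ).nab (T θ)

lemma Geo.nm_nonneg (G : Geo E D) (T : E → (ι → D) → ℝ) : 0 ≤ G.nm T := nrm_nonneg _ _

lemma UL.sm {n : ℕ} {T : Θ → E → (ι → D) → ℝ} (h : UL G b n T) (θ : Θ) : Sm (G θ).Ω (T θ) := by
  cases n <;> exact h.1 θ

lemma UL.nab {n : ℕ} {T : Θ → E → (ι → D) → ℝ} (h : UL G b (n + 1) T) :
    UL G b n fun θ => (G θ).nab (T θ) := h.2.2

variable (hG : ∀ θ, (G θ).Good)
include hG

lemma UL.congr {n : ℕ} {ι : Type} [Fintype ι] [DecidableEq ι] {T S : Θ → E → (ι → D) → ℝ}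
    (h : UL G b n T) (e : ∀ θ, EqOn (S θ) (T θ) (G θ).Ω) : UL G b n S := by
  induction n generalizing ι with
  | zero =>
    refine ⟨fun θ => (h.1 θ).congr (e θ), ?_⟩
    obtain ⟨C, hC⟩ := h.2
    exact ⟨C, fun θ => by rw [Geo.nm, e θ (hG θ).mem]; exact hC θ⟩
  | succ n ih =>
    refine ⟨fun θ => (h.1 θ).congr (e θ), ?_, ih h.2.2 fun θ => nab_congr (hG θ).isOpen (e θ)⟩
    obtain ⟨C, hC⟩ := h.2.1
    exact ⟨C, fun θ => by rw [Geo.nm, e θ (hG θ).mem]; exact hC θ⟩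

/-- Since `b ≥ 1`, a bounded derivative may be weakened to one bounded by a multiple of `b`. -/
lemma UL.mono {n : ℕ} {ι : Type} [Fintype ι] [DecidableEq ι] (hb : ∀ θ, 1 ≤ b θ)
    {T : Θ → E → (ι → D) → ℝ} (h : UL G b (n + 1) T) : UL G b n T := by
  induction n generalizing ι with
  | zero =>
    obtain ⟨C, hC⟩ := h.2.1
    refine ⟨h.1, |C|, fun θ => (hC θ).trans ?_⟩
    nlinarith [le_abs_self C, abs_nonneg C, hb θ]
  | succ n ih => exact ⟨h.1, h.2.1, ih h.2.2⟩

lemma UL.mono_le {n m : ℕ} (hb : ∀ θ, 1 ≤ b θ) {T : Θ → E → (ι → D) → ℝ} (hmn : m ≤ n)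
    (h : UL G b n T) : UL G b m T := by
  induction hmn with
  | refl => exact h
  | step _ ih => exact ih (h.mono hG hb)

lemma UL.add {n : ℕ} {ι : Type} [Fintype ι] [DecidableEq ι] {T S : Θ → E → (ι → D) → ℝ}
    (hT : UL G b n T) (hS : UL G b n S) : UL G b n fun θ z => T θ z + S θ z := by
  have key : ∀ θ, (G θ).nm (fun z => T θ z + S θ z) ≤ (G θ).nm (T θ) + (G θ).nm (S θ) :=
    fun θ => nrm_add_le ((hG θ).psd _ (hG θ).mem) _ _
  induction n generalizing ι with
  | zero =>
    obtain ⟨C, hC⟩ := hT.2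
    obtain ⟨C', hC'⟩ := hS.2
    exact ⟨fun θ => (hT.1 θ).add (hS.1 θ), C + C', fun θ => (key θ).trans
      (by rw [add_mul]; exact add_le_add (hC θ) (hC' θ))⟩
  | succ n ih =>
    obtain ⟨C, hC⟩ := hT.2.1
    obtain ⟨C', hC'⟩ := hS.2.1
    refine ⟨fun θ => (hT.1 θ).add (hS.1 θ), ⟨C + C', fun θ => (key θ).trans
      (add_le_add (hC θ) (hC' θ))⟩, ?_⟩
    refine UL.congr hG (ih hT.2.2 hS.2.2
      fun θ => nrm_add_le ((hG θ).psd _ (hG θ).mem) _ _) fun θ y hy => ?_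
    exact nab_add ((hT.1 θ).differentiableAt (hG θ).isOpen hy)
      ((hS.1 θ).differentiableAt (hG θ).isOpen hy)

lemma UL.smul {n : ℕ} {ι : Type} [Fintype ι] [DecidableEq ι] {T : Θ → E → (ι → D) → ℝ}
    (c : ℝ) (hT : UL G b n T) : UL G b n fun θ z => c • T θ z := by
  have key : ∀ θ, (G θ).nm (fun z => c • T θ z) = |c| * (G θ).nm (T θ) :=
    fun θ => nrm_smul ((hG θ).psd _ (hG θ).mem) _ _
  induction n generalizing ι with
  | zero =>
    obtain ⟨C, hC⟩ := hT.2
    refine ⟨fun θ => (hT.1 θ).smul c, |c| * C, fun θ => ?_⟩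
    rw [key, mul_assoc]
    exact mul_le_mul_of_nonneg_left (hC θ) (abs_nonneg c)
  | succ n ih =>
    obtain ⟨C, hC⟩ := hT.2.1
    refine ⟨fun θ => (hT.1 θ).smul c, ⟨|c| * C, fun θ => ?_⟩, ?_⟩
    · rw [key]
      exact mul_le_mul_of_nonneg_left (hC θ) (abs_nonneg c)
    · refine UL.congr hG (ih hT.2.2
        fun θ => nrm_smul ((hG θ).psd _ (hG θ).mem) _ _) fun θ y hy => ?_
      exact nab_smul c ((hT.1 θ).differentiableAt (hG θ).isOpen hy)

lemma UL.sub {n : ℕ} {T S : Θ → E → (ι → D) → ℝ}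
    (hT : UL G b n T) (hS : UL G b n S) : UL G b n fun θ z => T θ z - S θ z :=
  (hT.add hG (hS.smul hG (-1))).congr hG fun θ y _ => by simp [sub_eq_add_neg]

lemma UL.rl {n : ℕ} {ι κ : Type} [Fintype ι] [DecidableEq ι] [Fintype κ] [DecidableEq κ]
    {T : Θ → E → (ι → D) → ℝ} (f : ι ≃ κ)
    (hT : UL G b n T) : UL G b n fun θ z => rl f (T θ z) := by
  have key : ∀ θ, (G θ).nm (fun z => ExtRicciMCF.rl f (T θ z)) = (G θ).nm (T θ) :=
    fun θ => nrm_rl _ _ _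
  induction n generalizing ι κ with
  | zero =>
    obtain ⟨C, hC⟩ := hT.2
    exact ⟨fun θ => (hT.1 θ).rl f, C, fun θ => (key θ).trans_le (hC θ)⟩
  | succ n ih =>
    obtain ⟨C, hC⟩ := hT.2.1
    refine ⟨fun θ => (hT.1 θ).rl f, ⟨C, fun θ => (key θ).trans_le (hC θ)⟩, ?_⟩
    refine UL.congr hG (ih f.optionCongr hT.2.2 fun θ => nrm_rl _ _ _) fun θ y _ => ?_
    exact nab_rl f

lemma UL.contr {n : ℕ} {ι : Type} [Fintype ι] [DecidableEq ι]
    {T : Θ → E → (Option (Option ι) → D) → ℝ}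
    (hT : UL G b n T) : UL G b n fun θ z => contr ((G θ).B z) (T θ z) := by
  have key : ∀ {ι : Type} [Fintype ι] [DecidableEq ι] (T : Θ → E → (Option (Option ι) → D) → ℝ) θ,
      (G θ).nm (fun z => ExtRicciMCF.contr ((G θ).B z) (T θ z)) ≤
        Fintype.card D * (G θ).nm (T θ) :=
    fun T θ => nrm_contr_le ((hG θ).psd _ (hG θ).mem) _
  induction n generalizing ι with
  | zero =>
    obtain ⟨C, hC⟩ := hT.2
    refine ⟨fun θ => (hT.1 θ).contr (hG θ).smB, Fintype.card D * C, fun θ => (key T θ).trans ?_⟩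
    rw [mul_assoc]
    exact mul_le_mul_of_nonneg_left (hC θ) (by positivity)
  | succ n ih =>
    obtain ⟨C, hC⟩ := hT.2.1
    refine ⟨fun θ => (hT.1 θ).contr (hG θ).smB, ⟨Fintype.card D * C, fun θ => (key T θ).trans
      (mul_le_mul_of_nonneg_left (hC θ) (by positivity))⟩, ?_⟩
    refine UL.congr hG (ih (UL.rl hG (eqvC ι) hT.2.2)) fun θ y hy => ?_
    exact nab_contr ((hG θ).compat y hy) ((hT.1 θ).differentiableAt (hG θ).isOpen hy)

/-- At order zero two weighted factors would produce `b ^ 2`. Asking one more order of the second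
factor makes it bounded there, and only the first one carries the weight. -/
lemma UL.tprod {n : ℕ} {ι κ : Type} [Fintype ι] [DecidableEq ι] [Fintype κ] [DecidableEq κ]
    (hb : ∀ θ, 1 ≤ b θ) {T : Θ → E → (ι → D) → ℝ} {S : Θ → E → (κ → D) → ℝ}
    (hT : UL G b n T) (hS : UL G b (n + 1) S) :
    UL G b n fun θ z => tprod (T θ z) (S θ z) := by
  have key : ∀ θ, (G θ).nm (fun z => ExtRicciMCF.tprod (T θ z) (S θ z)) =
      (G θ).nm (T θ) * (G θ).nm (S θ) :=
    fun θ => nrm_tprod ((hG θ).psd _ (hG θ).mem) _ _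
  induction n generalizing ι κ with
  | zero =>
    obtain ⟨C, hC⟩ := hT.2
    obtain ⟨C', hC'⟩ := hS.2.1
    refine ⟨fun θ => (hT.1 θ).tprod (hS.1 θ), C * C', fun θ => ?_⟩
    rw [key, mul_right_comm]
    exact mul_le_mul (hC θ) (hC' θ) (Geo.nm_nonneg _ _) ((Geo.nm_nonneg _ _).trans (hC θ))
  | succ n ih =>
    obtain ⟨C, hC⟩ := hT.2.1
    obtain ⟨C', hC'⟩ := hS.2.1
    refine ⟨fun θ => (hT.1 θ).tprod (hS.1 θ), ⟨C * C', fun θ => ?_⟩, ?_⟩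
    · rw [key]
      exact mul_le_mul (hC θ) (hC' θ) (Geo.nm_nonneg _ _) ((Geo.nm_nonneg _ _).trans (hC θ))
    · have h1 := UL.rl hG (eqvL ι κ) (ih hT.2.2 (hS.mono hG hb)
        fun θ => nrm_tprod ((hG θ).psd _ (hG θ).mem) _ _)
      have h2 := UL.rl hG (eqvR ι κ) (ih (hT.mono hG hb) hS.2.2
        fun θ => nrm_tprod ((hG θ).psd _ (hG θ).mem) _ _)
      refine UL.congr hG (UL.add hG h1 h2) fun θ y hy => ?_
      exact nab_tprod ((hT.1 θ).differentiableAt (hG θ).isOpen hy)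
        ((hS.1 θ).differentiableAt (hG θ).isOpen hy)

lemma UL.tprod' {n : ℕ} (hb : ∀ θ, 1 ≤ b θ) {T : Θ → E → (ι → D) → ℝ}
    {S : Θ → E → (κ → D) → ℝ} (hT : UL G b (n + 1) T) (hS : UL G b n S) :
    UL G b n fun θ z => ExtRicciMCF.tprod (T θ z) (S θ z) := by
  refine UL.congr hG (UL.rl hG (Equiv.sumComm κ ι) (UL.tprod hG hb hS hT)) fun θ y _ => ?_
  ext J
  simp only [ExtRicciMCF.tprod, ExtRicciMCF.rl]
  rw [mul_comm]
  rfl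

/-- From order one on, no term of the Leibniz expansion has all the derivatives on both factors, so
the weight enters at most linearly and no order is lost. This linearity in the highest derivative is
what closes the final estimate. -/
lemma UL.tprod_succ {n : ℕ} (hb : ∀ θ, 1 ≤ b θ) {T : Θ → E → (ι → D) → ℝ}
    {S : Θ → E → (κ → D) → ℝ} (hT : UL G b (n + 1) T) (hS : UL G b (n + 1) S) :
    UL G b (n + 1) fun θ z => ExtRicciMCF.tprod (T θ z) (S θ z) := by
  obtain ⟨C, hC⟩ := hT.2.1
  obtain ⟨C', hC'⟩ := hS.2.1
  refine ⟨fun θ => (hT.1 θ).tprod (hS.1 θ), ⟨C * C', fun θ => ?_⟩, ?_⟩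
  · rw [Geo.nm, nrm_tprod ((hG θ).psd _ (hG θ).mem)]
    exact mul_le_mul (hC θ) (hC' θ) (Geo.nm_nonneg _ _) ((Geo.nm_nonneg _ _).trans (hC θ))
  · have h1 := UL.rl hG (eqvL ι κ) (hT.2.2.tprod hG hb hS)
    have h2 := UL.rl hG (eqvR ι κ) (UL.tprod' hG hb hT hS.2.2)
    refine UL.congr hG (UL.add hG h1 h2) fun θ y hy => ?_
    exact nab_tprod ((hT.1 θ).differentiableAt (hG θ).isOpen hy)
      ((hS.1 θ).differentiableAt (hG θ).isOpen hy)

lemma UL.zero {n : ℕ} {ι : Type} [Fintype ι] [DecidableEq ι] :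
    UL G b n fun (_ : Θ) (_ : E) (_ : ι → D) => (0 : ℝ) := by
  have key : ∀ {ι : Type} [Fintype ι] [DecidableEq ι] (θ : Θ),
      (G θ).nm (fun (_ : E) (_ : ι → D) => (0 : ℝ)) = 0 := by
    intro ι _ _ θ; simp [Geo.nm, nrm, ip]
  induction n generalizing ι with
  | zero => exact ⟨fun θ I => contDiffOn_const, 0, fun θ => by rw [key]; simp⟩
  | succ n ih =>
    refine ⟨fun θ I => contDiffOn_const, ⟨0, fun θ => (key θ).le⟩, ih.congr hG fun θ y _ => ?_⟩
    ext J; simp [Geo.nab, ExtRicciMCF.nab, der]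

lemma UL.sum {α : Type*} {n : ℕ} (A : Finset α) {T : α → Θ → E → (ι → D) → ℝ}
    (h : ∀ a ∈ A, UL G b n (T a)) : UL G b n fun θ z => ∑ a ∈ A, T a θ z := by
  classical
  induction A using Finset.induction_on with
  | empty => exact (UL.zero hG).congr hG fun θ y _ => by simp; rfl
  | insert a A ha ih =>
    refine ((h a (Finset.mem_insert_self a A)).add hG
      (ih fun c hc => h c (Finset.mem_insert_of_mem hc))).congr hG fun θ y _ => ?_
    simp [Finset.sum_insert ha]

lemma UL.act_of_tprod {n : ℕ} {Z : Θ → E → (Option (Option κ) → D) → ℝ}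
    {T : Θ → E → (ι → D) → ℝ} (h : UL G b n fun θ z => ExtRicciMCF.tprod (Z θ z) (T θ z)) :
    UL G b n fun θ z => act ((G θ).B z) (Z θ z) (T θ z) := by
  refine UL.sum hG Finset.univ fun s _ => ?_
  refine ((h.rl hG (eqvA κ s)).contr hG).congr hG fun θ y _ => ?_
  exact act1_eq _ _ _ _

end UL

/-! ### An additional index for the unit normal: the split connection -/

section Split

variable {D : Type} [Fintype D] [DecidableEq D]
  {ι κ : Type} [Fintype ι] [DecidableEq ι] [Fintype κ] [DecidableEq κ]
  {E : Type*} [NormedAddCommGroup E] [NormedSpace ℝ E]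

/-- Connection coefficients with an additional parallel index. -/
def oΓ (Γ : D → D → D → ℝ) : Option D → Option D → Option D → ℝ
  | some l, some j, some k => Γ l j k
  | _, _, _ => 0

@[simp] lemma oΓ_some (Γ : D → D → D → ℝ) (l j k : D) : oΓ Γ (some l) (some j) (some k) = Γ l j k :=
  rfl
@[simp] lemma oΓ_none1 (Γ : D → D → D → ℝ) (j k) : oΓ Γ none j k = 0 := by
  cases j <;> cases k <;> rfl
@[simp] lemma oΓ_none2 (Γ : D → D → D → ℝ) (l k) : oΓ Γ l none k = 0 := by
  cases l <;> cases k <;> rfl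
@[simp] lemma oΓ_none3 (Γ : D → D → D → ℝ) (l j) : oΓ Γ l j none = 0 := by
  cases l <;> cases j <;> rfl

/-- The geometry with an additional parallel unit vector. -/
def Geo.split (G : Geo E D) : Geo E (Option D) where
  Ω := G.Ω
  pt := G.pt
  -- The normal index is differentiated in the zero direction and has no connection coefficients, so
  -- covariant derivatives vanish when their new slot is normal.
  d := fun o => o.elim 0 G.d
  Γ := fun y => oΓ (G.Γ y)
  B := fun y => oB (G.B y)

lemma Geo.Good.split {G : Geo E D} (hG : G.Good) : G.split.Good where
  isOpen := hG.isOpen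
  mem := hG.mem
  smΓ := by
    rintro (_ | l) (_ | j) (_ | k)
    all_goals first | exact contDiffOn_const | exact hG.smΓ _ _ _
  smB := by
    rintro (_ | i) (_ | j)
    all_goals first | exact contDiffOn_const | exact hG.smB _ _
  psd := fun y hy => oB_posSemidef (hG.psd y hy)
  compat := by
    rintro y hy (_ | j) (_ | i) (_ | i')
    · refine ⟨by simpa [Geo.split] using hasFDerivAt_const _ _, by simp [Geo.split]⟩
    · refine ⟨by simpa [Geo.split] using hasFDerivAt_const _ _, by simp [Geo.split]⟩
    · refine ⟨by simpa [Geo.split] using hasFDerivAt_const _ _, by simp [Geo.split]⟩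
    · exact ⟨(hG.compat y hy · i i' |>.1) |> fun h => by
        have := ((hG.smB i i').contDiffAt (hG.isOpen.mem_nhds hy)).differentiableAt (by simp)
        exact this.hasFDerivAt, by simp [Geo.split]⟩
    · refine ⟨by simpa [Geo.split] using hasFDerivAt_const _ _, by simp [Geo.split]⟩
    · refine ⟨by simpa [Geo.split] using hasFDerivAt_const _ _, by
        simp [Geo.split]⟩
    · refine ⟨by simpa [Geo.split] using hasFDerivAt_const _ _, by
        simp [Geo.split]⟩
    · refine ⟨(hG.compat y hy j i i').1, ?_⟩
      have := (hG.compat y hy j i i').2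
      simpa [Geo.split, Fintype.sum_option] using this

/-- Filling the first slot with the additional index. -/
def fillN (T : (Option ι → Option D) → ℝ) : (ι → Option D) → ℝ := fun I => T (ocons none I)

lemma nrm_fillN_le {B : Matrix D D ℝ} (hB : B.PosSemidef) (T : (Option ι → Option D) → ℝ) :
    nrm (oB B) (fillN T) ≤ nrm (oB B) T := by
  obtain ⟨Q, hQ⟩ := exists_factor hB
  rw [nrm, nrm, ip_factor (oB_factor hQ), ip_factor (oB_factor hQ), sum_option_fun]
  have : ∀ K, pull (oB Q) (fillN T) K = pull (oB Q) T (ocons none K) := by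
    intro K
    rw [pull_ocons, Fintype.sum_option]
    simp
    rfl
  simp only [this]
  exact Real.sqrt_le_sqrt (Finset.single_le_sum (f := fun j => ∑ I, pull (oB Q) T (ocons j I) *
    pull (oB Q) T (ocons j I)) (fun j _ => Finset.sum_nonneg fun I _ => mul_self_nonneg _)
    (Finset.mem_univ none))

/-- Extension of a tensor by zero to the additional index. -/
def ext0 (T : (ι → D) → ℝ) : (ι → Option D) → ℝ :=
  pull (Matrix.of fun (i : D) (j : Option D) => if j = some i then (1 : ℝ) else 0) T

lemma ext0_some (T : (ι → D) → ℝ) (K : ι → D) : ext0 T (some ∘ K) = T K := by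
  have h := congrFun (pull_one T) K
  rw [← h, ext0, pull, pull]
  refine Finset.sum_congr rfl fun I _ => ?_
  congr 1
  refine Finset.prod_congr rfl fun s _ => ?_
  simp [Matrix.one_apply, eq_comm]

lemma ext0_none (T : (ι → D) → ℝ) (K : ι → Option D) (s : ι) (h : K s = none) : ext0 T K = 0 := by
  rw [ext0, pull]
  refine Finset.sum_eq_zero fun I _ => ?_
  rw [Finset.prod_eq_zero (Finset.mem_univ s) (by simp [h]), zero_mul]

lemma nrm_ext0 (B : Matrix D D ℝ) (T : (ι → D) → ℝ) : nrm (oB B) (ext0 T) = nrm B T := by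
  rw [ext0, nrm_pull]
  congr 1
  ext i j
  simp [Matrix.mul_apply, Matrix.transpose_apply]

/-- The additional index as a covector. -/
def nuN : (Unit → Option D) → ℝ := fun I => if I () = none then 1 else 0

lemma nrm_nuN (B : Matrix D D ℝ) : nrm (oB B) (nuN (D := D)) = 1 := by
  have : ∀ f : (Unit → Option D) → ℝ, ∑ I, f I = ∑ o, f (fun _ => o) := fun f =>
    (Fintype.sum_equiv (Equiv.funUnique Unit (Option D)).symm _ _ fun x => rfl).symm
  simp [nrm, ip, nuN, this]

variable {G : Geo E D} {y : E}

lemma nab_restr (T : E → (ι → Option D) → ℝ) :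
    G.nab (fun z => restr (T z)) y = restr (G.split.nab T y) := by
  ext J
  simp only [Geo.nab, nab, der, restr, Geo.split, Fintype.sum_option, Function.comp_apply, oΓ_none1,
    oΓ_some, zero_mul, zero_add, Option.elim_some]
  congr 1
  refine Finset.sum_congr rfl fun s _ => Finset.sum_congr rfl fun l _ => ?_
  congr 2
  exact (Function.comp_update some (J ∘ some) s l)

lemma nab_fillN (T : E → (Option ι → Option D) → ℝ) :
    G.split.nab (fun z => fillN (T z)) y = fillN (rl (eqvS ι) (G.split.nab T y)) := by
  ext J
  simp only [Geo.nab, nab, der, fillN, rl, Geo.split, Fintype.sum_option (α := ι)]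
  have h0 : (ocons (none : Option D) J ∘ eqvS ι) ∘ some = ocons none (J ∘ some) := by
    ext1 o; rcases o with _ | _ <;> rfl
  have h1 : (ocons (none : Option D) J ∘ eqvS ι) none = J none := rfl
  simp only [h0, h1, ocons_none, ocons_some, oΓ_none3, zero_mul, Finset.sum_const_zero, zero_add,
    update_ocons_some]

/-- The split connection does not mix the normal index with the tangential ones, so masking a slot
is parallel. The relabellings keep track of the masked slot, which comes second after a derivative
slot is added. -/
lemma nab_msk (T : E → (Option ι → Option D) → ℝ) :
    G.split.nab (fun z => msk (T z)) y = rl (eqvS ι) (msk (rl (eqvS ι) (G.split.nab T y))) := by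
  ext J
  have h0 : ((J ∘ eqvS ι) ∘ eqvS ι) = J := by
    ext1 o; rcases o with _ | _ | _ <;> rfl
  have h1 : (J ∘ eqvS ι) none = J (some none) := rfl
  simp only [rl, msk, h0, h1]
  simp only [Geo.nab, nab, der, Geo.split, Fintype.sum_option (α := ι), msk, Function.comp_apply,
    Function.update_self]
  have h2 : ∀ (s : ι) (l : Option D), Function.update (J ∘ some) (some s) l none = J (some none) :=
    fun s l => by rw [Function.update_of_ne (by simp)]; rfl
  simp only [h2]
  by_cases h : J (some none) = none
  · simp [h]
  · obtain ⟨k, hk⟩ := Option.ne_none_iff_exists'.1 h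
    simp only [hk, reduceCtorEq, if_false]
    congr 1
    congr 1
    refine Finset.sum_congr rfl fun l _ => ?_
    cases l <;> simp

/-- Extension by zero is the pullback by a constant matrix, which is parallel for the split
connection; in a normal derivative slot both sides vanish. -/
lemma nab_ext0 {T : E → (ι → D) → ℝ} (hT : ∀ I, DifferentiableAt ℝ (fun z => T z I) y) :
    G.split.nab (fun z => ext0 (T z)) y = ext0 (G.nab T y) := by
  ext J
  rw [← ocons_eta J]
  cases h : J none with
  | none =>
    rw [ext0_none _ _ none (by simp)]
    simp [Geo.nab, nab, der, Geo.split]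
  | some j =>
    have := der_pull (v := G.d j) (Υ := fun l k => oΓ (G.Γ y) l (some j) k)
      (Υ' := fun l k => G.Γ y l j k) (u := id) (y := y) (T := T)
      (P := fun _ => (Matrix.of fun (i : D) (j : Option D) => if j = some i then (1 : ℝ) else 0))
      differentiableAt_id hT (fun a k => differentiableAt_const _) (by
        intro a k
        cases k <;> simp)
    rw [ext0, pull_ocons]
    simp only [Matrix.of_apply, Option.some.injEq, ite_mul, one_mul, zero_mul, Finset.sum_ite_eq,
      Finset.mem_univ, if_true]
    have h3 := congrFun this (J ∘ some)
    simp only [fderiv_id, id] at h3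
    exact h3

lemma nab_nuN : G.split.nab (fun _ => nuN) y = fun _ => 0 := by
  ext J
  simp only [Geo.nab, nab, der, Geo.split]
  simp only [fderiv_fun_const, Pi.zero_apply, zero_apply, nuN]
  simp

end Split

/-! ### Passing bounds between tangential and split tensors -/

section ULSplit

variable {Θ : Type*} {D : Type} [Fintype D] [DecidableEq D]
  {ι κ : Type} [Fintype ι] [DecidableEq ι] [Fintype κ] [DecidableEq κ]
  {E : Type*} [NormedAddCommGroup E] [NormedSpace ℝ E] {G : Θ → Geo E D} {b : Θ → ℝ}
  (hG : ∀ θ, (G θ).Good)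
include hG

lemma Sm.ext0 {Ω : Set E} {T : E → (ι → D) → ℝ} (h : Sm Ω T) : Sm Ω fun z => ext0 (T z) :=
  Sm.pull (P := fun _ => _) (fun _ _ => contDiffOn_const) h

lemma Sm.msk {Ω : Set E} {T : E → (Option ι → Option D) → ℝ} (h : Sm Ω T) :
    Sm Ω fun z => msk (T z) := by
  intro I
  simp only [ExtRicciMCF.msk]
  split_ifs
  · exact contDiffOn_const
  · exact h I

lemma UL.restr {n : ℕ} {ι : Type} [Fintype ι] [DecidableEq ι] {T : Θ → E → (ι → Option D) → ℝ}
    (h : UL (fun θ => (G θ).split) b n T) : UL G b n fun θ z => restr (T θ z) := by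
  have key : ∀ θ, (G θ).nm (fun z => ExtRicciMCF.restr (T θ z)) ≤ (G θ).split.nm (T θ) :=
    fun θ => nrm_restr_le ((hG θ).psd _ (hG θ).mem) _
  induction n generalizing ι with
  | zero =>
    obtain ⟨C, hC⟩ := h.2
    exact ⟨fun θ I => h.1 θ _, C, fun θ => (key θ).trans (hC θ)⟩
  | succ n ih =>
    obtain ⟨C, hC⟩ := h.2.1
    refine ⟨fun θ I => h.1 θ _, ⟨C, fun θ => (key θ).trans (hC θ)⟩, ?_⟩
    exact (ih h.2.2 fun θ => nrm_restr_le ((hG θ).psd _ (hG θ).mem) _).congr hG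
      fun θ y _ => nab_restr _

lemma UL.ext0 {n : ℕ} {ι : Type} [Fintype ι] [DecidableEq ι] {T : Θ → E → (ι → D) → ℝ}
    (h : UL G b n T) : UL (fun θ => (G θ).split) b n fun θ z => ext0 (T θ z) := by
  have hG' : ∀ θ, (G θ).split.Good := fun θ => (hG θ).split
  have key : ∀ θ, (G θ).split.nm (fun z => ExtRicciMCF.ext0 (T θ z)) = (G θ).nm (T θ) :=
    fun θ => nrm_ext0 _ _
  induction n generalizing ι with
  | zero =>
    obtain ⟨C, hC⟩ := h.2
    exact ⟨fun θ => (h.1 θ).ext0 hG, C, fun θ => (key θ).trans_le (hC θ)⟩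
  | succ n ih =>
    obtain ⟨C, hC⟩ := h.2.1
    refine ⟨fun θ => (h.1 θ).ext0 hG, ⟨C, fun θ => (key θ).trans_le (hC θ)⟩, ?_⟩
    exact (ih h.2.2 fun θ => nrm_ext0 _ _).congr hG'
      fun θ y hy => nab_ext0 ((h.1 θ).differentiableAt (hG θ).isOpen hy)

lemma UL.fillN {n : ℕ} {ι : Type} [Fintype ι] [DecidableEq ι]
    {T : Θ → E → (Option ι → Option D) → ℝ}
    (h : UL (fun θ => (G θ).split) b n T) :
    UL (fun θ => (G θ).split) b n fun θ z => fillN (T θ z) := by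
  have hG' : ∀ θ, (G θ).split.Good := fun θ => (hG θ).split
  have key : ∀ {ι : Type} [Fintype ι] [DecidableEq ι] (T : Θ → E → (Option ι → Option D) → ℝ) θ,
      (G θ).split.nm (fun z => ExtRicciMCF.fillN (T θ z)) ≤ (G θ).split.nm (T θ) :=
    fun T θ => nrm_fillN_le ((hG θ).psd _ (hG θ).mem) _
  induction n generalizing ι with
  | zero =>
    obtain ⟨C, hC⟩ := h.2
    exact ⟨fun θ I => h.1 θ _, C, fun θ => (key T θ).trans (hC θ)⟩
  | succ n ih =>
    obtain ⟨C, hC⟩ := h.2.1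
    refine ⟨fun θ I => h.1 θ _, ⟨C, fun θ => (key T θ).trans (hC θ)⟩, ?_⟩
    exact (ih (UL.rl hG' (eqvS ι) h.2.2)).congr hG' fun θ y _ => nab_fillN _

lemma UL.msk {n : ℕ} {ι : Type} [Fintype ι] [DecidableEq ι]
    {T : Θ → E → (Option ι → Option D) → ℝ}
    (h : UL (fun θ => (G θ).split) b n T) :
    UL (fun θ => (G θ).split) b n fun θ z => msk (T θ z) := by
  have hG' : ∀ θ, (G θ).split.Good := fun θ => (hG θ).split
  have key : ∀ {ι : Type} [Fintype ι] [DecidableEq ι] (T : Θ → E → (Option ι → Option D) → ℝ) θ,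
      (G θ).split.nm (fun z => ExtRicciMCF.msk (T θ z)) ≤ (G θ).split.nm (T θ) :=
    fun T θ => nrm_msk_le ((hG θ).psd _ (hG θ).mem) _
  induction n generalizing ι with
  | zero =>
    obtain ⟨C, hC⟩ := h.2
    exact ⟨fun θ => (h.1 θ).msk hG, C, fun θ => (key T θ).trans (hC θ)⟩
  | succ n ih =>
    obtain ⟨C, hC⟩ := h.2.1
    refine ⟨fun θ => (h.1 θ).msk hG, ⟨C, fun θ => (key T θ).trans (hC θ)⟩, ?_⟩
    exact (UL.rl hG' (eqvS ι) (ih (UL.rl hG' (eqvS ι) h.2.2))).congr hG' fun θ y _ => nab_msk _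

lemma UL.nuN (hb : ∀ θ, 1 ≤ b θ) {n : ℕ} :
    UL (fun θ => (G θ).split) b n fun _ _ => nuN := by
  have hG' : ∀ θ, (G θ).split.Good := fun θ => (hG θ).split
  have key : ∀ θ, (G θ).split.nm (fun _ => ExtRicciMCF.nuN) = 1 := fun θ => nrm_nuN _
  cases n with
  | zero => exact ⟨fun θ I => contDiffOn_const, 1, fun θ => by rw [key, one_mul]; exact hb θ⟩
  | succ n =>
    refine ⟨fun θ I => contDiffOn_const, ⟨1, fun θ => (key θ).le⟩, ?_⟩
    exact (UL.zero hG').congr hG' fun θ y _ => nab_nuN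

end ULSplit

/-! ### Ambient tensors in a frame adapted to the hypersurface -/

section Frame

variable {D D' : Type} [Fintype D] [DecidableEq D] [Fintype D'] [DecidableEq D']
  {E E' : Type*} [NormedAddCommGroup E] [NormedSpace ℝ E] [NormedAddCommGroup E'] [NormedSpace ℝ E']

/-- A map `u` together with a frame `P`, adapted to it, of the target along `u`. The derivative of
the frame is expressed by the split connection and the (lowered) endomorphisms `Z`. -/
structure IsFrame (G : Geo E D) (G' : Geo E' D') (u : E → E') (P : E → Matrix D' (Option D) ℝ)
    (Z : E → (Option (Option Unit) → Option D) → ℝ) : Prop where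
  maps : MapsTo u G.Ω G'.Ω
  base : u G.pt = G'.pt
  smooth : ContDiffOn ℝ ∞ u G.Ω
  smP : ∀ a k, ContDiffOn ℝ ∞ (fun y => P y a k) G.Ω
  metric : ∀ y ∈ G.Ω, P y * oB (G.B y) * (P y).transpose = G'.B (u y)
  deriv : ∀ y ∈ G.Ω, ∀ j, fderiv ℝ u y (G.d j) = ∑ c, P y c (some j) • G'.d c
  Z_none : ∀ y ∈ G.Ω, ∀ q k, Z y (ocons q (ocons k fun _ => none)) = 0
  par : ∀ y ∈ G.Ω, ∀ j a k, fderiv ℝ (fun z => P z a k) y (G.d j) =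
    ∑ l, P y a l * (oΓ (G.Γ y) l (some j) k +
      ∑ q, oB (G.B y) q l * Z y (ocons q (ocons k fun _ => some j))) -
    ∑ b, (∑ c, P y c (some j) * G'.Γ (u y) a c b) * P y b k

/-- The derivative slot in front. -/
def eqvU (ι : Type) : Unit ⊕ ι ≃ Option ι where
  toFun := Sum.elim (fun _ => none) some
  invFun := fun o => o.elim (Sum.inl ()) Sum.inr
  left_inv := by rintro (_ | _) <;> rfl
  right_inv := by rintro (_ | _) <;> rfl

variable {ι : Type} [Fintype ι] [DecidableEq ι]

/-- The frame is parallel once the split connection is corrected by the rotation `Z`, so `der_pull`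
applies and leaves an algebraic error, the action of `Z`. The mask discards ambient derivatives in
the normal direction, which have no counterpart along the map. -/
lemma IsFrame.nab_pull {G : Geo E D} {G' : Geo E' D'} {u : E → E'} {P : E → Matrix D' (Option D) ℝ}
    {Z : E → (Option (Option Unit) → Option D) → ℝ} (h : IsFrame G G' u P Z) (hG : G.Good)
    (hG' : G'.Good) {T : E' → (ι → D') → ℝ} (hT : Sm G'.Ω T) {y : E} (hy : y ∈ G.Ω) :
    G.split.nab (fun z => pull (P z) (T (u z))) y =
      msk (pull (P y) (G'.nab T (u y))) +
      rl (eqvU ι) (act (oB (G.B y)) (Z y) (pull (P y) (T (u y)))) := by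
  ext J
  rw [← ocons_eta J]
  set K := J ∘ some
  cases hj : J none with
  | none =>
    have e4 : (ocons none K ∘ eqvU ι) ∘ Sum.inl = fun _ => (none : Option D) := rfl
    simp [Geo.nab, nab, der, Geo.split, msk, rl, act, act1, Finset.sum_apply, e4, h.Z_none y hy]
  | some j =>
    have hd := der_pull (v := G.d j) (Υ := fun l k => oΓ (G.Γ y) l (some j) k +
      ∑ q, oB (G.B y) q l * Z y (ocons q (ocons k fun _ => some j)))
      (Υ' := fun a b => ∑ c, P y c (some j) * G'.Γ (u y) a c b) (u := u) (y := y) (T := T) (P := P)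
      ((h.smooth.contDiffAt (hG.isOpen.mem_nhds hy)).differentiableAt (by simp))
      (hT.differentiableAt hG'.isOpen (h.maps hy))
      (fun a k => ((h.smP a k).contDiffAt (hG.isOpen.mem_nhds hy)).differentiableAt (by simp))
      (fun a k => h.par y hy j a k)
    have e1 : der (fderiv ℝ u y (G.d j)) (fun a b => ∑ c, P y c (some j) * G'.Γ (u y) a c b) T (u y)
        = ∑ c, P y c (some j) • fun I => G'.nab T (u y) (ocons c I) := by
      ext I
      simp only [der, h.deriv y hy, map_sum, map_smul, Finset.sum_apply, Pi.smul_apply, smul_eq_mul,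
        Geo.nab, nab, mul_sub, Finset.sum_sub_distrib, ocons_none, ocons_comp_some,
        Finset.sum_mul, Finset.mul_sum]
      congr 1
      rw [Finset.sum_comm_cycle]
      refine Finset.sum_congr rfl fun c _ => Finset.sum_congr rfl fun s _ =>
        Finset.sum_congr rfl fun l _ => by ring
    have e2 : pull (P y) (G'.nab T (u y)) (ocons (some j) K) =
        pull (P y) (∑ c, P y c (some j) • fun I => G'.nab T (u y) (ocons c I)) K := by
      rw [pull_ocons, pull_sum]
      simp [pull_smul]
    rw [e1] at hd
    have hd' := congrFun hd K
    rw [← e2] at hd'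
    simp only [Pi.add_apply, msk, ocons_none, reduceCtorEq, if_false, ← hd', rl]
    simp only [Geo.nab, nab, der, Geo.split, ocons_none, ocons_comp_some, Option.elim_some, act,
      Finset.sum_apply, act1, add_mul, Finset.sum_add_distrib]
    have e3 : ∀ s : ι, (ocons (some j) K ∘ eqvU ι) (Sum.inr s) = K s := fun s => rfl
    have e4 : (ocons (some j) K ∘ eqvU ι) ∘ Sum.inl = fun _ => some j := rfl
    have e5 : (ocons (some j) K ∘ eqvU ι) ∘ Sum.inr = K := rfl
    simp only [e3, e4, e5]
    have e6 : ∀ s, ∑ l, (∑ q, oB (G.B y) q l * Z y (ocons q (ocons (K s) fun _ => some j))) *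
        pull (P y) (T (u y)) (Function.update K s l) =
        ∑ q, ∑ p, oB (G.B y) q p * (Z y (ocons q (ocons (K s) fun _ => some j)) *
          pull (P y) (T (u y)) (Function.update K s p)) := by
      intro s
      rw [Finset.sum_comm]
      simp only [Finset.sum_mul, mul_assoc]
    simp only [e6]
    ring

variable {Θ : Type*} {G : Θ → Geo E D} {G' : Θ → Geo E' D'} {b : Θ → ℝ}
  {u : Θ → E → E'} {P : Θ → E → Matrix D' (Option D) ℝ}
  {Z : Θ → E → (Option (Option Unit) → Option D) → ℝ}

/-- Ambient tensors with bounded covariant derivatives have controlled components in an adapted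
frame. -/
lemma UL.frame {k : ℕ} (hG : ∀ θ, (G θ).Good) (hG' : ∀ θ, (G' θ).Good) (hb : ∀ θ, 1 ≤ b θ)
    (hF : ∀ θ, IsFrame (G θ) (G' θ) (u θ) (P θ) (Z θ))
    (hZ : UL (fun θ => (G θ).split) b (k + 1) Z) {T : Θ → E' → (ι → D') → ℝ}
    (hT : ∀ n, UL G' 1 n T) :
    UL (fun θ => (G θ).split) b (k + 2) fun θ z => pull (P θ z) (T θ (u θ z)) := by
  have hGs : ∀ θ, (G θ).split.Good := fun θ => (hG θ).split
  -- Induction on the order, for all tensors at once: one derivative replaces `T` by its ambient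
  -- covariant derivative and adds a product with `Z` that carries one derivative fewer. Hence the
  -- components are controlled to one order more than `Z`.
  have main : ∀ n ≤ k + 2, ∀ {ι : Type} [Fintype ι] [DecidableEq ι] {T : Θ → E' → (ι → D') → ℝ},
      (∀ n, UL G' 1 n T) →
      UL (fun θ => (G θ).split) b n fun θ z => pull (P θ z) (T θ (u θ z)) := by
    intro n
    induction n with
    | zero =>
      intro _ ι _ _ T hT
      have hs : ∀ θ, Sm (G θ).split.Ω fun z => pull (P θ z) (T θ (u θ z)) := fun θ =>
        Sm.pull (hF θ).smP fun I => ((hT 0).1 θ I).comp (hF θ).smooth (hF θ).maps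
      obtain ⟨C, hC⟩ := (hT 0).2
      refine ⟨hs, |C|, fun θ => ?_⟩
      have : (G θ).split.nm (fun z => pull (P θ z) (T θ (u θ z))) = (G' θ).nm (T θ) := by
        rw [Geo.nm, Geo.nm, ← (hF θ).base, ← (hF θ).metric _ (hG θ).mem, ← nrm_pull]
        rfl
      rw [this]
      refine (hC θ).trans ?_
      rw [Pi.one_apply, mul_one]
      nlinarith [le_abs_self C, abs_nonneg C, hb θ]
    | succ n ih =>
      intro hn ι _ _ T hT
      have h0 := ih (by omega) hT
      have hs : ∀ θ, Sm (G θ).split.Ω fun z => pull (P θ z) (T θ (u θ z)) := fun θ =>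
        Sm.pull (hF θ).smP fun I => ((hT 0).1 θ I).comp (hF θ).smooth (hF θ).maps
      refine ⟨hs, ?_, ?_⟩
      · obtain ⟨C, hC⟩ := (hT 0).2
        refine ⟨C, fun θ => ?_⟩
        have : (G θ).split.nm (fun z => pull (P θ z) (T θ (u θ z))) = (G' θ).nm (T θ) := by
          rw [Geo.nm, Geo.nm, ← (hF θ).base, ← (hF θ).metric _ (hG θ).mem, ← nrm_pull]
          rfl
        rw [this]
        simpa using hC θ
      · have h1 := (ih (by omega) (T := fun θ => (G' θ).nab (T θ)) fun n => (hT (n + 1)).nab).msk hG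
        have h2 : UL (fun θ => (G θ).split) b n
            fun θ z => ExtRicciMCF.tprod (Z θ z) (pull (P θ z) (T θ (u θ z))) := by
          -- At order zero only one factor may carry the weight, so `Z` is used one order higher,
          -- where it is bounded.
          cases n with
          | zero => exact UL.tprod' hGs hb (hZ.mono_le hGs hb (by omega)) h0
          | succ n => exact UL.tprod_succ hGs hb (hZ.mono_le hGs hb (by omega)) h0
        have h3 := (h2.act_of_tprod hGs).rl hGs (eqvU ι)
        exact (h1.add hGs h3).congr hGs fun θ y hy =>
          (hF θ).nab_pull (hG θ) (hG' θ) ((hT 0).1 θ) hy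
  exact main (k + 2) le_rfl hT

end Frame

/-- The two derivative slots in front. -/
def eqvU2 (ι : Type) : Option Unit ⊕ ι ≃ Option (Option ι) where
  toFun
    | Sum.inl none => none
    | Sum.inl (some _) => some none
    | Sum.inr i => some (some i)
  invFun
    | none => Sum.inl none
    | some none => Sum.inl (some ())
    | some (some i) => Sum.inr i
  left_inv := by rintro ((_ | _) | _) <;> rfl
  right_inv := by rintro (_ | _ | _) <;> rfl

/-- No derivative slots. -/
def eqvE (ι : Type) : Empty ⊕ ι ≃ ι := Equiv.emptySum Empty ι

/-! ### Heat equations for tensor fields and for their covariant derivatives -/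

section Heat

variable {D : Type} [Fintype D] [DecidableEq D]
  {ι κ : Type} [Fintype ι] [DecidableEq ι] [Fintype κ] [DecidableEq κ]
  {E : Type*} [NormedAddCommGroup E] [NormedSpace ℝ E] {G : Geo E D} {v : E} {y : E}

/-- Derivative of the components of a tensor field in a fixed direction. -/
def dt (v : E) (T : E → (ι → D) → ℝ) : E → (ι → D) → ℝ := fun y I => fderiv ℝ (fun z => T z I) y v

/-- `R` is the lowered curvature tensor of the connection. -/
def IsCurv (G : Geo E D) (R : E → (Option (Option (Option Unit)) → D) → ℝ) : Prop :=
  ∀ y ∈ G.Ω, ∀ p i j k, ∑ q, G.B y q p * R y (ocons q (ocons k (ocons i fun _ => j))) =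
    curvC G.d G.Γ y p i j k

/-- `Z` is the lowered derivative of the connection in the direction `v`. -/
def IsConnVar (G : Geo E D) (v : E) (Z : E → (Option (Option Unit) → D) → ℝ) : Prop :=
  ∀ y ∈ G.Ω, ∀ p j k, ∑ q, G.B y q p * Z y (ocons q (ocons k fun _ => j)) =
    fderiv ℝ (fun z => G.Γ z p j k) y v

/-- `V` is the derivative of the metric in the direction `v`. -/
def IsMetVar (G : Geo E D) (v : E) (V : E → (Option (Option Empty) → D) → ℝ) : Prop :=
  ∀ y ∈ G.Ω, Compat v
    (fun l k => (1 / 2) * ∑ q, G.B y q l * V y (ocons q (ocons k Empty.elim))) G.B y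

lemma nab_nab_eq (hG : G.Good) (hsymm : ∀ y ∈ G.Ω, ∀ p i j, G.Γ y p i j = G.Γ y p j i)
    {R : E → (Option (Option (Option Unit)) → D) → ℝ} (hR : IsCurv G R)
    {T : E → (ι → D) → ℝ} (hT : Sm G.Ω T) (hy : y ∈ G.Ω) :
    G.nab (G.nab T) y = rl (eqvS ι) (G.nab (G.nab T) y) -
      rl (eqvU2 ι) (act (G.B y) (R y) (T y)) := by
  ext J
  obtain ⟨i, j, I, rfl⟩ : ∃ i j I, J = ocons i (ocons j I) :=
    ⟨J none, J (some none), (J ∘ some) ∘ some, by ext o; rcases o with _ | _ | _ <;> rfl⟩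
  have h := nab_nab_comm (d := G.d) hG.isOpen hG.smΓ hT hy (hsymm y hy · i j) I
  have e1 : ocons i (ocons j I) ∘ eqvS ι = ocons j (ocons i I) := by
    ext o; rcases o with _ | _ | _ <;> rfl
  have e2 : (ocons i (ocons j I) ∘ eqvU2 ι) ∘ Sum.inl = ocons i fun _ => j := by
    ext o; rcases o with _ | _ <;> rfl
  have e3 : (ocons i (ocons j I) ∘ eqvU2 ι) ∘ Sum.inr = I := rfl
  have e4 : ∀ s : ι, (ocons i (ocons j I) ∘ eqvU2 ι) (Sum.inr s) = I s := fun s => rfl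
  simp only [Pi.sub_apply, rl, e1, act, Finset.sum_apply, act1, e2, e3, e4]
  have e5 : ∑ s, ∑ q, ∑ p, G.B y q p * (R y (ocons q (ocons (I s) (ocons i fun _ => j))) *
      T y (Function.update I s p)) =
      ∑ s, ∑ l, curvC G.d G.Γ y l i j (I s) * T y (Function.update I s l) := by
    refine Finset.sum_congr rfl fun s _ => ?_
    rw [Finset.sum_comm]
    refine Finset.sum_congr rfl fun l _ => ?_
    rw [← hR y hy, Finset.sum_mul]
    exact Finset.sum_congr rfl fun q _ => by ring
  rw [e5]
  linarith

lemma fderiv_fderiv_comm {F : Type*} [NormedAddCommGroup F] [NormedSpace ℝ F] {f : E → F}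
    {Ω : Set E} (hΩ : IsOpen Ω) (hf : ContDiffOn ℝ ∞ f Ω) (hy : y ∈ Ω) (v w : E) :
    fderiv ℝ (fun z => fderiv ℝ f z v) y w = fderiv ℝ (fun z => fderiv ℝ f z w) y v := by
  have hc : ContDiffAt ℝ ∞ f y := hf.contDiffAt (hΩ.mem_nhds hy)
  have hs := (hc.isSymmSndFDerivAt (by simpa using two_le_infty)) w v
  have hd : DifferentiableAt ℝ (fderiv ℝ f) y :=
    (hc.fderiv_right (m := 1) (by rw [one_add_one_eq_two]; exact two_le_infty)).differentiableAt
      (by simp)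
  rw [fderiv_clm_apply hd (differentiableAt_const _), fderiv_clm_apply hd (differentiableAt_const _)]
  simpa using hs

/-- Partial derivatives in constant directions commute, so the commutator consists only of the
variation of the connection coefficients. -/
lemma dt_nab (hG : G.Good) {Z : E → (Option (Option Unit) → D) → ℝ} (hZ : IsConnVar G v Z)
    {T : E → (ι → D) → ℝ} (hT : Sm G.Ω T) (hy : y ∈ G.Ω) :
    dt v (G.nab T) y = G.nab (dt v T) y - rl (eqvU ι) (act (G.B y) (Z y) (T y)) := by
  ext J
  obtain ⟨j, I, rfl⟩ : ∃ j I, J = ocons j I := ⟨J none, J ∘ some, (ocons_eta J).symm⟩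
  have hTd := hT.differentiableAt hG.isOpen hy
  have hΓd : ∀ l j k, DifferentiableAt ℝ (fun z => G.Γ z l j k) y := fun l j k =>
    ((hG.smΓ l j k).contDiffAt (hG.isOpen.mem_nhds hy)).differentiableAt (by simp)
  have h1 : HasFDerivAt (fun z => G.nab T z (ocons j I))
      (fderiv ℝ (fun z => fderiv ℝ (fun z => T z I) z (G.d j)) y - ∑ s, ∑ l,
        (G.Γ y l j (I s) • fderiv ℝ (fun z => T z (Function.update I s l)) y +
          T y (Function.update I s l) • fderiv ℝ (fun z => G.Γ z l j (I s)) y)) y := by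
    simp only [Geo.nab, nab_ocons, der]
    refine HasFDerivAt.fun_sub ?_ (HasFDerivAt.fun_sum fun s _ => HasFDerivAt.fun_sum fun l _ =>
      (hΓd _ _ _).hasFDerivAt.mul (hTd _).hasFDerivAt)
    exact (((contDiffOn_fderiv_apply hG.isOpen (hT I) (G.d j)).contDiffAt
      (hG.isOpen.mem_nhds hy)).differentiableAt (by simp)).hasFDerivAt
  have e2 : (ocons j I ∘ eqvU ι) ∘ Sum.inl = fun _ => j := rfl
  have e3 : (ocons j I ∘ eqvU ι) ∘ Sum.inr = I := rfl
  have e4 : ∀ s : ι, (ocons j I ∘ eqvU ι) (Sum.inr s) = I s := fun s => rfl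
  have e5 : ∑ s, ∑ q, ∑ p, G.B y q p * (Z y (ocons q (ocons (I s) fun _ => j)) *
      T y (Function.update I s p)) =
      ∑ s, ∑ l, fderiv ℝ (fun z => G.Γ z l j (I s)) y v * T y (Function.update I s l) := by
    refine Finset.sum_congr rfl fun s _ => ?_
    rw [Finset.sum_comm]
    refine Finset.sum_congr rfl fun l _ => ?_
    rw [← hZ y hy, Finset.sum_mul]
    exact Finset.sum_congr rfl fun q _ => by ring
  simp only [Pi.sub_apply, rl, act, Finset.sum_apply, act1, e2, e3, e4, e5]
  rw [dt, h1.fderiv, Geo.nab, nab_ocons, der]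
  simp only [sub_apply, sum_apply, add_apply, smul_apply, smul_eq_mul, dt,
    Finset.sum_add_distrib, fderiv_fderiv_comm hG.isOpen (hT I) hy (G.d j) v, mul_comm (T y _)]
  ring

/-- The heat equation with a source term. -/
def Heat (G : Geo E D) (v : E) (T P : E → (ι → D) → ℝ) : Prop :=
  ∀ y ∈ G.Ω, dt v T y = G.lap T y + P y

/-- The source term in the heat equation of the covariant derivative. -/
def srcNab (G : Geo E D) (R : E → (Option (Option (Option Unit)) → D) → ℝ)
    (Z : E → (Option (Option Unit) → D) → ℝ) (T P : E → (ι → D) → ℝ) : E → (Option ι → D) → ℝ :=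
  fun y => G.nab P y - rl (eqvU ι) (act (G.B y) (Z y) (T y)) +
    (contr (G.B y) (G.nab (fun z => rl (eqvU2 ι) (act (G.B z) (R z) (T z))) y) +
    contr (G.B y) (rl (eqvS ι).optionCongr
      (rl (eqvU2 (Option ι)) (act (G.B y) (R y) (G.nab T y)))))

lemma rl_sub' (f : ι ≃ κ) (T S : (ι → D) → ℝ) : rl f (T - S) = rl f T - rl f S := rfl
lemma contr_sub (B : Matrix D D ℝ) (T S : (Option (Option ι) → D) → ℝ) :
    contr B (T - S) = contr B T - contr B S := by
  ext I; simp [contr, mul_sub, Finset.sum_sub_distrib]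

lemma nab_sub {T S : E → (ι → D) → ℝ} (hT : ∀ I, DifferentiableAt ℝ (fun z => T z I) y)
    (hS : ∀ I, DifferentiableAt ℝ (fun z => S z I) y) :
    G.nab (fun z => T z - S z) y = G.nab T y - G.nab S y := by
  have h1 : (fun z => T z - S z) = fun z => T z + (-1 : ℝ) • S z := by
    funext z; rw [neg_one_smul, sub_eq_add_neg]
  rw [h1, Geo.nab, nab_add (S := fun z => (-1 : ℝ) • S z) hT (fun I => (hS I).const_mul (-1)),
    nab_smul _ hS, neg_one_smul,
    sub_eq_add_neg]

/-- To bring the outermost and the contracted derivatives into the order of `∇ΔT`, the Ricci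
identity is used twice: differentiated, to exchange the two inner derivatives, and for `∇T`, to
exchange the two outer ones. -/
lemma lap_nab (hG : G.Good) (hsymm : ∀ y ∈ G.Ω, ∀ p i j, G.Γ y p i j = G.Γ y p j i)
    {R : E → (Option (Option (Option Unit)) → D) → ℝ} (hR : IsCurv G R) (hRs : Sm G.Ω R)
    {T : E → (ι → D) → ℝ} (hT : Sm G.Ω T) (hy : y ∈ G.Ω) :
    G.lap (G.nab T) y = G.nab (G.lap T) y -
      (contr (G.B y) (G.nab (fun z => rl (eqvU2 ι) (act (G.B z) (R z) (T z))) y) +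
      contr (G.B y) (rl (eqvS ι).optionCongr
        (rl (eqvU2 (Option ι)) (act (G.B y) (R y) (G.nab T y))))) := by
  have h1 : EqOn (G.nab (G.nab T)) (fun z => rl (eqvS ι) (G.nab (G.nab T) z) -
      rl (eqvU2 ι) (act (G.B z) (R z) (T z))) G.Ω := fun z hz => nab_nab_eq hG hsymm hR hT hz
  have hn := hG.sm_nab (hG.sm_nab hT)
  have h2 : G.nab (G.nab (G.nab T)) y = rl (eqvS ι).optionCongr (G.nab (G.nab (G.nab T)) y) -
      G.nab (fun z => rl (eqvU2 ι) (act (G.B z) (R z) (T z))) y := by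
    have h4 := nab_congr hG.isOpen h1 hy (d := G.d) (Γ := G.Γ)
    have h3 := nab_sub (G := G) ((hn.rl (eqvS ι)).differentiableAt hG.isOpen hy)
      (((hG.sm_act hRs hT).rl (eqvU2 ι)).differentiableAt hG.isOpen hy)
    have h5 := nab_rl (d := G.d) (Γ := G.Γ) (y := y) (T := G.nab (G.nab T)) (eqvS ι)
    rw [← h5]
    exact h4.trans h3
  have h3 : rl (eqvS ι).optionCongr (G.nab (G.nab (G.nab T)) y) =
      rl (eqvC ι) (G.nab (G.nab (G.nab T)) y) - rl (eqvS ι).optionCongr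
        (rl (eqvU2 (Option ι)) (act (G.B y) (R y) (G.nab T y))) := by
    have := nab_nab_eq hG hsymm hR (hG.sm_nab hT) hy
    rw [this, rl_sub']
    rw [← this]
    congr 1
    ext J
    simp only [rl]
    congr 1
    ext o
    rcases o with _ | _ | _ | _ <;> rfl
  have h4 : G.nab (G.lap T) y = contr (G.B y) (rl (eqvC ι) (G.nab (G.nab (G.nab T)) y)) :=
    nab_contr (hG.compat y hy) (hn.differentiableAt hG.isOpen hy)
  have h5 : G.lap (G.nab T) y = contr (G.B y) (G.nab (G.nab (G.nab T)) y) := rfl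
  rw [h5, h2, h3, contr_sub, contr_sub, h4]
  abel

lemma Heat.nab {T P : E → (ι → D) → ℝ} (h : Heat G v T P) (hG : G.Good)
    (hsymm : ∀ y ∈ G.Ω, ∀ p i j, G.Γ y p i j = G.Γ y p j i)
    {R : E → (Option (Option (Option Unit)) → D) → ℝ} (hR : IsCurv G R) (hRs : Sm G.Ω R)
    {Z : E → (Option (Option Unit) → D) → ℝ} (hZ : IsConnVar G v Z)
    (hT : Sm G.Ω T) (hP : Sm G.Ω P) : Heat G v (G.nab T) (srcNab G R Z T P) := by
  intro y hy
  rw [dt_nab hG hZ hT hy, lap_nab hG hsymm hR hRs hT hy]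
  have h1 : G.nab (dt v T) y = G.nab (G.lap T) y + G.nab P y := by
    have h2 : EqOn (dt v T) (fun z => G.lap T z + P z) G.Ω := h
    rw [← nab_add ((hG.sm_lap hT).differentiableAt hG.isOpen hy) (hP.differentiableAt hG.isOpen hy)]
    exact nab_congr hG.isOpen h2 hy
  rw [h1, srcNab]
  abel

lemma nrm_act_le {B : Matrix D D ℝ} (hB : B.PosSemidef) (Z : (Option (Option κ) → D) → ℝ)
    (T : (ι → D) → ℝ) :
    nrm B (act B Z T) ≤ Fintype.card ι * (Fintype.card D * (nrm B Z * nrm B T)) := by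
  have h1 : ∀ s, nrm B (act1 B s Z T) ≤ Fintype.card D * (nrm B Z * nrm B T) := fun s => by
    rw [act1_eq]
    refine (nrm_contr_le hB _).trans ?_
    rw [nrm_rl, nrm_tprod hB]
  have h2 : ∀ A : Finset ι, nrm B (∑ s ∈ A, act1 B s Z T) ≤
      A.card * (Fintype.card D * (nrm B Z * nrm B T)) := by
    intro A
    induction A using Finset.induction_on with
    | empty => simp [nrm, ip]
    | insert a A ha ih =>
      rw [Finset.sum_insert ha, Finset.card_insert_of_notMem ha]
      refine (nrm_add_le hB _ _).trans ?_
      push_cast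
      linarith [h1 a]
  exact h2 Finset.univ

/-- Evolution of the squared norm along the heat equation. -/
lemma Heat.ip_self {T P : E → (ι → D) → ℝ} (h : Heat G v T P) (hG : G.Good) (hT : Sm G.Ω T)
    {V : E → (Option (Option Empty) → D) → ℝ} (hV : IsMetVar G v V) (hy : y ∈ G.Ω) :
    fderiv ℝ (fun z => ip (G.B z) (T z) (T z)) y v -
      G.lapFun (fun z => ip (G.B z) (T z) (T z)) y =
    2 * ip (G.B y) (P y) (T y) - ip (G.B y) (ExtRicciMCF.rl (eqvE ι) (act (G.B y) (V y) (T y))) (T y) -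
      2 * ip (G.B y) (G.nab T y) (G.nab T y) := by
  have hTd := hT.differentiableAt hG.isOpen hy
  rw [hG.bochner hT hy, fderiv_ip (hV y hy) hTd hTd, ip_comm (hG.psd y hy) (T y)]
  -- The time derivative for which the moving metric is parallel differs from `dt v` by half the
  -- action of the velocity `V` on each slot.
  have h1 : der v (fun l k => (1 / 2) * ∑ q, G.B y q l * V y (ocons q (ocons k Empty.elim))) T y =
      G.lap T y + P y + (-(1 / 2 : ℝ)) • ExtRicciMCF.rl (eqvE ι) (act (G.B y) (V y) (T y)) := by
    rw [← h y hy]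
    ext I
    simp only [der, dt, Pi.add_apply, Pi.smul_apply, smul_eq_mul, ExtRicciMCF.rl, act,
      Finset.sum_apply, act1]
    have e1 : (I ∘ eqvE ι) ∘ Sum.inl = Empty.elim := by ext o; exact o.elim
    have e2 : (I ∘ eqvE ι) ∘ Sum.inr = I := rfl
    have e3 : ∀ s : ι, (I ∘ eqvE ι) (Sum.inr s) = I s := fun _ => rfl
    have e4 : ∑ s, ∑ l, (1 / 2 * ∑ q, G.B y q l * V y (ocons q (ocons (I s) Empty.elim))) *
        T y (Function.update I s l) = 1 / 2 * ∑ s, ∑ q, ∑ p, G.B y q p *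
          (V y (ocons q (ocons (I s) Empty.elim)) * T y (Function.update I s p)) := by
      rw [Finset.mul_sum]
      refine Finset.sum_congr rfl fun s _ => ?_
      rw [Finset.sum_comm, Finset.mul_sum]
      refine Finset.sum_congr rfl fun l _ => ?_
      rw [Finset.mul_sum, Finset.mul_sum, Finset.sum_mul]
      exact Finset.sum_congr rfl fun q _ => by ring
    simp only [e1, e2, e3]
    rw [e4]
    ring
  rw [h1, ip_add_left, ip_add_left, ip_smul_left]
  ring

end Heat

/-! ### The differential inequality for two successive derivatives -/

section HeatUL

variable {Θ : Type*} {D : Type} [Fintype D] [DecidableEq D]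
  {ι κ : Type} [Fintype ι] [DecidableEq ι] [Fintype κ] [DecidableEq κ]
  {E : Type*} [NormedAddCommGroup E] [NormedSpace ℝ E] {G : Θ → Geo E D} {b : Θ → ℝ} {v : Θ → E}

/-- The new source contains one derivative of `P`, of `R` and of `T`, but `Z` only algebraically;
this accounts for the orders required and for the loss of one order. -/
lemma UL.srcNab (hG : ∀ θ, (G θ).Good) (hb : ∀ θ, 1 ≤ b θ) {n : ℕ}
    {R : Θ → E → (Option (Option (Option Unit)) → D) → ℝ} (hR : UL G b (n + 1) R)
    {Z : Θ → E → (Option (Option Unit) → D) → ℝ} (hZ : UL G b n Z)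
    {T P : Θ → E → (ι → D) → ℝ} (hT : UL G b (n + 1) T) (hP : UL G b (n + 1) P) :
    UL G b n fun θ => srcNab (G θ) (R θ) (Z θ) (T θ) (P θ) := by
  have h1 := ((hZ.tprod hG hb hT).act_of_tprod hG).rl hG (eqvU ι)
  have h2 := ((((UL.tprod_succ hG hb hR hT).act_of_tprod hG).rl hG (eqvU2 ι)).nab).contr hG
  have h3 := ((((UL.tprod' hG hb hR hT.nab).act_of_tprod hG).rl hG (eqvU2 (Option ι))).rl hG
    (eqvS ι).optionCongr).contr hG
  exact (hP.nab.sub hG h1).add hG (h2.add hG h3)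

/-- The differential inequality behind the estimate of `∇T`, when `T` and its source term are
bounded and the source term of `∇T` is at most linear in `∇T`. -/
theorem exists_heat_bound (hG : ∀ θ, (G θ).Good)
    {V : Θ → E → (Option (Option Empty) → D) → ℝ} (hV : ∀ θ, IsMetVar (G θ) (v θ) (V θ))
    (hVb : ∃ C, ∀ θ, (G θ).nm (V θ) ≤ C)
    {T P : Θ → E → (ι → D) → ℝ} {Q : Θ → E → (Option ι → D) → ℝ}
    (hT : ∀ θ, Sm (G θ).Ω (T θ)) (hTP : ∀ θ, Heat (G θ) (v θ) (T θ) (P θ))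
    (hTQ : ∀ θ, Heat (G θ) (v θ) ((G θ).nab (T θ)) (Q θ))
    (hTb : ∃ C, ∀ θ, (G θ).nm (T θ) ≤ C) (hPb : ∃ C, ∀ θ, (G θ).nm (P θ) ≤ C)
    (hQb : ∃ C, ∀ θ, (G θ).nm (Q θ) ≤ C * (1 + (G θ).nm ((G θ).nab (T θ)))) :
    ∃ N C : ℝ, 0 ≤ N ∧ ∀ θ,
      (fderiv ℝ (fun z => ip ((G θ).B z) ((G θ).nab (T θ) z) ((G θ).nab (T θ) z)) (G θ).pt (v θ) -
        (G θ).lapFun (fun z => ip ((G θ).B z) ((G θ).nab (T θ) z) ((G θ).nab (T θ) z)) (G θ).pt) +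
      N * (fderiv ℝ (fun z => ip ((G θ).B z) (T θ z) (T θ z)) (G θ).pt (v θ) -
        (G θ).lapFun (fun z => ip ((G θ).B z) (T θ z) (T θ z)) (G θ).pt) ≤
      C - (G θ).nm ((G θ).nab (T θ)) ^ 2 := by
  obtain ⟨CV, hCV⟩ := hVb
  obtain ⟨CT, hCT⟩ := hTb
  obtain ⟨CP, hCP⟩ := hPb
  obtain ⟨CQ, hCQ⟩ := hQb
  have key : ∀ {ι : Type} [Fintype ι] [DecidableEq ι] (S : Θ → E → (ι → D) → ℝ) (θ : Θ),
      |ip ((G θ).B (G θ).pt) (rl (eqvE ι) (act ((G θ).B (G θ).pt) (V θ (G θ).pt) (S θ (G θ).pt)))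
        (S θ (G θ).pt)| ≤ Fintype.card ι * (Fintype.card D * |CV|) * (G θ).nm (S θ) ^ 2 := by
    intro ι _ _ S θ
    have hp := (hG θ).psd _ (hG θ).mem
    refine (abs_ip_le hp _ _).trans ?_
    rw [nrm_rl]
    have h1 := nrm_act_le hp (V θ (G θ).pt) (S θ (G θ).pt)
    have h2 : nrm ((G θ).B (G θ).pt) (V θ (G θ).pt) ≤ |CV| := (hCV θ).trans (le_abs_self _)
    have h3 := nrm_nonneg ((G θ).B (G θ).pt) (S θ (G θ).pt)
    calc _ ≤ (Fintype.card ι * (Fintype.card D * (nrm ((G θ).B (G θ).pt) (V θ (G θ).pt) *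
          nrm ((G θ).B (G θ).pt) (S θ (G θ).pt)))) * nrm ((G θ).B (G θ).pt) (S θ (G θ).pt) :=
          mul_le_mul_of_nonneg_right h1 h3
      _ ≤ (Fintype.card ι * (Fintype.card D * (|CV| *
          nrm ((G θ).B (G θ).pt) (S θ (G θ).pt)))) * nrm ((G θ).B (G θ).pt) (S θ (G θ).pt) := by
          gcongr
      _ = _ := by rw [Geo.nm]; ring
  set a := (Fintype.card (Option ι) : ℝ) * (Fintype.card D * |CV|)
  set a' := (Fintype.card ι : ℝ) * (Fintype.card D * |CV|)
  have ha : 0 ≤ a := by positivity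
  have ha' : 0 ≤ a' := by positivity
  -- The good term is `-2 N |∇T|²`. Half of it absorbs `4 |CQ| |∇T|²` from twice the pairing of `Q`
  -- with `∇T`, and `a |∇T|²` from the velocity of the metric, and leaves `-|∇T|²`.
  set N := 4 * |CQ| + a + 1 with hN
  refine ⟨N, |CQ| + N * (2 * |CP| * |CT| + a' * CT ^ 2), by positivity, fun θ => ?_⟩
  have hp := (hG θ).psd _ (hG θ).mem
  rw [(hTQ θ).ip_self (hG θ) ((hG θ).sm_nab (hT θ)) (hV θ) (hG θ).mem,
    (hTP θ).ip_self (hG θ) (hT θ) (hV θ) (hG θ).mem]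
  set x := (G θ).nm ((G θ).nab (T θ))
  have hx : 0 ≤ x := Geo.nm_nonneg _ _
  have k1 := (abs_le.1 (key (fun θ => (G θ).nab (T θ)) θ)).1
  have k2 := (abs_le.1 (key T θ)).1
  have k3 := (abs_le.1 (abs_ip_le hp (Q θ (G θ).pt) ((G θ).nab (T θ) (G θ).pt))).2
  have k4 := (abs_le.1 (abs_ip_le hp (P θ (G θ).pt) (T θ (G θ).pt))).2
  have k5 := ip_self_nonneg hp ((G θ).nab ((G θ).nab (T θ)) (G θ).pt)
  have k6 : ip ((G θ).B (G θ).pt) ((G θ).nab (T θ) (G θ).pt) ((G θ).nab (T θ) (G θ).pt) = x ^ 2 :=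
    (nrm_sq hp _).symm
  have k7 : ip ((G θ).B (G θ).pt) (Q θ (G θ).pt) ((G θ).nab (T θ) (G θ).pt) ≤
      |CQ| * (1 + x) * x := by
    refine k3.trans (mul_le_mul_of_nonneg_right ((hCQ θ).trans ?_) hx)
    exact mul_le_mul_of_nonneg_right (le_abs_self _) (by positivity)
  have ht : 0 ≤ (G θ).nm (T θ) := Geo.nm_nonneg _ _
  have k8 : ip ((G θ).B (G θ).pt) (P θ (G θ).pt) (T θ (G θ).pt) ≤ |CP| * |CT| :=
    k4.trans (mul_le_mul ((hCP θ).trans (le_abs_self _)) ((hCT θ).trans (le_abs_self _)) ht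
      (abs_nonneg _))
  have k9 : (G θ).nm (T θ) ^ 2 ≤ CT ^ 2 := pow_le_pow_left₀ ht (hCT θ) 2
  have k10 := mul_le_mul_of_nonneg_left k9 ha'
  have k11 : |CQ| * (1 + x) * x ≤ |CQ| * (1 / 2 + 2 * x ^ 2) := by
    rw [mul_assoc]
    exact mul_le_mul_of_nonneg_left (by nlinarith [sq_nonneg (x - 1)]) (abs_nonneg _)
  rw [k6]
  have hN0 : 0 ≤ N := by positivity
  have k12 : 2 * ip ((G θ).B (G θ).pt) (P θ (G θ).pt) (T θ (G θ).pt) -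
      ip ((G θ).B (G θ).pt) (rl (eqvE ι) (act ((G θ).B (G θ).pt) (V θ (G θ).pt) (T θ (G θ).pt)))
        (T θ (G θ).pt) - 2 * x ^ 2 ≤ (2 * |CP| * |CT| + a' * CT ^ 2) - 2 * x ^ 2 := by
    linarith
  have k13 := mul_le_mul_of_nonneg_left k12 hN0
  have k14 : 0 ≤ N * x ^ 2 := by positivity
  have k15 : N * x ^ 2 = 4 * |CQ| * x ^ 2 + a * x ^ 2 + x ^ 2 := by rw [hN]; ring
  linarith

end HeatUL

/-! ### The Levi-Civita connection of a metric -/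

section LeviCivita

variable {D : Type} [Fintype D] [DecidableEq D]
  {E : Type*} [NormedAddCommGroup E] [NormedSpace ℝ E]

lemma contDiffOn_det {Ω : Set E} {A : E → Matrix D D ℝ}
    (h : ∀ i j, ContDiffOn ℝ ∞ (fun y => A y i j) Ω) : ContDiffOn ℝ ∞ (fun y => (A y).det) Ω := by
  simp only [Matrix.det_apply']
  exact ContDiffOn.sum fun σ _ => contDiffOn_const.mul (contDiffOn_prod fun i _ => h _ _)

lemma contDiffOn_inv {Ω : Set E} {A : E → Matrix D D ℝ}
    (h : ∀ i j, ContDiffOn ℝ ∞ (fun y => A y i j) Ω) (hdet : ∀ y ∈ Ω, (A y).det ≠ 0) (i j : D) :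
    ContDiffOn ℝ ∞ (fun y => (A y)⁻¹ i j) Ω := by
  have : ∀ y, (A y)⁻¹ i j = (A y).det⁻¹ * ((A y).updateRow j (Pi.single i 1)).det := by
    intro y
    rw [Matrix.inv_def, Matrix.smul_apply, Ring.inverse_eq_inv', Matrix.adjugate_apply, smul_eq_mul]
  simp only [this]
  refine ((contDiffOn_det h).inv hdet).mul (contDiffOn_det fun k l => ?_)
  by_cases hk : k = j
  · subst hk; simpa using contDiffOn_const
  · simpa [Matrix.updateRow_apply, hk] using h k l

/-- A connection preserving the metric preserves the inverse metric. -/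
lemma compat_of_metric {Ω : Set E} (hΩ : IsOpen Ω) {A : E → Matrix D D ℝ}
    (h : ∀ i j, ContDiffOn ℝ ∞ (fun y => A y i j) Ω) (hA : ∀ y ∈ Ω, (A y).PosDef) {y : E}
    (hy : y ∈ Ω) {v : E} {Υ : D → D → ℝ}
    (hΥ : ∀ a b, fderiv ℝ (fun z => A z a b) y v = ∑ p, (Υ p a * A y p b + Υ p b * A y a p)) :
    Compat v Υ (fun z => (A z)⁻¹) y := by
  have hdet : ∀ y ∈ Ω, (A y).det ≠ 0 := fun y hy => (hA y hy).det_pos.ne'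
  have hBd : ∀ i j, DifferentiableAt ℝ (fun z => (A z)⁻¹ i j) y := fun i j =>
    ((contDiffOn_inv h hdet i j).contDiffAt (hΩ.mem_nhds hy)).differentiableAt (by simp)
  have hAd : ∀ i j, DifferentiableAt ℝ (fun z => A z i j) y := fun i j =>
    ((h i j).contDiffAt (hΩ.mem_nhds hy)).differentiableAt (by simp)
  set B := (A y)⁻¹ with hB
  have hAB : A y * B = 1 := Matrix.mul_nonsing_inv _ (hdet y hy).isUnit
  have hBA : B * A y = 1 := Matrix.nonsing_inv_mul _ (hdet y hy).isUnit
  set U : Matrix D D ℝ := Matrix.of Υ with hU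
  set dB : Matrix D D ℝ := Matrix.of fun i j => fderiv ℝ (fun z => (A z)⁻¹ i j) y v with hdB
  set dA : Matrix D D ℝ := Matrix.of fun i j => fderiv ℝ (fun z => A z i j) y v with hdA
  have e1 : dA = U.transpose * A y + A y * U := by
    ext a b
    simp only [hdA, hU, Matrix.of_apply, hΥ, Matrix.add_apply, Matrix.mul_apply,
      Matrix.transpose_apply, Finset.sum_add_distrib]
    congr 1
    exact Finset.sum_congr rfl fun p _ => mul_comm _ _
  -- The derivative of `A * A⁻¹ = 1`, from which `dB = -B dA B`.
  have e2 : dA * B + A y * dB = 0 := by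
    ext i j
    have h1 : (fun z => ∑ k, A z i k * (A z)⁻¹ k j) =ᶠ[𝓝 y] fun _ => (1 : Matrix D D ℝ) i j := by
      filter_upwards [hΩ.mem_nhds hy] with z hz
      rw [← Matrix.mul_apply, Matrix.mul_nonsing_inv _ (hdet z hz).isUnit]
    have h2 : HasFDerivAt (fun z => ∑ k, A z i k * (A z)⁻¹ k j)
        (∑ k, (A y i k • fderiv ℝ (fun z => (A z)⁻¹ k j) y +
          (A y)⁻¹ k j • fderiv ℝ (fun z => A z i k) y)) y :=
      HasFDerivAt.fun_sum fun k _ => (hAd i k).hasFDerivAt.mul (hBd k j).hasFDerivAt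
    have h3 := h2.fderiv.symm.trans h1.fderiv_eq
    have h4 := congrArg (fun L => L v) h3
    simp only [sum_apply, add_apply, smul_apply, smul_eq_mul, fderiv_fun_const, Pi.zero_apply,
      zero_apply, Finset.sum_add_distrib] at h4
    simp only [Matrix.add_apply, Matrix.mul_apply, hdA, hdB, Matrix.of_apply, Matrix.zero_apply]
    rw [← h4, add_comm]
    congr 1
    exact Finset.sum_congr rfl fun p _ => mul_comm _ _
  have e3 : dB = -(U * B + B * U.transpose) := by
    calc dB = (B * A y) * dB := by rw [hBA, one_mul]
      _ = B * (dA * B + A y * dB) - B * dA * B := by noncomm_ring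
      _ = -(B * U.transpose * (A y * B) + (B * A y) * U * B) := by
          rw [e2, e1]; noncomm_ring
      _ = _ := by rw [hAB, hBA]; noncomm_ring
  have hBs : B.transpose = B := by
    rw [hB, Matrix.transpose_nonsing_inv]
    congr 1
    exact (hA y hy).1
  intro i j
  refine ⟨(hBd i j).hasFDerivAt, ?_⟩
  have e4 := congrFun (congrFun e3 i) j
  simp only [hdB, hU, Matrix.of_apply, Matrix.neg_apply, Matrix.add_apply, Matrix.mul_apply,
    Matrix.transpose_apply] at e4
  rw [e4, neg_add, sub_eq_add_neg]
  congr 2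
  exact Finset.sum_congr rfl fun p _ => mul_comm _ _

/-- Christoffel symbols of a metric, with constant commuting directions of differentiation. -/
def chr (d : D → E) (A : E → Matrix D D ℝ) (y : E) (k i j : D) : ℝ :=
  (1 / 2) * ∑ l, (A y)⁻¹ k l * (fderiv ℝ (fun z => A z j l) y (d i) +
    fderiv ℝ (fun z => A z i l) y (d j) - fderiv ℝ (fun z => A z i j) y (d l))

/-- A smooth Riemannian metric on the open set `Ω`. -/
structure IsMetric (Ω : Set E) (A : E → Matrix D D ℝ) : Prop where
  isOpen : IsOpen Ω
  sm : ∀ i j, ContDiffOn ℝ ∞ (fun y => A y i j) Ω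
  pos : ∀ y ∈ Ω, (A y).PosDef

variable {Ω : Set E} {A : E → Matrix D D ℝ} {d : D → E}

lemma IsMetric.symm (h : IsMetric Ω A) {y : E} (hy : y ∈ Ω) (i j : D) : A y i j = A y j i :=
  congrFun (congrFun (h.pos y hy).1 j) i

lemma IsMetric.det_ne (h : IsMetric Ω A) {y : E} (hy : y ∈ Ω) : (A y).det ≠ 0 :=
  (h.pos y hy).det_pos.ne'

lemma IsMetric.mul_inv (h : IsMetric Ω A) {y : E} (hy : y ∈ Ω) : A y * (A y)⁻¹ = 1 :=
  Matrix.mul_nonsing_inv _ (h.det_ne hy).isUnit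

lemma IsMetric.inv_mul (h : IsMetric Ω A) {y : E} (hy : y ∈ Ω) : (A y)⁻¹ * A y = 1 :=
  Matrix.nonsing_inv_mul _ (h.det_ne hy).isUnit

lemma IsMetric.inv_symm (h : IsMetric Ω A) {y : E} (hy : y ∈ Ω) (i j : D) :
    (A y)⁻¹ i j = (A y)⁻¹ j i := congrFun (congrFun (h.pos y hy).inv.1 j) i

lemma IsMetric.sm_inv (h : IsMetric Ω A) (i j : D) : ContDiffOn ℝ ∞ (fun y => (A y)⁻¹ i j) Ω :=
  contDiffOn_inv h.sm (fun _ hy => h.det_ne hy) i j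

lemma IsMetric.fderiv_symm (h : IsMetric Ω A) {y : E} (hy : y ∈ Ω) (i j : D) :
    fderiv ℝ (fun z => A z i j) y = fderiv ℝ (fun z => A z j i) y := by
  refine Filter.EventuallyEq.fderiv_eq ?_
  filter_upwards [h.isOpen.mem_nhds hy] with z hz using h.symm hz i j

lemma IsMetric.sm_chr (h : IsMetric Ω A) (d : D → E) (l j k : D) :
    ContDiffOn ℝ ∞ (fun z => chr d A z l j k) Ω :=
  contDiffOn_const.mul <| ContDiffOn.sum fun p _ => (h.sm_inv l p).mul <|
    ((contDiffOn_fderiv_apply h.isOpen (h.sm _ _) _).add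
      (contDiffOn_fderiv_apply h.isOpen (h.sm _ _) _)).sub
      (contDiffOn_fderiv_apply h.isOpen (h.sm _ _) _)

lemma IsMetric.chr_symm (h : IsMetric Ω A) {y : E} (hy : y ∈ Ω) (p i j : D) :
    chr d A y p i j = chr d A y p j i := by
  simp only [chr, h.fderiv_symm hy i j]
  congr 1
  exact Finset.sum_congr rfl fun l _ => by ring

/-- The lowered Christoffel symbols. -/
lemma IsMetric.chr_low (h : IsMetric Ω A) {y : E} (hy : y ∈ Ω) (l i j : D) :
    ∑ k, A y l k * chr d A y k i j = (1 / 2) * (fderiv ℝ (fun z => A z j l) y (d i) +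
      fderiv ℝ (fun z => A z i l) y (d j) - fderiv ℝ (fun z => A z i j) y (d l)) := by
  simp only [chr]
  set X : D → ℝ := fun l => fderiv ℝ (fun z => A z j l) y (d i) +
      fderiv ℝ (fun z => A z i l) y (d j) - fderiv ℝ (fun z => A z i j) y (d l) with hX
  have : ∑ k, A y l k * (1 / 2 * ∑ p, (A y)⁻¹ k p * X p) =
      1 / 2 * ((A y * (A y)⁻¹).mulVec X) l := by
    rw [← Matrix.mulVec_mulVec, Matrix.mulVec, dotProduct, Finset.mul_sum]
    refine Finset.sum_congr rfl fun k _ => ?_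
    simp only [Matrix.mulVec, dotProduct]
    ring
  rw [this, h.mul_inv hy, Matrix.one_mulVec]

/-- Metric compatibility: in the sum of the two lowered Christoffel symbols all derivatives of the
metric cancel except the one in the direction `j`. -/
lemma IsMetric.fderiv_eq_chr (h : IsMetric Ω A) {y : E} (hy : y ∈ Ω) (j a b : D) :
    fderiv ℝ (fun z => A z a b) y (d j) =
      ∑ p, (chr d A y p j a * A y p b + chr d A y p j b * A y a p) := by
  have h1 := h.chr_low (d := d) hy b j a
  have h2 := h.chr_low (d := d) hy a j b
  rw [Finset.sum_add_distrib]
  have e1 : ∑ p, chr d A y p j a * A y p b = ∑ p, A y b p * chr d A y p j a :=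
    Finset.sum_congr rfl fun p _ => by rw [h.symm hy p b, mul_comm]
  have e2 : ∑ p, chr d A y p j b * A y a p = ∑ p, A y a p * chr d A y p j b :=
    Finset.sum_congr rfl fun p _ => mul_comm _ _
  rw [e1, e2, h1, h2, h.fderiv_symm hy b a]
  ring

/-- The geometry of a Riemannian metric. -/
def lc (Ω : Set E) (pt : E) (d : D → E) (A : E → Matrix D D ℝ) : Geo E D :=
  ⟨Ω, pt, d, chr d A, fun y => (A y)⁻¹⟩

lemma IsMetric.good (h : IsMetric Ω A) (d : D → E) {pt : E} (hpt : pt ∈ Ω) : (lc Ω pt d A).Good where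
  isOpen := h.isOpen
  mem := hpt
  smΓ := h.sm_chr d
  smB := h.sm_inv
  psd := fun y hy => (h.pos y hy).inv.posSemidef
  compat := fun _ hy j => compat_of_metric h.isOpen h.sm h.pos hy fun a b => h.fderiv_eq_chr hy j a b

end LeviCivita

/-! ### Vector fields along a map -/

section Vectors

variable {D D' : Type} [Fintype D] [DecidableEq D] [Fintype D'] [DecidableEq D']
  {E E' : Type*} [NormedAddCommGroup E] [NormedSpace ℝ E] [NormedAddCommGroup E'] [NormedSpace ℝ E']

/-- The pairing of vectors by a metric. -/
def pr (M : Matrix D D ℝ) (X Y : D → ℝ) : ℝ := ∑ a, ∑ b, M a b * X a * Y b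

lemma pr_add_left (M : Matrix D D ℝ) (X X' Y : D → ℝ) : pr M (X + X') Y = pr M X Y + pr M X' Y := by
  simp [pr, mul_add, add_mul, Finset.sum_add_distrib]
lemma pr_smul_left (M : Matrix D D ℝ) (c : ℝ) (X Y : D → ℝ) : pr M (c • X) Y = c * pr M X Y := by
  simp only [pr, Pi.smul_apply, smul_eq_mul, Finset.mul_sum]
  exact Finset.sum_congr rfl fun a _ => Finset.sum_congr rfl fun b _ => by ring
lemma pr_smul_right (M : Matrix D D ℝ) (c : ℝ) (X Y : D → ℝ) : pr M X (c • Y) = c * pr M X Y := by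
  simp only [pr, Pi.smul_apply, smul_eq_mul, Finset.mul_sum]
  exact Finset.sum_congr rfl fun a _ => Finset.sum_congr rfl fun b _ => by ring
lemma pr_zero_left (M : Matrix D D ℝ) (Y : D → ℝ) : pr M 0 Y = 0 := by simp [pr]
lemma pr_zero_right (M : Matrix D D ℝ) (Y : D → ℝ) : pr M Y 0 = 0 := by simp [pr]
lemma pr_neg_left (M : Matrix D D ℝ) (X Y : D → ℝ) : pr M (-X) Y = -pr M X Y := by
  simp [pr]
lemma pr_sub_left (M : Matrix D D ℝ) (X X' Y : D → ℝ) : pr M (X - X') Y = pr M X Y - pr M X' Y := by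
  rw [sub_eq_add_neg, pr_add_left, pr_neg_left, sub_eq_add_neg]
lemma pr_sum_left {α : Type*} (M : Matrix D D ℝ) (A : Finset α) (X : α → D → ℝ) (Y : D → ℝ) :
    pr M (∑ k ∈ A, X k) Y = ∑ k ∈ A, pr M (X k) Y := by
  classical
  induction A using Finset.induction_on with
  | empty => simp [pr]
  | insert a A ha ih => rw [Finset.sum_insert ha, Finset.sum_insert ha, pr_add_left, ih]
lemma pr_comm {M : Matrix D D ℝ} (h : ∀ i j, M i j = M j i) (X Y : D → ℝ) : pr M X Y = pr M Y X := by
  simp only [pr]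
  rw [Finset.sum_comm]
  exact Finset.sum_congr rfl fun a _ => Finset.sum_congr rfl fun b _ => by rw [h b a]; ring

/-- Derivative of a vector field along a map in the direction `v`; `w` is the image of `v`, `Γ` are
the connection coefficients at the image point. -/
def cv (v : E) (Γ : D → D → D → ℝ) (w : D → ℝ) (X : E → D → ℝ) (y : E) : D → ℝ := fun a =>
  fderiv ℝ (fun z => X z a) y v + ∑ b, (∑ c, Γ a c b * w c) * X y b

variable {v : E} {Γ : D → D → D → ℝ} {w : D → ℝ} {y : E}

lemma cv_add {X Y : E → D → ℝ} (hX : ∀ a, DifferentiableAt ℝ (fun z => X z a) y)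
    (hY : ∀ a, DifferentiableAt ℝ (fun z => Y z a) y) :
    cv v Γ w (fun z => X z + Y z) y = cv v Γ w X y + cv v Γ w Y y := by
  ext a
  simp only [cv, Pi.add_apply, mul_add, Finset.sum_add_distrib]
  rw [fderiv_fun_add (hX a) (hY a), add_apply]
  ring

lemma cv_smul {f : E → ℝ} {X : E → D → ℝ} (hf : DifferentiableAt ℝ f y)
    (hX : ∀ a, DifferentiableAt ℝ (fun z => X z a) y) :
    cv v Γ w (fun z => f z • X z) y = fderiv ℝ f y v • X y + f y • cv v Γ w X y := by
  ext a
  simp only [cv, Pi.smul_apply, Pi.add_apply, smul_eq_mul, mul_left_comm _ (f y), ← Finset.mul_sum]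
  rw [fderiv_fun_mul hf (hX a), add_apply, smul_apply, smul_apply, smul_eq_mul, smul_eq_mul]
  ring

lemma cv_sum_smul {f : D' → E → ℝ} {X : D' → E → D → ℝ} (hf : ∀ k, DifferentiableAt ℝ (f k) y)
    (hX : ∀ k a, DifferentiableAt ℝ (fun z => X k z a) y) :
    cv v Γ w (fun z => ∑ k, f k z • X k z) y =
      ∑ k, (fderiv ℝ (f k) y v • X k y + f k y • cv v Γ w (X k) y) := by
  have : ∀ A : Finset D', cv v Γ w (fun z => ∑ k ∈ A, f k z • X k z) y =
      ∑ k ∈ A, (fderiv ℝ (f k) y v • X k y + f k y • cv v Γ w (X k) y) ∧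
      ∀ a, DifferentiableAt ℝ (fun z => (∑ k ∈ A, f k z • X k z) a) y := by
    intro A
    induction A using Finset.induction_on with
    | empty =>
      refine ⟨?_, fun a => by simp⟩
      ext a; simp [cv]
    | insert k A hk ih =>
      have h1 : ∀ a, DifferentiableAt ℝ (fun z => (f k z • X k z) a) y :=
        fun a => (hf k).mul (hX k a)
      simp only [Finset.sum_insert hk]
      refine ⟨?_, fun a => (h1 a).add (ih.2 a)⟩
      rw [cv_add h1 ih.2, cv_smul (hf k) (hX k), ih.1]
  exact (this Finset.univ).1

lemma cv_congr {X Y : E → D → ℝ} (h : X =ᶠ[𝓝 y] Y) : cv v Γ w X y = cv v Γ w Y y := by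
  ext a
  have h1 : (fun z => X z a) =ᶠ[𝓝 y] fun z => Y z a := h.mono fun z hz => congrFun hz a
  rw [cv, cv, h1.fderiv_eq, h.eq_of_nhds]

/-- Derivative of the pairing of vector fields along a map. -/
lemma fderiv_pr {M H : Matrix D D ℝ} {N : E → Matrix D D ℝ} {X Y : E → D → ℝ} (hM : N y = M)
    (hN : ∀ a b, DifferentiableAt ℝ (fun z => N z a b) y)
    (hNv : ∀ a b, fderiv ℝ (fun z => N z a b) y v = H a b +
      ∑ p, ((∑ c, Γ p c a * w c) * M p b + (∑ c, Γ p c b * w c) * M a p))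
    (hX : ∀ a, DifferentiableAt ℝ (fun z => X z a) y)
    (hY : ∀ a, DifferentiableAt ℝ (fun z => Y z a) y) :
    fderiv ℝ (fun z => pr (N z) (X z) (Y z)) y v =
      pr M (cv v Γ w X y) (Y y) + pr M (X y) (cv v Γ w Y y) + pr H (X y) (Y y) := by
  have h1 : HasFDerivAt (fun z => ∑ a, ∑ b, N z a b * X z a * Y z b)
      (∑ a, ∑ b, ((N y a b * X y a) • fderiv ℝ (fun z => Y z b) y +
        Y y b • (N y a b • fderiv ℝ (fun z => X z a) y + X y a • fderiv ℝ (fun z => N z a b) y))) y :=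
    HasFDerivAt.fun_sum fun a _ => HasFDerivAt.fun_sum fun b _ =>
      ((hN a b).hasFDerivAt.mul (hX a).hasFDerivAt).mul (hY b).hasFDerivAt
  simp only [pr]
  rw [h1.fderiv]
  simp only [sum_apply, add_apply, smul_apply, smul_eq_mul, hNv, hM, cv]
  generalize hU : (fun a b => ∑ c, Γ a c b * w c) = U
  have hU' : ∀ a b, ∑ c, Γ a c b * w c = U a b := fun a b => by rw [← hU]
  simp only [hU', mul_add, add_mul, Finset.sum_add_distrib, Finset.mul_sum, Finset.sum_mul]
  have e1 : ∑ a, ∑ b, ∑ p, Y y b * (X y a * (U p a * M p b)) =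
      ∑ a, ∑ b, ∑ p, M a b * (U a p * X y p) * Y y b := by
    calc _ = ∑ b, ∑ a, ∑ p, Y y b * (X y a * (U p a * M p b)) := Finset.sum_comm
      _ = ∑ b, ∑ p, ∑ a, Y y b * (X y a * (U p a * M p b)) :=
        Finset.sum_congr rfl fun b _ => Finset.sum_comm
      _ = ∑ p, ∑ b, ∑ a, Y y b * (X y a * (U p a * M p b)) := Finset.sum_comm
      _ = _ := Finset.sum_congr rfl fun a _ => Finset.sum_congr rfl fun b _ =>
        Finset.sum_congr rfl fun p _ => by ring
  have e2 : ∑ a, ∑ b, ∑ p, Y y b * (X y a * (U p b * M a p)) =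
      ∑ a, ∑ b, ∑ p, M a b * X y a * (U b p * Y y p) := by
    calc _ = ∑ a, ∑ p, ∑ b, Y y b * (X y a * (U p b * M a p)) :=
        Finset.sum_congr rfl fun b _ => Finset.sum_comm
      _ = _ := Finset.sum_congr rfl fun a _ => Finset.sum_congr rfl fun b _ =>
        Finset.sum_congr rfl fun p _ => by ring
  have e3 : ∑ a, ∑ b, Y y b * (M a b * fderiv ℝ (fun z => X z a) y v) =
      ∑ a, ∑ b, M a b * fderiv ℝ (fun z => X z a) y v * Y y b :=
    Finset.sum_congr rfl fun a _ => Finset.sum_congr rfl fun b _ => by ring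
  have e4 : ∑ a, ∑ b, Y y b * (X y a * H a b) = ∑ a, ∑ b, H a b * X y a * Y y b :=
    Finset.sum_congr rfl fun a _ => Finset.sum_congr rfl fun b _ => by ring
  rw [e1, e2, e3, e4]
  ring

end Vectors

/-! ### Commutators of covariant derivatives along a map -/

section Curvature

variable {D D' : Type} [Fintype D] [DecidableEq D] [Fintype D'] [DecidableEq D']
  {E E' : Type*} [NormedAddCommGroup E] [NormedSpace ℝ E] [NormedAddCommGroup E'] [NormedSpace ℝ E']

/-- Chain rule for an image vector with a part `v'` kept apart from the frame components: it is zero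
for spatial directions and the time direction of the target for the velocity of a flow. -/
lemma fderiv_comp_dir {f : E' → ℝ} {u : E → E'} {y v : E} {v' : E'} {w : D' → ℝ} {d' : D' → E'}
    (hf : DifferentiableAt ℝ f (u y)) (hu : DifferentiableAt ℝ u y)
    (h : fderiv ℝ u y v = v' + ∑ c, w c • d' c) :
    fderiv ℝ (fun z => f (u z)) y v = fderiv ℝ f (u y) v' + ∑ c, w c * fderiv ℝ f (u y) (d' c) := by
  have h1 : fderiv ℝ (fun z => f (u z)) y = (fderiv ℝ f (u y)).comp (fderiv ℝ u y) :=
    fderiv_comp y hf hu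
  rw [h1, ContinuousLinearMap.comp_apply, h, map_add, map_sum]
  simp only [map_smul, smul_eq_mul]

lemma sm_cv {Ω : Set E} (hΩ : IsOpen Ω) {v : E} {Γ : E → D' → D' → D' → ℝ} {w X : E → D' → ℝ}
    (hΓ : ∀ a b c, ContDiffOn ℝ ∞ (fun z => Γ z a b c) Ω)
    (hw : ∀ a, ContDiffOn ℝ ∞ (fun z => w z a) Ω) (hX : ∀ a, ContDiffOn ℝ ∞ (fun z => X z a) Ω)
    (a : D') : ContDiffOn ℝ ∞ (fun z => cv v (Γ z) (w z) X z a) Ω :=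
  (contDiffOn_fderiv_apply hΩ (hX a) v).add <| ContDiffOn.sum fun b _ =>
    (ContDiffOn.sum fun c _ => (hΓ a c b).mul (hw c)).mul (hX b)

/-- Commutator of two covariant derivatives along a map. -/
lemma cv_comm {Ω : Set E} (hΩ : IsOpen Ω) {Ω' : Set E'} (hΩ' : IsOpen Ω') {u : E → E'}
    (hu : ContDiffOn ℝ ∞ u Ω) (hmaps : MapsTo u Ω Ω') {Γ : E' → D' → D' → D' → ℝ}
    (hΓ : ∀ a b c, ContDiffOn ℝ ∞ (fun z => Γ z a b c) Ω') {d' : D' → E'} {v₁ v₂ : E}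
    {v₁' v₂' : E'} {w₁ w₂ X : E → D' → ℝ}
    (hw₁ : ∀ a, ContDiffOn ℝ ∞ (fun z => w₁ z a) Ω) (hw₂ : ∀ a, ContDiffOn ℝ ∞ (fun z => w₂ z a) Ω)
    (hX : ∀ a, ContDiffOn ℝ ∞ (fun z => X z a) Ω) {y : E} (hy : y ∈ Ω)
    (h₁ : fderiv ℝ u y v₁ = v₁' + ∑ c, w₁ y c • d' c)
    (h₂ : fderiv ℝ u y v₂ = v₂' + ∑ c, w₂ y c • d' c)
    (hww : ∀ a, fderiv ℝ (fun z => w₂ z a) y v₁ = fderiv ℝ (fun z => w₁ z a) y v₂) (a : D') :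
    cv v₁ (Γ (u y)) (w₁ y) (fun z => cv v₂ (Γ (u z)) (w₂ z) X z) y a -
      cv v₂ (Γ (u y)) (w₂ y) (fun z => cv v₁ (Γ (u z)) (w₁ z) X z) y a =
    ∑ b, ((∑ c, ∑ f, curvC d' Γ (u y) a c f b * w₁ y c * w₂ y f) +
      ∑ f, fderiv ℝ (fun z => Γ z a f b) (u y) v₁' * w₂ y f -
      ∑ c, fderiv ℝ (fun z => Γ z a c b) (u y) v₂' * w₁ y c) * X y b := by
  have dif : ∀ {f : E → ℝ}, ContDiffOn ℝ ∞ f Ω → DifferentiableAt ℝ f y := fun hf =>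
    (hf.contDiffAt (hΩ.mem_nhds hy)).differentiableAt (by simp)
  have hud : DifferentiableAt ℝ u y := (hu.contDiffAt (hΩ.mem_nhds hy)).differentiableAt (by simp)
  have hΓu : ∀ a b c, ContDiffOn ℝ ∞ (fun z => Γ (u z) a b c) Ω := fun a b c =>
    (hΓ a b c).comp hu hmaps
  have hΓd : ∀ a b c, DifferentiableAt ℝ (fun z => Γ z a b c) (u y) := fun a b c =>
    ((hΓ a b c).contDiffAt (hΩ'.mem_nhds (hmaps hy))).differentiableAt (by simp)
  -- derivative of the connection matrix
  have hU : ∀ {v : E} {v' : E'} {w η : E → D' → ℝ}, (∀ a, ContDiffOn ℝ ∞ (fun z => w z a) Ω) →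
      fderiv ℝ u y v = v' + ∑ c, η y c • d' c → ∀ a b,
      fderiv ℝ (fun z => ∑ f, Γ (u z) a f b * w z f) y v = ∑ f, (Γ (u y) a f b *
        fderiv ℝ (fun z => w z f) y v + w y f * (fderiv ℝ (fun z => Γ z a f b) (u y) v' +
        ∑ c, η y c * fderiv ℝ (fun z => Γ z a f b) (u y) (d' c))) := by
    intro v v' w η hw hv a b
    have h1 : HasFDerivAt (fun z => ∑ f, Γ (u z) a f b * w z f)
        (∑ f, (Γ (u y) a f b • fderiv ℝ (fun z => w z f) y +
          w y f • fderiv ℝ (fun z => Γ (u z) a f b) y)) y :=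
      HasFDerivAt.fun_sum fun f _ => (dif (hΓu a f b)).hasFDerivAt.mul (dif (hw f)).hasFDerivAt
    rw [h1.fderiv]
    simp only [sum_apply, add_apply, smul_apply, smul_eq_mul]
    refine Finset.sum_congr rfl fun f _ => ?_
    rw [fderiv_comp_dir (hΓd a f b) hud hv]
  have hcc : ∀ {v v₀ : E} {w w₀ : E → D' → ℝ}, (∀ a, ContDiffOn ℝ ∞ (fun z => w z a) Ω) →
      cv v₀ (Γ (u y)) (w₀ y) (fun z => cv v (Γ (u z)) (w z) X z) y a =
      fderiv ℝ (fun z => fderiv ℝ (fun z => X z a) z v) y v₀ +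
      (∑ b, ((∑ c, Γ (u y) a c b * w y c) * fderiv ℝ (fun z => X z b) y v₀ +
        X y b * fderiv ℝ (fun z => ∑ f, Γ (u z) a f b * w z f) y v₀)) +
      ∑ b, (∑ c, Γ (u y) a c b * w₀ y c) * (fderiv ℝ (fun z => X z b) y v +
        ∑ b', (∑ c, Γ (u y) b c b' * w y c) * X y b') := by
    intro v v₀ w w₀ hw
    have h2 : ∀ b, ContDiffOn ℝ ∞ (fun z => ∑ c, Γ (u z) a c b * w z c) Ω := fun b =>
      ContDiffOn.sum fun c _ => (hΓu a c b).mul (hw c)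
    have h1 : HasFDerivAt (fun z => cv v (Γ (u z)) (w z) X z a)
        (fderiv ℝ (fun z => fderiv ℝ (fun z => X z a) z v) y +
        ∑ b, ((∑ c, Γ (u y) a c b * w y c) • fderiv ℝ (fun z => X z b) y +
          X y b • fderiv ℝ (fun z => ∑ f, Γ (u z) a f b * w z f) y)) y :=
      (dif (contDiffOn_fderiv_apply hΩ (hX a) v)).hasFDerivAt.add <|
        HasFDerivAt.fun_sum fun b _ => (dif (h2 b)).hasFDerivAt.mul (dif (hX b)).hasFDerivAt
    rw [cv, h1.fderiv]
    simp only [sum_apply, add_apply, smul_apply, smul_eq_mul]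
    rfl
  rw [hcc hw₂, hcc hw₁, fderiv_fderiv_comm hΩ (hX a) hy v₂ v₁]
  simp only [hU hw₂ h₁, hU hw₁ h₂, hww]
  -- The products of two connection matrices and the derivatives of the coefficients in frame
  -- directions assemble to the curvature; the derivatives along `v₁'` and `v₂'` remain as separate
  -- terms.
  have key : ∀ b, ∑ b', (∑ c, Γ (u y) a c b' * w₁ y c) * ((∑ c, Γ (u y) b' c b * w₂ y c)) -
      ∑ b', (∑ c, Γ (u y) a c b' * w₂ y c) * ((∑ c, Γ (u y) b' c b * w₁ y c)) +
      ((∑ f, w₂ y f * ∑ c, w₁ y c * fderiv ℝ (fun z => Γ z a f b) (u y) (d' c)) -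
      ∑ f, w₁ y f * ∑ c, w₂ y c * fderiv ℝ (fun z => Γ z a f b) (u y) (d' c)) =
      ∑ c, ∑ f, curvC d' Γ (u y) a c f b * w₁ y c * w₂ y f := by
    intro b
    simp only [curvC, add_mul, sub_mul, Finset.sum_mul, Finset.mul_sum, Finset.sum_add_distrib,
      Finset.sum_sub_distrib]
    have e1 : ∑ b', ∑ c, ∑ f, Γ (u y) a f b' * w₁ y f * (Γ (u y) b' c b * w₂ y c) =
        ∑ c, ∑ f, ∑ p, Γ (u y) p f b * Γ (u y) a c p * w₁ y c * w₂ y f := by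
      rw [Finset.sum_comm]
      calc _ = ∑ c, ∑ f, ∑ b', Γ (u y) a f b' * w₁ y f * (Γ (u y) b' c b * w₂ y c) :=
            Finset.sum_congr rfl fun c _ => Finset.sum_comm
        _ = ∑ f, ∑ c, ∑ b', Γ (u y) a f b' * w₁ y f * (Γ (u y) b' c b * w₂ y c) :=
            Finset.sum_comm
        _ = _ := Finset.sum_congr rfl fun c _ => Finset.sum_congr rfl fun f _ =>
            Finset.sum_congr rfl fun p _ => by ring
    have e2 : ∑ b', ∑ c, ∑ f, Γ (u y) a f b' * w₂ y f * (Γ (u y) b' c b * w₁ y c) =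
        ∑ c, ∑ f, ∑ p, Γ (u y) p c b * Γ (u y) a f p * w₁ y c * w₂ y f := by
      rw [Finset.sum_comm]
      calc _ = ∑ c, ∑ f, ∑ b', Γ (u y) a f b' * w₂ y f * (Γ (u y) b' c b * w₁ y c) :=
            Finset.sum_congr rfl fun c _ => Finset.sum_comm
        _ = _ := Finset.sum_congr rfl fun c _ => Finset.sum_congr rfl fun f _ =>
            Finset.sum_congr rfl fun p _ => by ring
    have e3 : ∑ f, ∑ c, w₂ y f * (w₁ y c * fderiv ℝ (fun z => Γ z a f b) (u y) (d' c)) =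
        ∑ c, ∑ f, fderiv ℝ (fun z => Γ z a f b) (u y) (d' c) * w₁ y c * w₂ y f := by
      rw [Finset.sum_comm]
      exact Finset.sum_congr rfl fun c _ => Finset.sum_congr rfl fun f _ => by ring
    have e4 : ∑ f, ∑ c, w₁ y f * (w₂ y c * fderiv ℝ (fun z => Γ z a f b) (u y) (d' c)) =
        ∑ c, ∑ f, fderiv ℝ (fun z => Γ z a c b) (u y) (d' f) * w₁ y c * w₂ y f :=
      Finset.sum_congr rfl fun c _ => Finset.sum_congr rfl fun f _ => by ring
    rw [e1, e2, e3, e4]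
    ring
  simp only [← key, add_mul, sub_mul, mul_add, Finset.sum_add_distrib, Finset.sum_sub_distrib]
  have e5 : ∀ (w w' : E → D' → ℝ), ∑ b, (∑ c, Γ (u y) a c b * w y c) *
      ∑ b', (∑ c, Γ (u y) b c b' * w' y c) * X y b' =
      ∑ b', (∑ b, (∑ c, Γ (u y) a c b * w y c) * (∑ c, Γ (u y) b c b' * w' y c)) * X y b' := by
    intro w w'
    have : ∀ U W : D' → D' → ℝ, ∑ b, U a b * ∑ b', W b b' * X y b' =
        ∑ b', (∑ b, U a b * W b b') * X y b' := fun U W => by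
      simp only [Finset.mul_sum, Finset.sum_mul]
      rw [Finset.sum_comm]
      exact Finset.sum_congr rfl fun b _ => Finset.sum_congr rfl fun c _ => by ring
    exact this (fun a b => ∑ c, Γ (u y) a c b * w y c) (fun a b => ∑ c, Γ (u y) a c b * w' y c)
  rw [e5, e5]
  have e6 : ∀ (p q : D' → D' → ℝ), ∑ b, X y b * ∑ f, p b f * q b f =
    ∑ b, (∑ f, q b f * p b f) * X y b := fun p q =>
      Finset.sum_congr rfl fun b _ => by
        rw [mul_comm]; congr 1; exact Finset.sum_congr rfl fun f _ => mul_comm _ _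
  have e7 : ∀ (p q : D' → D' → ℝ), ∑ b, X y b * ∑ f, p b f * q b f =
    ∑ b, (∑ f, p b f * q b f) * X y b := fun p q =>
      Finset.sum_congr rfl fun b _ => mul_comm _ _
  rw [e6 (fun _ f => w₂ y f) fun b f => fderiv ℝ (fun z => Γ z a f b) (u y) v₁',
    e6 (fun _ f => w₁ y f) fun b f => fderiv ℝ (fun z => Γ z a f b) (u y) v₂',
    e7 (fun _ f => w₂ y f) fun b f => ∑ c, w₁ y c * fderiv ℝ (fun z => Γ z a f b) (u y) (d' c),
    e7 (fun _ f => w₁ y f) fun b f => ∑ c, w₂ y c * fderiv ℝ (fun z => Γ z a f b) (u y) (d' c)]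
  ring

end Curvature

/-! ### First variation of the Levi-Civita connection -/

section Variation

variable {D : Type} [Fintype D] [DecidableEq D]
  {E : Type*} [NormedAddCommGroup E] [NormedSpace ℝ E] {d : D → E} {Γ : E → D → D → D → ℝ}

lemma update_two_zero (i j l : D) : Function.update ![i, j] 0 l = ![l, j] := by
  ext s; fin_cases s <;> rfl
lemma update_two_one (i j l : D) : Function.update ![i, j] 1 l = ![i, l] := by
  ext s; fin_cases s <;> rfl

lemma nab_two (T : E → (Fin 2 → D) → ℝ) (y : E) (k i j : D) :
    nab d Γ T y (ocons k ![i, j]) = fderiv ℝ (fun z => T z ![i, j]) y (d k) -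
      (∑ l, Γ y l k i * T y ![l, j] + ∑ l, Γ y l k j * T y ![i, l]) := by
  rw [nab_ocons, der, Fin.sum_univ_two]
  simp only [update_two_zero, update_two_one]
  rfl

/-- The derivative of the connection in terms of the derivative of the metric. -/
def connZ (V : (Option (Fin 2) → D) → ℝ) (L : Option (Option Unit) → D) : ℝ :=
  (1 / 2) * (V (ocons (L (some (some ()))) ![L (some none), L none]) +
    V (ocons (L (some none)) ![L (some (some ())), L none]) -
    V (ocons (L none) ![L (some (some ())), L (some none)]))

/-- The formula for the lowered Christoffel symbols is differentiated along `v`. Since `v` commutes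
with the other directions, the derivatives of `A` become derivatives of `V`, and the Christoffel
terms left over turn them into covariant ones. -/
lemma IsMetric.connVar_low {Ω : Set E} {A : E → Matrix D D ℝ} (h : IsMetric Ω A) {v : E}
    {V : E → (Fin 2 → D) → ℝ}
    (hV : ∀ y ∈ Ω, ∀ i j, fderiv ℝ (fun z => A z i j) y v = V y ![i, j]) {y : E} (hy' : y ∈ Ω)
    (l j k : D) : ∑ q, A y l q * fderiv ℝ (fun z => chr d A z q j k) y v =
      connZ (nab d (chr d A) V y) (ocons l (ocons k fun _ => j)) := by
  have hVs : ∀ a b, V y ![a, b] = V y ![b, a] := fun a b => by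
    rw [← hV y hy', ← hV y hy', h.fderiv_symm hy']
  have dif : ∀ {f : E → ℝ}, ContDiffOn ℝ ∞ f Ω → DifferentiableAt ℝ f y := fun hf =>
    (hf.contDiffAt (h.isOpen.mem_nhds hy')).differentiableAt (by simp)
  have hc : ∀ a b c, fderiv ℝ (fun z => fderiv ℝ (fun z => A z a b) z (d c)) y v =
      fderiv ℝ (fun z => V z ![a, b]) y (d c) := by
    intro a b c
    rw [fderiv_fderiv_comm h.isOpen (h.sm a b) hy']
    have : (fun z => fderiv ℝ (fun z => A z a b) z v) =ᶠ[𝓝 y] fun z => V z ![a, b] := by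
      filter_upwards [h.isOpen.mem_nhds hy'] with z hz using hV z hz a b
    rw [this.fderiv_eq]
  have e1 : (fun z => ∑ q, A z l q * chr d A z q j k) =ᶠ[𝓝 y]
      fun z => (1 / 2) * (fderiv ℝ (fun z => A z k l) z (d j) +
    fderiv ℝ (fun z => A z j l) z (d k) - fderiv ℝ (fun z => A z j k) z (d l)) := by
    filter_upwards [h.isOpen.mem_nhds hy'] with z hz using h.chr_low hz l j k
  have e2 : HasFDerivAt (fun z => ∑ q, A z l q * chr d A z q j k)
      (∑ q, (A y l q • fderiv ℝ (fun z => chr d A z q j k) y +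
        chr d A y q j k • fderiv ℝ (fun z => A z l q) y)) y :=
    HasFDerivAt.fun_sum fun q _ => (dif (h.sm l q)).hasFDerivAt.mul
      (dif (h.sm_chr d q j k)).hasFDerivAt
  have hd : ∀ a b c, DifferentiableAt ℝ (fun z => fderiv ℝ (fun z => A z a b) z (d c)) y :=
    fun a b c => dif (contDiffOn_fderiv_apply h.isOpen (h.sm a b) (d c))
  have e3 := ((((hd k l j).hasFDerivAt.add (hd j l k).hasFDerivAt).sub
    (hd j k l).hasFDerivAt).const_mul (1 / 2 : ℝ))
  have e4 := congrArg (fun L => L v) ((e2.fderiv.symm.trans e1.fderiv_eq).trans e3.fderiv)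
  simp only [sum_apply, add_apply, sub_apply, smul_apply, smul_eq_mul,
    Finset.sum_add_distrib, hc, hV y hy'] at e4
  simp only [connZ, ocons_none, ocons_some, nab_two]
  have s1 : ∀ a b c, ∑ q, chr d A y q a b * V y ![q, c] = ∑ q, chr d A y q b a * V y ![q, c] :=
    fun a b c => Finset.sum_congr rfl fun q _ => by rw [h.chr_symm hy']
  have s2 : ∀ a b c, ∑ q, chr d A y q a b * V y ![c, q] = ∑ q, chr d A y q a b * V y ![q, c] :=
    fun a b c => Finset.sum_congr rfl fun q _ => by rw [hVs]
  rw [s2 j l k, s2 k l j, s2 l k j, s1 k j l, s1 l j k, s1 l k j]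
  have s3 : ∑ q, chr d A y q j k * V y ![l, q] = ∑ q, chr d A y q j k * V y ![q, l] := s2 j k l
  rw [s3] at e4
  linarith

lemma IsMetric.connVar {Ω : Set E} {A : E → Matrix D D ℝ} (h : IsMetric Ω A) {v : E}
    {V : E → (Fin 2 → D) → ℝ}
    (hV : ∀ y ∈ Ω, ∀ i j, fderiv ℝ (fun z => A z i j) y v = V y ![i, j]) (pt : E) :
    IsConnVar (lc Ω pt d A) v (fun y => connZ (nab d (chr d A) V y)) := by
  intro y hy p j k
  have hy' : y ∈ Ω := hy
  have hsym := h.inv_symm hy'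
  show ∑ q, (A y)⁻¹ q p * _ = fderiv ℝ (fun z => chr d A z p j k) y v
  simp only [← h.connVar_low hV hy']
  have : ∑ q, (A y)⁻¹ q p * ∑ r, A y q r * fderiv ℝ (fun z => chr d A z r j k) y v =
      ((A y)⁻¹ * A y).mulVec (fun r => fderiv ℝ (fun z => chr d A z r j k) y v) p := by
    rw [← Matrix.mulVec_mulVec]
    simp only [Matrix.mulVec, dotProduct]
    exact Finset.sum_congr rfl fun q _ => by rw [hsym q p]
  rw [this, h.inv_mul hy', Matrix.one_mulVec]

/-- Half of the velocity with one index raised is a connection matrix for which the moving metric is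
parallel: each of its two indices accounts for one half. -/
lemma IsMetric.metVar {Ω : Set E} {A : E → Matrix D D ℝ} (h : IsMetric Ω A) {v : E}
    {V : E → (Option (Option Empty) → D) → ℝ}
    (hV : ∀ y ∈ Ω, ∀ i j, fderiv ℝ (fun z => A z i j) y v = V y (ocons i (ocons j Empty.elim)))
    (pt : E) : IsMetVar (lc Ω pt d A) v V := by
  intro y hy
  have hy' : y ∈ Ω := hy
  refine compat_of_metric h.isOpen h.sm h.pos hy' fun a b => ?_
  have hVs : ∀ a b, V y (ocons a (ocons b Empty.elim)) = V y (ocons b (ocons a Empty.elim)) :=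
    fun a b => by rw [← hV y hy', ← hV y hy', h.fderiv_symm hy']
  have key : ∀ a b, ∑ p, (1 / 2 * ∑ q, (A y)⁻¹ q p * V y (ocons q (ocons a Empty.elim))) * A y p b =
      1 / 2 * V y (ocons b (ocons a Empty.elim)) := by
    intro a b
    have : ∑ p, (1 / 2 * ∑ q, (A y)⁻¹ q p * V y (ocons q (ocons a Empty.elim))) * A y p b =
        1 / 2 * Matrix.vecMul (fun q => V y (ocons q (ocons a Empty.elim))) ((A y)⁻¹ * A y) b := by
      rw [← Matrix.vecMul_vecMul]
      simp only [Matrix.vecMul, dotProduct, Finset.mul_sum, Finset.sum_mul]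
      exact Finset.sum_congr rfl fun p _ => Finset.sum_congr rfl fun q _ => by ring
    rw [this, h.inv_mul hy', Matrix.vecMul_one]
  show _ = ∑ p, ((1 / 2 * ∑ q, (A y)⁻¹ q p * V y (ocons q (ocons a Empty.elim))) * A y p b +
    (1 / 2 * ∑ q, (A y)⁻¹ q p * V y (ocons q (ocons b Empty.elim))) * A y a p)
  rw [Finset.sum_add_distrib, key]
  simp only [h.symm hy' a]
  rw [key, hV y hy', hVs b a]
  ring

end Variation

/-! ### Immersions with a normal field: the Gauss and Weingarten formulas -/

/-- A map `u` with differential `F` into a Riemannian manifold, and a normal field `e`. -/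
structure Imm (E E' D D' : Type*) where
  Ω : Set E
  pt : E
  d : D → E
  Ω' : Set E'
  d' : D' → E'
  N : E' → Matrix D' D' ℝ
  u : E → E'
  F : E → D → D' → ℝ
  e : E → D' → ℝ

variable {D D' : Type} [Fintype D] [DecidableEq D] [Fintype D'] [DecidableEq D']
  {E E' : Type*} [NormedAddCommGroup E] [NormedSpace ℝ E] [NormedAddCommGroup E'] [NormedSpace ℝ E']

/-- The induced metric. -/
def Imm.g (I : Imm E E' D D') (y : E) : Matrix D D ℝ :=
  Matrix.of fun i j => pr (I.N (I.u y)) (I.F y i) (I.F y j)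

/-- The geometry of the induced metric. -/
def Imm.geo (I : Imm E E' D D') : Geo E D := lc I.Ω I.pt I.d I.g

/-- The geometry of the ambient metric. -/
def Imm.geo' (I : Imm E E' D D') : Geo E' D' := lc I.Ω' (I.u I.pt) I.d' I.N

/-- Covariant derivative of vector fields along the map. -/
def Imm.cd (I : Imm E E' D D') (i : D) (X : E → D' → ℝ) (y : E) : D' → ℝ :=
  cv (I.d i) (chr I.d' I.N (I.u y)) (I.F y i) X y

/-- The second fundamental form. -/
def Imm.sff (I : Imm E E' D D') (y : E) (i j : D) : ℝ :=
  pr (I.N (I.u y)) (I.cd i (fun z => I.F z j) y) (I.e y)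

/-- The vectors `F` and `e` form an adapted frame along `u`. -/
structure Imm.Good (I : Imm E E' D D') : Prop where
  isOpen : IsOpen I.Ω
  mem : I.pt ∈ I.Ω
  met' : IsMetric I.Ω' I.N
  maps : MapsTo I.u I.Ω I.Ω'
  smu : ContDiffOn ℝ ∞ I.u I.Ω
  smF : ∀ i a, ContDiffOn ℝ ∞ (fun y => I.F y i a) I.Ω
  sme : ∀ a, ContDiffOn ℝ ∞ (fun y => I.e y a) I.Ω
  deriv : ∀ y ∈ I.Ω, ∀ j, fderiv ℝ I.u y (I.d j) = ∑ c, I.F y j c • I.d' c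
  -- The vectors `d'` are not assumed independent, so this symmetry of second derivatives does not
  -- follow from `deriv`.
  tors : ∀ y ∈ I.Ω, ∀ i j a, fderiv ℝ (fun z => I.F z j a) y (I.d i) =
    fderiv ℝ (fun z => I.F z i a) y (I.d j)
  orth : ∀ y ∈ I.Ω, ∀ i, pr (I.N (I.u y)) (I.F y i) (I.e y) = 0
  pos : ∀ y ∈ I.Ω, (I.g y).PosDef
  -- The completeness relation of the frame: the inverse ambient metric is the sum of its tangential
  -- and its normal part.
  complete : ∀ y ∈ I.Ω, ∀ a b, ∑ i, ∑ j, (I.g y)⁻¹ i j * I.F y i a * I.F y j b + I.e y a * I.e y b =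
    (I.N (I.u y))⁻¹ a b
  -- The constant is `1` for hypersurfaces and `0` for local isometries, which are treated as
  -- immersions with zero normal field.
  norm : ∃ c, ∀ y ∈ I.Ω, pr (I.N (I.u y)) (I.e y) (I.e y) = c

namespace Imm.Good

variable {I : Imm E E' D D'} (h : I.Good) {y : E}
include h

lemma dif {f : E → ℝ} (hf : ContDiffOn ℝ ∞ f I.Ω) (hy : y ∈ I.Ω) : DifferentiableAt ℝ f y :=
  (hf.contDiffAt (h.isOpen.mem_nhds hy)).differentiableAt (by simp)

lemma symm' (hy : y ∈ I.Ω) (a b : D') : I.N (I.u y) a b = I.N (I.u y) b a :=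
  h.met'.symm (h.maps hy) a b

lemma comm (hy : y ∈ I.Ω) (X Y : D' → ℝ) : pr (I.N (I.u y)) X Y = pr (I.N (I.u y)) Y X :=
  pr_comm (h.symm' hy) X Y

lemma smN (a b : D') : ContDiffOn ℝ ∞ (fun z => I.N (I.u z) a b) I.Ω :=
  (h.met'.sm a b).comp h.smu h.maps

lemma sm_pr {X Y : E → D' → ℝ} (hX : ∀ a, ContDiffOn ℝ ∞ (fun z => X z a) I.Ω)
    (hY : ∀ a, ContDiffOn ℝ ∞ (fun z => Y z a) I.Ω) :
    ContDiffOn ℝ ∞ (fun z => pr (I.N (I.u z)) (X z) (Y z)) I.Ω :=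
  ContDiffOn.sum fun a _ => ContDiffOn.sum fun b _ => ((h.smN a b).mul (hX a)).mul (hY b)

lemma met : IsMetric I.Ω I.g := ⟨h.isOpen, fun i j => h.sm_pr (h.smF i) (h.smF j), h.pos⟩

lemma good : I.geo.Good := h.met.good I.d h.mem

lemma good' : I.geo'.Good := h.met'.good I.d' (h.maps h.mem)

lemma smΓ' (a b c : D') : ContDiffOn ℝ ∞ (fun z => chr I.d' I.N (I.u z) a b c) I.Ω :=
  (h.met'.sm_chr I.d' a b c).comp h.smu h.maps

lemma sm_cd (i : D) {X : E → D' → ℝ} (hX : ∀ a, ContDiffOn ℝ ∞ (fun z => X z a) I.Ω) (a : D') :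
    ContDiffOn ℝ ∞ (fun z => I.cd i X z a) I.Ω :=
  sm_cv h.isOpen h.smΓ' (h.smF i) hX a

lemma sm_sff (i j : D) : ContDiffOn ℝ ∞ (fun z => I.sff z i j) I.Ω :=
  h.sm_pr (h.sm_cd i (h.smF j)) h.sme

lemma du (hy : y ∈ I.Ω) : DifferentiableAt ℝ I.u y :=
  (h.smu.contDiffAt (h.isOpen.mem_nhds hy)).differentiableAt (by simp)

/-- Derivative of the pairing in a direction that may move the metric. -/
lemma fderiv_pr_dir (hy : y ∈ I.Ω) {v : E} {v' : E'} {w : D' → ℝ}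
    (hv : fderiv ℝ I.u y v = v' + ∑ c, w c • I.d' c) {X Y : E → D' → ℝ}
    (hX : ∀ a, DifferentiableAt ℝ (fun z => X z a) y)
    (hY : ∀ a, DifferentiableAt ℝ (fun z => Y z a) y) :
    fderiv ℝ (fun z => pr (I.N (I.u z)) (X z) (Y z)) y v =
      pr (I.N (I.u y)) (cv v (chr I.d' I.N (I.u y)) w X y) (Y y) +
      pr (I.N (I.u y)) (X y) (cv v (chr I.d' I.N (I.u y)) w Y y) +
      pr (Matrix.of fun a b => fderiv ℝ (fun z => I.N z a b) (I.u y) v') (X y) (Y y) := by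
  refine fderiv_pr (N := fun z => I.N (I.u z)) rfl (fun a b => h.dif (h.smN a b) hy)
    (fun a b => ?_) hX hY
  have h1 : DifferentiableAt ℝ (fun z => I.N z a b) (I.u y) :=
    ((h.met'.sm a b).contDiffAt (h.met'.isOpen.mem_nhds (h.maps hy))).differentiableAt (by simp)
  rw [fderiv_comp_dir h1 (h.du hy) hv]
  simp only [Matrix.of_apply, h.met'.fderiv_eq_chr (d := I.d') (h.maps hy), Finset.mul_sum,
    Finset.sum_mul, Finset.sum_add_distrib, mul_add]
  congr 2
  · rw [Finset.sum_comm]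
    exact Finset.sum_congr rfl fun p _ => Finset.sum_congr rfl fun c _ => by ring
  · rw [Finset.sum_comm]
    exact Finset.sum_congr rfl fun p _ => Finset.sum_congr rfl fun c _ => by ring

lemma deriv' (hy : y ∈ I.Ω) (j : D) : fderiv ℝ I.u y (I.d j) = 0 + ∑ c, I.F y j c • I.d' c := by
  rw [zero_add]; exact h.deriv y hy j

lemma fderiv_pr_cd (hy : y ∈ I.Ω) (i : D) {X Y : E → D' → ℝ}
    (hX : ∀ a, DifferentiableAt ℝ (fun z => X z a) y)
    (hY : ∀ a, DifferentiableAt ℝ (fun z => Y z a) y) :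
    fderiv ℝ (fun z => pr (I.N (I.u z)) (X z) (Y z)) y (I.d i) =
      pr (I.N (I.u y)) (I.cd i X y) (Y y) + pr (I.N (I.u y)) (X y) (I.cd i Y y) := by
  rw [h.fderiv_pr_dir hy (h.deriv' hy i) hX hY]
  have : pr (Matrix.of fun a b => fderiv ℝ (fun z => I.N z a b) (I.u y) (0 : E')) (X y) (Y y) = 0 := by
    simp [pr]
  rw [this, add_zero]
  rfl

lemma cd_symm (hy : y ∈ I.Ω) (i j : D) :
    I.cd i (fun z => I.F z j) y = I.cd j (fun z => I.F z i) y := by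
  ext a
  simp only [Imm.cd, cv, Finset.sum_mul]
  rw [h.tors y hy i j a, Finset.sum_comm]
  congr 1
  refine Finset.sum_congr rfl fun b _ => Finset.sum_congr rfl fun c _ => ?_
  rw [h.met'.chr_symm (h.maps hy)]
  ring

lemma sff_symm (hy : y ∈ I.Ω) (i j : D) : I.sff y i j = I.sff y j i := by
  rw [Imm.sff, h.cd_symm hy]; rfl

/-- The derivative `I.cd` is compatible with the ambient metric and symmetric on the frame, so its
tangential part obeys the formula that determines the Christoffel symbols of the induced metric. -/
lemma gauss_low (hy : y ∈ I.Ω) (i j l : D) :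
    pr (I.N (I.u y)) (I.cd i (fun z => I.F z j) y) (I.F y l) =
      ∑ k, I.g y l k * I.geo.Γ y k i j := by
  have e : ∀ i j l, fderiv ℝ (fun z => I.g z j l) y (I.d i) =
      pr (I.N (I.u y)) (I.cd i (fun z => I.F z j) y) (I.F y l) +
      pr (I.N (I.u y)) (I.cd i (fun z => I.F z l) y) (I.F y j) := by
    intro i j l
    rw [h.comm hy (I.cd i (fun z => I.F z l) y)]
    exact h.fderiv_pr_cd hy i (fun a => h.dif (h.smF j a) hy) (fun a => h.dif (h.smF l a) hy)
  have := h.met.chr_low (d := I.d) hy l i j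
  rw [show ∑ k, I.g y l k * I.geo.Γ y k i j = ∑ k, I.g y l k * chr I.d I.g y k i j from rfl, this,
    e, e, e, h.cd_symm hy j i, h.cd_symm hy l i, h.cd_symm hy l j]
  ring

/-- The completeness relation applied to the covector dual to `X`; no independence of the frame is
needed. -/
lemma decomp (hy : y ∈ I.Ω) (X : D' → ℝ) :
    X = ∑ k, (∑ l, (I.g y)⁻¹ k l * pr (I.N (I.u y)) X (I.F y l)) • I.F y k +
      pr (I.N (I.u y)) X (I.e y) • I.e y := by
  have e1 : X = ((I.N (I.u y))⁻¹ * I.N (I.u y)).mulVec X := by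
    rw [h.met'.inv_mul (h.maps hy), Matrix.one_mulVec]
  ext a
  have e2 := congrFun e1 a
  rw [← Matrix.mulVec_mulVec] at e2
  simp only [Matrix.mulVec, dotProduct] at e2
  rw [e2]
  simp only [← h.complete y hy, Pi.add_apply, Finset.sum_apply, Pi.smul_apply, smul_eq_mul,
    add_mul, Finset.sum_add_distrib]
  have e3 : ∀ Y : D' → ℝ, ∑ b, Y b * ∑ c, I.N (I.u y) b c * X c = pr (I.N (I.u y)) X Y := by
    intro Y
    rw [h.comm hy]
    simp only [pr, Finset.mul_sum]
    exact Finset.sum_congr rfl fun a _ => Finset.sum_congr rfl fun b _ => by ring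
  congr 1
  · simp only [← e3, Finset.sum_mul]
    rw [Finset.sum_comm]
    refine Finset.sum_congr rfl fun k _ => ?_
    rw [Finset.sum_comm]
    refine Finset.sum_congr rfl fun l _ => ?_
    rw [Finset.mul_sum, Finset.sum_mul]
    exact Finset.sum_congr rfl fun b _ => by ring
  · rw [← e3, Finset.sum_mul]
    exact Finset.sum_congr rfl fun b _ => by ring

/-- The Gauss formula. -/
lemma cd_F (hy : y ∈ I.Ω) (i j : D) : I.cd i (fun z => I.F z j) y =
    ∑ k, I.geo.Γ y k i j • I.F y k + I.sff y i j • I.e y := by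
  rw [h.decomp hy (I.cd i (fun z => I.F z j) y)]
  simp only [h.gauss_low hy]
  congr 1
  refine Finset.sum_congr rfl fun k _ => ?_
  congr 1
  have : ∑ l, (I.g y)⁻¹ k l * ∑ p, I.g y l p * I.geo.Γ y p i j =
      ((I.g y)⁻¹ * I.g y).mulVec (fun p => I.geo.Γ y p i j) k := by
    rw [← Matrix.mulVec_mulVec]; rfl
  rw [this, h.met.inv_mul hy, Matrix.one_mulVec]

lemma cd_e_e (hy : y ∈ I.Ω) (i : D) : pr (I.N (I.u y)) (I.cd i I.e y) (I.e y) = 0 := by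
  obtain ⟨c, hc⟩ := h.norm
  have e1 : (fun z => pr (I.N (I.u z)) (I.e z) (I.e z)) =ᶠ[𝓝 y] fun _ => c := by
    filter_upwards [h.isOpen.mem_nhds hy] with z hz using hc z hz
  have e2 := e1.fderiv_eq (𝕜 := ℝ)
  have e3 := h.fderiv_pr_cd hy i (fun a => h.dif (h.sme a) hy) (fun a => h.dif (h.sme a) hy)
  rw [e2] at e3
  rw [h.comm hy (I.e y)] at e3
  simp at e3
  linarith

lemma cd_e_F (hy : y ∈ I.Ω) (i j : D) : pr (I.N (I.u y)) (I.cd i I.e y) (I.F y j) = -I.sff y i j := by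
  have e1 : (fun z => pr (I.N (I.u z)) (I.F z j) (I.e z)) =ᶠ[𝓝 y] fun _ => 0 := by
    filter_upwards [h.isOpen.mem_nhds hy] with z hz using h.orth z hz j
  have e2 := e1.fderiv_eq (𝕜 := ℝ)
  have e3 := h.fderiv_pr_cd hy i (fun a => h.dif (h.smF j a) hy) (fun a => h.dif (h.sme a) hy)
  rw [e2] at e3
  rw [h.comm hy (I.F y j)] at e3
  simp at e3
  rw [Imm.sff]
  linarith

/-- The Weingarten formula. -/
lemma cd_e (hy : y ∈ I.Ω) (i : D) : I.cd i I.e y =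
    -∑ k, (∑ l, (I.g y)⁻¹ k l * I.sff y i l) • I.F y k := by
  rw [h.decomp hy (I.cd i I.e y), h.cd_e_e hy]
  simp [h.cd_e_F hy]

/-- The curvature of the ambient space on tangent vectors. -/
lemma cd_comm (hy : y ∈ I.Ω) (i j : D) {X : E → D' → ℝ}
    (hX : ∀ a, ContDiffOn ℝ ∞ (fun z => X z a) I.Ω) (a : D') :
    I.cd i (I.cd j X) y a - I.cd j (I.cd i X) y a =
      ∑ b, (∑ c, ∑ f, curvC I.d' I.geo'.Γ (I.u y) a c f b * I.F y i c * I.F y j f) * X y b := by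
  have := cv_comm h.isOpen h.met'.isOpen h.smu h.maps (h.met'.sm_chr I.d') (h.smF i) (h.smF j) hX hy
    (h.deriv' hy i) (h.deriv' hy j) (h.tors y hy i j) a
  simp only [map_zero, zero_mul, Finset.sum_const_zero, add_zero, sub_zero] at this
  exact this

end Imm.Good

/-! ### Curvature in the adapted frame: the Gauss and Codazzi equations -/

section PullCons

variable {D D' : Type} [Fintype D] [DecidableEq D] [Fintype D'] [DecidableEq D']

lemma sum_cons_fun {n : ℕ} (f : (Fin (n + 1) → D) → ℝ) :
    ∑ J, f J = ∑ j : D, ∑ I : Fin n → D, f (Matrix.vecCons j I) := by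
  rw [← Fintype.sum_prod_type' (fun j I => f (Matrix.vecCons j I))]
  exact (Fintype.sum_equiv (Fin.consEquiv fun _ => D) _ _ fun x => rfl).symm

lemma pull_cons {n : ℕ} (P : Matrix D D' ℝ) (T : (Fin (n + 1) → D) → ℝ) (k : D') (K : Fin n → D') :
    pull P T (Matrix.vecCons k K) = ∑ j, P j k * pull P (fun I => T (Matrix.vecCons j I)) K := by
  simp only [pull, sum_cons_fun, Fin.prod_univ_succ, Matrix.cons_val_zero, Matrix.cons_val_succ,
    Finset.mul_sum, mul_assoc]

lemma pull_nil (P : Matrix D D' ℝ) (T : (Fin 0 → D) → ℝ) (K : Fin 0 → D') : pull P T K = T ![] := by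
  simp [pull, Subsingleton.elim default ![]]

lemma pull_unit (P : Matrix D D' ℝ) (T : (Unit → D) → ℝ) (k : D') :
    pull P T (fun _ => k) = ∑ j, P j k * T fun _ => j := by
  simp only [pull, Finset.univ_unique, Finset.prod_singleton]
  exact Fintype.sum_equiv (Equiv.funUnique Unit D) _ _ fun x => by
    congr 2

end PullCons

variable {D D' : Type} [Fintype D] [DecidableEq D] [Fintype D'] [DecidableEq D']
  {E E' : Type*} [NormedAddCommGroup E] [NormedSpace ℝ E] [NormedAddCommGroup E'] [NormedSpace ℝ E']

/-- The curvature tensor of a metric, with lowered index. -/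
def rmC (d : D → E) (A : E → Matrix D D ℝ) (y : E) (L : Fin 4 → D) : ℝ :=
  ∑ p, A y p (L 3) * curvC d (chr d A) y p (L 0) (L 1) (L 2)

/-- The frame along the map as a matrix. -/
def Imm.P (I : Imm E E' D D') (y : E) : Matrix D' (Option D) ℝ :=
  Matrix.of fun a o => o.elim (I.e y a) (fun i => I.F y i a)

/-- The second fundamental form as a tensor. -/
def Imm.A (I : Imm E E' D D') (y : E) (L : Fin 2 → D) : ℝ := I.sff y (L 0) (L 1)

/-- The ambient curvature tensor in the adapted frame. -/
def Imm.Rf (I : Imm E E' D D') (y : E) : (Fin 4 → Option D) → ℝ :=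
  pull (I.P y) (rmC I.d' I.N (I.u y))

/-- The normal components of the ambient curvature, as they enter the Codazzi equation. -/
def Imm.K (I : Imm E E' D D') (y : E) (L : Fin 3 → D) : ℝ :=
  I.Rf y ![some (L 0), some (L 1), some (L 2), none]

/-- The curvature of the induced metric, in terms of the Gauss equation. -/
def Imm.R (I : Imm E E' D D') (y : E) (L : Option (Option (Option Unit)) → D) : ℝ :=
  I.Rf y ![some (L (some (some none))), some (L (some (some (some ())))), some (L (some none)),
      some (L none)] +
    (I.A y ![L (some (some (some ()))), L (some none)] * I.A y ![L (some (some none)), L none] -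
    I.A y ![L (some (some none)), L (some none)] * I.A y ![L (some (some (some ()))), L none])

/-- The rotation of the adapted frame. -/
def Imm.Z (I : Imm E E' D D') (y : E) (L : Option (Option Unit) → Option D) : ℝ :=
  ext0 (I.A y) ![L (some (some ())), L (some none)] * nuN (fun _ => L none) -
    nuN (fun _ => L (some none)) * ext0 (I.A y) ![L (some (some ())), L none]

/-- The mean curvature. -/
def Imm.H (I : Imm E E' D D') (y : E) : ℝ := ∑ i, ∑ j, (I.g y)⁻¹ i j * I.sff y i j

lemma ext0_two (T : (Fin 2 → D) → ℝ) (i j : D) : ext0 T ![some i, some j] = T ![i, j] := by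
  rw [← ext0_some T ![i, j]]
  congr 1
  ext s; fin_cases s <;> rfl

namespace Imm.Good

variable {I : Imm E E' D D'} (h : I.Good) {y : E}
include h

lemma cd_cd_F (hy : y ∈ I.Ω) (i j k : D) : I.cd i (I.cd j fun z => I.F z k) y =
    ∑ p, (fderiv ℝ (fun z => I.geo.Γ z p j k) y (I.d i) • I.F y p +
      I.geo.Γ y p j k • I.cd i (fun z => I.F z p) y) +
    (fderiv ℝ (fun z => I.sff z j k) y (I.d i) • I.e y + I.sff y j k • I.cd i I.e y) := by
  have e1 : I.cd j (fun z => I.F z k) =ᶠ[𝓝 y]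
      fun z => ∑ p, I.geo.Γ z p j k • I.F z p + I.sff z j k • I.e z := by
    filter_upwards [h.isOpen.mem_nhds hy] with z hz using h.cd_F hz j k
  rw [Imm.cd, cv_congr e1, cv_add (X := fun z => ∑ p, I.geo.Γ z p j k • I.F z p)
    (Y := fun z => I.sff z j k • I.e z)]
  · rw [cv_sum_smul (f := fun p z => I.geo.Γ z p j k) (X := fun p z => I.F z p)
      (fun p => h.dif (h.good.smΓ p j k) hy) (fun p a => h.dif (h.smF p a) hy),
      cv_smul (h.dif (h.sm_sff j k) hy) (fun a => h.dif (h.sme a) hy)]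
    rfl
  · intro a
    have : (fun z => (∑ p, I.geo.Γ z p j k • I.F z p) a) =
      fun z => ∑ p, I.geo.Γ z p j k * I.F z p a := by ext z; simp
    rw [this]
    exact DifferentiableAt.fun_sum fun p _ =>
      (h.dif (h.good.smΓ p j k) hy).mul (h.dif (h.smF p a) hy)
  · exact fun a => (h.dif (h.sm_sff j k) hy).mul (h.dif (h.sme a) hy)

lemma Rf_eq (o₁ o₂ o₃ o₄ : Option D) : I.Rf y ![o₁, o₂, o₃, o₄] =
    pr (I.N (I.u y)) (fun a => ∑ b, (∑ c, ∑ f, curvC I.d' I.geo'.Γ (I.u y) a c f b * I.P y c o₁ *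
      I.P y f o₂) * I.P y b o₃) (fun a => I.P y a o₄) := by
  simp only [Imm.Rf, pull_cons, pull_nil, rmC, Matrix.cons_val, pr, Finset.mul_sum, Finset.sum_mul]
  have s : ∀ f : D' → D' → D' → D' → D' → ℝ, ∑ c, ∑ f', ∑ b, ∑ d, ∑ a, f a d b c f' =
      ∑ a, ∑ d, ∑ b, ∑ c, ∑ f', f a d b c f' := by
    intro f
    calc _ = ∑ c, ∑ f', ∑ b, ∑ a, ∑ d, f a d b c f' := by
          simp only [Finset.sum_comm (f := fun d a => f a d _ _ _)]
      _ = ∑ c, ∑ f', ∑ a, ∑ b, ∑ d, f a d b c f' := by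
          refine Finset.sum_congr rfl fun c _ => Finset.sum_congr rfl fun f' _ => ?_
          exact Finset.sum_comm
      _ = ∑ c, ∑ a, ∑ f', ∑ b, ∑ d, f a d b c f' :=
          Finset.sum_congr rfl fun c _ => Finset.sum_comm
      _ = ∑ a, ∑ c, ∑ f', ∑ b, ∑ d, f a d b c f' := Finset.sum_comm
      _ = _ := by
          refine Finset.sum_congr rfl fun a _ => ?_
          calc _ = ∑ c, ∑ f', ∑ d, ∑ b, f a d b c f' :=
                Finset.sum_congr rfl fun c _ => Finset.sum_congr rfl fun f' _ => Finset.sum_comm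
            _ = ∑ c, ∑ d, ∑ f', ∑ b, f a d b c f' :=
                Finset.sum_congr rfl fun c _ => Finset.sum_comm
            _ = ∑ d, ∑ c, ∑ f', ∑ b, f a d b c f' := Finset.sum_comm
            _ = _ := by
                refine Finset.sum_congr rfl fun d _ => ?_
                calc _ = ∑ c, ∑ b, ∑ f', f a d b c f' :=
                      Finset.sum_congr rfl fun c _ => Finset.sum_comm
                  _ = _ := Finset.sum_comm
  rw [s fun a d b c f' => I.P y c o₁ * (I.P y f' o₂ * (I.P y b o₃ * (I.P y d o₄ *
    (I.N (I.u y) a d * curvC I.d' (chr I.d' I.N) (I.u y) a c f' b))))]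
  refine Finset.sum_congr rfl fun a _ => Finset.sum_congr rfl fun d _ => Finset.sum_congr rfl
    fun b _ => Finset.sum_congr rfl fun c _ => Finset.sum_congr rfl fun f _ => ?_
  change _ = _ * (curvC I.d' (chr I.d' I.N) (I.u y) a c f b * _ * _ * _) * _
  ring

/-- Common source of both structure equations: a normal `o` leads to Codazzi, a tangential one to
Gauss. -/
lemma pr_comm_F (hy : y ∈ I.Ω) (i j k : D) (o : Option D) :
    pr (I.N (I.u y)) (I.cd i (I.cd j fun z => I.F z k) y) (fun a => I.P y a o) -
      pr (I.N (I.u y)) (I.cd j (I.cd i fun z => I.F z k) y) (fun a => I.P y a o) =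
    I.Rf y ![some i, some j, some k, o] := by
  rw [← pr_sub_left, h.Rf_eq]
  congr 1
  ext a
  exact h.cd_comm hy i j (h.smF k) a

/-- The Codazzi equation. -/
lemma codazzi (hy : y ∈ I.Ω) (h1 : pr (I.N (I.u y)) (I.e y) (I.e y) = 1) (i j k : D) :
    I.geo.nab I.A y (ocons i ![j, k]) - I.geo.nab I.A y (ocons j ![i, k]) = I.K y ![i, j, k] := by
  have e0 : ∀ i j k, pr (I.N (I.u y)) (I.cd i (I.cd j fun z => I.F z k) y) (I.e y) =
      ∑ p, I.geo.Γ y p j k * I.sff y i p + fderiv ℝ (fun z => I.sff z j k) y (I.d i) := by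
    intro i j k
    rw [h.cd_cd_F hy]
    simp only [pr_add_left, pr_sum_left, pr_smul_left, h.orth y hy, h1, h.cd_e_e hy, Imm.sff]
    simp
  have e1 : I.K y ![i, j, k] = I.Rf y ![some i, some j, some k, none] := rfl
  rw [e1, ← h.pr_comm_F hy]
  have e2 : (fun a => I.P y a none) = I.e y := rfl
  rw [e2, e0, e0, Geo.nab, nab_two, nab_two]
  have e3 : ∀ i j, I.A y ![i, j] = I.sff y i j := fun i j => rfl
  have e4 : ∀ i j, (fun z => I.A z ![i, j]) = fun z => I.sff z i j := fun i j => rfl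
  have e5 : ∀ p, I.geo.Γ y p i j = I.geo.Γ y p j i := fun p => h.met.chr_symm hy p i j
  have e6 : I.geo.d = I.d := rfl
  simp only [e3, e4, e5, e6]
  ring

/-- The Gauss equation. -/
lemma gauss (hy : y ∈ I.Ω) (i j k l : D) : ∑ p, I.g y l p * curvC I.d I.geo.Γ y p i j k =
    I.Rf y ![some i, some j, some k, some l] +
      (I.sff y j k * I.sff y i l - I.sff y i k * I.sff y j l) := by
  have horth : pr (I.N (I.u y)) (I.e y) (I.F y l) = 0 := by rw [h.comm hy]; exact h.orth y hy l
  have e0 : ∀ i j k, pr (I.N (I.u y)) (I.cd i (I.cd j fun z => I.F z k) y) (I.F y l) =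
      ∑ p, (fderiv ℝ (fun z => I.geo.Γ z p j k) y (I.d i) * I.g y l p +
        I.geo.Γ y p j k * ∑ q, I.g y l q * I.geo.Γ y q i p) - I.sff y j k * I.sff y i l := by
    intro i j k
    rw [h.cd_cd_F hy]
    simp only [pr_add_left, pr_sum_left, pr_smul_left, horth, h.cd_e_F hy, h.gauss_low hy]
    have : ∀ p, pr (I.N (I.u y)) (I.F y p) (I.F y l) = I.g y l p := fun p => h.comm hy _ _
    simp only [this]
    ring
  rw [← h.pr_comm_F hy]
  have e2 : (fun a => I.P y a (some l)) = I.F y l := rfl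
  rw [e2, e0, e0]
  have e7 : ∀ i j k, ∑ p, I.geo.Γ y p j k * ∑ q, I.g y l q * I.geo.Γ y q i p =
      ∑ p, I.g y l p * ∑ q, I.geo.Γ y q j k * I.geo.Γ y p i q := by
    intro i j k
    simp only [Finset.mul_sum]
    rw [Finset.sum_comm]
    exact Finset.sum_congr rfl fun p _ => Finset.sum_congr rfl fun q _ => by ring
  simp only [curvC, mul_add, mul_sub, Finset.sum_add_distrib, Finset.sum_sub_distrib, e7]
  have e8 : ∀ i j, ∑ p, fderiv ℝ (fun z => I.geo.Γ z p j k) y (I.d i) * I.g y l p =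
      ∑ p, I.g y l p * fderiv ℝ (fun z => I.geo.Γ z p j k) y (I.d i) := fun i j =>
    Finset.sum_congr rfl fun p _ => mul_comm _ _
  rw [e8, e8]
  ring

lemma isCurv : IsCurv I.geo I.R := by
  intro y hy p i j k
  have hy' : y ∈ I.Ω := hy
  have e1 : ∀ q, I.R y (ocons q (ocons k (ocons i fun _ => j))) =
      ∑ r, I.g y q r * curvC I.d I.geo.Γ y r i j k := fun q => by
    rw [h.gauss hy']; rfl
  have hs := h.met.inv_symm hy'
  have : ∑ q, (I.g y)⁻¹ q p * ∑ r, I.g y q r * curvC I.d I.geo.Γ y r i j k =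
      ((I.g y)⁻¹ * I.g y).mulVec (fun r => curvC I.d I.geo.Γ y r i j k) p := by
    rw [← Matrix.mulVec_mulVec]
    simp only [Matrix.mulVec, dotProduct]
    exact Finset.sum_congr rfl fun q _ => by rw [hs q p]
  simp only [e1]
  refine Eq.trans this ?_
  rw [h.met.inv_mul hy', Matrix.one_mulVec]
  rfl

lemma sm_P (a : D') (o : Option D) : ContDiffOn ℝ ∞ (fun y => I.P y a o) I.Ω := by
  cases o with
  | none => exact h.sme a
  | some i => exact h.smF i a

/-- The Gauss formula differentiates the tangential columns of the frame and the Weingarten formula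
the normal one. Together they say that the frame rotates by `I.Z`, which is built from the second
fundamental form. -/
lemma isFrame : IsFrame I.geo I.geo' I.u I.P I.Z where
  maps := h.maps
  base := rfl
  smooth := h.smu
  smP := h.sm_P
  metric := fun y hy => by
    ext a b
    refine Eq.trans ?_ (h.complete y hy a b)
    simp only [Matrix.mul_apply, Matrix.transpose_apply, Fintype.sum_option, oB_none_none,
      oB_some_none, oB_none_some, oB_some_some, mul_zero, Finset.sum_const_zero, add_zero, zero_add,
      mul_one, Finset.sum_mul]
    rw [add_comm]
    congr 1
    rw [Finset.sum_comm]
    refine Finset.sum_congr rfl fun i _ => Finset.sum_congr rfl fun j _ => ?_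
    change I.F y i a * (I.g y)⁻¹ i j * I.F y j b = _
    ring
  deriv := fun y hy j => h.deriv y hy j
  Z_none := fun y hy q k => by
    have e1 : ∀ o : Option D, ext0 (I.A y) ![none, o] = 0 := fun o => ext0_none _ _ 0 rfl
    simp [Imm.Z, e1]
  par := fun y hy j a k => by
    have hZ : ∀ q k, I.Z y (ocons q (ocons k fun _ => some j)) =
        ext0 (I.A y) ![some j, k] * nuN (fun _ => q) - nuN (fun _ => k) * ext0 (I.A y) ![some j, q] :=
      fun q k => rfl
    have e1 : ∀ o : Option D, ext0 (I.A y) ![o, none] = 0 := fun o => ext0_none _ _ 1 rfl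
    have e2 : ∀ k, ext0 (I.A y) ![some j, some k] = I.sff y j k := fun k => ext0_two _ _ _
    have e3 : ∀ o : Option D, nuN (fun _ => o) = if o = none then 1 else 0 := fun o => rfl
    have e4 : ∀ X : E → D' → ℝ, fderiv ℝ (fun z => X z a) y (I.d j) = I.cd j X y a -
        ∑ b, (∑ c, I.P y c (some j) * I.geo'.Γ (I.u y) a c b) * X y b := by
      intro X
      have : ∀ b, ∑ c, I.P y c (some j) * I.geo'.Γ (I.u y) a c b =
          ∑ c, chr I.d' I.N (I.u y) a c b * I.F y j c := fun b =>
        Finset.sum_congr rfl fun c _ => mul_comm _ _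
      simp only [this, Imm.cd, cv]
      ring
    cases k with
    | none =>
      have e5 : (fun z => I.P z a none) = fun z => I.e z a := rfl
      rw [e5]
      change fderiv ℝ (fun z => I.e z a) y (I.d j) = _
      rw [e4, h.cd_e hy]
      congr 1
      simp only [hZ, e3, Fintype.sum_option, e1, e2, oΓ]
      simp only [if_true, oB_none_none, oB_none_some, oB_some_none, oB_some_some]
      simp
      refine Finset.sum_congr rfl fun k _ => ?_
      rw [mul_comm]
      change I.F y k a * _ = I.F y k a * _
      congr 1
      refine Finset.sum_congr rfl fun l _ => ?_
      rw [h.met.inv_symm hy]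
      rfl
    | some k =>
      have e5 : (fun z => I.P z a (some k)) = fun z => I.F z k a := rfl
      rw [e5]
      change fderiv ℝ (fun z => I.F z k a) y (I.d j) = _
      rw [e4 fun z => I.F z k, h.cd_F hy]
      congr 1
      simp only [hZ, e3, Fintype.sum_option, e1, e2, oΓ]
      simp only [oB_none_none, oB_none_some, oB_some_none, oB_some_some]
      simp
      rw [add_comm]
      congr 1
      · exact mul_comm _ _
      · exact Finset.sum_congr rfl fun k _ => mul_comm _ _

end Imm.Good

/-! ### Simons' identity -/

variable {D D' : Type} [Fintype D] [DecidableEq D] [Fintype D'] [DecidableEq D']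
  {E E' : Type*} [NormedAddCommGroup E] [NormedSpace ℝ E] [NormedAddCommGroup E'] [NormedSpace ℝ E']

/-- Reordering of three slots. -/
def eqv3 : Option (Fin 2) ≃ Fin 3 := Equiv.ofBijective
  (fun o => o.elim 0 ![1, 2]) (by decide)
/-- Reordering of three slots, exchanging the first two. -/
def eqv3' : Option (Fin 2) ≃ Fin 3 := Equiv.ofBijective
  (fun o => o.elim 1 ![0, 2]) (by decide)
/-- Reordering of two slots. -/
def eqv2 : Fin 2 ≃ Option (Option Empty) := Equiv.ofBijective
  ![none, some none] (by decide)

namespace Imm.Good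

variable {I : Imm E E' D D'} (h : I.Good) {y : E}
include h

lemma sm_A : Sm I.Ω I.A := fun _ => h.sm_sff _ _

lemma sm_H : ContDiffOn ℝ ∞ I.H I.Ω :=
  ContDiffOn.sum fun i _ => ContDiffOn.sum fun j _ => (h.met.sm_inv i j).mul (h.sm_sff i j)

/-- `H` is regarded as a tensor without slots, the contraction of `I.A`; contraction is parallel, so
its Hessian is the trace of the second covariant derivative of `I.A`. -/
lemma hess_H (hy : y ∈ I.Ω) (i j : D) :
    fderiv ℝ (fun z => fderiv ℝ I.H z (I.d j)) y (I.d i) -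
      ∑ p, I.geo.Γ y p i j * fderiv ℝ I.H y (I.d p) =
    ∑ k, ∑ l, I.geo.B y k l * I.geo.nab (I.geo.nab I.A) y (ocons i (ocons j ![k, l])) := by
  set H0 : E → (Empty → D) → ℝ := fun z _ => I.H z with hH0
  have n1 : ∀ z j, I.geo.nab H0 z (ocons j Empty.elim) = fderiv ℝ I.H z (I.d j) := by
    intro z j
    simp only [Geo.nab, nab_ocons, der, Finset.univ_eq_empty, Finset.sum_empty, sub_zero]
    rfl
  have n2 : I.geo.nab (I.geo.nab H0) y (ocons i (ocons j Empty.elim)) =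
      fderiv ℝ (fun z => fderiv ℝ I.H z (I.d j)) y (I.d i) -
        ∑ p, I.geo.Γ y p i j * fderiv ℝ I.H y (I.d p) := by
    rw [Geo.nab, nab_ocons, der]
    simp only [Fintype.sum_option, ocons_none, update_ocons_none, n1, Finset.univ_eq_empty,
      Finset.sum_empty, add_zero]
    rfl
  rw [← n2]
  have c0 : ∀ z, H0 z = contr (I.geo.B z) (rl eqv2 (I.A z)) := fun z => rfl
  have sA : Sm I.Ω fun z => rl eqv2 (I.A z) := h.sm_A.rl eqv2
  have c1 : EqOn (I.geo.nab H0)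
      (fun z => contr (I.geo.B z) (rl (eqvC Empty) (I.geo.nab (fun z => rl eqv2 (I.A z)) z))) I.Ω := by
    intro z hz
    have : H0 = fun z => contr (I.geo.B z) (rl eqv2 (I.A z)) := funext c0
    rw [this]
    exact nab_contr (h.good.compat z hz) (sA.differentiableAt h.isOpen hz)
  have c2 := nab_congr (d := I.d) (Γ := I.geo.Γ) h.isOpen c1 hy
  have s2 : Sm I.Ω (I.geo.nab fun z => rl eqv2 (I.A z)) := h.good.sm_nab sA
  have c3 : I.geo.nab (I.geo.nab H0) y = contr (I.geo.B y) (rl (eqvC (Option Empty))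
      (rl (eqvC Empty).optionCongr (I.geo.nab (I.geo.nab fun z => rl eqv2 (I.A z)) y))) := by
    refine c2.trans ((nab_contr (h.good.compat y hy)
      ((s2.rl (eqvC Empty)).differentiableAt h.isOpen hy)).trans ?_)
    rw [nab_rl]
  have c4 : I.geo.nab (I.geo.nab fun z => rl eqv2 (I.A z)) y =
      rl eqv2.optionCongr.optionCongr (I.geo.nab (I.geo.nab I.A) y) := by
    have : I.geo.nab (fun z => rl eqv2 (I.A z)) = fun z => rl eqv2.optionCongr (I.geo.nab I.A z) :=
      funext fun z => nab_rl eqv2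
    rw [this]
    exact nab_rl _
  have c5 : ∀ k l, ((ocons k (ocons l (ocons i (ocons j Empty.elim))) ∘ eqvC (Option Empty)) ∘
      (eqvC Empty).optionCongr) ∘ eqv2.optionCongr.optionCongr = ocons i (ocons j ![k, l]) := by
    intro k l
    ext o
    rcases o with _ | _ | o
    · rfl
    · rfl
    · fin_cases o <;> rfl
  rw [c3, c4]
  generalize I.geo.nab (I.geo.nab I.A) y = T
  refine Finset.sum_congr rfl fun k _ => Finset.sum_congr rfl fun l _ => ?_
  rw [← c5]
  rfl

/-- The Codazzi equation holds on the whole open set and may therefore be differentiated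
covariantly. -/
lemma nab_K (hy : y ∈ I.Ω) (h1 : ∀ z ∈ I.Ω, pr (I.N (I.u z)) (I.e z) (I.e z) = 1) (a i j k : D) :
    I.geo.nab I.K y (ocons a ![i, j, k]) =
      I.geo.nab (I.geo.nab I.A) y (ocons a (ocons i ![j, k])) -
      I.geo.nab (I.geo.nab I.A) y (ocons a (ocons j ![i, k])) := by
  have sA := h.good.sm_nab h.sm_A
  have c1 : EqOn I.K (fun z => rl eqv3 (I.geo.nab I.A z) - rl eqv3' (I.geo.nab I.A z)) I.Ω := by
    intro z hz
    ext L
    have := h.codazzi hz (h1 z hz) (L 0) (L 1) (L 2)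
    have hL : L = ![L 0, L 1, L 2] := by ext s; fin_cases s <;> rfl
    conv_lhs => rw [hL]
    rw [← this]
    simp only [rl, Pi.sub_apply]
    congr 2
    · ext o
      rcases o with _ | o
      · rfl
      · fin_cases o <;> rfl
    · ext o
      rcases o with _ | o
      · rfl
      · fin_cases o <;> rfl
  have c2 := nab_congr (d := I.d) (Γ := I.geo.Γ) h.isOpen c1 hy
  have c3 := c2.trans (nab_sub (G := I.geo) ((sA.rl eqv3).differentiableAt h.isOpen hy)
    ((sA.rl eqv3').differentiableAt h.isOpen hy))
  have c4 : ∀ f : Option (Fin 2) ≃ Fin 3, I.geo.nab (fun z => rl f (I.geo.nab I.A z)) y =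
    rl f.optionCongr (I.geo.nab (I.geo.nab I.A) y) := fun f => nab_rl f
  rw [c4, c4] at c3
  rw [show I.geo.nab I.K y = _ from c3]
  simp only [rl, Pi.sub_apply]
  congr 2
  · ext o
    rcases o with _ | _ | o
    · rfl
    · rfl
    · fin_cases o <;> rfl
  · ext o
    rcases o with _ | _ | o
    · rfl
    · rfl
    · fin_cases o <;> rfl

/-- Simons' identity. -/
lemma simons (hy : y ∈ I.Ω) (h1 : ∀ z ∈ I.Ω, pr (I.N (I.u z)) (I.e z) (I.e z) = 1) (i j : D) :
    ∑ k, ∑ l, I.geo.B y k l * I.geo.nab (I.geo.nab I.A) y (ocons i (ocons j ![k, l])) =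
      I.geo.lap I.A y ![i, j] +
      (∑ k, ∑ l, I.geo.B y k l * (I.geo.nab I.K y (ocons i ![j, k, l]) +
        I.geo.nab I.K y (ocons k ![i, l, j])) -
      ∑ k, ∑ l, I.geo.B y k l * act (I.geo.B y) (I.R y) (I.A y)
        (Sum.elim (ocons i fun _ => k) ![l, j])) := by
  have hA2 : ∀ a b k l, I.geo.nab (I.geo.nab I.A) y (ocons a (ocons b ![k, l])) =
      I.geo.nab (I.geo.nab I.A) y (ocons a (ocons b ![l, k])) := by
    intro a b k l
    have e1 : EqOn I.A (fun z => rl (Equiv.swap 0 1) (I.A z)) I.Ω := fun z hz => by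
      ext L
      exact h.sff_symm hz _ _
    have e2 : EqOn (I.geo.nab I.A) (fun z => rl (Equiv.swap 0 1).optionCongr (I.geo.nab I.A z)) I.Ω :=
      fun z hz => (nab_congr (d := I.d) (Γ := I.geo.Γ) h.isOpen e1 hz).trans (nab_rl _)
    have e3 := (nab_congr (d := I.d) (Γ := I.geo.Γ) h.isOpen e2 hy).trans (nab_rl _)
    rw [show I.geo.nab (I.geo.nab I.A) y (ocons a (ocons b ![k, l])) = _ from
      congrFun e3 (ocons a (ocons b ![k, l]))]
    simp only [rl]
    congr 1
    ext o
    rcases o with _ | _ | o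
    · rfl
    · rfl
    · fin_cases o <;> rfl
  have hcomm : ∀ k l, I.geo.nab (I.geo.nab I.A) y (ocons i (ocons k ![l, j])) =
      I.geo.nab (I.geo.nab I.A) y (ocons k (ocons i ![l, j])) -
      act (I.geo.B y) (I.R y) (I.A y) (Sum.elim (ocons i fun _ => k) ![l, j]) := by
    intro k l
    have e1 := nab_nab_comm (d := I.d) h.isOpen h.good.smΓ h.sm_A hy
      (fun p => h.met.chr_symm hy p i k) ![l, j]
    have e2 : act (I.geo.B y) (I.R y) (I.A y) (Sum.elim (ocons i fun _ => k) ![l, j]) =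
        ∑ s, ∑ p, curvC I.d I.geo.Γ y p i k (![l, j] s) *
          I.A y (Function.update ![l, j] s p) := by
      simp only [act, Finset.sum_apply, act1, Sum.elim_inr]
      refine Finset.sum_congr rfl fun s _ => ?_
      rw [Finset.sum_comm]
      refine Finset.sum_congr rfl fun p _ => ?_
      rw [show curvC I.d I.geo.Γ y p i k (![l, j] s) = _ from (h.isCurv y hy p i k (![l, j] s)).symm,
        Finset.sum_mul]
      refine Finset.sum_congr rfl fun q _ => ?_
      rw [mul_assoc]
      rfl
    rw [e2]
    exact (sub_eq_iff_eq_add'.mp e1).trans (sub_eq_add_neg _ _).symm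
  -- Four moves lead from `∇ᵢ∇ⱼA_{kl}` to `∇ₖ∇ₗA_{ij}`: Codazzi in `j, k`, symmetry of `A`, the
  -- Ricci identity in `i, k`, and Codazzi in `i, l`.
  have e1 : ∀ k l, I.geo.nab (I.geo.nab I.A) y (ocons i (ocons j ![k, l])) =
      I.geo.nab (I.geo.nab I.A) y (ocons k (ocons l ![i, j])) +
      ((I.geo.nab I.K y (ocons i ![j, k, l]) + I.geo.nab I.K y (ocons k ![i, l, j])) -
        act (I.geo.B y) (I.R y) (I.A y) (Sum.elim (ocons i fun _ => k) ![l, j])) := by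
    intro k l
    rw [h.nab_K hy h1, h.nab_K hy h1, hA2 i k j l, hcomm]
    ring
  simp only [e1, mul_add, mul_sub, Finset.sum_add_distrib, Finset.sum_sub_distrib]
  rfl

end Imm.Good

/-! ### Evolution equations along the mean curvature flow -/

/-- Evolution by mean curvature in a manifold with moving metric. The vector `v` is the time
direction in the source, `v'` the time direction in the target, and `η` the velocity of the ambient
metric. -/
structure Imm.Flow (I : Imm E E' D D') (v : E) (v' : E') (η : E' → (Fin 2 → D') → ℝ) : Prop where
  good : I.Good
  unit : ∀ y ∈ I.Ω, pr (I.N (I.u y)) (I.e y) (I.e y) = 1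
  vel : ∀ y ∈ I.Ω, fderiv ℝ I.u y v = v' + ∑ c, (I.H y * I.e y c) • I.d' c
  -- Equality of the mixed second derivatives of the map; stated in components for the same reason
  -- as `tors`.
  Fdot : ∀ y ∈ I.Ω, ∀ j a, fderiv ℝ (fun z => I.F z j a) y v =
    fderiv ℝ (fun z => I.H z * I.e z a) y (I.d j)
  metdot : ∀ y ∈ I.Ω', ∀ a b, fderiv ℝ (fun z => I.N z a b) y v' = η y ![a, b]

/-- The velocity of the ambient metric in the adapted frame. -/
def Imm.hf (I : Imm E E' D D') (η : E' → (Fin 2 → D') → ℝ) (y : E) : (Fin 2 → Option D) → ℝ :=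
  pull (I.P y) (η (I.u y))

/-- The velocity of the ambient connection in the adapted frame. -/
def Imm.Zb (I : Imm E E' D D') (η : E' → (Fin 2 → D') → ℝ) (y : E) :
    (Option (Option Unit) → Option D) → ℝ :=
  pull (I.P y) (connZ (I.geo'.nab η (I.u y)))

/-- The velocity of the induced metric. -/
def Imm.V (I : Imm E E' D D') (η : E' → (Fin 2 → D') → ℝ) (y : E) (L : Fin 2 → D) : ℝ :=
  I.hf η y ![some (L 0), some (L 1)] - 2 * (I.H y * I.A y L)

/-- The source term in the evolution of the second fundamental form. -/
def Imm.src (I : Imm E E' D D') (η : E' → (Fin 2 → D') → ℝ) (y : E) (L : Fin 2 → D) : ℝ :=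
  (∑ k, ∑ l, I.geo.B y k l * (I.geo.nab I.K y (ocons (L 0) ![L 1, k, l]) +
    I.geo.nab I.K y (ocons k ![L 0, l, L 1])) -
  ∑ k, ∑ l, I.geo.B y k l * act (I.geo.B y) (I.R y) (I.A y)
    (Sum.elim (ocons (L 0) fun _ => k) ![l, L 1])) -
  I.H y * (∑ k, ∑ l, I.geo.B y k l * (I.A y ![L 0, k] * I.A y ![L 1, l])) +
  I.H y * I.Rf y ![none, some (L 0), some (L 1), none] +
  I.Zb η y (ocons none (ocons (some (L 1)) fun _ => some (L 0))) +
  (1 / 2) * (I.hf η y ![none, none] * I.A y L)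

namespace Imm.Flow

variable {I : Imm E E' D D'} {v : E} {v' : E'} {η : E' → (Fin 2 → D') → ℝ} (h : I.Flow v v' η)
  {y : E}
include h

/-- Time derivative of vector fields along the map. -/
lemma fderiv_pr_vel (hy : y ∈ I.Ω) {X Y : E → D' → ℝ}
    (hX : ∀ a, DifferentiableAt ℝ (fun z => X z a) y)
    (hY : ∀ a, DifferentiableAt ℝ (fun z => Y z a) y) :
    fderiv ℝ (fun z => pr (I.N (I.u z)) (X z) (Y z)) y v =
      pr (I.N (I.u y)) (cv v (chr I.d' I.N (I.u y)) (I.H y • I.e y) X y) (Y y) +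
      pr (I.N (I.u y)) (X y) (cv v (chr I.d' I.N (I.u y)) (I.H y • I.e y) Y y) +
      pr (Matrix.of fun a b => η (I.u y) ![a, b]) (X y) (Y y) := by
  rw [h.good.fderiv_pr_dir hy (h.vel y hy) hX hY]
  simp only [h.metdot _ (h.good.maps hy)]
  rfl

lemma hf_eq (o o' : Option D) : I.hf η y ![o, o'] =
    pr (Matrix.of fun a b => η (I.u y) ![a, b]) (fun a => I.P y a o) (fun a => I.P y a o') := by
  simp only [Imm.hf, pull_cons, pull_nil, pr, Matrix.of_apply, Finset.mul_sum]
  exact Finset.sum_congr rfl fun a _ => Finset.sum_congr rfl fun b _ => by ring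

lemma cd_He (hy : y ∈ I.Ω) (j : D) : I.cd j (fun z => I.H z • I.e z) y =
    fderiv ℝ I.H y (I.d j) • I.e y + I.H y • I.cd j I.e y :=
  cv_smul (h.good.dif h.good.sm_H hy) fun a => h.good.dif (h.good.sme a) hy

/-- The ambient connection has no torsion, so the covariant time derivative of a tangent vector is
the spatial derivative of the velocity. -/
lemma vel_F (hy : y ∈ I.Ω) (j : D) :
    cv v (chr I.d' I.N (I.u y)) (I.H y • I.e y) (fun z => I.F z j) y =
      I.cd j (fun z => I.H z • I.e z) y := by
  ext a
  simp only [Imm.cd, cv, Finset.sum_mul]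
  rw [h.Fdot y hy j a, Finset.sum_comm]
  congr 1
  refine Finset.sum_congr rfl fun b _ => Finset.sum_congr rfl fun c _ => ?_
  rw [h.good.met'.chr_symm (h.good.maps hy)]
  simp only [Pi.smul_apply, smul_eq_mul]
  ring

/-- The normal velocity contributes `-2 H A` by the Weingarten relation, and the motion of the
ambient metric contributes its tangential components. -/
lemma metric_vel (hy : y ∈ I.Ω) (i j : D) : fderiv ℝ (fun z => I.g z i j) y v = I.V η y ![i, j] := by
  have e1 : (fun z => I.g z i j) = fun z => pr (I.N (I.u z)) (I.F z i) (I.F z j) := rfl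
  have horth : ∀ l, pr (I.N (I.u y)) (I.e y) (I.F y l) = 0 := fun l => by
    rw [h.good.comm hy]; exact h.good.orth y hy l
  have e2 : ∀ i j, pr (I.N (I.u y)) (I.cd i (fun z => I.H z • I.e z) y) (I.F y j) =
      -(I.H y * I.sff y i j) := fun i j => by
    rw [h.cd_He hy, pr_add_left, pr_smul_left, pr_smul_left, horth, h.good.cd_e_F hy]; ring
  rw [e1, h.fderiv_pr_vel hy (fun a => h.good.dif (h.good.smF i a) hy)
    (fun a => h.good.dif (h.good.smF j a) hy), h.vel_F hy i, h.vel_F hy j, e2,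
    h.good.comm hy (I.F y i), e2, h.good.sff_symm hy j i, Imm.V, h.hf_eq]
  simp only [Imm.A, Matrix.cons_val]
  change _ + _ + pr _ (I.F y i) (I.F y j) = pr _ (I.F y i) (I.F y j) - _
  ring

/-- Obtained by differentiating the orthogonality of `F k` and `e` in time; the normal part of the
derivative of `H e` is the gradient of `H`. -/
lemma e_vel_F (hy : y ∈ I.Ω) (k : D) :
    pr (I.N (I.u y)) (I.F y k) (cv v (chr I.d' I.N (I.u y)) (I.H y • I.e y) I.e y) =
      -fderiv ℝ I.H y (I.d k) - pr (Matrix.of fun a b => η (I.u y) ![a, b]) (I.F y k) (I.e y) := by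
  have e1 : (fun z => pr (I.N (I.u z)) (I.F z k) (I.e z)) =ᶠ[𝓝 y] fun _ => 0 := by
    filter_upwards [h.good.isOpen.mem_nhds hy] with z hz using h.good.orth z hz k
  have e2 := h.fderiv_pr_vel hy (fun a => h.good.dif (h.good.smF k a) hy)
    (fun a => h.good.dif (h.good.sme a) hy)
  rw [e1.fderiv_eq, h.vel_F hy, h.cd_He hy, pr_add_left, pr_smul_left, pr_smul_left,
    h.unit y hy, h.good.cd_e_e hy] at e2
  simp at e2
  linarith

lemma e_vel_e (hy : y ∈ I.Ω) :
    pr (I.N (I.u y)) (I.e y) (cv v (chr I.d' I.N (I.u y)) (I.H y • I.e y) I.e y) =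
      -(1 / 2) * pr (Matrix.of fun a b => η (I.u y) ![a, b]) (I.e y) (I.e y) := by
  have e1 : (fun z => pr (I.N (I.u z)) (I.e z) (I.e z)) =ᶠ[𝓝 y] fun _ => 1 := by
    filter_upwards [h.good.isOpen.mem_nhds hy] with z hz using h.unit z hz
  have e2 := h.fderiv_pr_vel hy (fun a => h.good.dif (h.good.sme a) hy)
    (fun a => h.good.dif (h.good.sme a) hy)
  rw [e1.fderiv_eq, h.good.comm hy _ (I.e y)] at e2
  simp at e2
  linarith

/-- Both `∇e` and its pairing with `e` are known. Differentiating the relation that `∇ⱼe` is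
orthogonal to `e` expresses the second derivative of `e` through a product of first ones, which
gives the quadratic term in `A`. -/
lemma cd_cd_He (hy : y ∈ I.Ω) (i j : D) :
    pr (I.N (I.u y)) (I.cd i (I.cd j fun z => I.H z • I.e z) y) (I.e y) =
      fderiv ℝ (fun z => fderiv ℝ I.H z (I.d j)) y (I.d i) -
      I.H y * ∑ k, ∑ l, I.geo.B y k l * (I.A y ![i, k] * I.A y ![j, l]) := by
  have s1 : ContDiffOn ℝ ∞ (fun z => fderiv ℝ I.H z (I.d j)) I.Ω :=
    contDiffOn_fderiv_apply h.good.isOpen h.good.sm_H _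
  have s2 := h.good.sm_cd j h.good.sme
  have e1 : I.cd j (fun z => I.H z • I.e z) =ᶠ[𝓝 y]
      fun z => fderiv ℝ I.H z (I.d j) • I.e z + I.H z • I.cd j I.e z := by
    filter_upwards [h.good.isOpen.mem_nhds hy] with z hz using h.cd_He hz j
  have e2 : I.cd i (I.cd j fun z => I.H z • I.e z) y =
      (fderiv ℝ (fun z => fderiv ℝ I.H z (I.d j)) y (I.d i) • I.e y +
        fderiv ℝ I.H y (I.d j) • I.cd i I.e y) +
      (fderiv ℝ I.H y (I.d i) • I.cd j I.e y + I.H y • I.cd i (I.cd j I.e) y) := by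
    rw [Imm.cd, cv_congr e1, cv_add (X := fun z => fderiv ℝ I.H z (I.d j) • I.e z)
      (Y := fun z => I.H z • I.cd j I.e z)]
    · rw [cv_smul (h.good.dif s1 hy) (fun a => h.good.dif (h.good.sme a) hy),
        cv_smul (h.good.dif h.good.sm_H hy) (fun a => h.good.dif (s2 a) hy)]
      rfl
    · exact fun a => (h.good.dif s1 hy).mul (h.good.dif (h.good.sme a) hy)
    · exact fun a => (h.good.dif h.good.sm_H hy).mul (h.good.dif (s2 a) hy)
  have e3 : pr (I.N (I.u y)) (I.cd i (I.cd j I.e) y) (I.e y) =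
      -∑ k, ∑ l, I.geo.B y k l * (I.A y ![i, k] * I.A y ![j, l]) := by
    have f1 : (fun z => pr (I.N (I.u z)) (I.cd j I.e z) (I.e z)) =ᶠ[𝓝 y] fun _ => 0 := by
      filter_upwards [h.good.isOpen.mem_nhds hy] with z hz using h.good.cd_e_e hz j
    have f2 := h.good.fderiv_pr_cd hy i (fun a => h.good.dif (s2 a) hy)
      (fun a => h.good.dif (h.good.sme a) hy)
    rw [f1.fderiv_eq] at f2
    have f3 : pr (I.N (I.u y)) (I.cd j I.e y) (I.cd i I.e y) =
        ∑ k, ∑ l, I.geo.B y k l * (I.A y ![i, k] * I.A y ![j, l]) := by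
      rw [h.good.cd_e hy j, pr_neg_left, pr_sum_left]
      simp only [pr_smul_left]
      rw [← Finset.sum_neg_distrib]
      refine Finset.sum_congr rfl fun k _ => ?_
      rw [h.good.comm hy, h.good.cd_e_F hy, Finset.sum_mul, ← Finset.sum_neg_distrib]
      refine Finset.sum_congr rfl fun l _ => ?_
      change -((I.g y)⁻¹ k l * I.sff y j l * -I.sff y i k) =
        (I.g y)⁻¹ k l * (I.sff y i k * I.sff y j l)
      ring
    rw [f3] at f2
    simp at f2
    linarith
  rw [e2]
  simp only [pr_add_left, pr_smul_left, h.unit y hy, h.good.cd_e_e hy, e3]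
  ring

/-- Commuting the time derivative with `I.cd i` by `cv_comm` costs two terms: ambient curvature with
one argument in the direction of the velocity `H e`, and the variation of the ambient connection
caused by the moving metric. -/
lemma vel_cd_F (hy : y ∈ I.Ω) (i j : D) :
    pr (I.N (I.u y)) (cv v (chr I.d' I.N (I.u y)) (I.H y • I.e y) (I.cd i fun z => I.F z j) y)
      (I.e y) = pr (I.N (I.u y)) (I.cd i (I.cd j fun z => I.H z • I.e z) y) (I.e y) +
      I.H y * I.Rf y ![none, some i, some j, none] +
      I.Zb η y (ocons none (ocons (some j) fun _ => some i)) := by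
  have hw : ∀ a, ContDiffOn ℝ ∞ (fun z => (I.H z • I.e z) a) I.Ω := fun a =>
    h.good.sm_H.mul (h.good.sme a)
  have e1 := cv_comm h.good.isOpen h.good.met'.isOpen h.good.smu h.good.maps
    (h.good.met'.sm_chr I.d') (v₁ := v) (w₁ := fun z => I.H z • I.e z) hw (h.good.smF i)
    (h.good.smF j) hy (h.vel y hy) (h.good.deriv' hy i) (fun a => h.Fdot y hy i a)
  have e2 : I.cd i (fun z => cv v (chr I.d' I.N (I.u z)) (I.H z • I.e z) (fun z => I.F z j) z) y =
      I.cd i (I.cd j fun z => I.H z • I.e z) y := by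
    refine cv_congr ?_
    filter_upwards [h.good.isOpen.mem_nhds hy] with z hz using h.vel_F hz j
  have e3 : cv v (chr I.d' I.N (I.u y)) (I.H y • I.e y) (I.cd i fun z => I.F z j) y =
      I.cd i (I.cd j fun z => I.H z • I.e z) y +
      ((I.H y • fun a => ∑ b, (∑ c, ∑ f, curvC I.d' I.geo'.Γ (I.u y) a c f b * I.P y c none *
        I.P y f (some i)) * I.P y b (some j)) +
      fun a => ∑ b, (∑ f, fderiv ℝ (fun z => chr I.d' I.N z a f b) (I.u y) v' * I.F y i f) *
        I.F y j b) := by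
    rw [← e2]
    ext a
    have e4 := e1 a
    rw [sub_eq_iff_eq_add'] at e4
    refine e4.trans ?_
    rw [Pi.add_apply]
    congr 1
    simp only [map_zero, zero_mul, Finset.sum_const_zero, sub_zero, add_mul,
      Finset.sum_add_distrib, Pi.add_apply, Pi.smul_apply, smul_eq_mul, Finset.mul_sum,
      Finset.sum_mul]
    congr 1
    refine Finset.sum_congr rfl fun b _ => Finset.sum_congr rfl fun c _ =>
      Finset.sum_congr rfl fun f _ => ?_
    change curvC I.d' (chr I.d' I.N) (I.u y) a c f b * (I.H y * I.e y c) * I.F y i f * I.F y j b =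
      I.H y * (curvC I.d' (chr I.d' I.N) (I.u y) a c f b * I.e y c * I.F y i f * I.F y j b)
    ring
  rw [e3, pr_add_left, pr_add_left, pr_smul_left, ← add_assoc]
  congr 1
  · rw [h.good.Rf_eq]; rfl
  · have low := fun l j k => h.good.met'.connVar_low (d := I.d') h.metdot (h.good.maps hy) l j k
    have e5 : ∀ l j k, connZ (I.geo'.nab η (I.u y)) (ocons l (ocons k fun _ => j)) =
      ∑ q, I.N (I.u y) l q * fderiv ℝ (fun z => chr I.d' I.N z q j k) (I.u y) v' :=
      fun l j k => (low l j k).symm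
    simp only [Imm.Zb, pull_ocons, pull_unit, e5]
    rw [h.good.comm hy]
    simp only [pr, Finset.mul_sum, Finset.sum_mul]
    refine Finset.sum_congr rfl fun a _ => ?_
    rw [Finset.sum_comm]
    refine Finset.sum_congr rfl fun b _ => ?_
    rw [Finset.sum_comm]
    refine Finset.sum_congr rfl fun f _ => Finset.sum_congr rfl fun c _ => ?_
    change _ = I.e y a * (I.F y j b * (I.F y i f * _))
    ring

/-- Evolution of the second fundamental form. -/
lemma heat : Heat I.geo v I.A (I.src η) := by
  intro y hy
  have hy' : y ∈ I.Ω := hy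
  ext L
  have hL : L = ![L 0, L 1] := by ext s; fin_cases s <;> rfl
  rw [hL]
  set i := L 0
  set j := L 1
  have e1 : dt v I.A y ![i, j] = fderiv ℝ (fun z => pr (I.N (I.u z))
      (I.cd i (fun z => I.F z j) z) (I.e z)) y v := rfl
  rw [e1, h.fderiv_pr_vel hy' (fun a => h.good.dif (h.good.sm_cd i (h.good.smF j) a) hy')
    (fun a => h.good.dif (h.good.sme a) hy'), h.vel_cd_F hy', h.cd_cd_He hy', h.good.cd_F hy']
  -- In the Gauss expansion, the gradient of `H` times the Christoffel symbols completes the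
  -- Hessian, the mixed components of `η` cancel, and half of the purely normal one survives.
  simp only [pr_add_left, pr_sum_left, pr_smul_left, h.e_vel_F hy', h.e_vel_e hy']
  -- Simons' identity trades the Hessian of `H` for the Laplacian of `I.A` plus terms of the source.
  have e2 := h.good.hess_H hy' i j
  rw [h.good.simons hy' h.unit] at e2
  have e3 : I.hf η y ![none, none] = pr (Matrix.of fun a b => η (I.u y) ![a, b]) (I.e y) (I.e y) :=
    h.hf_eq none none
  simp only [Imm.src, Pi.add_apply, Matrix.cons_val, e3, mul_sub, mul_neg, Finset.sum_sub_distrib,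
    Finset.sum_neg_distrib]
  have e4 : I.A y ![i, j] = I.sff y i j := rfl
  rw [e4]
  linarith

lemma metVar : IsMetVar I.geo v fun y => rl eqv2 (I.V η y) :=
  h.good.met.metVar (fun y hy i j => by
    rw [h.metric_vel hy]
    simp only [rl]
    congr 1
    ext s; fin_cases s <;> rfl) I.pt

lemma connVar : IsConnVar I.geo v fun y => connZ (I.geo.nab (I.V η) y) :=
  h.good.met.connVar (fun _ hy i j => h.metric_vel hy i j) I.pt

end Imm.Flow

/-! ### Iterated covariant derivatives of a solution of the heat equation -/

section Iterates

variable {Θ : Type*} {D : Type} [Fintype D] [DecidableEq D]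
  {E : Type*} [NormedAddCommGroup E] [NormedSpace ℝ E]

/-- The norm of the `n`-th covariant derivative at the base point. -/
def Geo.nmIter (G : Geo E D) : ℕ → ∀ {ι : Type} [Fintype ι] [DecidableEq ι],
    (E → (ι → D) → ℝ) → ℝ
  | 0, _, _, _, T => G.nm T
  | n + 1, _, _, _, T => G.nmIter n (G.nab T)

/-- The squared norm of the `n`-th covariant derivative. -/
def Geo.sqIter (G : Geo E D) : ℕ → ∀ {ι : Type} [Fintype ι] [DecidableEq ι],
    (E → (ι → D) → ℝ) → E → ℝ
  | 0, _, _, _, T => fun z => ip (G.B z) (T z) (T z)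
  | n + 1, _, _, _, T => G.sqIter n (G.nab T)

variable {G : Θ → Geo E D} {b : Θ → ℝ}

lemma UL.of_nmIter (hG : ∀ θ, (G θ).Good) {n : ℕ} {ι : Type} [Fintype ι] [DecidableEq ι]
    {T : Θ → E → (ι → D) → ℝ} (hT : ∀ θ, Sm (G θ).Ω (T θ))
    (h : ∀ j < n, ∃ C, ∀ θ, (G θ).nmIter j (T θ) ≤ C)
    (hn : ∃ C, ∀ θ, (G θ).nmIter n (T θ) ≤ C * b θ) : UL G b n T := by
  induction n generalizing ι with
  | zero => exact ⟨hT, hn⟩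
  | succ n ih =>
    exact ⟨hT, h 0 n.succ_pos, ih (fun θ => (hG θ).sm_nab (hT θ))
      (fun j hj => h (j + 1) (Nat.succ_lt_succ hj)) hn⟩

/-- A differential inequality for a combination of the norms of two successive covariant
derivatives of a solution to the heat equation. -/
theorem exists_heat_bound_iter (hG : ∀ θ, (G θ).Good)
    (hsymm : ∀ θ, ∀ y ∈ (G θ).Ω, ∀ p i j, (G θ).Γ y p i j = (G θ).Γ y p j i) {v : Θ → E}
    {V : Θ → E → (Option (Option Empty) → D) → ℝ} (hV : ∀ θ, IsMetVar (G θ) (v θ) (V θ))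
    (hVb : ∃ C, ∀ θ, (G θ).nm (V θ) ≤ C) {k : ℕ}
    {R : Θ → E → (Option (Option (Option Unit)) → D) → ℝ} (hR : ∀ θ, IsCurv (G θ) (R θ))
    (hRb : UL G b (k + 1) R) {Z : Θ → E → (Option (Option Unit) → D) → ℝ}
    (hZ : ∀ θ, IsConnVar (G θ) (v θ) (Z θ)) (hZb : UL G b k Z)
    {ι : Type} [Fintype ι] [DecidableEq ι] {T P : Θ → E → (ι → D) → ℝ}
    (hTP : ∀ θ, Heat (G θ) (v θ) (T θ) (P θ)) (hT : UL G b (k + 1) T) (hP : UL G b (k + 1) P)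
    (hb : ∀ θ, b θ = 1 + (G θ).nmIter (k + 1) (T θ)) (hb1 : ∀ θ, 1 ≤ b θ) :
    ∃ N C, 0 ≤ N ∧ ∀ θ, (fderiv ℝ ((G θ).sqIter (k + 1) (T θ)) (G θ).pt (v θ) -
        (G θ).lapFun ((G θ).sqIter (k + 1) (T θ)) (G θ).pt) +
      N * (fderiv ℝ ((G θ).sqIter k (T θ)) (G θ).pt (v θ) -
        (G θ).lapFun ((G θ).sqIter k (T θ)) (G θ).pt) ≤ C - (G θ).nmIter (k + 1) (T θ) ^ 2 := by
  induction k generalizing ι with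
  | zero =>
    -- At order zero the bound by `C * b` says that the source of `∇T` is at most linear in `∇T`,
    -- because `b = 1 + |∇T|`.
    obtain ⟨C, hC⟩ := (UL.srcNab hG hb1 hRb hZb hT hP).2
    exact exists_heat_bound hG hV hVb (fun θ => hT.sm θ) hTP
      (fun θ => (hTP θ).nab (hG θ) (hsymm θ) (hR θ) (hRb.sm θ) (hZ θ) (hT.sm θ) (hP.sm θ))
      hT.2.1 hP.2.1 ⟨C, fun θ => (hC θ).trans_eq (by rw [hb]; rfl)⟩
  | succ k ih =>
    -- The statement for `T` at `k + 1` is the one for `∇T` at `k`: the norms agree by definition,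
    -- so the weight `b` is unchanged.
    exact ih (hRb.mono hG hb1) (hZb.mono hG hb1)
      (fun θ => (hTP θ).nab (hG θ) (hsymm θ) (hR θ) (hRb.sm θ) (hZ θ) (hT.sm θ) (hP.sm θ))
      hT.nab (UL.srcNab hG hb1 hRb hZb hT hP) hb

end Iterates

/-! ### Control of all coefficients in terms of the second fundamental form -/

section Assembly

variable {Θ : Type*} {D D' : Type} [Fintype D] [DecidableEq D] [Fintype D'] [DecidableEq D']
  {E E' : Type*} [NormedAddCommGroup E] [NormedSpace ℝ E] [NormedAddCommGroup E'] [NormedSpace ℝ E']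

section Reindex

variable {G : Θ → Geo E D} {b : Θ → ℝ} (hG : ∀ θ, (G θ).Good)
  {ι κ : Type} [Fintype ι] [DecidableEq ι] [Fintype κ] [DecidableEq κ] {n : ℕ}
include hG

/-- A version of relabelling for index maps written out as formulas: bijectivity on the slots is
decidable and the formula is checked slot by slot. -/
lemma UL.reindex {T : Θ → E → (ι → D) → ℝ} (hT : UL G b n T) (φ : (κ → D) → ι → D) (f : ι → κ)
    (hf : Function.Bijective f) (hφ : ∀ L s, φ L s = L (f s)) :
    UL G b n fun θ z L => T θ z (φ L) := by
  have : φ = fun L => L ∘ f := funext fun L => funext fun s => hφ L s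
  rw [this]
  exact hT.rl hG (Equiv.ofBijective f hf)

lemma UL.scalar_mul (hb : ∀ θ, 1 ≤ b θ) {s : Θ → E → ℝ} {T : Θ → E → (ι → D) → ℝ}
    (hs : UL G b (n + 1) fun θ z (_ : Empty → D) => s θ z) (hT : UL G b (n + 1) T) :
    UL G b (n + 1) fun θ z => s θ z • T θ z :=
  (UL.tprod_succ hG hb hs hT).rl hG (eqvE ι)

lemma UL.connZ {V : Θ → E → (Option (Fin 2) → D) → ℝ} (hV : UL G b n V) :
    UL G b n fun θ z => connZ (V θ z) := by
  have h1 := hV.reindex hG (κ := Option (Option Unit))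
    (fun L => ocons (L (some (some ()))) ![L (some none), L none])
    (fun o => o.elim (some (some ())) ![some none, none]) (by decide)
    (by rintro L (_ | s); · rfl
        · fin_cases s <;> rfl)
  have h2 := hV.reindex hG (κ := Option (Option Unit))
    (fun L => ocons (L (some none)) ![L (some (some ())), L none])
    (fun o => o.elim (some none) ![some (some ()), none]) (by decide)
    (by rintro L (_ | s); · rfl
        · fin_cases s <;> rfl)
  have h3 := hV.reindex hG (κ := Option (Option Unit))
    (fun L => ocons (L none) ![L (some (some ())), L (some none)])
    (fun o => o.elim none ![some (some ()), some none]) (by decide)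
    (by rintro L (_ | s); · rfl
        · fin_cases s <;> rfl)
  exact (((h1.add hG h2).sub hG h3).smul hG (1 / 2)).congr hG fun θ y _ => rfl

end Reindex

variable {I : Θ → Imm E E' D D'} {v : Θ → E} {v' : Θ → E'} {η : Θ → E' → (Fin 2 → D') → ℝ}
  (h : ∀ θ, (I θ).Flow (v θ) (v' θ) (η θ)) {b : Θ → ℝ} (hb : ∀ θ, 1 ≤ b θ) {k : ℕ}
  (hRm : ∀ n, UL (fun θ => (I θ).geo') 1 n fun θ => rmC (I θ).d' (I θ).N)
  (hη : ∀ n, UL (fun θ => (I θ).geo') 1 n η)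
  (hA : UL (fun θ => (I θ).geo) b (k + 1) fun θ => (I θ).A)
include h hb hA

lemma UL.frameZ : UL (fun θ => (I θ).geo.split) b (k + 1) fun θ => (I θ).Z := by
  have hG : ∀ θ, (I θ).geo.Good := fun θ => (h θ).good.good
  have hGs : ∀ θ, (I θ).geo.split.Good := fun θ => (hG θ).split
  have h1 := UL.tprod_succ hGs hb (hA.ext0 hG) (UL.nuN hG hb)
  have h2 := h1.reindex hGs (κ := Option (Option Unit))
    (fun L => Sum.elim ![L (some (some ())), L (some none)] fun _ => L none)
    (Sum.elim ![some (some ()), some none] fun _ => none) (by decide)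
    (by rintro L (s | s); · fin_cases s <;> rfl
        · rfl)
  have h3 := h1.reindex hGs (κ := Option (Option Unit))
    (fun L => Sum.elim ![L (some (some ())), L none] fun _ => L (some none))
    (Sum.elim ![some (some ()), none] fun _ => some none) (by decide)
    (by rintro L (s | s); · fin_cases s <;> rfl
        · rfl)
  refine (h2.sub hGs h3).congr hGs fun θ y _ => ?_
  ext L
  simp only [Imm.Z, Pi.sub_apply, ExtRicciMCF.tprod, Sum.elim_comp_inl, Sum.elim_comp_inr]
  ring

/-- The rotation `Z` of the frame is linear in the second fundamental form, so ambient tensors are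
controlled to one order more than `A`. This extra order pays for the derivative of the curvature in
the source. -/
lemma UL.frame_pull {ι : Type} [Fintype ι] [DecidableEq ι] {T : Θ → E' → (ι → D') → ℝ}
    (hT : ∀ n, UL (fun θ => (I θ).geo') 1 n T) :
    UL (fun θ => (I θ).geo.split) b (k + 2) fun θ z => pull ((I θ).P z) (T θ ((I θ).u z)) :=
  UL.frame (fun θ => (h θ).good.good) (fun θ => (h θ).good.good') hb
    (fun θ => (h θ).good.isFrame) (UL.frameZ h hb hA) hT

lemma UL.curvK (hRm : ∀ n, UL (fun θ => (I θ).geo') 1 n fun θ => rmC (I θ).d' (I θ).N) :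
    UL (fun θ => (I θ).geo) b (k + 2) fun θ => (I θ).K := by
  have hG : ∀ θ, (I θ).geo.Good := fun θ => (h θ).good.good
  have hGs : ∀ θ, (I θ).geo.split.Good := fun θ => (hG θ).split
  have h1 := UL.frame_pull h hb hA hRm
  have h2 := ((h1.reindex hGs (κ := Option (Fin 3))
    (fun L => ![L (some 0), L (some 1), L (some 2), L none]) ![some 0, some 1, some 2, none]
    (by decide) (by intro L s; fin_cases s <;> rfl)).fillN hG).restr hG
  exact h2.congr hG fun θ y _ => rfl

lemma UL.curvR (hRm : ∀ n, UL (fun θ => (I θ).geo') 1 n fun θ => rmC (I θ).d' (I θ).N) :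
    UL (fun θ => (I θ).geo) b (k + 1) fun θ => (I θ).R := by
  have hG : ∀ θ, (I θ).geo.Good := fun θ => (h θ).good.good
  have hGs : ∀ θ, (I θ).geo.split.Good := fun θ => (hG θ).split
  have h1 := (((UL.frame_pull h hb hA hRm).mono hGs hb).reindex hGs
    (κ := Option (Option (Option Unit))) (fun L => ![L (some (some none)),
      L (some (some (some ()))), L (some none), L none])
    ![some (some none), some (some (some ())), some none, none] (by decide)
    (by intro L s; fin_cases s <;> rfl)).restr hG
  have h3 := UL.tprod_succ hG hb hA hA
  have h4 := h3.reindex hG (κ := Option (Option (Option Unit)))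
    (fun L => Sum.elim ![L (some (some (some ()))), L (some none)] ![L (some (some none)), L none])
    (Sum.elim ![some (some (some ())), some none] ![some (some none), none]) (by decide)
    (by rintro L (s | s) <;> fin_cases s <;> rfl)
  have h5 := h3.reindex hG (κ := Option (Option (Option Unit)))
    (fun L => Sum.elim ![L (some (some none)), L (some none)] ![L (some (some (some ()))), L none])
    (Sum.elim ![some (some none), some none] ![some (some (some ())), none]) (by decide)
    (by rintro L (s | s) <;> fin_cases s <;> rfl)
  refine (h1.add hG (h4.sub hG h5)).congr hG fun θ y _ => ?_
  ext L
  simp only [Imm.R, Imm.Rf, ExtRicciMCF.restr, Pi.add_apply, Pi.sub_apply, ExtRicciMCF.tprod,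
    Function.comp_apply, Sum.elim_comp_inl, Sum.elim_comp_inr]

lemma UL.meanH : UL (fun θ => (I θ).geo) b (k + 1) fun θ z (_ : Empty → D) => (I θ).H z :=
  (hA.rl (fun θ => (h θ).good.good) eqv2).contr fun θ => (h θ).good.good

lemma UL.velV (hη : ∀ n, UL (fun θ => (I θ).geo') 1 n η) :
    UL (fun θ => (I θ).geo) b (k + 1) fun θ => (I θ).V (η θ) := by
  have hG : ∀ θ, (I θ).geo.Good := fun θ => (h θ).good.good
  have hGs : ∀ θ, (I θ).geo.split.Good := fun θ => (hG θ).split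
  have h1 := (((UL.frame_pull h hb hA hη).mono hGs hb).reindex hGs
    (fun L => ![L 0, L 1]) id Function.bijective_id (by intro L s; fin_cases s <;> rfl)).restr hG
  have h2 := (UL.scalar_mul hG hb (UL.meanH h hb hA) hA).smul hG 2
  exact (h1.sub hG h2).congr hG fun θ y _ => rfl

/-- Each term is a relabelled contraction of products of `A`, of curvature, and of frame components
of the ambient velocity and its covariant derivative, all controlled to the order `k + 1`. -/
lemma UL.src (hRm : ∀ n, UL (fun θ => (I θ).geo') 1 n fun θ => rmC (I θ).d' (I θ).N)
    (hη : ∀ n, UL (fun θ => (I θ).geo') 1 n η) :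
    UL (fun θ => (I θ).geo) b (k + 1) fun θ => (I θ).src (η θ) := by
  have hG : ∀ θ, (I θ).geo.Good := fun θ => (h θ).good.good
  have hG' : ∀ θ, (I θ).geo'.Good := fun θ => (h θ).good.good'
  have hGs : ∀ θ, (I θ).geo.split.Good := fun θ => (hG θ).split
  -- `I.K` is controlled to order `k + 2`, so its covariant derivative is still available at order
  -- `k + 1`.
  have hK := (UL.curvK h hb hA hRm).nab
  have hH := UL.meanH h hb hA
  have hRf := (UL.frame_pull h hb hA hRm).mono hGs hb
  have hhf := (UL.frame_pull h hb hA hη).mono hGs hb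
  have hZb := (UL.frame_pull h hb hA fun n => (hη (n + 1)).nab.connZ hG').mono hGs hb
  have a1 := (hK.reindex hG (κ := Option (Option (Fin 2)))
    (fun L => ocons (L (some (some 0))) ![L (some (some 1)), L none, L (some none)])
    (fun o => o.elim (some (some 0)) ![some (some 1), none, some none]) (by decide)
    (by rintro L (_ | s); · rfl
        · fin_cases s <;> rfl)).contr hG
  have a2 := (hK.reindex hG (κ := Option (Option (Fin 2)))
    (fun L => ocons (L none) ![L (some (some 0)), L (some none), L (some (some 1))])
    (fun o => o.elim none ![some (some 0), some none, some (some 1)]) (by decide)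
    (by rintro L (_ | s); · rfl
        · fin_cases s <;> rfl)).contr hG
  have a3 := (((UL.tprod_succ hG hb (UL.curvR h hb hA hRm) hA).act_of_tprod hG).reindex hG
    (κ := Option (Option (Fin 2)))
    (fun L => Sum.elim (ocons (L (some (some 0))) fun _ => L none)
      ![L (some none), L (some (some 1))])
    (Sum.elim (fun o => o.elim (some (some 0)) fun _ => none) ![some none, some (some 1)])
    (by decide) (by rintro L ((_ | s) | s); · rfl
                    · rfl
                    · fin_cases s <;> rfl)).contr hG
  have a4 := UL.scalar_mul hG hb hH (((UL.tprod_succ hG hb hA hA).reindex hG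
    (κ := Option (Option (Fin 2)))
    (fun L => Sum.elim ![L (some (some 0)), L none] ![L (some (some 1)), L (some none)])
    (Sum.elim ![some (some 0), none] ![some (some 1), some none]) (by decide)
    (by rintro L (s | s) <;> fin_cases s <;> rfl)).contr hG)
  have a5 := UL.scalar_mul hG hb hH ((((hRf.reindex hGs (κ := Option (Option (Fin 2)))
    (fun L => ![L none, L (some (some 0)), L (some (some 1)), L (some none)])
    ![none, some (some 0), some (some 1), some none] (by decide)
    (by intro L s; fin_cases s <;> rfl)).fillN hG).fillN hG).restr hG)
  have a6 := ((hZb.reindex hGs (κ := Option (Fin 2))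
    (fun L => ocons (L none) (ocons (L (some 1)) fun _ => L (some 0)))
    (fun o => o.elim none fun o => o.elim (some 1) fun _ => some 0) (by decide)
    (by rintro L (_ | _ | s) <;> rfl)).fillN hG).restr hG
  have a7 := (UL.scalar_mul hG hb (((((hhf.reindex hGs (κ := Option (Option Empty))
    (fun L => ![L none, L (some none)]) ![none, some none] (by decide)
    (by intro L s; fin_cases s <;> rfl)).fillN hG).fillN hG).restr hG).congr hG
    (S := fun θ z _ => (I θ).hf (η θ) z ![none, none]) fun θ y _ => rfl) hA).smul hG (1 / 2)
  refine ((((((a1.add hG a2).sub hG a3).sub hG a4).add hG a5).add hG a6).add hG a7).congr hG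
    fun θ y _ => ?_
  ext L
  simp only [Imm.src, Imm.Rf, Imm.Zb, Pi.add_apply, Pi.sub_apply, Pi.smul_apply, smul_eq_mul,
    mul_add, Finset.sum_add_distrib, ExtRicciMCF.contr, ExtRicciMCF.restr, ExtRicciMCF.fillN,
    ExtRicciMCF.tprod, Function.comp_apply, Sum.elim_comp_inl, Sum.elim_comp_inr, ocons_none,
    ocons_some]

/-- The differential inequality for the covariant derivatives of the second fundamental form. -/
theorem Imm.exists_heat_bound
    (hRm : ∀ n, UL (fun θ => (I θ).geo') 1 n fun θ => rmC (I θ).d' (I θ).N)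
    (hη : ∀ n, UL (fun θ => (I θ).geo') 1 n η)
    (hbk : ∀ θ, b θ = 1 + (I θ).geo.nmIter (k + 1) (I θ).A) :
    ∃ N C, 0 ≤ N ∧ ∀ θ, (fderiv ℝ ((I θ).geo.sqIter (k + 1) (I θ).A) (I θ).pt (v θ) -
        (I θ).geo.lapFun ((I θ).geo.sqIter (k + 1) (I θ).A) (I θ).pt) +
      N * (fderiv ℝ ((I θ).geo.sqIter k (I θ).A) (I θ).pt (v θ) -
        (I θ).geo.lapFun ((I θ).geo.sqIter k (I θ).A) (I θ).pt) ≤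
      C - (I θ).geo.nmIter (k + 1) (I θ).A ^ 2 := by
  have hG : ∀ θ, (I θ).geo.Good := fun θ => (h θ).good.good
  have hV := UL.velV h hb hA hη
  exact exists_heat_bound_iter (G := fun θ => (I θ).geo) hG
    (fun θ y hy p i j => (h θ).good.met.chr_symm hy p i j) (fun θ => (h θ).metVar)
    (hV.rl hG eqv2).2.1 (fun θ => (h θ).good.isCurv) (UL.curvR h hb hA hRm)
    (fun θ => (h θ).connVar) (hV.nab.connZ hG) (fun θ => (h θ).heat) hA (UL.src h hb hA hRm hη)
    hbk hb

end Assembly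

/-! ### Naturality under maps preserving connection and metric -/

section Iso

variable {D D₁ D₂ : Type} [Fintype D] [DecidableEq D] [Fintype D₁] [DecidableEq D₁]
  [Fintype D₂] [DecidableEq D₂] {E₁ E₂ : Type*} [NormedAddCommGroup E₁] [NormedSpace ℝ E₁]
  [NormedAddCommGroup E₂] [NormedSpace ℝ E₂]

/-- A map whose differential, with components `P`, preserves the connection and the metric. -/
structure IsIso (G₁ : Geo E₁ D₁) (G₂ : Geo E₂ D₂) (κ : E₁ → E₂) (P : E₁ → Matrix D₂ D₁ ℝ) :
    Prop where
  maps : MapsTo κ G₁.Ω G₂.Ω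
  smooth : ContDiffOn ℝ ∞ κ G₁.Ω
  smP : ∀ a k, ContDiffOn ℝ ∞ (fun y => P y a k) G₁.Ω
  metric : ∀ y ∈ G₁.Ω, P y * G₁.B y * (P y).transpose = G₂.B (κ y)
  deriv : ∀ y ∈ G₁.Ω, ∀ j, fderiv ℝ κ y (G₁.d j) = ∑ c, P y c j • G₂.d c
  par : ∀ y ∈ G₁.Ω, ∀ j a k, fderiv ℝ (fun z => P z a k) y (G₁.d j) =
    ∑ l, P y a l * G₁.Γ y l j k - ∑ b, (∑ c, P y c j * G₂.Γ (κ y) a c b) * P y b k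

variable {G₁ : Geo E₁ D₁} {G₂ : Geo E₂ D₂} {κ : E₁ → E₂} {P : E₁ → Matrix D₂ D₁ ℝ}
  {ι : Type} [Fintype ι] [DecidableEq ι]

lemma IsIso.nab_pull (h : IsIso G₁ G₂ κ P) (h₁ : G₁.Good) (h₂ : G₂.Good)
    {T : E₂ → (ι → D₂) → ℝ} (hT : Sm G₂.Ω T) {y : E₁} (hy : y ∈ G₁.Ω) :
    G₁.nab (fun z => pull (P z) (T (κ z))) y = pull (P y) (G₂.nab T (κ y)) := by
  ext J
  rw [← ocons_eta J, Geo.nab, nab_ocons, pull_ocons]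
  generalize J none = j
  generalize J ∘ some = K
  have hκ : DifferentiableAt ℝ κ y :=
    (h.smooth.contDiffAt (h₁.isOpen.mem_nhds hy)).differentiableAt (by simp)
  rw [der_pull hκ (hT.differentiableAt h₂.isOpen (h.maps hy))
    (fun a k => ((h.smP a k).contDiffAt (h₁.isOpen.mem_nhds hy)).differentiableAt (by simp))
    (fun a k => h.par y hy j a k), h.deriv y hy j]
  have : der (∑ c, P y c j • G₂.d c) (fun a b => ∑ c, P y c j * G₂.Γ (κ y) a c b) T (κ y) =
      ∑ c, P y c j • fun I => G₂.nab T (κ y) (ocons c I) := by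
    ext I
    simp only [der, map_sum, map_smul, smul_eq_mul, Finset.sum_apply, Pi.smul_apply, Geo.nab,
      nab_ocons, mul_sub, Finset.sum_sub_distrib, Finset.mul_sum, Finset.sum_mul]
    congr 1
    rw [Finset.sum_comm_cycle]
    refine Finset.sum_congr rfl fun c _ => Finset.sum_congr rfl fun s _ =>
      Finset.sum_congr rfl fun l _ => ?_
    ring
  rw [this, pull_sum, Finset.sum_apply]
  refine Finset.sum_congr rfl fun c _ => ?_
  rw [pull_smul]
  rfl

lemma sqIter_congr {U : Set E₁} (hU : IsOpen U) {k : ℕ} {ι : Type} [Fintype ι] [DecidableEq ι]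
    {T S : E₁ → (ι → D₁) → ℝ} (e : EqOn T S U) : EqOn (G₁.sqIter k T) (G₁.sqIter k S) U := by
  induction k generalizing ι with
  | zero => intro y hy; simp only [Geo.sqIter, e hy]
  | succ k ih => exact ih (nab_congr hU e)

lemma sqIter_smul (h₁ : G₁.Good) {k : ℕ} {ι : Type} [Fintype ι] [DecidableEq ι]
    {T : E₁ → (ι → D₁) → ℝ} (hT : Sm G₁.Ω T) (c : ℝ) :
    EqOn (G₁.sqIter k fun z => c • T z) (fun z => c ^ 2 * G₁.sqIter k T z) G₁.Ω := by
  induction k generalizing ι with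
  | zero =>
    intro y hy
    simp only [Geo.sqIter]
    rw [ip_smul_left, ip_comm (h₁.psd y hy), ip_smul_left]
    ring
  | succ k ih =>
    have e : EqOn (G₁.nab fun z => c • T z) (fun z => c • G₁.nab T z) G₁.Ω := fun y hy =>
      nab_smul c (hT.differentiableAt h₁.isOpen hy)
    exact fun y hy => (sqIter_congr h₁.isOpen e hy).trans (ih (h₁.sm_nab hT) hy)

lemma IsIso.sqIter_pull (h : IsIso G₁ G₂ κ P) (h₁ : G₁.Good) (h₂ : G₂.Good) {k : ℕ} {ι : Type}
    [Fintype ι] [DecidableEq ι] {T : E₂ → (ι → D₂) → ℝ} (hT : Sm G₂.Ω T) :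
    EqOn (G₁.sqIter k fun z => pull (P z) (T (κ z))) (fun z => G₂.sqIter k T (κ z)) G₁.Ω := by
  induction k generalizing ι with
  | zero =>
    intro y hy
    simp only [Geo.sqIter]
    rw [ip_pull, h.metric y hy]
  | succ k ih =>
    exact fun y hy => (sqIter_congr h₁.isOpen (fun z hz => h.nab_pull h₁ h₂ hT hz) hy).trans
      (ih (h₂.sm_nab hT) hy)

lemma Geo.Good.nmIter_sq (h₁ : G₁.Good) {k : ℕ} {ι : Type} [Fintype ι] [DecidableEq ι]
    (T : E₁ → (ι → D₁) → ℝ) : G₁.nmIter k T ^ 2 = G₁.sqIter k T G₁.pt := by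
  induction k generalizing ι with
  | zero => exact nrm_sq (h₁.psd _ h₁.mem) _
  | succ k ih => exact ih _

lemma Geo.nmIter_nonneg (G : Geo E₁ D₁) {k : ℕ} {ι : Type} [Fintype ι] [DecidableEq ι]
    (T : E₁ → (ι → D₁) → ℝ) : 0 ≤ G.nmIter k T := by
  induction k generalizing ι with
  | zero => exact nrm_nonneg _ _
  | succ k ih => exact ih _

lemma Geo.Good.sm_sqIter (h₁ : G₁.Good) {k : ℕ} {ι : Type} [Fintype ι] [DecidableEq ι]
    {T : E₁ → (ι → D₁) → ℝ} (hT : Sm G₁.Ω T) : ContDiffOn ℝ ∞ (G₁.sqIter k T) G₁.Ω := by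
  induction k generalizing ι with
  | zero =>
    exact ContDiffOn.sum fun I _ => ContDiffOn.sum fun J _ =>
      ((contDiffOn_prod fun s _ => h₁.smB _ _).mul (hT I)).mul (hT J)
  | succ k ih => exact ih (h₁.sm_nab hT)

lemma contr_pull (B : Matrix D₁ D₁ ℝ) (P : Matrix D₂ D₁ ℝ) (T : (Option (Option ι) → D₂) → ℝ) :
    contr B (pull P T) = pull P (contr (P * B * P.transpose) T) := by
  ext K
  simp only [contr_eq_sum, pull_sum, pull_smul, pull_ocons, Finset.sum_apply, Pi.smul_apply,
    Matrix.mul_apply, Matrix.transpose_apply, smul_eq_mul, Finset.sum_mul, Finset.mul_sum]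
  calc _ = ∑ i, ∑ a, ∑ j, ∑ b, B i j * (P a i * (P b j * pull P (fun I => T (ocons a (ocons b I))) K)) :=
        Finset.sum_congr rfl fun i _ => Finset.sum_comm
    _ = ∑ a, ∑ i, ∑ j, ∑ b, B i j * (P a i * (P b j * pull P (fun I => T (ocons a (ocons b I))) K)) :=
        Finset.sum_comm
    _ = ∑ a, ∑ i, ∑ b, ∑ j, B i j * (P a i * (P b j * pull P (fun I => T (ocons a (ocons b I))) K)) :=
        Finset.sum_congr rfl fun a _ => Finset.sum_congr rfl fun i _ => Finset.sum_comm
    _ = ∑ a, ∑ b, ∑ i, ∑ j, B i j * (P a i * (P b j * pull P (fun I => T (ocons a (ocons b I))) K)) :=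
        Finset.sum_congr rfl fun a _ => Finset.sum_comm
    _ = ∑ a, ∑ b, ∑ j, ∑ i, B i j * (P a i * (P b j * pull P (fun I => T (ocons a (ocons b I))) K)) :=
        Finset.sum_congr rfl fun a _ => Finset.sum_congr rfl fun b _ => Finset.sum_comm
    _ = _ := Finset.sum_congr rfl fun a _ => Finset.sum_congr rfl fun b _ =>
        Finset.sum_congr rfl fun j _ => Finset.sum_congr rfl fun i _ => by ring

end Iso

/-! ### Local isometries preserve the connection and the curvature -/

section MetricIso

variable {D : Type} [Fintype D] [DecidableEq D] {E₁ E₂ : Type*}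
  [NormedAddCommGroup E₁] [NormedSpace ℝ E₁] [NormedAddCommGroup E₂] [NormedSpace ℝ E₂]

lemma det_ne_of_posDef {A₁ A₂ P : Matrix D D ℝ} (h₁ : A₁.PosDef) (h : A₁ = P.transpose * A₂ * P) :
    P.det ≠ 0 := by
  intro h0
  have := h₁.det_pos
  rw [h, Matrix.det_mul, h0, mul_zero] at this
  exact this.ne rfl

lemma inv_eq_of_pull {A₁ A₂ P : Matrix D D ℝ} (h₁ : A₁.PosDef) (h : A₁ = P.transpose * A₂ * P) :
    P * A₁⁻¹ * P.transpose = A₂⁻¹ := by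
  have hP := det_ne_of_posDef h₁ h
  have hPt : P.transpose.det ≠ 0 := by rwa [Matrix.det_transpose]
  rw [h, Matrix.mul_inv_rev, Matrix.mul_inv_rev, ← mul_assoc, ← mul_assoc,
    Matrix.mul_nonsing_inv _ hP.isUnit, one_mul, mul_assoc, Matrix.nonsing_inv_mul _ hPt.isUnit,
    mul_one]

lemma chr_congr {D : Type} [Fintype D] [DecidableEq D] {Ω : Set E₁} (hΩ : IsOpen Ω) {d : D → E₁}
    {A A' : E₁ → Matrix D D ℝ} (e : EqOn A A' Ω) {y : E₁} (hy : y ∈ Ω) : chr d A y = chr d A' y := by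
  have h1 : ∀ a b, (fun z => A z a b) =ᶠ[𝓝 y] fun z => A' z a b := fun a b => by
    filter_upwards [hΩ.mem_nhds hy] with z hz; rw [e hz]
  ext k i j
  simp only [chr, e hy, (h1 _ _).fderiv_eq]

/-- The Ricci tensor. -/
def ricC (d : D → E₁) (A : E₁ → Matrix D D ℝ) (y : E₁) (L : Fin 2 → D) : ℝ :=
  ∑ i, curvC d (chr d A) y i i (L 0) (L 1)

/-- The slots of the curvature tensor that are contracted in the Ricci tensor, in front. -/
def eqvRic : Fin 4 ≃ Option (Option (Fin 2)) := Equiv.ofBijective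
  ![none, some (some 0), some (some 1), some none] (by decide)

/-- Written as a contraction, the Ricci tensor inherits naturality and bounds from the curvature
tensor. -/
lemma IsMetric.ricC_eq {Ω : Set E₁} {d : D → E₁} {A : E₁ → Matrix D D ℝ} (h : IsMetric Ω A) {y : E₁}
    (hy : y ∈ Ω) : ricC d A y = contr (A y)⁻¹ (rl eqvRic (rmC d A y)) := by
  ext L
  refine Finset.sum_congr rfl fun i _ => ?_
  have e1 : ∀ q, rl eqvRic (rmC d A y) (ocons i (ocons q L)) =
      ∑ p, A y p q * curvC d (chr d A) y p i (L 0) (L 1) := fun q => rfl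
  have e2 : ∑ q, (A y)⁻¹ i q * ∑ p, A y p q * curvC d (chr d A) y p i (L 0) (L 1) =
      ((A y)⁻¹ * A y).mulVec (fun p => curvC d (chr d A) y p i (L 0) (L 1)) i := by
    rw [← Matrix.mulVec_mulVec]
    simp only [Matrix.mulVec, dotProduct, h.symm hy _]
  simp only [e1]
  rw [e2, h.inv_mul hy, Matrix.one_mulVec]

/-- Data of a local isometry. -/
structure MetIso (Ω₁ : Set E₁) (d₁ : D → E₁) (A₁ : E₁ → Matrix D D ℝ) (Ω₂ : Set E₂) (d₂ : D → E₂)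
    (A₂ : E₂ → Matrix D D ℝ) (κ : E₁ → E₂) (P : E₁ → Matrix D D ℝ) : Prop where
  met₁ : IsMetric Ω₁ A₁
  met₂ : IsMetric Ω₂ A₂
  maps : MapsTo κ Ω₁ Ω₂
  smooth : ContDiffOn ℝ ∞ κ Ω₁
  smP : ∀ a k, ContDiffOn ℝ ∞ (fun y => P y a k) Ω₁
  deriv : ∀ y ∈ Ω₁, ∀ j, fderiv ℝ κ y (d₁ j) = ∑ c, P y c j • d₂ c
  tors : ∀ y ∈ Ω₁, ∀ i j a, fderiv ℝ (fun z => P z a j) y (d₁ i) = fderiv ℝ (fun z => P z a i) y (d₁ j)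
  metric : ∀ y ∈ Ω₁, A₁ y = (P y).transpose * A₂ (κ y) * P y

variable {Ω₁ : Set E₁} {d₁ : D → E₁} {A₁ : E₁ → Matrix D D ℝ} {Ω₂ : Set E₂} {d₂ : D → E₂}
    {A₂ : E₂ → Matrix D D ℝ} {κ : E₁ → E₂} {P : E₁ → Matrix D D ℝ}

/-- A local isometry as an immersion without normal directions. -/
def MetIso.imm (_ : MetIso Ω₁ d₁ A₁ Ω₂ d₂ A₂ κ P) (pt : E₁) : Imm E₁ E₂ D D :=
  ⟨Ω₁, pt, d₁, Ω₂, d₂, A₂, κ, fun y i a => P y a i, fun _ _ => 0⟩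

variable (h : MetIso Ω₁ d₁ A₁ Ω₂ d₂ A₂ κ P) {pt : E₁} (hpt : pt ∈ Ω₁)
include h

lemma MetIso.imm_g {y : E₁} (hy : y ∈ Ω₁) : (h.imm pt).g y = A₁ y := by
  rw [h.metric y hy]
  ext i j
  simp only [Imm.g, Matrix.of_apply, pr, Matrix.mul_apply, Matrix.transpose_apply, Finset.sum_mul]
  rw [Finset.sum_comm]
  refine Finset.sum_congr rfl fun b _ => Finset.sum_congr rfl fun a _ => ?_
  change A₂ (κ y) a b * P y a i * P y b j = _
  ring

lemma MetIso.sff_eq (y : E₁) (i j : D) : (h.imm pt).sff y i j = 0 := pr_zero_right _ _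

lemma MetIso.imm_Γ {y : E₁} (hy : y ∈ Ω₁) : (h.imm pt).geo.Γ y = chr d₁ A₁ y :=
  chr_congr h.met₁.isOpen (fun _ hz => h.imm_g hz) hy

include hpt

lemma MetIso.good : (h.imm pt).Good where
  isOpen := h.met₁.isOpen
  mem := hpt
  met' := h.met₂
  maps := h.maps
  smu := h.smooth
  smF := fun i a => h.smP a i
  sme := fun _ => contDiffOn_const
  deriv := h.deriv
  tors := h.tors
  orth := fun _ _ _ => pr_zero_right _ _
  pos := fun y hy => by rw [h.imm_g hy]; exact h.met₁.pos y hy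
  complete := fun y hy a b => by
    rw [h.imm_g hy]
    change _ = (A₂ (κ y))⁻¹ a b
    rw [← inv_eq_of_pull (h.met₁.pos y hy) (h.metric y hy)]
    simp only [Matrix.mul_apply, Matrix.transpose_apply, Finset.sum_mul]
    change _ + (0 : ℝ) * 0 = _
    rw [mul_zero, add_zero, Finset.sum_comm]
    refine Finset.sum_congr rfl fun j _ => Finset.sum_congr rfl fun i _ => ?_
    change _ * P y a i * P y b j = _
    ring
  norm := ⟨0, fun _ _ => pr_zero_left _ _⟩


/-- An isometry is an immersion with zero normal field; its Gauss formula, without a normal term, is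
the transformation law of the connection. -/
lemma MetIso.isIso (pt₂ : E₂) : IsIso (lc Ω₁ pt d₁ A₁) (lc Ω₂ pt₂ d₂ A₂) κ P where
  maps := h.maps
  smooth := h.smooth
  smP := h.smP
  metric := fun y hy => inv_eq_of_pull (h.met₁.pos y hy) (h.metric y hy)
  deriv := h.deriv
  par := fun y hy j a k => by
    have h1 := congrFun ((h.good hpt).cd_F hy j k) a
    rw [h.sff_eq, zero_smul, add_zero, h.imm_Γ hy] at h1
    simp only [Imm.cd, cv, Finset.sum_apply, Pi.smul_apply, smul_eq_mul] at h1
    change fderiv ℝ (fun z => P z a k) y (d₁ j) + ∑ b, (∑ c, chr d₂ A₂ (κ y) a c b * P y c j) * P y b k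
      = ∑ l, chr d₁ A₁ y l j k * P y a l at h1
    change fderiv ℝ (fun z => P z a k) y (d₁ j) = ∑ l, P y a l * chr d₁ A₁ y l j k -
      ∑ b, (∑ c, P y c j * chr d₂ A₂ (κ y) a c b) * P y b k
    simp only [mul_comm (P y _ _) (chr d₁ A₁ y _ _ _), mul_comm (P y _ _) (chr d₂ A₂ _ _ _ _)]
    linarith

/-- This is the Gauss equation with vanishing second fundamental form. -/
lemma MetIso.rmC_pull {y : E₁} (hy : y ∈ Ω₁) : rmC d₁ A₁ y = pull (P y) (rmC d₂ A₂ (κ y)) := by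
  ext L
  have h1 := (h.good hpt).gauss hy (L 0) (L 1) (L 2) (L 3)
  have e1 : ∀ p, curvC (h.imm pt).d (h.imm pt).geo.Γ y p (L 0) (L 1) (L 2) =
      curvC d₁ (chr d₁ A₁) y p (L 0) (L 1) (L 2) := by
    intro p
    have e2 : ∀ a b c, (fun z => (h.imm pt).geo.Γ z a b c) =ᶠ[𝓝 y] fun z => chr d₁ A₁ z a b c := by
      intro a b c
      filter_upwards [h.met₁.isOpen.mem_nhds hy] with z hz
      rw [h.imm_Γ hz]
    simp only [curvC, (e2 _ _ _).fderiv_eq, h.imm_Γ hy]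
    rfl
  simp only [h.sff_eq, e1, mul_zero, sub_zero, add_zero, h.imm_g hy] at h1
  rw [rmC]
  simp only [h.met₁.symm hy _ (L 3), h1]
  have e3 : (![some (L 0), some (L 1), some (L 2), some (L 3)] : Fin 4 → Option D) = some ∘ L := by
    ext s; fin_cases s <;> rfl
  rw [e3]
  rfl

/-- Naturality of the Ricci tensor. -/
lemma MetIso.ric_pull {y : E₁} (hy : y ∈ Ω₁) (L : Fin 2 → D) :
    ricC d₁ A₁ y L = pull (P y) (ricC d₂ A₂ (κ y)) L := by
  rw [h.met₁.ricC_eq hy, h.met₂.ricC_eq (h.maps hy), h.rmC_pull hpt hy, ← pull_rl, contr_pull,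
    inv_eq_of_pull (h.met₁.pos y hy) (h.metric y hy)]

end MetricIso

/-! ### Naturality of the second fundamental form -/

variable {D D' : Type} [Fintype D] [DecidableEq D] [Fintype D'] [DecidableEq D']
  {E₁ E₂ E₁' E₂' : Type*} [NormedAddCommGroup E₁] [NormedSpace ℝ E₁]
  [NormedAddCommGroup E₂] [NormedSpace ℝ E₂] [NormedAddCommGroup E₁'] [NormedSpace ℝ E₁']
  [NormedAddCommGroup E₂'] [NormedSpace ℝ E₂']

lemma pr_pull (M : Matrix D' D' ℝ) (Q : Matrix D' D' ℝ) (X Y : D' → ℝ) :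
    pr (Q.transpose * M * Q) X Y = pr M (Q.mulVec X) (Q.mulVec Y) := by
  simp only [pr, Matrix.mul_apply, Matrix.transpose_apply, Matrix.mulVec, dotProduct,
    Finset.sum_mul, Finset.mul_sum]
  calc _ = ∑ a, ∑ c, ∑ b, ∑ d, Q d a * M d c * Q c b * X a * Y b :=
        Finset.sum_congr rfl fun a _ => Finset.sum_comm
    _ = ∑ a, ∑ c, ∑ d, ∑ b, Q d a * M d c * Q c b * X a * Y b :=
        Finset.sum_congr rfl fun a _ => Finset.sum_congr rfl fun c _ => Finset.sum_comm
    _ = ∑ a, ∑ d, ∑ c, ∑ b, Q d a * M d c * Q c b * X a * Y b :=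
        Finset.sum_congr rfl fun a _ => Finset.sum_comm
    _ = ∑ d, ∑ a, ∑ c, ∑ b, Q d a * M d c * Q c b * X a * Y b := Finset.sum_comm
    _ = ∑ d, ∑ c, ∑ a, ∑ b, Q d a * M d c * Q c b * X a * Y b :=
        Finset.sum_congr rfl fun d _ => Finset.sum_comm
    _ = ∑ d, ∑ c, ∑ b, ∑ a, Q d a * M d c * Q c b * X a * Y b :=
        Finset.sum_congr rfl fun d _ => Finset.sum_congr rfl fun c _ => Finset.sum_comm
    _ = _ := Finset.sum_congr rfl fun d _ => Finset.sum_congr rfl fun c _ =>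
        Finset.sum_congr rfl fun b _ => Finset.sum_congr rfl fun a _ => by ring

/-- Compatibility of two immersions with a change of the source and an isometry of the targets. -/
structure ImmIso (I₁ : Imm E₁ E₁' D D') (I₂ : Imm E₂ E₂' D D') (κ : E₁ → E₂)
    (P : E₁ → Matrix D D ℝ) (Φ : E₁' → E₂') (Q : E₁' → Matrix D' D' ℝ) : Prop where
  good₁ : I₁.Good
  good₂ : I₂.Good
  unit₁ : ∀ y ∈ I₁.Ω, pr (I₁.N (I₁.u y)) (I₁.e y) (I₁.e y) = 1
  unit₂ : ∀ y ∈ I₂.Ω, pr (I₂.N (I₂.u y)) (I₂.e y) (I₂.e y) = 1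
  maps : MapsTo κ I₁.Ω I₂.Ω
  smooth : ContDiffOn ℝ ∞ κ I₁.Ω
  smP : ∀ a k, ContDiffOn ℝ ∞ (fun y => P y a k) I₁.Ω
  deriv : ∀ y ∈ I₁.Ω, ∀ j, fderiv ℝ κ y (I₁.d j) = ∑ c, P y c j • I₂.d c
  tors : ∀ y ∈ I₁.Ω, ∀ i j a, fderiv ℝ (fun z => P z a j) y (I₁.d i) =
    fderiv ℝ (fun z => P z a i) y (I₁.d j)
  target : MetIso I₁.Ω' I₁.d' I₁.N I₂.Ω' I₂.d' I₂.N Φ Q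
  comm : ∀ y ∈ I₁.Ω, I₂.u (κ y) = Φ (I₁.u y)
  frame : ∀ y ∈ I₁.Ω, ∀ j, (Q (I₁.u y)).mulVec (I₁.F y j) = ∑ k, P y k j • I₂.F (κ y) k

namespace ImmIso

variable {I₁ : Imm E₁ E₁' D D'} {I₂ : Imm E₂ E₂' D D'} {κ : E₁ → E₂}
    {P : E₁ → Matrix D D ℝ} {Φ : E₁' → E₂'} {Q : E₁' → Matrix D' D' ℝ}
    (h : ImmIso I₁ I₂ κ P Φ Q) {y : E₁}
include h

lemma pr_eq (hy : y ∈ I₁.Ω) (X Y : D' → ℝ) : pr (I₁.N (I₁.u y)) X Y =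
    pr (I₂.N (I₂.u (κ y))) ((Q (I₁.u y)).mulVec X) ((Q (I₁.u y)).mulVec Y) := by
  rw [h.target.metric _ (h.good₁.maps hy), pr_pull, h.comm y hy]

lemma g_eq (hy : y ∈ I₁.Ω) : I₁.g y = (P y).transpose * I₂.g (κ y) * P y := by
  ext i j
  have e1 : I₁.g y i j = pr (I₁.N (I₁.u y)) (I₁.F y i) (I₁.F y j) := rfl
  rw [e1, h.pr_eq hy, h.frame y hy, h.frame y hy, pr_sum_left]
  simp only [pr_smul_left, Matrix.mul_apply, Matrix.transpose_apply, Finset.sum_mul]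
  rw [Finset.sum_comm]
  refine Finset.sum_congr rfl fun k _ => ?_
  rw [h.good₂.comm (h.maps hy), pr_sum_left, Finset.mul_sum]
  refine Finset.sum_congr rfl fun l _ => ?_
  rw [pr_smul_left, h.good₂.comm (h.maps hy)]
  change P y k i * (P y l j * I₂.g (κ y) k l) = _
  ring

lemma source : MetIso I₁.Ω I₁.d I₁.g I₂.Ω I₂.d I₂.g κ P :=
  ⟨h.good₁.met, h.good₂.met, h.maps, h.smooth, h.smP, h.deriv, h.tors, fun _ hy => h.g_eq hy⟩

/-- The sign by which the unit normals differ. -/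
lemma exists_sign (hy : y ∈ I₁.Ω) : ∃ ε : ℝ, ε ^ 2 = 1 ∧
    ε = pr (I₂.N (I₂.u (κ y))) ((Q (I₁.u y)).mulVec (I₁.e y)) (I₂.e (κ y)) ∧
    (Q (I₁.u y)).mulVec (I₁.e y) = ε • I₂.e (κ y) := by
  set X := (Q (I₁.u y)).mulVec (I₁.e y) with hX
  have hP := det_ne_of_posDef (h.good₁.pos y hy) (h.g_eq hy)
  -- The image of the first normal is orthogonal to the images of the first tangent vectors; as `P`
  -- is invertible, these span the same space as the second tangent vectors.
  have h1 : ∀ l, pr (I₂.N (I₂.u (κ y))) X (I₂.F (κ y) l) = 0 := by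
    have e1 : (P y).transpose.mulVec (fun l => pr (I₂.N (I₂.u (κ y))) X (I₂.F (κ y) l)) = 0 := by
      ext j
      have e2 := h.good₁.orth y hy j
      rw [h.pr_eq hy, h.frame y hy, pr_sum_left] at e2
      simp only [pr_smul_left] at e2
      rw [Pi.zero_apply, ← e2]
      refine Finset.sum_congr rfl fun k _ => ?_
      rw [h.good₂.comm (h.maps hy)]
      rfl
    have := Matrix.eq_zero_of_mulVec_eq_zero (by rwa [Matrix.det_transpose]) e1
    exact fun l => congrFun this l
  have h2 := h.good₂.decomp (h.maps hy) X
  simp only [h1, mul_zero, Finset.sum_const_zero, zero_smul, zero_add] at h2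
  refine ⟨_, ?_, rfl, h2⟩
  have h3 := h.unit₁ y hy
  rw [h.pr_eq hy, ← hX] at h3
  set ε := pr (I₂.N (I₂.u (κ y))) X (I₂.e (κ y))
  rw [h2, pr_smul_left, pr_smul_right, h.unit₂ _ (h.maps hy)] at h3
  nlinarith

/-- The differential `Q` of an isometry of the targets is parallel, so it commutes with covariant
differentiation along the map. -/
lemma cd_eq (hy : y ∈ I₁.Ω) (i : D) {X : E₁ → D' → ℝ}
    (hX : ∀ a, ContDiffOn ℝ ∞ (fun z => X z a) I₁.Ω) :
    (Q (I₁.u y)).mulVec (I₁.cd i X y) = cv (I₁.d i) (chr I₂.d' I₂.N (I₂.u (κ y)))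
      ((Q (I₁.u y)).mulVec (I₁.F y i)) (fun z => (Q (I₁.u z)).mulVec (X z)) y := by
  have hu := h.good₁.maps hy
  have hpar := (h.target.isIso hu (Φ (I₁.u y))).par _ hu
  have hQs : ∀ a b, ContDiffOn ℝ ∞ (fun z => Q (I₁.u z) a b) I₁.Ω := fun a b =>
    (h.target.smP a b).comp h.good₁.smu h.good₁.maps
  have hQd : ∀ a b, DifferentiableAt ℝ (fun z => Q z a b) (I₁.u y) := fun a b =>
    ((h.target.smP a b).contDiffAt (h.target.met₁.isOpen.mem_nhds hu)).differentiableAt (by simp)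
  have e1 : ∀ a b, fderiv ℝ (fun z => Q (I₁.u z) a b) y (I₁.d i) =
      ∑ c, I₁.F y i c * (∑ l, Q (I₁.u y) a l * chr I₁.d' I₁.N (I₁.u y) l c b -
        ∑ b', (∑ e, Q (I₁.u y) e c * chr I₂.d' I₂.N (I₂.u (κ y)) a e b') * Q (I₁.u y) b' b) := by
    intro a b
    rw [fderiv_comp_dir (hQd a b) (h.good₁.du hy) (h.good₁.deriv' hy i), map_zero, zero_add]
    refine Finset.sum_congr rfl fun c _ => ?_
    rw [h.comm y hy]
    exact congrArg _ (hpar c a b)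
  ext a
  have e2 : HasFDerivAt (fun z => (Q (I₁.u z)).mulVec (X z) a)
      (∑ b, (Q (I₁.u y) a b • fderiv ℝ (fun z => X z b) y +
        X y b • fderiv ℝ (fun z => Q (I₁.u z) a b) y)) y :=
    HasFDerivAt.fun_sum fun b _ => (h.good₁.dif (hQs a b) hy).hasFDerivAt.mul
      (h.good₁.dif (hX b) hy).hasFDerivAt
  rw [cv, e2.fderiv]
  simp only [sum_apply, add_apply, smul_apply, smul_eq_mul, e1, Matrix.mulVec, dotProduct, Imm.cd,
    cv, mul_add, mul_sub, Finset.sum_add_distrib, Finset.sum_sub_distrib, Finset.mul_sum,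
    Finset.sum_mul]
  have s1 : ∑ b, ∑ c, ∑ l, X y b * (I₁.F y i c * (Q (I₁.u y) a l * chr I₁.d' I₁.N (I₁.u y) l c b)) =
      ∑ l, ∑ b, ∑ c, Q (I₁.u y) a l * (chr I₁.d' I₁.N (I₁.u y) l c b * I₁.F y i c * X y b) := by
    calc _ = ∑ b, ∑ l, ∑ c, X y b * (I₁.F y i c * (Q (I₁.u y) a l *
            chr I₁.d' I₁.N (I₁.u y) l c b)) := Finset.sum_congr rfl fun b _ => Finset.sum_comm
      _ = ∑ l, ∑ b, ∑ c, X y b * (I₁.F y i c * (Q (I₁.u y) a l *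
            chr I₁.d' I₁.N (I₁.u y) l c b)) := Finset.sum_comm
      _ = _ := Finset.sum_congr rfl fun l _ => Finset.sum_congr rfl fun b _ =>
          Finset.sum_congr rfl fun c _ => by ring
  have s2 : ∑ b, ∑ c, ∑ b', ∑ e, X y b * (I₁.F y i c * (Q (I₁.u y) e c *
        chr I₂.d' I₂.N (I₂.u (κ y)) a e b' * Q (I₁.u y) b' b)) =
      ∑ b', ∑ b, ∑ e, ∑ c, chr I₂.d' I₂.N (I₂.u (κ y)) a e b' *
        (Q (I₁.u y) e c * I₁.F y i c) * (Q (I₁.u y) b' b * X y b) := by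
    calc _ = ∑ b, ∑ b', ∑ c, ∑ e, X y b * (I₁.F y i c * (Q (I₁.u y) e c *
            chr I₂.d' I₂.N (I₂.u (κ y)) a e b' * Q (I₁.u y) b' b)) :=
          Finset.sum_congr rfl fun b _ => Finset.sum_comm
      _ = ∑ b', ∑ b, ∑ c, ∑ e, X y b * (I₁.F y i c * (Q (I₁.u y) e c *
            chr I₂.d' I₂.N (I₂.u (κ y)) a e b' * Q (I₁.u y) b' b)) := Finset.sum_comm
      _ = ∑ b', ∑ b, ∑ e, ∑ c, X y b * (I₁.F y i c * (Q (I₁.u y) e c *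
            chr I₂.d' I₂.N (I₂.u (κ y)) a e b' * Q (I₁.u y) b' b)) :=
          Finset.sum_congr rfl fun b' _ => Finset.sum_congr rfl fun b _ => Finset.sum_comm
      _ = _ := Finset.sum_congr rfl fun b' _ => Finset.sum_congr rfl fun b _ =>
          Finset.sum_congr rfl fun e _ => Finset.sum_congr rfl fun c _ => by ring
  rw [s1, s2]
  ring

/-- The term in which `P` is differentiated is tangential and disappears on pairing with the normal,
so the second fundamental form transforms as a tensor, up to the sign `ε`. -/
lemma sff_eq (hy : y ∈ I₁.Ω) {ε : ℝ} (hε : (Q (I₁.u y)).mulVec (I₁.e y) = ε • I₂.e (κ y)) (i j : D) :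
    I₁.sff y i j = ε * ∑ l, ∑ k, P y l i * P y k j * I₂.sff (κ y) l k := by
  have hκ : DifferentiableAt ℝ κ y :=
    (h.smooth.contDiffAt (h.good₁.isOpen.mem_nhds hy)).differentiableAt (by simp)
  have hFd : ∀ k a, DifferentiableAt ℝ (fun z => I₂.F z k a) (κ y) := fun k a =>
    h.good₂.dif (h.good₂.smF k a) (h.maps hy)
  have e1 : (fun z => (Q (I₁.u z)).mulVec (I₁.F z j)) =ᶠ[𝓝 y]
      fun z => ∑ k, P z k j • I₂.F (κ z) k := by
    filter_upwards [h.good₁.isOpen.mem_nhds hy] with z hz using h.frame z hz j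
  have e2 : ∀ k, cv (I₁.d i) (chr I₂.d' I₂.N (I₂.u (κ y))) ((Q (I₁.u y)).mulVec (I₁.F y i))
      (fun z => I₂.F (κ z) k) y = ∑ l, P y l i • I₂.cd l (fun z => I₂.F z k) (κ y) := by
    intro k
    ext a
    have hv : fderiv ℝ κ y (I₁.d i) = 0 + ∑ c, P y c i • I₂.d c := by
      rw [zero_add]; exact h.deriv y hy i
    simp only [cv, Imm.cd, Finset.sum_apply, Pi.smul_apply, smul_eq_mul]
    rw [fderiv_comp_dir (hFd k a) hκ hv, map_zero, zero_add, h.frame y hy]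
    simp only [mul_add, Finset.sum_add_distrib, Finset.sum_apply, Pi.smul_apply, smul_eq_mul,
      Finset.mul_sum, Finset.sum_mul]
    congr 1
    calc _ = ∑ b, ∑ l, ∑ c, chr I₂.d' I₂.N (I₂.u (κ y)) a c b * (P y l i * I₂.F (κ y) l c) *
            I₂.F (κ y) k b := Finset.sum_congr rfl fun b _ => Finset.sum_comm
      _ = ∑ l, ∑ b, ∑ c, chr I₂.d' I₂.N (I₂.u (κ y)) a c b * (P y l i * I₂.F (κ y) l c) *
            I₂.F (κ y) k b := Finset.sum_comm
      _ = _ := Finset.sum_congr rfl fun l _ => Finset.sum_congr rfl fun b _ =>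
          Finset.sum_congr rfl fun c _ => by ring
  have e3 : (Q (I₁.u y)).mulVec (I₁.cd i (fun z => I₁.F z j) y) =
      ∑ k, (fderiv ℝ (fun z => P z k j) y (I₁.d i) • I₂.F (κ y) k +
        P y k j • ∑ l, P y l i • I₂.cd l (fun z => I₂.F z k) (κ y)) := by
    rw [h.cd_eq hy i (h.good₁.smF j), cv_congr e1, cv_sum_smul (f := fun k z => P z k j)
      (X := fun k z => I₂.F (κ z) k) (fun k => h.good₁.dif (h.smP k j) hy)
      (fun k a => (hFd k a).comp y hκ)]
    simp only [e2]
  rw [Imm.sff, h.pr_eq hy, hε, e3, pr_smul_right, pr_sum_left]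
  simp only [pr_add_left, pr_smul_left, pr_sum_left, h.good₂.orth _ (h.maps hy)]
  congr 1
  rw [Finset.sum_comm]
  refine Finset.sum_congr rfl fun k _ => ?_
  rw [mul_zero, zero_add, Finset.mul_sum]
  refine Finset.sum_congr rfl fun l _ => ?_
  change _ * (_ * I₂.sff (κ y) l k) = _
  ring

/-- Naturality of the mean curvature vector. -/
lemma mean_eq (hy : y ∈ I₁.Ω) : (Q (I₁.u y)).mulVec (I₁.H y • I₁.e y) =
    I₂.H (κ y) • I₂.e (κ y) := by
  obtain ⟨ε, hε, -, he⟩ := h.exists_sign hy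
  have e1 : I₁.H y = ε * I₂.H (κ y) := by
    have e2 := inv_eq_of_pull (h.good₁.pos y hy) (h.g_eq hy)
    simp only [Imm.H, ← e2, h.sff_eq hy he, Matrix.mul_apply, Matrix.transpose_apply,
      Finset.sum_mul, Finset.mul_sum]
    calc _ = ∑ i, ∑ l, ∑ j, ∑ k, (I₁.g y)⁻¹ i j * (ε * (P y l i * P y k j * I₂.sff (κ y) l k)) :=
          Finset.sum_congr rfl fun i _ => Finset.sum_comm
      _ = ∑ l, ∑ i, ∑ j, ∑ k, (I₁.g y)⁻¹ i j * (ε * (P y l i * P y k j * I₂.sff (κ y) l k)) :=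
          Finset.sum_comm
      _ = ∑ l, ∑ i, ∑ k, ∑ j, (I₁.g y)⁻¹ i j * (ε * (P y l i * P y k j * I₂.sff (κ y) l k)) :=
          Finset.sum_congr rfl fun l _ => Finset.sum_congr rfl fun i _ => Finset.sum_comm
      _ = ∑ l, ∑ k, ∑ i, ∑ j, (I₁.g y)⁻¹ i j * (ε * (P y l i * P y k j * I₂.sff (κ y) l k)) :=
          Finset.sum_congr rfl fun l _ => Finset.sum_comm
      _ = ∑ l, ∑ k, ∑ j, ∑ i, (I₁.g y)⁻¹ i j * (ε * (P y l i * P y k j * I₂.sff (κ y) l k)) :=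
          Finset.sum_congr rfl fun l _ => Finset.sum_congr rfl fun k _ => Finset.sum_comm
      _ = _ := Finset.sum_congr rfl fun l _ => Finset.sum_congr rfl fun k _ =>
          Finset.sum_congr rfl fun j _ => Finset.sum_congr rfl fun i _ => by ring
  rw [Matrix.mulVec_smul, he, e1, smul_smul, mul_right_comm, ← pow_two, hε, one_mul]

/-- Naturality of the norms of the covariant derivatives of the second fundamental form. -/
theorem sqIter_A (hy : y ∈ I₁.Ω) (k : ℕ) :
    I₁.geo.sqIter k I₁.A y = I₂.geo.sqIter k I₂.A (κ y) := by
  -- Unit normals correspond only up to a sign. As a function it is smooth with square one, hence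
  -- locally constant, and the squared norms do not see it.
  set σ : E₁ → ℝ := fun z => pr (I₂.N (I₂.u (κ z))) ((Q (I₁.u z)).mulVec (I₁.e z)) (I₂.e (κ z))
  have hσ : ContDiffOn ℝ ∞ σ I₁.Ω := by
    refine ContDiffOn.sum fun a _ => ContDiffOn.sum fun b _ => ((?_ : ContDiffOn ℝ ∞ _ _).mul
      (ContDiffOn.sum fun c _ => (?_ : ContDiffOn ℝ ∞ _ _).mul (h.good₁.sme c))).mul ?_
    · exact (h.good₂.smN a b).comp h.smooth h.maps
    · exact (h.target.smP a c).comp h.good₁.smu h.good₁.maps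
    · exact (h.good₂.sme b).comp h.smooth h.maps
  have hσ1 : ∀ z ∈ I₁.Ω, σ z ^ 2 = 1 := fun z hz => by
    obtain ⟨ε, hε, h2, -⟩ := h.exists_sign hz
    change ε = σ z at h2
    rw [← h2, hε]
  have hσ2 : ∀ z ∈ I₁.Ω, I₁.A z = σ z • pull (P z) (I₂.A (κ z)) := fun z hz => by
    obtain ⟨ε, -, h2, he⟩ := h.exists_sign hz
    ext L
    have hL : L = ![L 0, L 1] := by ext s; fin_cases s <;> rfl
    rw [Imm.A, h.sff_eq hz he, Pi.smul_apply, smul_eq_mul]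
    change _ = σ z * _
    rw [h2]
    congr 1
    rw [hL]
    simp only [pull_cons, pull_nil, Finset.mul_sum, Imm.A, Matrix.cons_val]
    exact Finset.sum_congr rfl fun l _ => Finset.sum_congr rfl fun k _ => by ring
  set U := {z ∈ I₁.Ω | σ z = σ y} with hU
  -- Two numbers of square one at distance less than one are equal.
  have hUo : IsOpen U := by
    have e1 : U = I₁.Ω ∩ σ ⁻¹' (Metric.ball (σ y) 1) := by
      ext z
      refine ⟨fun hz => ⟨hz.1, by rw [mem_preimage, hz.2]; exact Metric.mem_ball_self one_pos⟩,
        fun hz => ⟨hz.1, ?_⟩⟩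
      have h1 : (σ z - σ y) * (σ z + σ y) = 0 := by nlinarith [hσ1 z hz.1, hσ1 y hy]
      have h2 := abs_lt.1 (Real.dist_eq _ _ ▸ hz.2 : |σ z - σ y| < 1)
      rcases mul_eq_zero.1 h1 with h3 | h3
      · linarith
      · nlinarith [hσ1 y hy]
    rw [e1]
    exact hσ.continuousOn.isOpen_inter_preimage h.good₁.isOpen Metric.isOpen_ball
  have hyU : y ∈ U := ⟨hy, rfl⟩
  have e1 : EqOn I₁.A (fun z => σ y • pull (P z) (I₂.A (κ z))) U := fun z hz => by
    rw [hσ2 z hz.1, hz.2]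
  have sm2 : Sm I₁.Ω fun z => pull (P z) (I₂.A (κ z)) :=
    Sm.pull h.smP fun L => (h.good₂.sm_A L).comp h.smooth h.maps
  rw [sqIter_congr hUo e1 hyU, sqIter_smul h.good₁.good sm2 _ hy]
  simp only [hσ1 y hy, one_mul]
  exact (h.source.isIso h.good₁.mem I₂.pt).sqIter_pull h.good₁.good h.good₂.good h.good₂.sm_A hy

end ImmIso

/-! ### The unit normal of a hyperplane -/

section Frame

variable {m : ℕ}

/-- The determinant is linear in its first row. -/
lemma sum_conormal (F : Fin m → Fin (m + 1) → ℝ) (X : Fin (m + 1) → ℝ) :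
    ∑ b, Matrix.det (Matrix.of (Fin.cons (Pi.single b 1) F : Fin (m + 1) → Fin (m + 1) → ℝ)) * X b =
      Matrix.det (Matrix.of (Fin.cons X F : Fin (m + 1) → Fin (m + 1) → ℝ)) := by
  have key : ∀ Y : Fin (m + 1) → ℝ, Matrix.det (Matrix.of (Fin.cons Y F : Fin (m + 1) → Fin (m + 1) → ℝ))
      = Matrix.detRowAlternating.toMultilinearMap.toLinearMap (Fin.cons 0 F) 0 Y := by
    intro Y
    rw [MultilinearMap.toLinearMap_apply]
    have : Function.update (Fin.cons 0 F : Fin (m + 1) → Fin (m + 1) → ℝ) 0 Y = Fin.cons Y F := by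
      rw [Fin.update_cons_zero]
    rw [this]
    rfl
  simp only [key]
  have hX : X = ∑ b, X b • (Pi.single b 1 : Fin (m + 1) → ℝ) := by
    ext a; simp [Pi.single_apply]
  conv_rhs => rw [hX]
  rw [map_sum]
  exact Finset.sum_congr rfl fun b _ => by rw [map_smul, smul_eq_mul, mul_comm]

/-- Some vector lies outside the span of `F` and completes it to a basis, whose determinant is
nonzero but is a combination of the components of the conormal. -/
lemma conormal_ne {F : Fin m → Fin (m + 1) → ℝ} (hF : LinearIndependent ℝ F) :
    ∃ b, Matrix.det (Matrix.of (Fin.cons (Pi.single b 1) F : Fin (m + 1) → Fin (m + 1) → ℝ)) ≠ 0 := by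
  by_contra! h0
  have h1 : Submodule.span ℝ (Set.range F) ≠ ⊤ := by
    intro h
    have h2 := finrank_range_le_card (R := ℝ) F
    rw [Set.finrank, h, finrank_top, Module.finrank_fin_fun, Fintype.card_fin] at h2
    omega
  obtain ⟨X, -, hX⟩ := SetLike.exists_of_lt (lt_top_iff_ne_top.2 h1)
  have h3 : LinearIndependent ℝ (Fin.cons X F : Fin (m + 1) → Fin (m + 1) → ℝ) :=
    linearIndependent_finCons.2 ⟨hF, hX⟩
  have h4 := (Matrix.linearIndependent_rows_iff_isUnit (A := Matrix.of (Fin.cons X F))).1 h3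
  rw [Matrix.isUnit_iff_isUnit_det, ← sum_conormal] at h4
  simp [h0] at h4

/-- The normal vector of a hyperplane. -/
def nvec (N : Matrix (Fin (m + 1)) (Fin (m + 1)) ℝ) (F : Fin m → Fin (m + 1) → ℝ)
    (a : Fin (m + 1)) : ℝ :=
  (∑ b, N⁻¹ a b * Matrix.det (Matrix.of
    (Fin.cons (Pi.single b 1) F : Fin (m + 1) → Fin (m + 1) → ℝ))) /
  Real.sqrt (∑ c, ∑ d, N⁻¹ c d *
    Matrix.det (Matrix.of (Fin.cons (Pi.single c 1) F : Fin (m + 1) → Fin (m + 1) → ℝ)) *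
    Matrix.det (Matrix.of (Fin.cons (Pi.single d 1) F : Fin (m + 1) → Fin (m + 1) → ℝ)))

lemma pr_pos {D : Type} [Fintype D] [DecidableEq D] {N : Matrix D D ℝ} (hN : N.PosDef) {X : D → ℝ}
    (hX : X ≠ 0) : 0 < pr N X X := by
  have := hN.dotProduct_mulVec_pos hX
  simp only [star_trivial, dotProduct, Matrix.mulVec, Finset.mul_sum] at this
  refine this.trans_eq (Finset.sum_congr rfl fun a _ => Finset.sum_congr rfl fun b _ => by ring)

lemma lincomb_ne {F : Fin m → Fin (m + 1) → ℝ} (hF : LinearIndependent ℝ F) {c : Fin m → ℝ} (hc : c ≠ 0) : ∑ i, c i • F i ≠ 0 := by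
  intro h
  exact hc (funext fun i => Fintype.linearIndependent_iff.1 hF c h i)

variable {N : Matrix (Fin (m + 1)) (Fin (m + 1)) ℝ} (hN : N.PosDef) {F : Fin m → Fin (m + 1) → ℝ}
  (hF : LinearIndependent ℝ F)
include hN

lemma pr_inv_mulVec (X c : Fin (m + 1) → ℝ) : pr N X (N⁻¹.mulVec c) = ∑ b, c b * X b := by
  have h1 : N.mulVec (N⁻¹.mulVec c) = c := by
    rw [Matrix.mulVec_mulVec, Matrix.mul_nonsing_inv _ hN.det_pos.ne'.isUnit, Matrix.one_mulVec]
  calc pr N X (N⁻¹.mulVec c) = ∑ a, X a * N.mulVec (N⁻¹.mulVec c) a := by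
        generalize N⁻¹.mulVec c = Y
        simp only [pr, Matrix.mulVec, dotProduct, Finset.mul_sum]
        exact Finset.sum_congr rfl fun a _ => Finset.sum_congr rfl fun b _ => by ring
    _ = _ := by rw [h1]; exact Finset.sum_congr rfl fun b _ => mul_comm _ _

include hF

lemma conormal_sq_pos : 0 < ∑ c, ∑ d, N⁻¹ c d *
    Matrix.det (Matrix.of (Fin.cons (Pi.single c 1) F : Fin (m + 1) → Fin (m + 1) → ℝ)) *
    Matrix.det (Matrix.of (Fin.cons (Pi.single d 1) F : Fin (m + 1) → Fin (m + 1) → ℝ)) := by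
  obtain ⟨b, hb⟩ := conormal_ne hF
  exact pr_pos hN.inv (X := fun b => Matrix.det (Matrix.of
    (Fin.cons (Pi.single b 1) F : Fin (m + 1) → Fin (m + 1) → ℝ))) fun h => hb (congrFun h b)

lemma nvec_orth (i : Fin m) : pr N (F i) (nvec N F) = 0 := by
  set q := Real.sqrt (∑ c, ∑ d, N⁻¹ c d *
    Matrix.det (Matrix.of (Fin.cons (Pi.single c 1) F : Fin (m + 1) → Fin (m + 1) → ℝ)) *
    Matrix.det (Matrix.of (Fin.cons (Pi.single d 1) F : Fin (m + 1) → Fin (m + 1) → ℝ))) with hq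
  have h1 : nvec N F = q⁻¹ • N⁻¹.mulVec (fun b => Matrix.det (Matrix.of
    (Fin.cons (Pi.single b 1) F : Fin (m + 1) → Fin (m + 1) → ℝ))) := by
    ext a
    rw [Pi.smul_apply, smul_eq_mul, mul_comm, ← div_eq_mul_inv]
    rfl
  rw [h1, pr_smul_right, pr_inv_mulVec hN, sum_conormal]
  rw [Matrix.det_zero_of_row_eq (i := 0) (j := i.succ) (Fin.succ_ne_zero i).symm, mul_zero]
  ext a
  simp

lemma nvec_unit : pr N (nvec N F) (nvec N F) = 1 := by
  have hpos := conormal_sq_pos hN hF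
  set cn : Fin (m + 1) → ℝ := fun b => Matrix.det (Matrix.of
    (Fin.cons (Pi.single b 1) F : Fin (m + 1) → Fin (m + 1) → ℝ)) with hcn
  have hpos' : 0 < pr N⁻¹ cn cn := hpos
  have h1 : nvec N F = (Real.sqrt (pr N⁻¹ cn cn))⁻¹ • N⁻¹.mulVec cn := by
    ext a
    rw [Pi.smul_apply, smul_eq_mul, mul_comm, ← div_eq_mul_inv]
    rfl
  have h2 : ∑ b, cn b * N⁻¹.mulVec cn b = pr N⁻¹ cn cn := by
    simp only [pr, Matrix.mulVec, dotProduct, Finset.mul_sum]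
    exact Finset.sum_congr rfl fun a _ => Finset.sum_congr rfl fun b _ => by ring
  rw [h1, pr_smul_left, pr_smul_right, pr_inv_mulVec hN, h2, ← mul_assoc, ← mul_inv,
    Real.mul_self_sqrt hpos'.le, inv_mul_cancel₀ hpos'.ne']

lemma gram_posDef : (Matrix.of fun i j => pr N (F i) (F j)).PosDef := by
  have hs : ∀ i j, N i j = N j i := fun i j => congrFun (congrFun hN.1 j) i
  refine Matrix.PosDef.of_dotProduct_mulVec_pos ?_ fun c hc => ?_
  · ext i j
    simp only [Matrix.conjTranspose_apply, Matrix.of_apply, star_trivial]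
    exact pr_comm hs _ _
  · have := pr_pos hN (lincomb_ne hF hc)
    rw [pr_sum_left] at this
    refine this.trans_eq ?_
    simp only [star_trivial, dotProduct, Matrix.mulVec, Matrix.of_apply, Finset.mul_sum,
      pr_smul_left]
    refine Finset.sum_congr rfl fun i _ => ?_
    rw [pr_comm hs, pr_sum_left, Finset.mul_sum]
    refine Finset.sum_congr rfl fun j _ => ?_
    rw [pr_smul_left, pr_comm hs (F j)]
    ring

/-- The matrix `P` of the frame satisfies `Pᵀ N P = oB g`; inverting this relation gives `N⁻¹ = P
(oB g⁻¹) Pᵀ`. -/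
lemma frame_complete (a b : Fin (m + 1)) :
    ∑ i, ∑ j, (Matrix.of fun i j => pr N (F i) (F j))⁻¹ i j * F i a * F j b + nvec N F a * nvec N F b =
      N⁻¹ a b := by
  set g : Matrix (Fin m) (Fin m) ℝ := Matrix.of fun i j => pr N (F i) (F j) with hg
  have hs : ∀ i j, N i j = N j i := fun i j => congrFun (congrFun hN.1 j) i
  set P : Matrix (Fin (m + 1)) (Option (Fin m)) ℝ :=
    Matrix.of fun a o => o.elim (nvec N F a) fun i => F i a with hP
  have h1 : P.transpose * N * P = oB g := by
    ext o o'
    have e1 : (P.transpose * N * P) o o' = pr N (fun a => P a o) (fun a => P a o') := by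
      simp only [pr, Matrix.mul_apply, Matrix.transpose_apply, Finset.sum_mul]
      rw [Finset.sum_comm]
      exact Finset.sum_congr rfl fun a _ => Finset.sum_congr rfl fun b _ => by ring
    rw [e1]
    rcases o with _ | i <;> rcases o' with _ | j
    · exact nvec_unit hN hF
    · exact (pr_comm hs _ _).trans (nvec_orth hN hF j)
    · exact nvec_orth hN hF i
    · rfl
  have h2 : (oB g⁻¹ * P.transpose * N) * P = 1 := by
    rw [Matrix.mul_assoc, Matrix.mul_assoc, ← Matrix.mul_assoc P.transpose, h1, oB_mul,
      Matrix.nonsing_inv_mul _ (gram_posDef hN hF).det_pos.ne'.isUnit, oB_one]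
  -- `P` is square, since `Option (Fin m)` and `Fin (m + 1)` have the same cardinality, so a left
  -- inverse is a right inverse.
  have h3 : P * (oB g⁻¹ * P.transpose * N) = 1 :=
    (Matrix.mul_eq_one_comm_of_card_eq _ _ _ (by simp)).1 h2
  have h4 : P * oB g⁻¹ * P.transpose = N⁻¹ := by
    rw [← Matrix.inv_eq_left_inv (B := P * oB g⁻¹ * P.transpose)]
    rw [← h3]; simp only [Matrix.mul_assoc]
  rw [← h4]
  simp only [Matrix.mul_apply, Matrix.transpose_apply, Fintype.sum_option, oB_none_none,
    oB_some_none, oB_none_some, oB_some_some, mul_zero, Finset.sum_const_zero, add_zero, zero_add,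
    mul_one, Finset.sum_mul]
  rw [add_comm]
  congr 1
  rw [Finset.sum_comm]
  refine Finset.sum_congr rfl fun i _ => Finset.sum_congr rfl fun j _ => ?_
  change _ = F j a * g⁻¹ j i * F i b
  ring

end Frame

/-! ### Spatial derivatives up to the initial time -/

section Slices

variable {E F : Type*} [NormedAddCommGroup E] [NormedSpace ℝ E] [NormedAddCommGroup F]
  [NormedSpace ℝ F]

/-- A domain in space-time on which spatial derivatives make sense up to the boundary. -/
structure Sliced (K : Set (ℝ × E)) : Prop where
  uniq : UniqueDiffOn ℝ K
  nhds : ∀ p ∈ K, ∀ᶠ z in 𝓝 p.2, (p.1, z) ∈ K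

lemma Sliced.of_isOpen {K : Set (ℝ × E)} (hK : IsOpen K) : Sliced K where
  uniq := hK.uniqueDiffOn
  nhds := fun p hp => (Continuous.prodMk_right p.1).continuousAt.eventually (hK.mem_nhds hp)

/-- Spatial derivatives at a fixed time are derivatives within `K`. These are smooth functions on
`K` even where `K` is not open in the time direction. -/
lemma Sliced.fderiv_eq {K : Set (ℝ × E)} (hK : Sliced K) {f : ℝ × E → F} {p : ℝ × E} (hp : p ∈ K)
    (hf : DifferentiableWithinAt ℝ f K p) (v : E) :
    fderiv ℝ (fun z => f (p.1, z)) p.2 v = fderivWithin ℝ f K p (0, v) := by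
  have h1 : HasFDerivWithinAt (fun z : E => (p.1, z)) (ContinuousLinearMap.inr ℝ ℝ E)
      {z | (p.1, z) ∈ K} p.2 := (hasFDerivAt_prodMk_right p.1 p.2).hasFDerivWithinAt
  have h2 := hf.hasFDerivWithinAt.comp p.2 h1 fun z hz => hz
  have h3 := (h2.hasFDerivAt (hK.nhds p hp)).fderiv
  change (fderiv ℝ (f ∘ fun z => (p.1, z)) p.2) v = _
  rw [h3]
  rfl

lemma Sliced.contDiffOn {K : Set (ℝ × E)} (hK : Sliced K) {f : ℝ × E → F} (hf : ContDiffOn ℝ ∞ f K)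
    (v : E) : ContDiffOn ℝ ∞ (fun p => fderiv ℝ (fun z => f (p.1, z)) p.2 v) K := by
  have h1 : ContDiffOn ℝ ∞ (fun p => fderivWithin ℝ f K p (0, v)) K :=
    (hf.fderivWithin hK.uniq (by simp)).clm_apply contDiffOn_const
  exact h1.congr fun p hp => hK.fderiv_eq hp ((hf.differentiableOn (by simp)) p hp) v

lemma fderiv_slice {f : ℝ × E → F} {p : ℝ × E} (hf : DifferentiableAt ℝ f p) (v : E) :
    fderiv ℝ f p (0, v) = fderiv ℝ (fun z => f (p.1, z)) p.2 v := by
  have := (Sliced.of_isOpen (isOpen_univ (X := ℝ × E))).fderiv_eq (mem_univ p)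
    hf.differentiableWithinAt v
  rw [this, fderivWithin_univ]

end Slices

/-! ### Joint smoothness in space and time of the coordinate expressions -/

section Frozen

variable {n m r : ℕ}

lemma christoffel_eq (G : EuclideanSpace ℝ (Fin n) → Matrix (Fin n) (Fin n) ℝ)
    (y : EuclideanSpace ℝ (Fin n)) :
    christoffel G y = chr (fun i => EuclideanSpace.single i (1 : ℝ)) G y := rfl

variable {K : Set (ℝ × EuclideanSpace ℝ (Fin n))} (hK : Sliced K)
  {G : ℝ → EuclideanSpace ℝ (Fin n) → Matrix (Fin n) (Fin n) ℝ}
  (hG : ∀ i j, ContDiffOn ℝ ∞ (fun p : ℝ × EuclideanSpace ℝ (Fin n) => G p.1 p.2 i j) K)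
  (hdet : ∀ p ∈ K, (G p.1 p.2).det ≠ 0)
include hK

lemma Sliced.sm_pd {F : Type*} [NormedAddCommGroup F] [NormedSpace ℝ F]
    {u : ℝ → EuclideanSpace ℝ (Fin n) → F}
    (hu : ContDiffOn ℝ ∞ (fun p : ℝ × EuclideanSpace ℝ (Fin n) => u p.1 p.2) K) (i : Fin n) :
    ContDiffOn ℝ ∞ (fun p : ℝ × EuclideanSpace ℝ (Fin n) => pd i (u p.1) p.2) K :=
  hK.contDiffOn hu _

include hG hdet

lemma Sliced.sm_christoffel (k i j : Fin n) : ContDiffOn ℝ ∞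
    (fun p : ℝ × EuclideanSpace ℝ (Fin n) => christoffel (G p.1) p.2 k i j) K := by
  refine contDiffOn_const.mul (ContDiffOn.sum fun l _ => ?_)
  refine (contDiffOn_inv (A := fun p : ℝ × EuclideanSpace ℝ (Fin n) => G p.1 p.2) hG hdet k l).mul
    (((hK.sm_pd (u := fun t z => G t z j l) (hG _ _) _).add
      (hK.sm_pd (u := fun t z => G t z i l) (hG _ _) _)).sub
      (hK.sm_pd (u := fun t z => G t z i j) (hG _ _) _))

lemma Sliced.sm_covDeriv {T : ℝ → EuclideanSpace ℝ (Fin n) → (Fin r → Fin n) → ℝ}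
    (hT : ∀ I, ContDiffOn ℝ ∞ (fun p : ℝ × EuclideanSpace ℝ (Fin n) => T p.1 p.2 I) K)
    (I : Fin (r + 1) → Fin n) : ContDiffOn ℝ ∞
    (fun p : ℝ × EuclideanSpace ℝ (Fin n) => covDeriv (G p.1) (T p.1) p.2 I) K :=
  (hK.sm_pd (u := fun t z => T t z (Fin.tail I)) (hT _) _).sub <|
    ContDiffOn.sum fun _ _ => ContDiffOn.sum fun _ _ =>
      (hK.sm_christoffel hG hdet _ _ _).mul (hT _)

lemma Sliced.sm_iterCovDeriv {T : ℝ → EuclideanSpace ℝ (Fin n) → (Fin r → Fin n) → ℝ}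
    (hT : ∀ I, ContDiffOn ℝ ∞ (fun p : ℝ × EuclideanSpace ℝ (Fin n) => T p.1 p.2 I) K) (k : ℕ)
    (I : Fin (r + k) → Fin n) : ContDiffOn ℝ ∞
    (fun p : ℝ × EuclideanSpace ℝ (Fin n) => iterCovDeriv (G p.1) (T p.1) k p.2 I) K := by
  induction k with
  | zero => exact hT I
  | succ k ih =>
    exact hK.sm_covDeriv (r := r + k) (T := fun t => iterCovDeriv (G t) (T t) k) hG hdet ih I

end Frozen

lemma sm_nvec {E : Type*} [NormedAddCommGroup E] [NormedSpace ℝ E] {m : ℕ} {K : Set E}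
    {A : E → Matrix (Fin (m + 1)) (Fin (m + 1)) ℝ} {F : E → Fin m → Fin (m + 1) → ℝ}
    (hA : ∀ i j, ContDiffOn ℝ ∞ (fun p => A p i j) K) (hpos : ∀ p ∈ K, (A p).PosDef)
    (hF : ∀ i a, ContDiffOn ℝ ∞ (fun p => F p i a) K) (himm : ∀ p ∈ K, LinearIndependent ℝ (F p))
    (a : Fin (m + 1)) : ContDiffOn ℝ ∞ (fun p => nvec (A p) (F p) a) K := by
  have hinv : ∀ c d, ContDiffOn ℝ ∞ (fun p => (A p)⁻¹ c d) K := fun c d =>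
    contDiffOn_inv hA (fun p hp => (hpos p hp).det_pos.ne') c d
  have hcn : ∀ b, ContDiffOn ℝ ∞ (fun p => Matrix.det (Matrix.of
      (Fin.cons (Pi.single b 1) (F p) : Fin (m + 1) → Fin (m + 1) → ℝ))) K := fun b => by
    refine contDiffOn_det fun i j => ?_
    refine Fin.cases ?_ (fun i => ?_) i
    · exact contDiffOn_const
    · exact hF i j
  refine (ContDiffOn.sum fun b _ => (hinv a b).mul (hcn b)).div
    (ContDiffOn.sqrt (ContDiffOn.sum fun c _ => ContDiffOn.sum fun d _ =>
      ((hinv c d).mul (hcn c)).mul (hcn d)) fun p hp => ?_) fun p hp => ?_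
  · exact (conormal_sq_pos (hpos p hp) (himm p hp)).ne'
  · exact (Real.sqrt_pos.2 (conormal_sq_pos (hpos p hp) (himm p hp))).ne'

section FrozenHypersurface

variable {m : ℕ} {K : Set (ℝ × EuclideanSpace ℝ (Fin m))} (hK : Sliced K)
  {K' : Set (ℝ × EuclideanSpace ℝ (Fin (m + 1)))} (hK' : Sliced K')
  {G : ℝ → EuclideanSpace ℝ (Fin (m + 1)) → Matrix (Fin (m + 1)) (Fin (m + 1)) ℝ}
  (hG : ∀ i j, ContDiffOn ℝ ∞ (fun p : ℝ × EuclideanSpace ℝ (Fin (m + 1)) => G p.1 p.2 i j) K')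
  (hpos : ∀ p ∈ K', (G p.1 p.2).PosDef)
  {ξ : ℝ → EuclideanSpace ℝ (Fin m) → EuclideanSpace ℝ (Fin (m + 1))}
  (hξ : ContDiffOn ℝ ∞ (fun p : ℝ × EuclideanSpace ℝ (Fin m) => ξ p.1 p.2) K)
  (hmaps : ∀ p ∈ K, (p.1, ξ p.1 p.2) ∈ K')
  (himm : ∀ p ∈ K, LinearIndependent ℝ fun (i : Fin m) (a : Fin (m + 1)) => pd i (ξ p.1) p.2 a)
include hK hξ

lemma Sliced.sm_frame (i : Fin m) (a : Fin (m + 1)) : ContDiffOn ℝ ∞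
    (fun p : ℝ × EuclideanSpace ℝ (Fin m) => pd i (ξ p.1) p.2 a) K :=
  contDiffOn_euclidean.1 (hK.sm_pd hξ i) a

include hmaps

lemma Sliced.sm_comp {f : ℝ → EuclideanSpace ℝ (Fin (m + 1)) → ℝ}
    (hf : ContDiffOn ℝ ∞ (fun p : ℝ × EuclideanSpace ℝ (Fin (m + 1)) => f p.1 p.2) K') :
    ContDiffOn ℝ ∞ (fun p : ℝ × EuclideanSpace ℝ (Fin m) => f p.1 (ξ p.1 p.2)) K :=
  hf.comp (contDiffOn_fst.prodMk hξ) hmaps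

include hG

lemma Sliced.sm_inducedMetric (i j : Fin m) : ContDiffOn ℝ ∞
    (fun p : ℝ × EuclideanSpace ℝ (Fin m) => inducedMetric (G p.1) (ξ p.1) p.2 i j) K := by
  simp only [inducedMetric, Matrix.of_apply]
  exact ContDiffOn.sum fun a _ => ContDiffOn.sum fun b _ =>
    ((hK.sm_comp hξ hmaps (f := fun t z => G t z a b) (hG a b)).mul (hK.sm_frame hξ i a)).mul
      (hK.sm_frame hξ j b)

include himm hpos

lemma Sliced.sm_unitNormal (a : Fin (m + 1)) : ContDiffOn ℝ ∞
    (fun p : ℝ × EuclideanSpace ℝ (Fin m) => unitNormal (G p.1) (ξ p.1) p.2 a) K :=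
  sm_nvec (A := fun p : ℝ × EuclideanSpace ℝ (Fin m) => G p.1 (ξ p.1 p.2))
    (fun i j => hK.sm_comp hξ hmaps (f := fun t z => G t z i j) (hG i j))
    (fun p hp => hpos _ (hmaps p hp)) (hK.sm_frame hξ) himm a

include hK'

lemma Sliced.sm_secondFund (I : Fin 2 → Fin m) : ContDiffOn ℝ ∞
    (fun p : ℝ × EuclideanSpace ℝ (Fin m) => secondFund (G p.1) (ξ p.1) p.2 I) K := by
  refine ContDiffOn.sum fun a _ => ContDiffOn.sum fun b _ =>
    ((hK.sm_comp hξ hmaps (f := fun t z => G t z a b) (hG a b)).mul (ContDiffOn.add ?_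
      (ContDiffOn.sum fun c _ => ContDiffOn.sum fun d _ => ((?_ : ContDiffOn ℝ ∞ _ _).mul
      (hK.sm_frame hξ _ _)).mul
      (hK.sm_frame hξ _ _)))).mul (hK.sm_unitNormal hG hpos hξ hmaps himm b)
  · exact contDiffOn_euclidean.1 (hK.sm_pd (u := fun t => pd (I 1) (ξ t)) (hK.sm_pd hξ _) _) a
  · exact hK.sm_comp hξ hmaps (f := fun t z => christoffel (G t) z a c d)
      (hK'.sm_christoffel hG (fun p hp => (hpos p hp).det_pos.ne') a c d)

/-- Joint smoothness, up to the boundary, of the squared norms of the covariant derivatives of the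
second fundamental form. -/
lemma Sliced.sm_tensorNorm_sq (k : ℕ) : ContDiffOn ℝ ∞ (fun p : ℝ × EuclideanSpace ℝ (Fin m) =>
    ip (inducedMetric (G p.1) (ξ p.1) p.2)⁻¹
      (iterCovDeriv (inducedMetric (G p.1) (ξ p.1)) (secondFund (G p.1) (ξ p.1)) k p.2)
      (iterCovDeriv (inducedMetric (G p.1) (ξ p.1)) (secondFund (G p.1) (ξ p.1)) k p.2)) K := by
  have hdet : ∀ p ∈ K, (inducedMetric (G p.1) (ξ p.1) p.2).det ≠ 0 := fun p hp =>
    (gram_posDef (hpos _ (hmaps p hp)) (himm p hp)).det_pos.ne'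
  have h1 := hK.sm_iterCovDeriv (G := fun t => inducedMetric (G t) (ξ t))
    (hK.sm_inducedMetric hG hξ hmaps) hdet (T := fun t => secondFund (G t) (ξ t))
    (hK.sm_secondFund hK' hG hpos hξ hmaps himm) k
  exact ContDiffOn.sum fun I _ => ContDiffOn.sum fun J _ =>
    ((contDiffOn_prod fun s _ => contDiffOn_inv (hK.sm_inducedMetric hG hξ hmaps) hdet _ _).mul
      (h1 I)).mul (h1 J)

end FrozenHypersurface

/-! ### Coordinate covariant derivatives in the abstract calculus -/

section Norms

variable {n r : ℕ}

/-- The coordinate directions. -/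
def sgl (n : ℕ) (i : Fin n) : EuclideanSpace ℝ (Fin n) := EuclideanSpace.single i 1

lemma covDeriv_eq (G : EuclideanSpace ℝ (Fin n) → Matrix (Fin n) (Fin n) ℝ)
    (T : EuclideanSpace ℝ (Fin n) → (Fin r → Fin n) → ℝ) (y : EuclideanSpace ℝ (Fin n)) :
    covDeriv G T y = rl (finSuccEquiv r).symm (nab (sgl n) (chr (sgl n) G) T y) := by
  ext I
  have e1 : (I ∘ (finSuccEquiv r).symm) none = I 0 := rfl
  have e2 : (I ∘ (finSuccEquiv r).symm) ∘ some = Fin.tail I := by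
    ext s; simp [Fin.tail]
  rw [rl, nab, e1, e2]
  rfl

variable {D : Type} [Fintype D] [DecidableEq D] {E : Type*} [NormedAddCommGroup E] [NormedSpace ℝ E]

lemma Geo.sqIter_rl (G : Geo E D) {k : ℕ} {ι κ : Type} [Fintype ι] [DecidableEq ι] [Fintype κ]
    [DecidableEq κ] (f : ι ≃ κ) (T : E → (ι → D) → ℝ) :
    G.sqIter k (fun z => rl f (T z)) = G.sqIter k T := by
  induction k generalizing ι κ with
  | zero => ext y; exact ip_rl _ _ _ _
  | succ k ih =>
    have e : (G.nab fun z => rl f (T z)) = fun z => rl f.optionCongr (G.nab T z) := by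
      ext1 y; exact nab_rl f
    change G.sqIter k (G.nab fun z => rl f (T z)) = G.sqIter k (G.nab T)
    rw [e, ih]

variable (Ω : Set (EuclideanSpace ℝ (Fin n))) (pt : EuclideanSpace ℝ (Fin n))
  (G : EuclideanSpace ℝ (Fin n) → Matrix (Fin n) (Fin n) ℝ)
  (T : EuclideanSpace ℝ (Fin n) → (Fin r → Fin n) → ℝ)

/-- Stated for an arbitrary starting order `k`, because `iterCovDeriv` recurses on the outermost
derivative and `Geo.sqIter` on the innermost one. -/
lemma sqIter_iterCovDeriv (j k : ℕ) {N : ℕ} (hN : k + j = N) :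
    (lc Ω pt (sgl n) G).sqIter j (iterCovDeriv G T k) =
      fun y => ip (G y)⁻¹ (iterCovDeriv G T N y) (iterCovDeriv G T N y) := by
  induction j generalizing k with
  | zero => subst hN; rfl
  | succ j ih =>
    rw [← ih (k + 1) (by omega)]
    have e : iterCovDeriv G T (k + 1) = fun z => rl (finSuccEquiv (r + k)).symm
        ((lc Ω pt (sgl n) G).nab (iterCovDeriv G T k) z) :=
      funext fun y => covDeriv_eq G (iterCovDeriv G T k) y
    have e2 : (lc Ω pt (sgl n) G).sqIter j (iterCovDeriv G T (k + 1)) =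
        (lc Ω pt (sgl n) G).sqIter j fun z => rl (finSuccEquiv (r + k)).symm
          ((lc Ω pt (sgl n) G).nab (iterCovDeriv G T k) z) := congrArg _ e
    rw [e2, Geo.sqIter_rl]
    rfl

lemma ip_iterCovDeriv (k : ℕ) (y : EuclideanSpace ℝ (Fin n)) :
    ip (G y)⁻¹ (iterCovDeriv G T k y) (iterCovDeriv G T k y) =
      (lc Ω pt (sgl n) G).sqIter k T y :=
  (congrFun (sqIter_iterCovDeriv Ω pt G T k 0 (zero_add k)) y).symm

lemma tensorNorm_iterCovDeriv_sq {y : EuclideanSpace ℝ (Fin n)} (hG : (G y).PosDef) (k : ℕ) :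
    tensorNorm (G y) (iterCovDeriv G T k y) ^ 2 = (lc Ω pt (sgl n) G).sqIter k T y := by
  rw [tensorNorm_eq_nrm, nrm_sq hG.inv.posSemidef, ip_iterCovDeriv Ω pt]

end Norms

/-! ### Parametrized hypersurfaces at a fixed time -/

section Frames

variable {m : ℕ} {E E' : Type*} [NormedAddCommGroup E] [NormedSpace ℝ E] [NormedAddCommGroup E']
  [NormedSpace ℝ E']

/-- An immersed hypersurface, with its unit normal determined by the coordinates. -/
structure Imm.Frame (I : Imm E E' (Fin m) (Fin (m + 1))) : Prop where
  isOpen : IsOpen I.Ω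
  mem : I.pt ∈ I.Ω
  met' : IsMetric I.Ω' I.N
  maps : MapsTo I.u I.Ω I.Ω'
  smu : ContDiffOn ℝ ∞ I.u I.Ω
  smF : ∀ i a, ContDiffOn ℝ ∞ (fun y => I.F y i a) I.Ω
  deriv : ∀ y ∈ I.Ω, ∀ j, fderiv ℝ I.u y (I.d j) = ∑ c, I.F y j c • I.d' c
  tors : ∀ y ∈ I.Ω, ∀ i j a, fderiv ℝ (fun z => I.F z j a) y (I.d i) =
    fderiv ℝ (fun z => I.F z i a) y (I.d j)
  indep : ∀ y ∈ I.Ω, LinearIndependent ℝ (I.F y)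
  normal : ∀ y, I.e y = nvec (I.N (I.u y)) (I.F y)

variable {I : Imm E E' (Fin m) (Fin (m + 1))} (h : I.Frame)
include h

lemma Imm.Frame.unit {y : E} (hy : y ∈ I.Ω) : pr (I.N (I.u y)) (I.e y) (I.e y) = 1 := by
  rw [h.normal]; exact nvec_unit (h.met'.pos _ (h.maps hy)) (h.indep y hy)

lemma Imm.Frame.good : I.Good where
  isOpen := h.isOpen
  mem := h.mem
  met' := h.met'
  maps := h.maps
  smu := h.smu
  smF := h.smF
  sme := fun a => by
    simp only [h.normal]
    exact sm_nvec (A := fun y => I.N (I.u y)) (fun i j => (h.met'.sm i j).comp h.smu h.maps)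
      (fun p hp => h.met'.pos _ (h.maps hp)) h.smF h.indep a
  deriv := h.deriv
  tors := h.tors
  orth := fun y hy i => by
    rw [h.normal]; exact nvec_orth (h.met'.pos _ (h.maps hy)) (h.indep y hy) i
  pos := fun y hy => gram_posDef (h.met'.pos _ (h.maps hy)) (h.indep y hy)
  complete := fun y hy a b => by
    rw [h.normal]; exact frame_complete (h.met'.pos _ (h.maps hy)) (h.indep y hy) a b
  norm := ⟨1, fun _ hy => h.unit hy⟩

end Frames

section Slice

variable {m : ℕ}

lemma EuclideanSpace.sum_sgl {n : ℕ} (v : EuclideanSpace ℝ (Fin n)) : ∑ c, v c • sgl n c = v := by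
  ext a
  simp [sgl, Pi.single_apply]

lemma fderiv_coord {n : ℕ} {E : Type*} [NormedAddCommGroup E] [NormedSpace ℝ E]
    {u : E → EuclideanSpace ℝ (Fin n)} {y : E} (hu : DifferentiableAt ℝ u y) (v : E) (a : Fin n) :
    fderiv ℝ (fun z => u z a) y v = fderiv ℝ u y v a := by
  have := (EuclideanSpace.proj (𝕜 := ℝ) a).hasFDerivAt.comp y hu.hasFDerivAt
  have h2 : fderiv ℝ (fun z => u z a) y = (EuclideanSpace.proj (𝕜 := ℝ) a).comp (fderiv ℝ u y) :=
    this.fderiv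
  rw [h2]
  rfl

/-- Symmetry of the second derivative of a map between Euclidean spaces. -/
lemma pd_comm {n n' : ℕ} {u : EuclideanSpace ℝ (Fin n) → EuclideanSpace ℝ (Fin n')}
    {y : EuclideanSpace ℝ (Fin n)} (hu : ContDiffAt ℝ ∞ u y) (i j : Fin n) (a : Fin n') :
    fderiv ℝ (fun z => pd j u z a) y (sgl n i) = fderiv ℝ (fun z => pd i u z a) y (sgl n j) := by
  have h1 : DifferentiableAt ℝ (fderiv ℝ u) y :=
    (hu.fderiv_right (m := (∞ : WithTop ℕ∞)) (by simp)).differentiableAt (by simp)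
  have h2 : ∀ i j, fderiv ℝ (fun z => pd j u z a) y (sgl n i) =
      fderiv ℝ (fderiv ℝ u) y (sgl n i) (sgl n j) a := by
    intro i j
    have h3 : HasFDerivAt (fun z => pd j u z) ((fderiv ℝ (fderiv ℝ u) y).flip (sgl n j)) y := by
      have := h1.hasFDerivAt.clm_apply (hasFDerivAt_const (sgl n j) y)
      simp only [ContinuousLinearMap.comp_zero, zero_add] at this
      exact this
    rw [fderiv_coord h3.differentiableAt, h3.fderiv]
    rfl
  rw [h2, h2, (hu.isSymmSndFDerivAt (by rw [minSmoothness_of_isRCLikeNormedField]; exact WithTop.coe_le_coe.2 le_top)).eq]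

lemma contDiffOn_pd {n n' : ℕ} {u : EuclideanSpace ℝ (Fin n) → EuclideanSpace ℝ (Fin n')}
    {Ω : Set (EuclideanSpace ℝ (Fin n))} (hΩ : IsOpen Ω) (hu : ContDiffOn ℝ ∞ u Ω) (i : Fin n) :
    ContDiffOn ℝ ∞ (pd i u) Ω :=
  (hu.fderiv_of_isOpen hΩ (by simp)).clm_apply contDiffOn_const

/-- A parametrized hypersurface at a fixed time. -/
def slice (Ω : Set (EuclideanSpace ℝ (Fin m))) (pt : EuclideanSpace ℝ (Fin m))
    (Ω' : Set (EuclideanSpace ℝ (Fin (m + 1))))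
    (G : EuclideanSpace ℝ (Fin (m + 1)) → Matrix (Fin (m + 1)) (Fin (m + 1)) ℝ)
    (u : EuclideanSpace ℝ (Fin m) → EuclideanSpace ℝ (Fin (m + 1))) :
    Imm (EuclideanSpace ℝ (Fin m)) (EuclideanSpace ℝ (Fin (m + 1))) (Fin m) (Fin (m + 1)) :=
  ⟨Ω, pt, sgl m, Ω', sgl (m + 1), G, u, fun y i a => pd i u y a, fun y a => unitNormal G u y a⟩

variable {Ω : Set (EuclideanSpace ℝ (Fin m))} {pt : EuclideanSpace ℝ (Fin m)}
  {Ω' : Set (EuclideanSpace ℝ (Fin (m + 1)))}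
  {G : EuclideanSpace ℝ (Fin (m + 1)) → Matrix (Fin (m + 1)) (Fin (m + 1)) ℝ}
  {u : EuclideanSpace ℝ (Fin m) → EuclideanSpace ℝ (Fin (m + 1))}

lemma slice_frame (hΩ : IsOpen Ω) (hpt : pt ∈ Ω) (hG : IsMetric Ω' G) (hmaps : MapsTo u Ω Ω')
    (hu : ContDiffOn ℝ ∞ u Ω)
    (hind : ∀ y ∈ Ω, LinearIndependent ℝ fun (i : Fin m) (a : Fin (m + 1)) => pd i u y a) :
    (slice Ω pt Ω' G u).Frame where
  isOpen := hΩ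
  mem := hpt
  met' := hG
  maps := hmaps
  smu := hu
  smF := fun i a => contDiffOn_euclidean.1 (contDiffOn_pd hΩ hu i) a
  deriv := fun _ _ _ => (EuclideanSpace.sum_sgl _).symm
  tors := fun _ hy i j a => pd_comm (hu.contDiffAt (hΩ.mem_nhds hy)) i j a
  indep := hind
  normal := fun _ => rfl

lemma slice_A (hΩ : IsOpen Ω) (hu : ContDiffOn ℝ ∞ u Ω) :
    EqOn (secondFund G u) (slice Ω pt Ω' G u).A Ω := by
  intro y hy
  ext L
  simp only [Imm.A, Imm.sff, pr, secondFund]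
  refine Finset.sum_congr rfl fun a _ => Finset.sum_congr rfl fun b _ => ?_
  have h1 : DifferentiableAt ℝ (pd (L 1) u) y :=
    ((contDiffOn_pd hΩ hu (L 1)).contDiffAt (hΩ.mem_nhds hy)).differentiableAt (by simp)
  have h2 : (slice Ω pt Ω' G u).cd (L 0) (fun z => (slice Ω pt Ω' G u).F z (L 1)) y a =
      pd (L 0) (pd (L 1) u) y a +
      ∑ c, ∑ d, christoffel G (u y) a c d * pd (L 0) u y c * pd (L 1) u y d := by
    have h3 := fderiv_coord h1 (sgl m (L 0)) a
    rw [Imm.cd, cv]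
    congr 1
    rw [Finset.sum_comm]
    simp only [Finset.sum_mul]
    rfl
  rw [h2]
  rfl

lemma slice_H (hΩ : IsOpen Ω) (hu : ContDiffOn ℝ ∞ u Ω) {y : EuclideanSpace ℝ (Fin m)} (hy : y ∈ Ω) :
    meanCurv G u y = (slice Ω pt Ω' G u).H y := by
  refine Finset.sum_congr rfl fun i _ => Finset.sum_congr rfl fun j _ => ?_
  rw [slice_A (pt := pt) (Ω' := Ω') hΩ hu hy]
  rfl

/-- The frozen norms in terms of the abstract ones. -/
lemma slice_sqIter (hΩ : IsOpen Ω) (hu : ContDiffOn ℝ ∞ u Ω) {y : EuclideanSpace ℝ (Fin m)}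
    (hy : y ∈ Ω) (k : ℕ) :
    ip (inducedMetric G u y)⁻¹ (iterCovDeriv (inducedMetric G u) (secondFund G u) k y)
      (iterCovDeriv (inducedMetric G u) (secondFund G u) k y) =
    (slice Ω pt Ω' G u).geo.sqIter k (slice Ω pt Ω' G u).A y := by
  rw [ip_iterCovDeriv Ω pt]
  exact sqIter_congr hΩ (slice_A (pt := pt) (Ω' := Ω') hΩ hu) hy

end Slice

/-! ### Metrics on the manifold in charts -/

section Charts

variable {n : ℕ} {M : Type*} [TopologicalSpace M] [ChartedSpace (EuclideanSpace ℝ (Fin n)) M]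

/-- The preferred chart at a point. -/
abbrev cht (n : ℕ) {M : Type*} [TopologicalSpace M] [ChartedSpace (EuclideanSpace ℝ (Fin n)) M]
    (a : M) : OpenPartialHomeomorph M (EuclideanSpace ℝ (Fin n)) :=
  chartAt (EuclideanSpace ℝ (Fin n)) a

lemma ctr_mem (a : M) : ctr n a ∈ (cht n a).target := mem_chart_target _ a

lemma cht_symm_ctr (a : M) : (cht n a).symm (ctr n a) = a :=
  (cht n a).left_inv (mem_chart_source _ a)

variable [IsManifold (𝓡 n) ∞ M]

lemma contDiffOn_cht {E : Type*} [NormedAddCommGroup E] [NormedSpace ℝ E] {U : Set E} {f : E → M}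
    (hf : ContMDiffOn 𝓘(ℝ, E) (𝓡 n) ∞ f U) {b : M} (hb : MapsTo f U (cht n b).source) :
    ContDiffOn ℝ ∞ (fun y => cht n b (f y)) U :=
  contMDiffOn_iff_contDiffOn.1 (contMDiffOn_chart.comp hf hb)

lemma mdifferentiableAt_cht_symm {a : M} {y : EuclideanSpace ℝ (Fin n)} (hy : y ∈ (cht n a).target) :
    MDifferentiableAt (𝓡 n) (𝓡 n) (cht n a).symm y :=
  ((contMDiffOn_chart_symm (n := ∞)).contMDiffAt ((cht n a).open_target.mem_nhds hy)).mdifferentiableAt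
    (by simp)

/-- The coordinate vector fields. -/
def cvec (a : M) (y : EuclideanSpace ℝ (Fin n)) (i : Fin n) :
    TangentSpace (𝓡 n) ((cht n a).symm y) :=
  mfderiv (𝓡 n) (𝓡 n) (cht n a).symm y (sgl n i : EuclideanSpace ℝ (Fin n))

lemma contMDiffOn_cvec (a : M) (i : Fin n) :
    ContMDiffOn 𝓘(ℝ, EuclideanSpace ℝ (Fin n)) ((𝓡 n).prod (𝓡 n)) ∞
      (fun y => (⟨(cht n a).symm y, cvec a y i⟩ : TangentBundle (𝓡 n) M)) (cht n a).target := by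
  have h1 := (contMDiffOn_chart_symm (I := 𝓡 n) (n := ∞) (x := a)).contMDiffOn_tangentMapWithin
    (m := ∞) (by simp) (cht n a).open_target.uniqueMDiffOn
  have h2 : ContMDiffOn 𝓘(ℝ, EuclideanSpace ℝ (Fin n)) ((𝓡 n).prod (𝓡 n)) ∞
      (fun y => (⟨y, sgl n i⟩ : TangentBundle (𝓡 n) (EuclideanSpace ℝ (Fin n)))) (cht n a).target :=
    contMDiffOn_vectorSpace_iff_contDiffOn.2 contDiffOn_const
  refine (h1.comp h2 fun y hy => hy).congr fun y hy => ?_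
  rw [Function.comp_apply, tangentMapWithin, mfderivWithin_of_isOpen (cht n a).open_target hy]
  rfl

lemma cvec_sum (a : M) (y : EuclideanSpace ℝ (Fin n)) (v : EuclideanSpace ℝ (Fin n)) :
    mfderiv (𝓡 n) (𝓡 n) (cht n a).symm y v = ∑ i, v i • cvec a y i := by
  conv_lhs => rw [← EuclideanSpace.sum_sgl v]
  erw [map_sum]
  refine Finset.sum_congr rfl fun i _ => ?_
  erw [map_smul]
  rfl

lemma chartMetric_apply (g : RMetric n M) (a : M) (y : EuclideanSpace ℝ (Fin n)) (i j : Fin n) :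
    chartMetric g a y i j = g.inner ((cht n a).symm y) (cvec a y i) (cvec a y j) := rfl

lemma sm_chartMetric (g : RMetric n M) (a : M) (i j : Fin n) :
    ContDiffOn ℝ ∞ (fun y => chartMetric g a y i j) (cht n a).target := by
  have h1 : ContMDiffOn 𝓘(ℝ, EuclideanSpace ℝ (Fin n)) _ ∞ _ (cht n a).target :=
    g.contMDiff.comp_contMDiffOn (contMDiffOn_chart_symm (I := 𝓡 n) (n := ∞) (x := a))
  have h2 := ContMDiffOn.clm_bundle_apply₂ (F₁ := EuclideanSpace ℝ (Fin n))
    (F₂ := EuclideanSpace ℝ (Fin n)) (F₃ := ℝ) (E₃ := fun _ : M => ℝ)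
    (ψ := fun y => g.inner ((cht n a).symm y)) h1 (contMDiffOn_cvec a i) (contMDiffOn_cvec a j)
  intro y hy
  have h3 := h2 y hy
  rw [Bundle.contMDiffWithinAt_totalSpace] at h3
  exact contMDiffWithinAt_iff_contDiffWithinAt.1 h3.2

lemma mfderiv_cht_symm_ne {a : M} {y : EuclideanSpace ℝ (Fin n)} (hy : y ∈ (cht n a).target)
    {v : EuclideanSpace ℝ (Fin n)} (hv : v ≠ 0) :
    mfderiv (𝓡 n) (𝓡 n) (cht n a).symm y v ≠ 0 := by
  intro h
  have h1 : MDifferentiableAt (𝓡 n) (𝓡 n) (cht n a) ((cht n a).symm y) :=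
    ((contMDiffOn_chart (n := ∞)).contMDiffAt ((cht n a).open_source.mem_nhds
      ((cht n a).map_target hy))).mdifferentiableAt (by simp)
  have h2 := mfderiv_comp y h1 (mdifferentiableAt_cht_symm hy)
  have h3 : (cht n a ∘ (cht n a).symm) =ᶠ[𝓝 y] id := by
    filter_upwards [(cht n a).open_target.mem_nhds hy] with z hz using (cht n a).right_inv hz
  rw [h3.mfderiv_eq, mfderiv_id] at h2
  have h4 := DFunLike.congr_fun h2 v
  apply hv
  change v = (mfderiv (𝓡 n) (𝓡 n) (cht n a) ((cht n a).symm y))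
    (mfderiv (𝓡 n) (𝓡 n) (cht n a).symm y v) at h4
  rw [h4, h, map_zero]
  rfl

lemma isMetric_chartMetric (g : RMetric n M) (a : M) :
    IsMetric (cht n a).target (chartMetric g a) where
  isOpen := (cht n a).open_target
  sm := sm_chartMetric g a
  pos := fun y hy => by
    refine Matrix.PosDef.of_dotProduct_mulVec_pos ?_ fun c hc => ?_
    · ext i j
      exact g.symm _ _ _
    · have h1 := g.pos ((cht n a).symm y) (mfderiv (𝓡 n) (𝓡 n) (cht n a).symm y (WithLp.toLp 2 c))
        (mfderiv_cht_symm_ne hy fun h => hc (congrArg WithLp.ofLp h))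
      rw [cvec_sum] at h1
      refine h1.trans_eq ?_
      simp only [map_sum, map_smul, sum_apply, smul_apply, smul_eq_mul, star_trivial, dotProduct,
        Matrix.mulVec, Finset.mul_sum]
      rw [Finset.sum_comm]
      refine Finset.sum_congr rfl fun i _ => Finset.sum_congr rfl fun j _ => ?_
      rw [chartMetric_apply]
      ring

end Charts

/-! ### Maps between manifolds in charts -/

section Rep

variable {n n' : ℕ} {M M' : Type*} [TopologicalSpace M] [ChartedSpace (EuclideanSpace ℝ (Fin n)) M]
  [TopologicalSpace M'] [ChartedSpace (EuclideanSpace ℝ (Fin n')) M']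

/-- The map `Ψ` in the charts at `a` and `b`. -/
def rep (n n' : ℕ) {M M' : Type*} [TopologicalSpace M] [ChartedSpace (EuclideanSpace ℝ (Fin n)) M]
    [TopologicalSpace M'] [ChartedSpace (EuclideanSpace ℝ (Fin n')) M'] (Ψ : M → M') (a : M) (b : M') (y : EuclideanSpace ℝ (Fin n)) : EuclideanSpace ℝ (Fin n') :=
  cht n' b (Ψ ((cht n a).symm y))

/-- The domain of `rep n n' Ψ a b`. -/
def dom (n n' : ℕ) {M M' : Type*} [TopologicalSpace M] [ChartedSpace (EuclideanSpace ℝ (Fin n)) M]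
    [TopologicalSpace M'] [ChartedSpace (EuclideanSpace ℝ (Fin n')) M'] (Ψ : M → M') (a : M)
    (b : M') : Set (EuclideanSpace ℝ (Fin n)) :=
  (cht n a).target ∩ (cht n a).symm ⁻¹' (Ψ ⁻¹' (cht n' b).source)

variable {Ψ : M → M'} {a : M} {b : M'} {y : EuclideanSpace ℝ (Fin n)}

lemma isOpen_dom (hΨ : Continuous Ψ) : IsOpen (dom n n' Ψ a b) :=
  (cht n a).continuousOn_symm.isOpen_inter_preimage (cht n a).open_target
    ((cht n' b).open_source.preimage hΨ)

lemma rep_mem (hy : y ∈ dom n n' Ψ a b) : rep n n' Ψ a b y ∈ (cht n' b).target :=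
  (cht n' b).map_source hy.2

lemma cht_symm_rep (hy : y ∈ dom n n' Ψ a b) :
    (cht n' b).symm (rep n n' Ψ a b y) = Ψ ((cht n a).symm y) := (cht n' b).left_inv hy.2

variable [IsManifold (𝓡 n) ∞ M] [IsManifold (𝓡 n') ∞ M'] (hΨ : ContMDiff (𝓡 n) (𝓡 n') ∞ Ψ)
include hΨ

lemma contDiffOn_rep : ContDiffOn ℝ ∞ (rep n n' Ψ a b) (dom n n' Ψ a b) :=
  contDiffOn_cht (hΨ.comp_contMDiffOn ((contMDiffOn_chart_symm (n := ∞)).mono inter_subset_left))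
    fun _ hy => hy.2

lemma mfderiv_rep (hy : y ∈ dom n n' Ψ a b) (v : EuclideanSpace ℝ (Fin n)) :
    (mfderiv (𝓡 n) (𝓡 n') Ψ ((cht n a).symm y) (mfderiv (𝓡 n) (𝓡 n) (cht n a).symm y v) :
      EuclideanSpace ℝ (Fin n')) =
    mfderiv (𝓡 n') (𝓡 n') (cht n' b).symm (rep n n' Ψ a b y) (fderiv ℝ (rep n n' Ψ a b) y v) := by
  have ho : IsOpen (dom n n' Ψ a b) := isOpen_dom hΨ.continuous
  have h1 := mfderiv_comp y (hΨ.mdifferentiableAt (x := (cht n a).symm y) (by simp))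
    (mdifferentiableAt_cht_symm hy.1)
  have hr : DifferentiableAt ℝ (rep n n' Ψ a b) y :=
    ((contDiffOn_rep hΨ).contDiffAt (ho.mem_nhds hy)).differentiableAt (by simp)
  have h2 := mfderiv_comp y (mdifferentiableAt_cht_symm (rep_mem hy)) hr.mdifferentiableAt
  have h3 : (Ψ ∘ (cht n a).symm) =ᶠ[𝓝 y] ((cht n' b).symm ∘ rep n n' Ψ a b) := by
    filter_upwards [ho.mem_nhds hy] with z hz using (cht_symm_rep hz).symm
  rw [h3.mfderiv_eq, h2, mfderiv_eq_fderiv] at h1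
  exact (DFunLike.congr_fun h1 v).symm

lemma linearIndependent_rep (himm : Function.Injective (mfderiv (𝓡 n) (𝓡 n') Ψ ((cht n a).symm y)))
    (hy : y ∈ dom n n' Ψ a b) :
    LinearIndependent ℝ fun (i : Fin n) (k : Fin n') => pd i (rep n n' Ψ a b) y k := by
  refine Fintype.linearIndependent_iff.2 fun c hc => ?_
  have h1 : fderiv ℝ (rep n n' Ψ a b) y (WithLp.toLp 2 c) = 0 := by
    rw [← EuclideanSpace.sum_sgl (WithLp.toLp 2 c), map_sum]
    ext k
    have := congrFun hc k
    simp only [Finset.sum_apply, Pi.smul_apply] at this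
    simp only [map_smul]
    simpa [pd, sgl] using this
  have h2 := mfderiv_rep hΨ hy (WithLp.toLp 2 c)
  rw [h1] at h2
  by_contra h0
  have h3 : (WithLp.toLp 2 c : EuclideanSpace ℝ (Fin n)) ≠ 0 := fun h => h0 fun i =>
    congrFun (congrArg WithLp.ofLp h) i
  refine mfderiv_cht_symm_ne hy.1 h3 (himm ?_)
  refine h2.trans ?_
  erw [map_zero, map_zero]
  rfl

end Rep

section Isometries

variable {n : ℕ} {M : Type*} [TopologicalSpace M] [ChartedSpace (EuclideanSpace ℝ (Fin n)) M]
  [IsManifold (𝓡 n) ∞ M]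

/-- The matrix of partial derivatives. -/
def jac {n n' : ℕ} (f : EuclideanSpace ℝ (Fin n) → EuclideanSpace ℝ (Fin n'))
    (y : EuclideanSpace ℝ (Fin n)) : Matrix (Fin n') (Fin n) ℝ :=
  Matrix.of fun k i => pd i f y k

/-- The factors are present because the self-similar metrics are isometric to `g` only after
multiplication by `e^s`. With `Ψ` the identity the lemma describes a change of charts. -/
lemma metIso_rep {g₁ g₂ : RMetric n M} {c₁ c₂ : ℝ} (hc₁ : 0 < c₁) (hc₂ : 0 < c₂) {Ψ : M → M}
    (hΨ : ContMDiff (𝓡 n) (𝓡 n) ∞ Ψ)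
    (hg : ∀ (p : M) (v v' : TangentSpace (𝓡 n) p), c₁ * g₁.inner p v v' =
      c₂ * g₂.inner (Ψ p) (mfderiv (𝓡 n) (𝓡 n) Ψ p v) (mfderiv (𝓡 n) (𝓡 n) Ψ p v')) (a b : M) :
    MetIso (dom n n Ψ a b) (sgl n) (fun y => c₁ • chartMetric g₁ a y) (cht n b).target (sgl n)
      (fun y => c₂ • chartMetric g₂ b y) (rep n n Ψ a b) (jac (rep n n Ψ a b)) := by
  have ho : IsOpen (dom n n Ψ a b) := isOpen_dom hΨ.continuous
  have hr := contDiffOn_rep hΨ (a := a) (b := b)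
  have hs := isMetric_chartMetric g₁ a
  have ht := isMetric_chartMetric g₂ b
  refine ⟨⟨ho, fun i j => contDiffOn_const.mul ((hs.sm i j).mono inter_subset_left),
    fun y hy => (hs.pos y hy.1).smul hc₁⟩, ⟨ht.isOpen, fun i j => contDiffOn_const.mul (ht.sm i j),
    fun y hy => (ht.pos y hy).smul hc₂⟩, fun y hy => rep_mem hy, hr,
    fun k i => contDiffOn_euclidean.1 (contDiffOn_pd ho hr i) k,
    fun y _ j => (EuclideanSpace.sum_sgl (pd j (rep n n Ψ a b) y)).symm,
    fun y hy i j k => pd_comm (hr.contDiffAt (ho.mem_nhds hy)) i j k, fun y hy => ?_⟩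
  ext i j
  have e1 : ∀ i, (mfderiv (𝓡 n) (𝓡 n) Ψ ((cht n a).symm y) (cvec a y i) :
      EuclideanSpace ℝ (Fin n)) = ∑ k, jac (rep n n Ψ a b) y k i • cvec b (rep n n Ψ a b y) k := fun i =>
    (mfderiv_rep hΨ hy (sgl n i)).trans (cvec_sum b _ _)
  have e2 : ∀ {p q : M} (_ : p = q) (v w : EuclideanSpace ℝ (Fin n)), g₂.inner p v w =
      g₂.inner q v w := by rintro p _ rfl v w; rfl
  have e3 : c₁ * chartMetric g₁ a y i j = c₂ * g₂.inner ((cht n b).symm (rep n n Ψ a b y))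
      (∑ k, jac (rep n n Ψ a b) y k i • cvec b (rep n n Ψ a b y) k)
      (∑ k, jac (rep n n Ψ a b) y k j • cvec b (rep n n Ψ a b y) k) := by
    rw [chartMetric_apply, hg]
    congr 1
    exact (e2 (cht_symm_rep hy).symm _ _).trans (congrArg₂ (fun v w : EuclideanSpace ℝ (Fin n) =>
      g₂.inner ((cht n b).symm (rep n n Ψ a b y)) v w) (e1 i) (e1 j))
  change c₁ * chartMetric g₁ a y i j = _
  rw [e3]
  simp only [map_sum, map_smul, sum_apply, smul_apply, smul_eq_mul, Matrix.mul_apply,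
    Matrix.transpose_apply, Finset.mul_sum, Finset.sum_mul]
  refine Finset.sum_congr rfl fun k _ => Finset.sum_congr rfl fun l _ => ?_
  rw [Matrix.smul_apply, chartMetric_apply, smul_eq_mul]
  ring

end Isometries

/-- The squared norm of `∇^k 𝒜` for a parametrized hypersurface. -/
def sffSq {m : ℕ} (G : EuclideanSpace ℝ (Fin (m + 1)) → Matrix (Fin (m + 1)) (Fin (m + 1)) ℝ)
    (u : EuclideanSpace ℝ (Fin m) → EuclideanSpace ℝ (Fin (m + 1))) (k : ℕ)
    (y : EuclideanSpace ℝ (Fin m)) : ℝ :=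
  ip (inducedMetric G u y)⁻¹ (iterCovDeriv (inducedMetric G u) (secondFund G u) k y)
    (iterCovDeriv (inducedMetric G u) (secondFund G u) k y)

section SliceIso

variable {m : ℕ} {Ω₁ Ω₂ : Set (EuclideanSpace ℝ (Fin m))}
  {Ω₁' Ω₂' : Set (EuclideanSpace ℝ (Fin (m + 1)))} {y₁ y₂ : EuclideanSpace ℝ (Fin m)}
  {G₁ G₂ : EuclideanSpace ℝ (Fin (m + 1)) → Matrix (Fin (m + 1)) (Fin (m + 1)) ℝ}
  {u₁ u₂ : EuclideanSpace ℝ (Fin m) → EuclideanSpace ℝ (Fin (m + 1))}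
  {κ : EuclideanSpace ℝ (Fin m) → EuclideanSpace ℝ (Fin m)}
  {Φ : EuclideanSpace ℝ (Fin (m + 1)) → EuclideanSpace ℝ (Fin (m + 1))}

lemma slice_immIso (h₁ : (slice Ω₁ y₁ Ω₁' G₁ u₁).Frame) (h₂ : (slice Ω₂ y₂ Ω₂' G₂ u₂).Frame)
    (hmaps : MapsTo κ Ω₁ Ω₂) (hκ : ContDiffOn ℝ ∞ κ Ω₁)
    (hΦ : MetIso Ω₁' (sgl (m + 1)) G₁ Ω₂' (sgl (m + 1)) G₂ Φ (jac Φ))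
    (hc : ∀ y ∈ Ω₁, u₂ (κ y) = Φ (u₁ y)) :
    ImmIso (slice Ω₁ y₁ Ω₁' G₁ u₁) (slice Ω₂ y₂ Ω₂' G₂ u₂) κ (jac κ) Φ (jac Φ) where
  good₁ := h₁.good
  good₂ := h₂.good
  unit₁ := fun _ hy => h₁.unit hy
  unit₂ := fun _ hy => h₂.unit hy
  maps := hmaps
  smooth := hκ
  smP := fun k i => contDiffOn_euclidean.1 (contDiffOn_pd h₁.isOpen hκ i) k
  deriv := fun y _ j => (EuclideanSpace.sum_sgl (pd j κ y)).symm
  tors := fun y hy i j k => pd_comm (hκ.contDiffAt (h₁.isOpen.mem_nhds hy)) i j k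
  target := hΦ
  comm := hc
  frame := fun y hy j => by
    have d1 : DifferentiableAt ℝ u₁ y :=
      (h₁.smu.contDiffAt (h₁.isOpen.mem_nhds hy)).differentiableAt (by simp)
    have d2 : DifferentiableAt ℝ κ y :=
      (hκ.contDiffAt (h₁.isOpen.mem_nhds hy)).differentiableAt (by simp)
    have d3 : DifferentiableAt ℝ u₂ (κ y) :=
      (h₂.smu.contDiffAt (h₂.isOpen.mem_nhds (hmaps hy))).differentiableAt (by simp)
    have d4 : DifferentiableAt ℝ Φ (u₁ y) :=
      (hΦ.smooth.contDiffAt (hΦ.met₁.isOpen.mem_nhds (h₁.maps hy))).differentiableAt (by simp)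
    have e1 : (u₂ ∘ κ) =ᶠ[𝓝 y] (Φ ∘ u₁) := by
      filter_upwards [h₁.isOpen.mem_nhds hy] with z hz using hc z hz
    have e2 := e1.fderiv_eq (𝕜 := ℝ)
    rw [fderiv_comp y d3 d2, fderiv_comp y d4 d1] at e2
    have e3 : fderiv ℝ u₂ (κ y) (pd j κ y) = fderiv ℝ Φ (u₁ y) (pd j u₁ y) :=
      DFunLike.congr_fun e2 (sgl m j)
    rw [← EuclideanSpace.sum_sgl (pd j κ y), ← EuclideanSpace.sum_sgl (pd j u₁ y), map_sum,
      map_sum] at e3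
    ext a
    have e4 := congrFun (congrArg WithLp.ofLp e3) a
    simp only [map_smul, WithLp.ofLp_sum, WithLp.ofLp_smul, Finset.sum_apply, Pi.smul_apply,
      smul_eq_mul] at e4
    simp only [Finset.sum_apply, Pi.smul_apply, smul_eq_mul, Matrix.mulVec, dotProduct]
    refine Eq.trans (Finset.sum_congr rfl fun b _ => ?_) e4.symm
    exact mul_comm _ _

lemma sffSq_eq (h₁ : (slice Ω₁ y₁ Ω₁' G₁ u₁).Frame) {y : EuclideanSpace ℝ (Fin m)} (hy : y ∈ Ω₁)
    (k : ℕ) : sffSq G₁ u₁ k y =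
      (slice Ω₁ y₁ Ω₁' G₁ u₁).geo.sqIter k (slice Ω₁ y₁ Ω₁' G₁ u₁).A y :=
  slice_sqIter h₁.isOpen h₁.smu hy k

end SliceIso

/-! ### Rescaling of the ambient metric -/

section Scaling

variable {n : ℕ} {D : Type} [Fintype D] [DecidableEq D] {E : Type*} [NormedAddCommGroup E]
  [NormedSpace ℝ E] {c : ℝ}

variable {m : ℕ} {G : EuclideanSpace ℝ (Fin (m + 1)) → Matrix (Fin (m + 1)) (Fin (m + 1)) ℝ}
    {u : EuclideanSpace ℝ (Fin m) → EuclideanSpace ℝ (Fin (m + 1))} {y : EuclideanSpace ℝ (Fin m)}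

lemma inducedMetric_smul : inducedMetric (fun z => c • G z) u y = c • inducedMetric G u y := by
  ext i j
  simp only [inducedMetric, Matrix.of_apply, Matrix.smul_apply, smul_eq_mul, Finset.mul_sum, mul_assoc]

variable (hc : 0 < c)
include hc

lemma inv_smul_posDef {A : Matrix D D ℝ} (hA : A.PosDef) : (c • A)⁻¹ = c⁻¹ • A⁻¹ := by
  refine Matrix.inv_eq_left_inv ?_
  rw [Matrix.smul_mul, Matrix.mul_smul, smul_smul, Matrix.nonsing_inv_mul _ hA.det_pos.ne'.isUnit,
    inv_mul_cancel₀ hc.ne', one_smul]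

lemma chr_smul {d : D → E} {A : E → Matrix D D ℝ} {y : E} (hA : (A y).PosDef) :
    chr d (fun z => c • A z) y = chr d A y := by
  ext k i j
  have e : ∀ a b (v : E), fderiv ℝ (fun z => (c • A z) a b) y v =
      c * fderiv ℝ (fun z => A z a b) y v := by
    intro a b v
    have h1 : fderiv ℝ (c • fun z => A z a b) = c • fderiv ℝ fun z => A z a b :=
      fderiv_const_smul_field c
    exact DFunLike.congr_fun (congrFun h1 y) v
  simp only [chr, inv_smul_posDef hc hA, e]
  congr 1
  refine Finset.sum_congr rfl fun l _ => ?_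
  rw [Matrix.smul_apply, smul_eq_mul]
  field_simp

lemma ricC_smul {Ω : Set E} {d : D → E} {A : E → Matrix D D ℝ} (hA : IsMetric Ω A) {y : E}
    (hy : y ∈ Ω) : ricC d (fun z => c • A z) y = ricC d A y := by
  ext L
  have e : ∀ a i j, (fun z => chr d (fun z => c • A z) z a i j) =ᶠ[𝓝 y] fun z => chr d A z a i j := by
    intro a i j
    filter_upwards [hA.isOpen.mem_nhds hy] with z hz
    rw [chr_smul hc (hA.pos z hz)]
  simp only [ricC, curvC, (e _ _ _).fderiv_eq, chr_smul hc (hA.pos y hy)]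

lemma unitNormal_smul (hG : (G (u y)).PosDef) :
    unitNormal (fun z => c • G z) u y = (Real.sqrt c)⁻¹ • unitNormal G u y := by
  ext a
  have e1 : ∑ i, ∑ j, (c • G (u y))⁻¹ i j * conormal u y i * conormal u y j =
      c⁻¹ * ∑ i, ∑ j, (G (u y))⁻¹ i j * conormal u y i * conormal u y j := by
    simp only [inv_smul_posDef hc hG, Matrix.smul_apply, smul_eq_mul, Finset.mul_sum, mul_assoc]
  have e2 : ∑ b, (c • G (u y))⁻¹ a b * conormal u y b =
      c⁻¹ * ∑ b, (G (u y))⁻¹ a b * conormal u y b := by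
    simp only [inv_smul_posDef hc hG, Matrix.smul_apply, smul_eq_mul, Finset.mul_sum, mul_assoc]
  simp only [unitNormal, e1, e2, PiLp.smul_apply, smul_eq_mul]
  rw [Real.sqrt_mul (inv_nonneg.2 hc.le), Real.sqrt_inv]
  have h := Real.mul_self_sqrt hc.le
  have h0 := (Real.sqrt_pos.2 hc).ne'
  generalize ∑ b, (G (u y))⁻¹ a b * conormal u y b = S
  rw [mul_div_mul_comm]
  congr 1
  rw [eq_comm, inv_eq_iff_eq_inv, inv_div, div_eq_mul_inv, inv_inv, ← h, Real.sqrt_mul_self (Real.sqrt_nonneg c)]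
  field_simp

/-- The connection does not change, the metric scales by `c` and the unit normal by `c^{-1/2}`. -/
lemma secondFund_smul (hG : (G (u y)).PosDef) :
    secondFund (fun z => c • G z) u y = Real.sqrt c • secondFund G u y := by
  ext L
  have h := Real.mul_self_sqrt hc.le
  have h0 := (Real.sqrt_pos.2 hc).ne'
  simp only [secondFund, unitNormal_smul hc hG, christoffel_eq, chr_smul hc hG, Matrix.smul_apply,
    smul_eq_mul, PiLp.smul_apply, Pi.smul_apply]
  rw [Finset.mul_sum]
  simp only [Finset.mul_sum (a := √c)]
  refine Finset.sum_congr rfl fun a _ => Finset.sum_congr rfl fun b _ => ?_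
  nth_rewrite 1 [← h]
  field_simp

/-- The mean curvature vector scales by `c⁻¹`; for `c = e^s` this compensates the change of time `dt
= e^{-s} ds`. -/
lemma meanCurv_smul (hG : (G (u y)).PosDef) (hg : (inducedMetric G u y).PosDef) :
    meanCurv (fun z => c • G z) u y • unitNormal (fun z => c • G z) u y =
      c⁻¹ • (meanCurv G u y • unitNormal G u y) := by
  have h := Real.mul_self_sqrt hc.le
  have h0 := (Real.sqrt_pos.2 hc).ne'
  have e1 : meanCurv (fun z => c • G z) u y = c⁻¹ * Real.sqrt c * meanCurv G u y := by
    simp only [meanCurv, secondFund_smul hc hG, inducedMetric_smul, inv_smul_posDef hc hg,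
      Matrix.smul_apply, Pi.smul_apply, smul_eq_mul, Finset.mul_sum]
    exact Finset.sum_congr rfl fun a _ => Finset.sum_congr rfl fun b _ => by ring
  rw [e1, unitNormal_smul hc hG, smul_smul, smul_smul]
  congr 1
  field_simp

/-- The two inverse metrics contribute `c⁻²` and the square of the second fundamental form
contributes `c`. -/
lemma sffSq_smul (hG : (G (u y)).PosDef) (hg : (inducedMetric G u y).PosDef) :
    sffSq (fun z => c • G z) u 0 y = c⁻¹ * sffSq G u 0 y := by
  have h := Real.mul_self_sqrt hc.le
  simp only [sffSq, iterCovDeriv, secondFund_smul hc hG, inducedMetric_smul, inv_smul_posDef hc hg]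
  rw [ip_smul_left, ip_comm (hg.inv.posSemidef.smul (inv_nonneg.2 hc.le)), ip_smul_left]
  have e : ∀ B : Matrix (Fin m) (Fin m) ℝ, ∀ A : (Fin 2 → Fin m) → ℝ,
      √c * (√c * ip (c⁻¹ • B) A A) = c⁻¹ * ip B A A := by
    intro B A
    rw [← mul_assoc (√c), h]
    simp only [ip, Fin.prod_univ_two, Matrix.smul_apply, smul_eq_mul, Finset.mul_sum]
    refine Finset.sum_congr rfl fun a _ => Finset.sum_congr rfl fun b _ => ?_
    field_simp
  exact e _ _

end Scaling

/-! ### A moving hypersurface as a map of space-time -/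

section Spacetime

variable {m : ℕ}

/-- The spatial coordinate directions in space-time. -/
def ssgl (n : ℕ) (i : Fin n) : ℝ × EuclideanSpace ℝ (Fin n) := (0, sgl n i)

/-- The track of a moving hypersurface. -/
def spt (K : Set (ℝ × EuclideanSpace ℝ (Fin m))) (p : ℝ × EuclideanSpace ℝ (Fin m))
    (K' : Set (ℝ × EuclideanSpace ℝ (Fin (m + 1))))
    (N : ℝ → EuclideanSpace ℝ (Fin (m + 1)) → Matrix (Fin (m + 1)) (Fin (m + 1)) ℝ)
    (ξ : ℝ → EuclideanSpace ℝ (Fin m) → EuclideanSpace ℝ (Fin (m + 1))) :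
    Imm (ℝ × EuclideanSpace ℝ (Fin m)) (ℝ × EuclideanSpace ℝ (Fin (m + 1))) (Fin m) (Fin (m + 1)) :=
  ⟨K, p, ssgl m, K', ssgl (m + 1), fun q => N q.1 q.2, fun q => (q.1, ξ q.1 q.2),
    fun q i a => pd i (ξ q.1) q.2 a, fun q a => unitNormal (N q.1) (ξ q.1) q.2 a⟩

/-- A moving immersed hypersurface in coordinates. -/
structure IsTrack (K : Set (ℝ × EuclideanSpace ℝ (Fin m)))
    (K' : Set (ℝ × EuclideanSpace ℝ (Fin (m + 1))))
    (N : ℝ → EuclideanSpace ℝ (Fin (m + 1)) → Matrix (Fin (m + 1)) (Fin (m + 1)) ℝ)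
    (ξ : ℝ → EuclideanSpace ℝ (Fin m) → EuclideanSpace ℝ (Fin (m + 1))) : Prop where
  isOpen : IsOpen K
  met' : IsMetric K' fun q => N q.1 q.2
  maps : ∀ q ∈ K, (q.1, ξ q.1 q.2) ∈ K'
  sm : ContDiffOn ℝ ∞ (fun q : ℝ × EuclideanSpace ℝ (Fin m) => ξ q.1 q.2) K
  indep : ∀ q ∈ K, LinearIndependent ℝ fun (i : Fin m) (a : Fin (m + 1)) => pd i (ξ q.1) q.2 a

variable {K : Set (ℝ × EuclideanSpace ℝ (Fin m))}
    {K' : Set (ℝ × EuclideanSpace ℝ (Fin (m + 1)))}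
    {N : ℝ → EuclideanSpace ℝ (Fin (m + 1)) → Matrix (Fin (m + 1)) (Fin (m + 1)) ℝ}
    {ξ : ℝ → EuclideanSpace ℝ (Fin m) → EuclideanSpace ℝ (Fin (m + 1))}
    (h : IsTrack K K' N ξ) {q : ℝ × EuclideanSpace ℝ (Fin m)}

lemma hasFDerivAt_inr {E : Type*} [NormedAddCommGroup E] [NormedSpace ℝ E] (t : ℝ) (z : E) (v : E) :
    fderiv ℝ (fun z : E => (t, z)) z v = (0, v) := by
  rw [(hasFDerivAt_prodMk_right t z).fderiv]; rfl

lemma ssgl_sum {n : ℕ} (v : EuclideanSpace ℝ (Fin n)) : ∑ c, v c • ssgl n c = (0, v) := by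
  have : ∀ c, v c • ssgl n c = (0, v c • sgl n c) := fun c => by simp [ssgl]
  simp only [this]
  rw [Prod.ext_iff, Prod.fst_sum, Prod.snd_sum]
  exact ⟨by simp, EuclideanSpace.sum_sgl v⟩

lemma isMetric_slice {n : ℕ} {K' : Set (ℝ × EuclideanSpace ℝ (Fin n))}
    {N : ℝ → EuclideanSpace ℝ (Fin n) → Matrix (Fin n) (Fin n) ℝ}
    (hN : IsMetric K' fun q => N q.1 q.2) (t : ℝ) :
    IsMetric {z | (t, z) ∈ K'} (N t) where
  isOpen := hN.isOpen.preimage (Continuous.prodMk_right t)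
  sm := fun i j => (hN.sm i j).comp (contDiff_prodMk_right t).contDiffOn fun _ hz => hz
  pos := fun _ hz => hN.pos _ hz

/-- The space-time geometry differentiates in spatial directions only, so on each time slice it is
the geometry of the metric at that time. -/
lemma slice_metIso {n : ℕ} {K' : Set (ℝ × EuclideanSpace ℝ (Fin n))}
    {N : ℝ → EuclideanSpace ℝ (Fin n) → Matrix (Fin n) (Fin n) ℝ}
    (hN : IsMetric K' fun q => N q.1 q.2) (t : ℝ) :
    MetIso {z | (t, z) ∈ K'} (sgl n) (N t) K' (ssgl n) (fun q => N q.1 q.2)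
      (fun z => (t, z)) fun _ => 1 where
  met₁ := isMetric_slice hN t
  met₂ := hN
  maps := fun _ hz => hz
  smooth := (contDiff_prodMk_right t).contDiffOn
  smP := fun _ _ => contDiffOn_const
  deriv := fun z _ j => by
    rw [hasFDerivAt_inr]
    simp [Matrix.one_apply, ssgl]
  tors := fun _ _ _ _ _ => by simp
  metric := fun _ _ => by simp

include h

lemma IsTrack.diff (hq : q ∈ K) :
    DifferentiableAt ℝ (fun q : ℝ × EuclideanSpace ℝ (Fin m) => ξ q.1 q.2) q :=
  (h.sm.contDiffAt (h.isOpen.mem_nhds hq)).differentiableAt (by simp)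

lemma IsTrack.pd_eq (hq : q ∈ K) (j : Fin m) : pd j (ξ q.1) q.2 =
    fderiv ℝ (fun q : ℝ × EuclideanSpace ℝ (Fin m) => ξ q.1 q.2) q (ssgl m j) :=
  (fderiv_slice (h.diff hq) (sgl m j)).symm

lemma IsTrack.fderiv_u (hq : q ∈ K) (v : ℝ × EuclideanSpace ℝ (Fin m)) :
    fderiv ℝ (fun q : ℝ × EuclideanSpace ℝ (Fin m) => (q.1, ξ q.1 q.2)) q v =
      (v.1, fderiv ℝ (fun q : ℝ × EuclideanSpace ℝ (Fin m) => ξ q.1 q.2) q v) := by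
  rw [(hasFDerivAt_fst.prodMk (h.diff hq).hasFDerivAt).fderiv]
  rfl

lemma IsTrack.second (hq : q ∈ K) (v w : ℝ × EuclideanSpace ℝ (Fin m)) (a : Fin (m + 1)) :
    fderiv ℝ (fun z => fderiv ℝ (fun q : ℝ × EuclideanSpace ℝ (Fin m) => ξ q.1 q.2) z w a) q v =
    fderiv ℝ (fun z => fderiv ℝ (fun q : ℝ × EuclideanSpace ℝ (Fin m) => ξ q.1 q.2) z v a) q w := by
  have hu := h.sm.contDiffAt (h.isOpen.mem_nhds hq)
  set u := fun q : ℝ × EuclideanSpace ℝ (Fin m) => ξ q.1 q.2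
  have h1 : DifferentiableAt ℝ (fderiv ℝ u) q :=
    (hu.fderiv_right (m := (∞ : WithTop ℕ∞)) (by simp)).differentiableAt (by simp)
  have h2 : ∀ v w, fderiv ℝ (fun z => fderiv ℝ u z w a) q v = fderiv ℝ (fderiv ℝ u) q v w a := by
    intro v w
    have h3 : HasFDerivAt (fun z => fderiv ℝ u z w) ((fderiv ℝ (fderiv ℝ u) q).flip w) q := by
      have := h1.hasFDerivAt.clm_apply (hasFDerivAt_const w q)
      simp only [ContinuousLinearMap.comp_zero, zero_add] at this
      exact this
    rw [fderiv_coord h3.differentiableAt, h3.fderiv]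
    rfl
  rw [h2, h2, (hu.isSymmSndFDerivAt
    (by rw [minSmoothness_of_isRCLikeNormedField]; exact WithTop.coe_le_coe.2 le_top)).eq]

lemma IsTrack.sm_F (i : Fin m) (a : Fin (m + 1)) :
    ContDiffOn ℝ ∞ (fun q : ℝ × EuclideanSpace ℝ (Fin m) => pd i (ξ q.1) q.2 a) K :=
  (Sliced.of_isOpen h.isOpen).sm_frame h.sm i a

lemma IsTrack.frame (hq : q ∈ K) : (spt K q K' N ξ).Frame where
  isOpen := h.isOpen
  mem := hq
  met' := h.met'
  maps := fun _ hz => h.maps _ hz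
  smu := contDiffOn_fst.prodMk h.sm
  smF := h.sm_F
  deriv := fun z hz j => by
    refine (h.fderiv_u hz _).trans ?_
    rw [show (spt K q K' N ξ).d j = ssgl m j from rfl, ← h.pd_eq hz]
    exact (ssgl_sum (pd j (ξ z.1) z.2)).symm
  tors := fun z hz i j a => by
    have e : ∀ j, (fun z : ℝ × EuclideanSpace ℝ (Fin m) => pd j (ξ z.1) z.2 a) =ᶠ[𝓝 z]
        fun z => fderiv ℝ (fun q : ℝ × EuclideanSpace ℝ (Fin m) => ξ q.1 q.2) z (ssgl m j) a := by
      intro j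
      filter_upwards [h.isOpen.mem_nhds hz] with x hx
      rw [h.pd_eq hx]
    change fderiv ℝ (fun z : ℝ × EuclideanSpace ℝ (Fin m) => pd j (ξ z.1) z.2 a) z (ssgl m i) =
      fderiv ℝ (fun z : ℝ × EuclideanSpace ℝ (Fin m) => pd i (ξ z.1) z.2 a) z (ssgl m j)
    rw [(e j).fderiv_eq, (e i).fderiv_eq, h.second hz]
  indep := h.indep
  normal := fun _ => rfl

lemma IsTrack.slice_frame (hq : q ∈ K) :
    (slice {z | (q.1, z) ∈ K} q.2 {z | (q.1, z) ∈ K'} (N q.1) (ξ q.1)).Frame := by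
  have h1 : ContDiffOn ℝ ∞ (ξ q.1) {z | (q.1, z) ∈ K} :=
    h.sm.comp (contDiff_prodMk_right q.1).contDiffOn fun _ hz => hz
  exact ExtRicciMCF.slice_frame (h.isOpen.preimage (Continuous.prodMk_right q.1)) hq
    (isMetric_slice h.met' q.1) (fun z hz => h.maps (q.1, z) hz) h1 fun z hz => h.indep (q.1, z) hz

/-- The inclusion of a time slice identifies the hypersurface at that time with the space-time
track, so norms of covariant derivatives computed on the track are those of the slice. -/
lemma IsTrack.immIso (hq : q ∈ K) (q' : ℝ × EuclideanSpace ℝ (Fin m)) (hq' : q' ∈ K) :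
    ImmIso (slice {z | (q.1, z) ∈ K} q.2 {z | (q.1, z) ∈ K'} (N q.1) (ξ q.1)) (spt K q' K' N ξ)
      (fun z => (q.1, z)) (fun _ => 1) (fun z => (q.1, z)) fun _ => 1 where
  good₁ := (h.slice_frame hq).good
  good₂ := (h.frame hq').good
  unit₁ := fun _ hz => (h.slice_frame hq).unit hz
  unit₂ := fun _ hz => (h.frame hq').unit hz
  maps := fun _ hz => hz
  smooth := (contDiff_prodMk_right q.1).contDiffOn
  smP := fun _ _ => contDiffOn_const
  deriv := fun z _ j => by
    refine (hasFDerivAt_inr q.1 z (sgl m j)).trans ?_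
    simp [Matrix.one_apply, spt, ssgl]
  tors := fun _ _ _ _ _ => by simp
  target := slice_metIso h.met' q.1
  comm := fun _ _ => rfl
  frame := fun z hz j => by
    rw [Matrix.one_mulVec]
    simp only [Matrix.one_apply, ite_smul, one_smul, zero_smul, Finset.sum_ite_eq',
      Finset.mem_univ, if_true]
    rfl

lemma IsTrack.sqIter_eq (hq : q ∈ K) (k : ℕ) {q' : ℝ × EuclideanSpace ℝ (Fin m)} (hq' : q' ∈ K) :
    (spt K q' K' N ξ).geo.sqIter k (spt K q' K' N ξ).A q = sffSq (N q.1) (ξ q.1) k q.2 := by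
  rw [sffSq_eq (h.slice_frame hq) (y := q.2) hq, (h.immIso hq q' hq').sqIter_A (y := q.2) hq]

/-- The slice and the track have the same unit normal, so pairing it with their mean curvature
vectors, which agree by naturality, compares the scalars. -/
lemma IsTrack.H_eq (hq : q ∈ K) {q' : ℝ × EuclideanSpace ℝ (Fin m)} (hq' : q' ∈ K) :
    (spt K q' K' N ξ).H q = meanCurv (N q.1) (ξ q.1) q.2 := by
  have h1 := (h.immIso hq q' hq').mean_eq (y := q.2) hq
  rw [Matrix.one_mulVec] at h1
  have h2 := congrArg (pr (N q.1 (ξ q.1 q.2)) ((spt K q' K' N ξ).e q)) h1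
  have h3 : pr (N q.1 (ξ q.1 q.2)) ((spt K q' K' N ξ).e q) ((spt K q' K' N ξ).e q) = 1 :=
    (h.frame hq').unit hq
  rw [pr_smul_right, pr_smul_right] at h2
  have h4 : pr (N q.1 (ξ q.1 q.2)) ((spt K q' K' N ξ).e q)
      ((slice {z | (q.1, z) ∈ K} q.2 {z | (q.1, z) ∈ K'} (N q.1) (ξ q.1)).e q.2) = 1 := h3
  rw [h4, h3, mul_one, mul_one] at h2
  exact h2.symm.trans (slice_H (u := ξ q.1) (h.slice_frame hq).isOpen (h.slice_frame hq).smu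
    (y := q.2) hq).symm

/-- The track of a mean curvature flow. -/
lemma IsTrack.flow (hmcf : ∀ q ∈ K,
      fderiv ℝ (fun q : ℝ × EuclideanSpace ℝ (Fin m) => ξ q.1 q.2) q (1, 0) =
        meanCurv (N q.1) (ξ q.1) q.2 • unitNormal (N q.1) (ξ q.1) q.2)
    {η : ℝ × EuclideanSpace ℝ (Fin (m + 1)) → (Fin 2 → Fin (m + 1)) → ℝ}
    (hη : ∀ q ∈ K', ∀ a b, fderiv ℝ (fun z : ℝ × EuclideanSpace ℝ (Fin (m + 1)) => N z.1 z.2 a b) q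
      (1, 0) = η q ![a, b]) (hq : q ∈ K) :
    (spt K q K' N ξ).Flow (1, 0) (1, 0) η where
  good := (h.frame hq).good
  unit := fun _ hz => (h.frame hq).unit hz
  vel := fun z hz => by
    have e1 : ∑ c, ((spt K q K' N ξ).H z * (spt K q K' N ξ).e z c) • (spt K q K' N ξ).d' c =
        (0, meanCurv (N z.1) (ξ z.1) z.2 • unitNormal (N z.1) (ξ z.1) z.2) := by
      rw [h.H_eq hz hq]
      exact ssgl_sum (meanCurv (N z.1) (ξ z.1) z.2 • unitNormal (N z.1) (ξ z.1) z.2)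
    rw [e1, ← hmcf z hz]
    refine (h.fderiv_u hz _).trans ?_
    simp
  Fdot := fun z hz j a => by
    have e1 : (fun z : ℝ × EuclideanSpace ℝ (Fin m) => pd j (ξ z.1) z.2 a) =ᶠ[𝓝 z]
        fun z => fderiv ℝ (fun q : ℝ × EuclideanSpace ℝ (Fin m) => ξ q.1 q.2) z (ssgl m j) a := by
      filter_upwards [h.isOpen.mem_nhds hz] with x hx
      rw [h.pd_eq hx]
    have e2 : (fun z => (spt K q K' N ξ).H z * (spt K q K' N ξ).e z a) =ᶠ[𝓝 z]
        fun z => fderiv ℝ (fun q : ℝ × EuclideanSpace ℝ (Fin m) => ξ q.1 q.2) z (1, 0) a := by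
      filter_upwards [h.isOpen.mem_nhds hz] with x hx
      rw [hmcf x hx, h.H_eq hx hq]
      rfl
    change fderiv ℝ (fun z : ℝ × EuclideanSpace ℝ (Fin m) => pd j (ξ z.1) z.2 a) z (1, 0) = _
    rw [e1.fderiv_eq, e2.fderiv_eq, h.second hz]
    rfl
  metdot := hη

end Spacetime

/-! ### Derivatives at a maximum; the metric as a parallel tensor -/

section MaximumPrinciple

variable {D : Type} [Fintype D] [DecidableEq D] {E : Type*} [NormedAddCommGroup E] [NormedSpace ℝ E]

/-- The second derivative is nonpositive at a maximum. -/
lemma second_deriv_nonpos {φ : E → ℝ} {y v : E} (hφ : ContDiffAt ℝ ∞ φ y)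
    (hmax : IsLocalMax (fun t : ℝ => φ (y + t • v)) 0) :
    fderiv ℝ (fun z => fderiv ℝ φ z v) y v ≤ 0 := by
  have hl : ∀ t : ℝ, HasDerivAt (fun t : ℝ => y + t • v) v t := fun t => by
    simpa using ((hasDerivAt_id t).smul_const v).const_add y
  have hd : ∀ᶠ t in 𝓝 (0 : ℝ), DifferentiableAt ℝ φ (y + t • v) := by
    have h1 : ∀ᶠ z in 𝓝 (y + (0 : ℝ) • v), ContDiffAt ℝ 1 φ z := by
      rw [zero_smul, add_zero]
      exact (hφ.of_le (WithTop.coe_le_coe.2 le_top)).eventually (by simp)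
    filter_upwards [(hl 0).continuousAt.eventually h1] with t ht using ht.differentiableAt (by simp)
  have e1 : deriv (fun t : ℝ => φ (y + t • v)) =ᶠ[𝓝 0] fun t => fderiv ℝ φ (y + t • v) v := by
    filter_upwards [hd] with t ht using (ht.hasFDerivAt.comp_hasDerivAt t (hl t)).deriv
  have h2 : DifferentiableAt ℝ (fun z => fderiv ℝ φ z v) (y + (0 : ℝ) • v) := by
    rw [zero_smul, add_zero]
    exact ((hφ.fderiv_right (m := (∞ : WithTop ℕ∞)) (by simp)).differentiableAt (by simp)).clm_apply
      (differentiableAt_const v)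
  have e2 : deriv (deriv fun t : ℝ => φ (y + t • v)) 0 = fderiv ℝ (fun z => fderiv ℝ φ z v) y v := by
    rw [e1.deriv_eq]
    have := (h2.hasFDerivAt.comp_hasDerivAt 0 (hl 0)).deriv
    simp only [zero_smul, add_zero] at this
    exact this
  -- A positive second derivative would make the point a local minimum as well, so the function
  -- would be locally constant and its second derivative zero.
  by_contra! hpos
  rw [← e2] at hpos
  have hc : ContinuousAt (fun t : ℝ => φ (y + t • v)) 0 :=
    (hd.self_of_nhds.hasFDerivAt.comp_hasDerivAt 0 (hl 0)).continuousAt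
  have hmin := isLocalMin_of_deriv_deriv_pos hpos hmax.deriv_eq_zero hc
  have e3 : (fun t : ℝ => φ (y + t • v)) =ᶠ[𝓝 0] fun _ => φ (y + (0 : ℝ) • v) := by
    filter_upwards [hmin, hmax] with t h1 h2 using le_antisymm h2 h1
  have e4 := e3.deriv.deriv_eq
  simp only [deriv_const', deriv_const] at e4
  exact hpos.ne' e4

/-- The Laplacian is nonpositive at a maximum. -/
lemma Geo.Good.lapFun_nonpos {G : Geo E D} (hG : G.Good) {φ : E → ℝ} (hφ : ContDiffOn ℝ ∞ φ G.Ω)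
    (hmax : ∀ c : D → ℝ, IsLocalMax (fun t : ℝ => φ (G.pt + t • ∑ i, c i • G.d i)) 0) :
    G.lapFun φ G.pt ≤ 0 := by
  have hφ' := hφ.contDiffAt (hG.isOpen.mem_nhds hG.mem)
  have hdφ := hφ'.differentiableAt (by simp)
  have h0 : ∀ l, fderiv ℝ φ G.pt (G.d l) = 0 := fun l => by
    have h1 := (hmax (Pi.single l 1)).hasDerivAt_eq_zero (f' := fderiv ℝ φ G.pt (G.d l))
    apply h1
    have h2 : HasDerivAt (fun t : ℝ => G.pt + t • G.d l) (G.d l) 0 := by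
      simpa using ((hasDerivAt_id (0 : ℝ)).smul_const (G.d l)).const_add G.pt
    have h3 : DifferentiableAt ℝ φ (G.pt + (0 : ℝ) • G.d l) := by simpa using hdφ
    have h4 := h3.hasFDerivAt.comp_hasDerivAt 0 h2
    simp only [Pi.single_apply, ite_smul, one_smul, zero_smul, Finset.sum_ite_eq', Finset.mem_univ,
      if_true, add_zero] at h4 ⊢
    exact h4
  obtain ⟨Q, hQ⟩ := exists_factor (hG.psd _ hG.mem)
  have hd2 : DifferentiableAt ℝ (fderiv ℝ φ) G.pt :=
    (hφ'.fderiv_right (m := (∞ : WithTop ℕ∞)) (by simp)).differentiableAt (by simp)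
  have e1 : ∀ v w, fderiv ℝ (fun z => fderiv ℝ φ z w) G.pt v = fderiv ℝ (fderiv ℝ φ) G.pt v w := by
    intro v w
    have := (hd2.hasFDerivAt.clm_apply (hasFDerivAt_const w G.pt)).fderiv
    rw [this]
    simp
  -- The gradient terms vanish at the maximum, and with `B = Q Qᵀ` the Laplacian becomes a sum of
  -- second derivatives along single directions.
  have e2 : G.lapFun φ G.pt = ∑ c, fderiv ℝ (fderiv ℝ φ) G.pt (∑ i, Q i c • G.d i)
      (∑ i, Q i c • G.d i) := by
    simp only [Geo.lapFun, h0, e1, mul_zero, Finset.sum_const_zero, sub_zero, hQ, Matrix.mul_apply,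
      Matrix.transpose_apply, map_sum, map_smul, sum_apply, smul_apply, smul_eq_mul, Finset.mul_sum,
      Finset.sum_mul]
    calc _ = ∑ i, ∑ c, ∑ j, Q i c * Q j c * fderiv ℝ (fderiv ℝ φ) G.pt (G.d i) (G.d j) :=
          Finset.sum_congr rfl fun i _ => Finset.sum_comm
      _ = ∑ c, ∑ i, ∑ j, Q i c * Q j c * fderiv ℝ (fderiv ℝ φ) G.pt (G.d i) (G.d j) :=
          Finset.sum_comm
      _ = ∑ c, ∑ j, ∑ i, Q i c * Q j c * fderiv ℝ (fderiv ℝ φ) G.pt (G.d i) (G.d j) :=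
          Finset.sum_congr rfl fun c _ => Finset.sum_comm
      _ = _ := Finset.sum_congr rfl fun c _ => Finset.sum_congr rfl fun j _ =>
          Finset.sum_congr rfl fun i _ => by ring
  rw [e2]
  exact Finset.sum_nonpos fun c _ => by
    rw [← e1]; exact second_deriv_nonpos hφ' (hmax fun i => Q i c)

lemma Geo.Good.lapFun_add_mul {G : Geo E D} (hG : G.Good) {φ χ : E → ℝ}
    (hφ : ContDiffOn ℝ ∞ φ G.Ω) (hχ : ContDiffOn ℝ ∞ χ G.Ω) (N : ℝ) :
    G.lapFun (fun z => φ z + N * χ z) G.pt = G.lapFun φ G.pt + N * G.lapFun χ G.pt := by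
  have d1 : ∀ {φ : E → ℝ}, ContDiffOn ℝ ∞ φ G.Ω → ∀ z ∈ G.Ω, DifferentiableAt ℝ φ z :=
    fun h z hz => (h.contDiffAt (hG.isOpen.mem_nhds hz)).differentiableAt (by simp)
  have e1 : ∀ {φ χ : E → ℝ}, ContDiffOn ℝ ∞ φ G.Ω → ContDiffOn ℝ ∞ χ G.Ω → ∀ z ∈ G.Ω, ∀ v,
      fderiv ℝ (fun z => φ z + N * χ z) z v = fderiv ℝ φ z v + N * fderiv ℝ χ z v := by
    intro φ χ hφ hχ z hz v
    have h1 : HasFDerivAt (fun z => φ z + N * χ z) (fderiv ℝ φ z + N • fderiv ℝ χ z) z :=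
      (d1 hφ z hz).hasFDerivAt.add ((d1 hχ z hz).hasFDerivAt.const_mul N)
    rw [h1.fderiv]
    rfl
  have e2 : ∀ i j, fderiv ℝ (fun z => fderiv ℝ (fun z => φ z + N * χ z) z (G.d j)) G.pt (G.d i) =
      fderiv ℝ (fun z => fderiv ℝ φ z (G.d j)) G.pt (G.d i) +
        N * fderiv ℝ (fun z => fderiv ℝ χ z (G.d j)) G.pt (G.d i) := by
    intro i j
    have h1 : (fun z => fderiv ℝ (fun z => φ z + N * χ z) z (G.d j)) =ᶠ[𝓝 G.pt]
        fun z => fderiv ℝ φ z (G.d j) + N * fderiv ℝ χ z (G.d j) := by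
      filter_upwards [hG.isOpen.mem_nhds hG.mem] with z hz using e1 hφ hχ z hz _
    rw [h1.fderiv_eq, e1 (contDiffOn_fderiv_apply hG.isOpen hφ _)
      (contDiffOn_fderiv_apply hG.isOpen hχ _) _ hG.mem]
  simp only [Geo.lapFun, e1 hφ hχ _ hG.mem, e2, Finset.mul_sum, ← Finset.sum_add_distrib]
  refine Finset.sum_congr rfl fun i _ => Finset.sum_congr rfl fun j _ => ?_
  have : ∑ l, G.Γ G.pt l i j * (fderiv ℝ φ G.pt (G.d l) + N * fderiv ℝ χ G.pt (G.d l)) =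
      ∑ l, G.Γ G.pt l i j * fderiv ℝ φ G.pt (G.d l) +
      N * ∑ l, G.Γ G.pt l i j * fderiv ℝ χ G.pt (G.d l) := by
    rw [Finset.mul_sum, ← Finset.sum_add_distrib]
    exact Finset.sum_congr rfl fun l _ => by ring
  rw [this]
  ring

/-- The metric, as a tensor. -/
def mtens (A : E → Matrix D D ℝ) (y : E) (L : Fin 2 → D) : ℝ := A y (L 0) (L 1)

lemma IsMetric.nab_mtens {Ω : Set E} {A : E → Matrix D D ℝ} (h : IsMetric Ω A) {d : D → E} {y : E}
    (hy : y ∈ Ω) : nab d (chr d A) (mtens A) y = 0 := by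
  ext J
  simp only [nab, der, Fin.sum_univ_two, Pi.zero_apply]
  change fderiv ℝ (fun z => A z (J (some 0)) (J (some 1))) y _ - _ = 0
  rw [h.fderiv_eq_chr hy, Finset.sum_add_distrib]
  simp [mtens, Function.update_of_ne]

/-- The metric is parallel and its norm is the square root of the dimension. It enters the ambient
velocity by differentiation of the factor `e^s`. -/
lemma UL.mtens {Θ : Type*} {Ω : Θ → Set E} {pt : Θ → E} {d : Θ → D → E} {A : Θ → E → Matrix D D ℝ}
    (h : ∀ θ, IsMetric (Ω θ) (A θ)) (hpt : ∀ θ, pt θ ∈ Ω θ) (n : ℕ) :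
    UL (fun θ => lc (Ω θ) (pt θ) (d θ) (A θ)) 1 n fun θ => mtens (A θ) := by
  have hG : ∀ θ, (lc (Ω θ) (pt θ) (d θ) (A θ)).Good := fun θ => (h θ).good _ (hpt θ)
  have hsm : ∀ θ, Sm (lc (Ω θ) (pt θ) (d θ) (A θ)).Ω (ExtRicciMCF.mtens (A θ)) :=
    fun θ L => (h θ).sm _ _
  have hb : ∀ θ, (lc (Ω θ) (pt θ) (d θ) (A θ)).nm (ExtRicciMCF.mtens (A θ)) ≤
      Real.sqrt (Fintype.card D) := by
    intro θ
    refine Real.sqrt_le_sqrt (le_of_eq ?_)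
    change ip (A θ (pt θ))⁻¹ _ _ = _
    obtain ⟨Q, hQ⟩ := exists_factor ((h θ).pos _ (hpt θ)).inv.posSemidef
    have e1 : Q.transpose * A θ (pt θ) * Q = 1 := by
      rw [mul_eq_one_comm, ← Matrix.mul_assoc, ← hQ, (h θ).inv_mul (hpt θ)]
    have e2 : ∀ i j, pull Q (ExtRicciMCF.mtens (A θ) (pt θ)) ![i, j] = (1 : Matrix D D ℝ) i j := by
      intro i j
      rw [← e1]
      simp only [pull_cons, pull_nil, Matrix.mul_apply, Matrix.transpose_apply, Finset.sum_mul,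
        Finset.mul_sum]
      rw [Finset.sum_comm]
      refine Finset.sum_congr rfl fun b _ => Finset.sum_congr rfl fun a _ => ?_
      change _ * (_ * A θ (pt θ) a b) = _
      ring
    rw [ip_factor hQ, sum_cons_fun, Finset.sum_congr rfl fun i _ => sum_cons_fun (n := 0) _]
    have e3 : ∀ i j, ∑ I : Fin 0 → D,
        pull Q (ExtRicciMCF.mtens (A θ) (pt θ)) (Matrix.vecCons i (Matrix.vecCons j I)) *
        pull Q (ExtRicciMCF.mtens (A θ) (pt θ)) (Matrix.vecCons i (Matrix.vecCons j I)) =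
        (1 : Matrix D D ℝ) i j := fun i j => by
      rw [Fintype.sum_subsingleton _ ![], e2]
      simp [Matrix.one_apply]
    refine (Finset.sum_congr rfl fun i _ => Finset.sum_congr rfl fun j _ => e3 i j).trans ?_
    change ∑ i : D, ∑ j : D, (1 : Matrix D D ℝ) i j = _
    simp only [Matrix.one_apply, Finset.sum_ite_eq, Finset.mem_univ, if_true, Finset.sum_const,
      Finset.card_univ, nsmul_eq_mul, mul_one]
  cases n with
  | zero => exact ⟨hsm, _, fun θ => (hb θ).trans_eq (mul_one _).symm⟩
  | succ n =>
    exact ⟨hsm, ⟨_, hb⟩, (UL.zero hG).congr hG fun θ y hy => (h θ).nab_mtens hy⟩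

end MaximumPrinciple

/-! ### Time-dependent maps in charts -/

section Families

variable {n n' : ℕ} {A B : Type*} [TopologicalSpace A] [ChartedSpace (EuclideanSpace ℝ (Fin n)) A]
  [TopologicalSpace B] [ChartedSpace (EuclideanSpace ℝ (Fin n')) B]

/-- The domain of a moving map in the charts at `a` and `b`. -/
def fdom (n n' : ℕ) {A B : Type*} [TopologicalSpace A] [ChartedSpace (EuclideanSpace ℝ (Fin n)) A]
    [TopologicalSpace B] [ChartedSpace (EuclideanSpace ℝ (Fin n')) B] (J : Set ℝ) (F : ℝ → A → B)
    (a : A) (b : B) : Set (ℝ × EuclideanSpace ℝ (Fin n)) :=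
  {q | q.1 ∈ J ∧ q.2 ∈ dom n n' (F q.1) a b}

variable [IsManifold (𝓡 n) ∞ A] [IsManifold (𝓡 n') ∞ B] {J : Set ℝ} {F : ℝ → A → B}
  (hF : ContMDiffOn (𝓘(ℝ, ℝ).prod (𝓡 n)) (𝓡 n') ∞ (fun q : ℝ × A => F q.1 q.2) (J ×ˢ univ))
  {a : A} {b : B}
include hF

lemma family_contMDiff {t : ℝ} (ht : t ∈ J) : ContMDiff (𝓡 n) (𝓡 n') ∞ (F t) := by
  rw [← contMDiffOn_univ]
  exact hF.comp (contMDiff_const.prodMk contMDiff_id).contMDiffOn fun p _ => ⟨ht, mem_univ p⟩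

lemma contMDiffOn_lift (a : A) : ContMDiffOn 𝓘(ℝ, ℝ × EuclideanSpace ℝ (Fin n)) (𝓡 n') ∞
    (fun q : ℝ × EuclideanSpace ℝ (Fin n) => F q.1 ((cht n a).symm q.2))
    (J ×ˢ (cht n a).target) := by
  have h1 : ContMDiffOn 𝓘(ℝ, ℝ × EuclideanSpace ℝ (Fin n)) (𝓡 n) ∞
      (fun q : ℝ × EuclideanSpace ℝ (Fin n) => (cht n a).symm q.2) (J ×ˢ (cht n a).target) :=
    (contMDiffOn_chart_symm (n := ∞)).comp contDiff_snd.contMDiff.contMDiffOn fun _ h => h.2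
  exact hF.comp ((contDiff_fst.contMDiff.contMDiffOn).prodMk h1) fun q hq => ⟨hq.1, mem_univ _⟩

/-- Relative openness follows from continuity of the map in space and time. It gives openness when
`J` is open, and unique differentiability when `J` contains its initial time. -/
lemma fdom_eq : ∃ u, IsOpen u ∧ fdom n n' J F a b = (J ×ˢ (cht n a).target) ∩ u := by
  obtain ⟨u, hu, h⟩ := continuousOn_iff'.1 (contMDiffOn_lift hF a).continuousOn _
    (cht n' b).open_source
  refine ⟨u, hu, ?_⟩
  rw [inter_comm _ u, ← h, inter_comm]
  ext q
  exact ⟨fun h => ⟨⟨h.1, h.2.1⟩, h.2.2⟩, fun h => ⟨h.1.1, h.1.2, h.2⟩⟩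

lemma sm_fdom : ContDiffOn ℝ ∞ (fun q : ℝ × EuclideanSpace ℝ (Fin n) => rep n n' (F q.1) a b q.2)
    (fdom n n' J F a b) :=
  contDiffOn_cht ((contMDiffOn_lift hF a).mono fun _ h => ⟨h.1, h.2.1⟩) fun _ h => h.2.2

lemma isOpen_fdom (hJ : IsOpen J) : IsOpen (fdom n n' J F a b) := by
  obtain ⟨u, hu, h⟩ := fdom_eq hF (a := a) (b := b)
  rw [h]
  exact (hJ.prod (cht n a).open_target).inter hu

lemma sliced_fdom (hJ : UniqueDiffOn ℝ J) : Sliced (fdom n n' J F a b) where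
  uniq := by
    obtain ⟨u, hu, h⟩ := fdom_eq hF (a := a) (b := b)
    rw [h]
    exact (hJ.prod (cht n a).open_target.uniqueDiffOn).inter hu
  nhds := fun q hq => by
    have h1 : IsOpen (dom n n' (F q.1) a b) := isOpen_dom (family_contMDiff hF hq.1).continuous
    filter_upwards [h1.mem_nhds hq.2] with z hz using ⟨hq.1, hz⟩

end Families

/-! ### Hypersurfaces in charts: independence of charts and isometries -/

section Hypersurfaces

variable {m : ℕ} {M : Type*} [TopologicalSpace M] [ChartedSpace (EuclideanSpace ℝ (Fin (m + 1))) M]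
  [IsManifold (𝓡 (m + 1)) ∞ M] {S : Type*} [TopologicalSpace S]
  [ChartedSpace (EuclideanSpace ℝ (Fin m)) S] [IsManifold (𝓡 m) ∞ S]

lemma hyp_frame (g : RMetric (m + 1) M) {c : ℝ} (hc : 0 < c) {X : S → M}
    (hX : ContMDiff (𝓡 m) (𝓡 (m + 1)) ∞ X)
    (himm : ∀ p, Function.Injective (mfderiv (𝓡 m) (𝓡 (m + 1)) X p)) {a : S} {b : M}
    {Ω : Set (EuclideanSpace ℝ (Fin m))} {Ω' : Set (EuclideanSpace ℝ (Fin (m + 1)))}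
    (hΩ : IsOpen Ω) (hΩ' : IsOpen Ω') (h₁ : Ω ⊆ dom m (m + 1) X a b) (h₂ : Ω' ⊆ (cht (m + 1) b).target)
    (hm : MapsTo (rep m (m + 1) X a b) Ω Ω') {y : EuclideanSpace ℝ (Fin m)} (hy : y ∈ Ω) :
    (slice Ω y Ω' (fun z => c • chartMetric g b z) (rep m (m + 1) X a b)).Frame :=
  slice_frame hΩ hy ⟨hΩ', fun i j => contDiffOn_const.mul ((sm_chartMetric g b i j).mono h₂),
    fun z hz => ((isMetric_chartMetric g b).pos z (h₂ hz)).smul hc⟩ hm ((contDiffOn_rep hX).mono h₁)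
    fun _ hz => linearIndependent_rep hX (himm _) (h₁ hz)

lemma inducedMetric_posDef (g : RMetric (m + 1) M) {X : S → M}
    (hX : ContMDiff (𝓡 m) (𝓡 (m + 1)) ∞ X)
    (himm : ∀ p, Function.Injective (mfderiv (𝓡 m) (𝓡 (m + 1)) X p)) {a : S} {b : M}
    {y : EuclideanSpace ℝ (Fin m)} (hy : y ∈ dom m (m + 1) X a b) :
    (inducedMetric (chartMetric g b) (rep m (m + 1) X a b) y).PosDef :=
  gram_posDef ((isMetric_chartMetric g b).pos _ (rep_mem hy)) (linearIndependent_rep hX (himm _) hy)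

lemma ctr_mem_dom (X : S → M) (p : S) : ctr m p ∈ dom m (m + 1) X p (X p) :=
  ⟨ctr_mem p, by
    change X ((cht m p).symm (ctr m p)) ∈ (cht (m + 1) (X p)).source
    rw [cht_symm_ctr]; exact mem_chart_source _ _⟩

lemma normCovSecondFund_sq (g : RMetric (m + 1) M) {X : S → M}
    (hX : ContMDiff (𝓡 m) (𝓡 (m + 1)) ∞ X)
    (himm : ∀ p, Function.Injective (mfderiv (𝓡 m) (𝓡 (m + 1)) X p)) (k : ℕ) (p : S) :
    normCovSecondFund g X k p ^ 2 =
      sffSq (chartMetric g (X p)) (rep m (m + 1) X p (X p)) k (ctr m p) :=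
  nrm_sq (inducedMetric_posDef g hX himm (ctr_mem_dom X p)).inv.posSemidef _

lemma meanCurv_eq {Ω : Set (EuclideanSpace ℝ (Fin m))} {y₁ y : EuclideanSpace ℝ (Fin m)}
    {Ω' : Set (EuclideanSpace ℝ (Fin (m + 1)))}
    {G : EuclideanSpace ℝ (Fin (m + 1)) → Matrix (Fin (m + 1)) (Fin (m + 1)) ℝ}
    {u : EuclideanSpace ℝ (Fin m) → EuclideanSpace ℝ (Fin (m + 1))}
    (h : (slice Ω y₁ Ω' G u).Frame) (hy : y ∈ Ω) : meanCurv G u y = (slice Ω y₁ Ω' G u).H y :=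
  slice_H h.isOpen h.smu hy

/-- Naturality of the geometry of hypersurfaces under isometries of the ambient manifold and under
changes of charts. -/
lemma hyp_iso {g₁ g₂ : RMetric (m + 1) M} {c₁ c₂ : ℝ} (hc₁ : 0 < c₁) (hc₂ : 0 < c₂) {Ψ : M → M}
    (hΨ : ContMDiff (𝓡 (m + 1)) (𝓡 (m + 1)) ∞ Ψ)
    (hg : ∀ (p : M) (v v' : TangentSpace (𝓡 (m + 1)) p), c₁ * g₁.inner p v v' =
      c₂ * g₂.inner (Ψ p) (mfderiv (𝓡 (m + 1)) (𝓡 (m + 1)) Ψ p v)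
        (mfderiv (𝓡 (m + 1)) (𝓡 (m + 1)) Ψ p v'))
    {X : S → M} (hX : ContMDiff (𝓡 m) (𝓡 (m + 1)) ∞ X)
    (himm : ∀ p, Function.Injective (mfderiv (𝓡 m) (𝓡 (m + 1)) X p)) {X₂ : S → M} (hX₂ : X₂ = Ψ ∘ X)
    {a a' : S} {b b' : M} {y : EuclideanSpace ℝ (Fin m)} (hy : y ∈ dom m (m + 1) X a b)
    (ha' : (cht m a).symm y ∈ (cht m a').source)
    (hb' : Ψ (X ((cht m a).symm y)) ∈ (cht (m + 1) b').source) :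
    (∀ k, sffSq (fun z => c₁ • chartMetric g₁ b z) (rep m (m + 1) X a b) k y =
      sffSq (fun z => c₂ • chartMetric g₂ b' z) (rep m (m + 1) X₂ a' b') k
        (cht m a' ((cht m a).symm y))) ∧
    fderiv ℝ (rep (m + 1) (m + 1) Ψ b b') (rep m (m + 1) X a b y)
      (meanCurv (fun z => c₁ • chartMetric g₁ b z) (rep m (m + 1) X a b) y •
        unitNormal (fun z => c₁ • chartMetric g₁ b z) (rep m (m + 1) X a b) y) =
      meanCurv (fun z => c₂ • chartMetric g₂ b' z) (rep m (m + 1) X₂ a' b')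
        (cht m a' ((cht m a).symm y)) •
        unitNormal (fun z => c₂ • chartMetric g₂ b' z) (rep m (m + 1) X₂ a' b')
          (cht m a' ((cht m a).symm y)) := by
  subst hX₂
  have hX₂ : ContMDiff (𝓡 m) (𝓡 (m + 1)) ∞ (Ψ ∘ X) := hΨ.comp hX
  have hid : ContMDiff (𝓡 m) (𝓡 m) ∞ (id : S → S) := contMDiff_id
  have himm₂ : ∀ p, Function.Injective (mfderiv (𝓡 m) (𝓡 (m + 1)) (Ψ ∘ X) p) := fun p => by
    rw [mfderiv_comp p (hΨ.mdifferentiableAt (by simp)) (hX.mdifferentiableAt (by simp))]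
    -- A map that pulls a metric back to a positive definite form has injective differential.
    have hΨi : Function.Injective (mfderiv (𝓡 (m + 1)) (𝓡 (m + 1)) Ψ (X p)) := by
      refine (injective_iff_map_eq_zero _).2 fun v hv => ?_
      by_contra h0
      have h1 := hg (X p) v v
      rw [hv] at h1
      have h2 := mul_pos hc₁ (g₁.pos (X p) v h0)
      rw [h1] at h2
      simp at h2
    exact fun v w hvw => himm p (hΨi hvw)
  have hI := metIso_rep hc₁ hc₂ hΨ hg b b'
  -- The domain is shrunk so that the immersion, the change of source charts and the composite with
  -- `Ψ` are all expressed in the given charts.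
  set Ω₁ : Set (EuclideanSpace ℝ (Fin m)) := dom m (m + 1) X a b ∩ dom m m (id : S → S) a a' ∩
    dom m (m + 1) (Ψ ∘ X) a b' with hΩ₁
  have ho : IsOpen Ω₁ := ((isOpen_dom hX.continuous).inter (isOpen_dom continuous_id)).inter
    (isOpen_dom hX₂.continuous)
  have hy₁ : y ∈ Ω₁ := ⟨⟨hy, hy.1, ha'⟩, hy.1, hb'⟩
  have hsymm : ∀ z ∈ Ω₁, (cht m a').symm (rep m m (id : S → S) a a' z) = (cht m a).symm z :=
    fun z hz => cht_symm_rep hz.1.2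
  have hκ : MapsTo (rep m m (id : S → S) a a') Ω₁ (dom m (m + 1) (Ψ ∘ X) a' b') := fun z hz => by
    refine ⟨rep_mem hz.1.2, ?_⟩
    change Ψ (X ((cht m a').symm (rep m m (id : S → S) a a' z))) ∈ (cht (m + 1) b').source
    rw [hsymm z hz]
    exact hz.2.2
  have h₁ := hyp_frame g₁ hc₁ hX himm (a := a) (b := b) (Ω' := dom (m + 1) (m + 1) Ψ b b') ho
    (isOpen_dom hΨ.continuous) (fun z hz => hz.1.1) inter_subset_left (fun z hz => by
      refine ⟨rep_mem hz.1.1, ?_⟩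
      change Ψ ((cht (m + 1) b).symm (rep m (m + 1) X a b z)) ∈ (cht (m + 1) b').source
      rw [cht_symm_rep hz.1.1]
      exact hz.2.2) hy₁
  have h₂ := hyp_frame g₂ hc₂ hX₂ himm₂ (a := a') (b := b') (isOpen_dom hX₂.continuous)
    (cht (m + 1) b').open_target subset_rfl subset_rfl (fun z hz => rep_mem hz) (hκ hy₁)
  have hiso := slice_immIso h₁ h₂ hκ ((contDiffOn_rep hid).mono fun z hz => hz.1.2) hI fun z hz => by
    change cht (m + 1) b' (Ψ (X ((cht m a').symm _))) = cht (m + 1) b' (Ψ ((cht (m + 1) b).symm _))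
    rw [hsymm z hz, cht_symm_rep hz.1.1]
  refine ⟨fun k => ?_, ?_⟩
  · rw [sffSq_eq h₁ hy₁, hiso.sqIter_A (y := y) hy₁]
    exact (sffSq_eq h₂ (hκ hy₁) k).symm
  · have h3 := hiso.mean_eq (y := y) hy₁
    change _ = meanCurv _ _ (rep m m (id : S → S) a a' y) • unitNormal _ _ _
    rw [meanCurv_eq h₁ hy₁, meanCurv_eq h₂ (hκ hy₁)]
    generalize hv : (_ : ℝ) • unitNormal (fun z => c₁ • chartMetric g₁ b z) (rep m (m + 1) X a b) y = v
    ext k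
    have h4 := congrFun h3 k
    have e3 : fderiv ℝ (rep (m + 1) (m + 1) Ψ b b') (rep m (m + 1) X a b y) v k =
        (jac (rep (m + 1) (m + 1) Ψ b b') (rep m (m + 1) X a b y)).mulVec (WithLp.ofLp v) k := by
      conv_lhs => rw [← EuclideanSpace.sum_sgl v, map_sum]
      simp only [map_smul, WithLp.ofLp_sum, WithLp.ofLp_smul, Finset.sum_apply, Pi.smul_apply,
        smul_eq_mul, Matrix.mulVec, dotProduct]
      exact Finset.sum_congr rfl fun i _ => mul_comm _ _
    rw [e3, ← hv]
    exact h4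

end Hypersurfaces

/-! ### Curvature and `dw ⊗ dw` as tensor fields in coordinates -/

section Tensors

variable {D : Type} [Fintype D] [DecidableEq D] {E : Type*} [NormedAddCommGroup E] [NormedSpace ℝ E]

lemma lc_sqIter (Ω Ω' : Set E) (pt pt' : E) (d : D → E) (A : E → Matrix D D ℝ) (k : ℕ) {ι : Type}
    [Fintype ι] [DecidableEq ι] (T : E → (ι → D) → ℝ) :
    (lc Ω pt d A).sqIter k T = (lc Ω' pt' d A).sqIter k T := by
  induction k generalizing ι with
  | zero => rfl
  | succ k ih => exact ih _

lemma IsMetric.sm_rmC {Ω : Set E} {A : E → Matrix D D ℝ} (h : IsMetric Ω A) (d : D → E) :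
    Sm Ω (rmC d A) := fun _ => ContDiffOn.sum fun _ _ => (h.sm _ _).mul <|
  ((contDiffOn_fderiv_apply h.isOpen (h.sm_chr d _ _ _) _).sub
    (contDiffOn_fderiv_apply h.isOpen (h.sm_chr d _ _ _) _)).add <|
    ContDiffOn.sum fun _ _ => ((h.sm_chr d _ _ _).mul (h.sm_chr d _ _ _)).sub
      ((h.sm_chr d _ _ _).mul (h.sm_chr d _ _ _))

lemma pull_two {D' : Type} [Fintype D'] [DecidableEq D'] (P : Matrix D D' ℝ)
    (T : (Fin 2 → D) → ℝ) (i j : D') :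
    pull P T ![i, j] = ∑ l, (∑ k, P k i * T ![k, l]) * P l j := by
  simp only [pull_cons, pull_nil, Finset.mul_sum, Finset.sum_mul]
  rw [Finset.sum_comm]
  exact Finset.sum_congr rfl fun l _ => Finset.sum_congr rfl fun k _ => by ring

variable {n : ℕ}

lemma sm_diffSq {w : EuclideanSpace ℝ (Fin n) → ℝ} {U : Set (EuclideanSpace ℝ (Fin n))}
    (hU : IsOpen U) (hw : ContDiffOn ℝ ∞ w U) : Sm U (diffSq w) := fun _ =>
  (contDiffOn_fderiv_apply hU hw _).mul (contDiffOn_fderiv_apply hU hw _)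

lemma diffSq_comp {w w' : EuclideanSpace ℝ (Fin n) → ℝ}
    {κ : EuclideanSpace ℝ (Fin n) → EuclideanSpace ℝ (Fin n)} {y : EuclideanSpace ℝ (Fin n)}
    (hw' : DifferentiableAt ℝ w' (κ y)) (hκ : DifferentiableAt ℝ κ y)
    (e : w =ᶠ[𝓝 y] fun z => w' (κ z)) : diffSq w y = pull (jac κ y) (diffSq w' (κ y)) := by
  have h1 : ∀ i, pd i w y = ∑ k, jac κ y k i * pd k w' (κ y) := by
    intro i
    have h2 : fderiv ℝ w y = (fderiv ℝ w' (κ y)).comp (fderiv ℝ κ y) := by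
      rw [e.fderiv_eq]; exact fderiv_comp y hw' hκ
    have h3 : pd i w y = fderiv ℝ w' (κ y) (pd i κ y) := DFunLike.congr_fun h2 (sgl n i)
    rw [h3, ← EuclideanSpace.sum_sgl (pd i κ y), map_sum]
    simp only [map_smul, smul_eq_mul]
    rfl
  ext L
  have hL : L = ![L 0, L 1] := by ext s; fin_cases s <;> rfl
  rw [hL, pull_two]
  simp only [diffSq, h1, Matrix.cons_val_zero, Matrix.cons_val_one]
  rw [Finset.sum_mul_sum, Finset.sum_comm]
  refine Finset.sum_congr rfl fun l _ => ?_
  rw [Finset.sum_mul]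
  exact Finset.sum_congr rfl fun k _ => by ring

end Tensors

/-! ### The normalized ambient metric -/

section Ambient

variable {n : ℕ} {M : Type*} [TopologicalSpace M] [ChartedSpace (EuclideanSpace ℝ (Fin n)) M]
  [IsManifold (𝓡 n) ∞ M] {g : RMetric n M} {T : ℝ} {w f : M → ℝ} {ψ : ℝ → M ≃ₘ^∞⟮𝓡 n, 𝓡 n⟯ M}
  {gbar : ℝ → RMetric n M} {wbar : ℝ → M → ℝ}

/-- The original time as a function of the normalized time. -/
def tau (T s : ℝ) : ℝ := T - Real.exp (-s)

lemma tau_lt (T s : ℝ) : tau T s < T := by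
  have := Real.exp_pos (-s); unfold tau; linarith

lemma hasDerivAt_tau (T s : ℝ) : HasDerivAt (tau T) (Real.exp (-s)) s := by
  have := ((hasDerivAt_neg s).exp).const_sub T
  rw [mul_neg_one, neg_neg] at this
  exact this

lemma contDiff_tau (T : ℝ) : ContDiff ℝ ∞ (tau T) :=
  contDiff_const.sub (contDiff_neg.exp)

/-- The normalized ambient metric in the chart at `b`. -/
def amet (T : ℝ) (gbar : ℝ → RMetric n M) (b : M) (s : ℝ) (y : EuclideanSpace ℝ (Fin n)) :
    Matrix (Fin n) (Fin n) ℝ := Real.exp s • chartMetric (gbar (tau T s)) b y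

/-- The domain of the normalized ambient metric. -/
def adom (n : ℕ) {M : Type*} [TopologicalSpace M] [ChartedSpace (EuclideanSpace ℝ (Fin n)) M]
    (b : M) : Set (ℝ × EuclideanSpace ℝ (Fin n)) := univ ×ˢ (cht n b).target

/-- The velocity of the normalized ambient metric. -/
def avel (T : ℝ) (gbar : ℝ → RMetric n M) (wbar : ℝ → M → ℝ) (b : M)
    (q : ℝ × EuclideanSpace ℝ (Fin n)) : (Fin 2 → Fin n) → ℝ :=
  mtens (fun q => amet T gbar b q.1 q.2) q -
    (2 : ℝ) • ricC (ssgl n) (fun q => amet T gbar b q.1 q.2) q +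
    (2 * alpha n) • diffSq (chartFun (wbar (tau T q.1)) b) q.2

/-- Evolution of the metric in an arbitrary chart. -/
lemma hasDerivAt_chartMetric (hflow : SolvesExtendedRicciFlow (Iio T) gbar wbar)
    (hw : ∀ t < T, ContMDiff (𝓡 n) 𝓘(ℝ, ℝ) ∞ (wbar t)) {t : ℝ} (ht : t < T) (b : M)
    {y : EuclideanSpace ℝ (Fin n)} (hy : y ∈ (cht n b).target) (i j : Fin n) :
    HasDerivAt (fun τ => chartMetric (gbar τ) b y i j)
      (-2 * ricC (sgl n) (chartMetric (gbar t) b) y ![i, j] +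
        2 * alpha n * diffSq (chartFun (wbar t) b) y ![i, j]) t := by
  -- The flow equation is given at `p` in the preferred chart at `p` only. The transition map to the
  -- chart at `b` is independent of time, and the Ricci tensor and `dw ⊗ dw` transform like the
  -- metric.
  set p := (cht n b).symm y
  have hid : ContMDiff (𝓡 n) (𝓡 n) ∞ (id : M → M) := contMDiff_id
  have hdom : y ∈ dom n n (id : M → M) b p := ⟨hy, mem_chart_source _ p⟩
  have hiso : ∀ τ, MetIso (dom n n (id : M → M) b p) (sgl n) (chartMetric (gbar τ) b)
      (cht n p).target (sgl n) (chartMetric (gbar τ) p) (rep n n (id : M → M) b p)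
      (jac (rep n n (id : M → M) b p)) := fun τ => by
    have := metIso_rep (g₁ := gbar τ) (g₂ := gbar τ) one_pos one_pos hid
      (fun p v v' => by rw [mfderiv_id]; rfl) b p
    simpa only [one_smul] using this
  have hrep : rep n n (id : M → M) b p y = ctr n p := rfl
  set P := jac (rep n n (id : M → M) b p) y
  have e1 : ∀ τ, chartMetric (gbar τ) b y i j =
      ∑ l, (∑ k, P k i * chartMetric (gbar τ) p (ctr n p) k l) * P l j := fun τ => by
    rw [(hiso τ).metric y hdom, hrep]
    simp only [Matrix.mul_apply, Matrix.transpose_apply]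
    rfl
  have e2 : ricC (sgl n) (chartMetric (gbar t) b) y ![i, j] =
      ∑ l, (∑ k, P k i * ricci (chartMetric (gbar t) p) (ctr n p) k l) * P l j := by
    rw [(hiso t).ric_pull hdom hdom, pull_two, hrep]
    rfl
  have hcf : ∀ b : M, ContDiffOn ℝ ∞ (chartFun (wbar t) b) (cht n b).target := fun b =>
    contMDiffOn_iff_contDiffOn.1 ((hw t ht).comp_contMDiffOn (contMDiffOn_chart_symm (n := ∞)))
  have ho : IsOpen (dom n n (id : M → M) b p) := isOpen_dom continuous_id
  have e3 : diffSq (chartFun (wbar t) b) y ![i, j] =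
      ∑ l, (∑ k, P k i * diffSq (chartFun (wbar t) p) (ctr n p) ![k, l]) * P l j := by
    rw [diffSq_comp (w' := chartFun (wbar t) p) (κ := rep n n (id : M → M) b p), pull_two, hrep]
    · exact ((hcf p).contDiffAt ((cht n p).open_target.mem_nhds (rep_mem hdom))).differentiableAt
        (by simp)
    · exact ((contDiffOn_rep hid).contDiffAt (ho.mem_nhds hdom)).differentiableAt (by simp)
    · filter_upwards [ho.mem_nhds hdom] with z hz
      change wbar t _ = wbar t _
      rw [cht_symm_rep hz]
      rfl
  have e4 := HasDerivAt.fun_sum (u := Finset.univ) fun l (_ : l ∈ Finset.univ) =>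
    (HasDerivAt.fun_sum (u := Finset.univ) fun k (_ : k ∈ Finset.univ) =>
      (((hflow t ht p).1 k l).const_mul (P k i))).mul_const (P l j)
  rw [show (fun τ => chartMetric (gbar τ) b y i j) = _ from funext e1]
  refine e4.congr_deriv ?_
  rw [e2, e3]
  simp only [Finset.mul_sum, Finset.sum_mul, ← Finset.sum_add_distrib]
  exact Finset.sum_congr rfl fun l _ => Finset.sum_congr rfl fun k _ => by ring

variable (hsol : IsShrinkingSelfSimilar T g w f ψ gbar wbar)
include hsol

/-- For `t = tau T s` one has `T - t = e^{-s}`, so the factors cancel. All normalized metrics are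
isometric to the one metric `g`, and this is why the constants do not depend on `s`. -/
lemma amet_isom (s : ℝ) (p : M) (v v' : TangentSpace (𝓡 n) p) :
    Real.exp s * (gbar (tau T s)).inner p v v' = 1 * g.inner (ψ (tau T s) p)
      (mfderiv (𝓡 n) (𝓡 n) (ψ (tau T s)) p v) (mfderiv (𝓡 n) (𝓡 n) (ψ (tau T s)) p v') := by
  rw [hsol.gbar_eq _ (tau_lt T s), ← mul_assoc]
  congr 1
  rw [tau, sub_sub_cancel, ← Real.exp_add, add_neg_cancel, Real.exp_zero]

lemma psi_family : ContMDiffOn (𝓘(ℝ, ℝ).prod (𝓡 n)) (𝓡 n) ∞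
    (fun q : ℝ × M => ψ (tau T q.1) q.2) (univ ×ˢ univ) :=
  hsol.smooth_ψ.comp (f := fun q : ℝ × M => (tau T q.1, q.2))
    (((contDiff_tau T).contMDiff.comp contMDiff_fst).prodMk contMDiff_snd).contMDiffOn
    fun q _ => ⟨tau_lt T q.1, mem_univ _⟩

lemma amet_metIso (s : ℝ) (b b' : M) : MetIso (dom n n (ψ (tau T s)) b b') (sgl n)
    (amet T gbar b s) (cht n b').target (sgl n) (chartMetric g b') (rep n n (ψ (tau T s)) b b')
    (jac (rep n n (ψ (tau T s)) b b')) := by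
  have := metIso_rep (Real.exp_pos s) one_pos (ψ (tau T s)).contMDiff (amet_isom hsol s) b b'
  simp only [one_smul] at this
  exact this

/-- Joint smoothness in time and space is read off from the formula `ψ_t^* g` near each point, since
each `gbar t` by itself is smooth only in space. -/
lemma isMetric_amet (b : M) : IsMetric (adom n b) fun q => amet T gbar b q.1 q.2 where
  isOpen := isOpen_univ.prod (cht n b).open_target
  pos := fun q hq => ((isMetric_chartMetric _ b).pos _ hq.2).smul (Real.exp_pos _)
  sm := fun i j q hq => by
    set b' := ψ (tau T q.1) ((cht n b).symm q.2)
    have hF := psi_family hsol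
    have hV : IsOpen (fdom n n univ (fun s => ψ (tau T s)) b b') :=
      isOpen_fdom (F := fun s => ψ (tau T s)) hF isOpen_univ
    have hqV : q ∈ fdom n n univ (fun s => ψ (tau T s)) b b' :=
      ⟨mem_univ _, hq.2, mem_chart_source _ b'⟩
    have h1 := sm_fdom (F := fun s => ψ (tau T s)) hF (a := b) (b := b')
    have hP : ∀ k i, ContDiffOn ℝ ∞ (fun q : ℝ × EuclideanSpace ℝ (Fin n) =>
        jac (rep n n (ψ (tau T q.1)) b b') q.2 k i) (fdom n n univ (fun s => ψ (tau T s)) b b') :=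
      fun k i => contDiffOn_euclidean.1 ((Sliced.of_isOpen hV).sm_pd
        (u := fun s => rep n n (ψ (tau T s)) b b') h1 i) k
    have hA : ∀ k l, ContDiffOn ℝ ∞ (fun q : ℝ × EuclideanSpace ℝ (Fin n) =>
        chartMetric g b' (rep n n (ψ (tau T q.1)) b b' q.2) k l)
        (fdom n n univ (fun s => ψ (tau T s)) b b') := fun k l =>
      (sm_chartMetric g b' k l).comp h1 fun z hz => rep_mem hz.2
    refine ContDiffAt.contDiffWithinAt (ContDiffAt.congr_of_eventuallyEq
      (f := fun q => ∑ l, (∑ k, jac (rep n n (ψ (tau T q.1)) b b') q.2 k i *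
        chartMetric g b' (rep n n (ψ (tau T q.1)) b b' q.2) k l) *
          jac (rep n n (ψ (tau T q.1)) b b') q.2 l j) ?_ ?_)
    · exact (ContDiffOn.sum fun l _ => (ContDiffOn.sum fun k _ => (hP k i).mul (hA k l)).mul
        (hP l j)).contDiffAt (hV.mem_nhds hqV)
    · filter_upwards [hV.mem_nhds hqV] with z hz
      rw [(amet_metIso hsol z.1 b b').metric z.2 hz.2]
      simp only [Matrix.mul_apply, Matrix.transpose_apply]

lemma contMDiff_wbar {t : ℝ} (ht : t < T) : ContMDiff (𝓡 n) 𝓘(ℝ, ℝ) ∞ (wbar t) := by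
  have h1 := hsol.smooth_w.comp (ψ t).contMDiff
  rwa [show wbar t = w ∘ ψ t from funext (hsol.wbar_eq t ht)]

lemma sm_adiffSq (b : M) :
    Sm (adom n b) fun q => diffSq (chartFun (wbar (tau T q.1)) b) q.2 := fun L => by
  have h1 : ContDiffOn ℝ ∞ (fun q : ℝ × EuclideanSpace ℝ (Fin n) =>
      chartFun (wbar (tau T q.1)) b q.2) (adom n b) := by
    have h2 := contMDiffOn_iff_contDiffOn.1 (hsol.smooth_w.comp_contMDiffOn
      (contMDiffOn_lift (F := fun s => ψ (tau T s)) (psi_family hsol) b))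
    exact h2.congr fun q _ => hsol.wbar_eq _ (tau_lt T q.1) _
  have hK : Sliced (adom n b) := Sliced.of_isOpen (isOpen_univ.prod (cht n b).open_target)
  exact (hK.sm_pd (u := fun s => chartFun (wbar (tau T s)) b) h1 _).mul
    (hK.sm_pd (u := fun s => chartFun (wbar (tau T s)) b) h1 _)

/-- The norms of the covariant derivatives of a tensor field on the normalized ambient manifold. -/
lemma amb_nmIter {r : ℕ} {b : M} {q : ℝ × EuclideanSpace ℝ (Fin n)} (hq : q ∈ adom n b)
    {S : ℝ × EuclideanSpace ℝ (Fin n) → (Fin r → Fin n) → ℝ} (hS : Sm (adom n b) S)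
    {S' : EuclideanSpace ℝ (Fin n) → (Fin r → Fin n) → ℝ} {b' : M}
    (hb' : b' = ψ (tau T q.1) ((cht n b).symm q.2)) (hS' : Sm (cht n b').target S')
    (e : ∀ z ∈ dom n n (ψ (tau T q.1)) b b', S (q.1, z) = pull (jac (rep n n (ψ (tau T q.1)) b b') z)
      (S' (rep n n (ψ (tau T q.1)) b b' z))) (k : ℕ) :
    (lc (adom n b) q (ssgl n) fun q => amet T gbar b q.1 q.2).nmIter k S =
      tensorNorm (chartMetric g b' (ctr n b')) (iterCovDeriv (chartMetric g b') S' k (ctr n b')) := by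
  have hN := isMetric_amet hsol b
  have hdom : q.2 ∈ dom n n (ψ (tau T q.1)) b b' := by
    refine ⟨hq.2, ?_⟩
    rw [hb']
    exact mem_chart_source _ _
  have hrep : rep n n (ψ (tau T q.1)) b b' q.2 = ctr n b' := by rw [hb']; rfl
  have hm := amet_metIso hsol q.1 b b'
  refine (sq_eq_sq₀ (Geo.nmIter_nonneg _ _) (show 0 ≤ tensorNorm (chartMetric g b' (ctr n b'))
    (iterCovDeriv (chartMetric g b') S' k (ctr n b')) from Real.sqrt_nonneg _)).1 ?_
  rw [(hN.good (ssgl n) hq).nmIter_sq, tensorNorm_iterCovDeriv_sq (cht n b').target (ctr n b') _ _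
    ((isMetric_chartMetric g b').pos _ (ctr_mem b'))]
  -- Two isometries are composed: the inclusion of the time slice into space-time and the chart
  -- expression of `ψ`.
  have hs := slice_metIso (N := fun s y => amet T gbar b s y) hN q.1
  have h1 := ((hs.isIso (pt := q.2) hq q).sqIter_pull (k := k) (hs.met₁.good (sgl _) hq)
    (hN.good (ssgl _) hq) hS) hq
  refine h1.symm.trans ?_
  simp only [pull_one]
  rw [lc_sqIter _ (dom n n (ψ (tau T q.1)) b b') _ q.2]
  refine (sqIter_congr (isOpen_dom (ψ (tau T q.1)).continuous) e hdom).trans ?_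
  have h2 := ((hm.isIso hdom (ctr n b')).sqIter_pull (k := k) (hm.met₁.good (sgl _) hdom)
    (hm.met₂.good (sgl _) (ctr_mem b')) hS') hdom
  exact h2.trans (congrArg _ hrep)

end Ambient

/-! ### Uniform bounds for the ambient curvature and the ambient velocity -/

section AmbientBounds

variable {n : ℕ} {M : Type*} [TopologicalSpace M] [ChartedSpace (EuclideanSpace ℝ (Fin n)) M]
  [IsManifold (𝓡 n) ∞ M] {g : RMetric n M} {T : ℝ} {w f : M → ℝ} {ψ : ℝ → M ≃ₘ^∞⟮𝓡 n, 𝓡 n⟯ M}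
  {gbar : ℝ → RMetric n M} {wbar : ℝ → M → ℝ} (hsol : IsShrinkingSelfSimilar T g w f ψ gbar wbar)
include hsol

lemma amb_nmIter_rm {b : M} {q : ℝ × EuclideanSpace ℝ (Fin n)} (hq : q ∈ adom n b) (k : ℕ) :
    (lc (adom n b) q (ssgl n) fun q => amet T gbar b q.1 q.2).nmIter k
      (rmC (ssgl n) fun q => amet T gbar b q.1 q.2) =
        normCovRm g k (ψ (tau T q.1) ((cht n b).symm q.2)) := by
  have hN := isMetric_amet hsol b
  refine amb_nmIter hsol hq (hN.sm_rmC _) rfl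
    ((isMetric_chartMetric g _).sm_rmC (sgl n)) (fun z hz => ?_) k
  have hs := slice_metIso (N := fun s y => amet T gbar b s y) hN q.1
  have h1 := hs.rmC_pull (pt := z) (y := z) ⟨mem_univ _, hz.1⟩ ⟨mem_univ _, hz.1⟩
  rw [pull_one] at h1
  rw [← h1]
  exact (amet_metIso hsol q.1 b _).rmC_pull hz hz

lemma amb_nmIter_diffSq {b : M} {q : ℝ × EuclideanSpace ℝ (Fin n)} (hq : q ∈ adom n b) (k : ℕ) :
    (lc (adom n b) q (ssgl n) fun q => amet T gbar b q.1 q.2).nmIter k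
      (fun q => diffSq (chartFun (wbar (tau T q.1)) b) q.2) =
        normCovDiffSq g w k (ψ (tau T q.1) ((cht n b).symm q.2)) := by
  have hcf : ∀ b : M, ContDiffOn ℝ ∞ (chartFun w b) (cht n b).target := fun b =>
    contMDiffOn_iff_contDiffOn.1 (hsol.smooth_w.comp_contMDiffOn (contMDiffOn_chart_symm (n := ∞)))
  refine amb_nmIter hsol hq (sm_adiffSq hsol b) rfl
    (sm_diffSq (cht n _).open_target (hcf _)) (fun z hz => ?_) k
  have ho := isOpen_dom (n := n) (n' := n) (a := b)
    (b := ψ (tau T q.1) ((cht n b).symm q.2)) (ψ (tau T q.1)).continuous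
  refine diffSq_comp ?_ ?_ ?_
  · exact ((hcf _).contDiffAt ((cht n _).open_target.mem_nhds (rep_mem hz))).differentiableAt
      (by simp)
  · exact ((contDiffOn_rep (ψ (tau T q.1)).contMDiff).contDiffAt (ho.mem_nhds hz)).differentiableAt
      (by simp)
  · filter_upwards [ho.mem_nhds hz] with z hz
    change wbar _ _ = w _
    rw [cht_symm_rep hz, hsol.wbar_eq _ (tau_lt T q.1)]

/-- The factor `e^s` reproduces the metric when differentiated, and in front of the time derivative
it cancels against `dt/ds = e^{-s}`. The Ricci tensor is unchanged by the rescaling. -/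
lemma amet_fderiv {b : M} {q : ℝ × EuclideanSpace ℝ (Fin n)} (hq : q ∈ adom n b) (i j : Fin n) :
    fderiv ℝ (fun z : ℝ × EuclideanSpace ℝ (Fin n) => amet T gbar b z.1 z.2 i j) q (1, 0) =
      avel T gbar wbar b q ![i, j] := by
  obtain ⟨s, y⟩ := q
  have hN := isMetric_amet hsol b
  have hd : DifferentiableAt ℝ (fun z : ℝ × EuclideanSpace ℝ (Fin n) => amet T gbar b z.1 z.2 i j)
      (s, y) := ((hN.sm i j).contDiffAt (hN.isOpen.mem_nhds hq)).differentiableAt (by simp)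
  have h1 : HasDerivAt (fun σ => amet T gbar b σ y i j)
      (fderiv ℝ (fun z : ℝ × EuclideanSpace ℝ (Fin n) => amet T gbar b z.1 z.2 i j) (s, y) (1, 0))
      s := HasFDerivAt.comp_hasDerivAt (f := fun σ : ℝ => (σ, y)) s hd.hasFDerivAt
      ((hasDerivAt_id s).prodMk (hasDerivAt_const s y))
  have h2 := (Real.hasDerivAt_exp s).mul ((hasDerivAt_chartMetric hsol.flow
    (fun t ht => contMDiff_wbar hsol ht) (tau_lt T s) b hq.2 i j).comp s (hasDerivAt_tau T s))
  refine (h1.unique h2).trans ?_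
  have hs := slice_metIso (N := fun s y => amet T gbar b s y) hN s
  have h3 := hs.ric_pull (pt := y) (y := y) hq hq ![i, j]
  rw [pull_one] at h3
  have h4 : ricC (sgl n) (amet T gbar b s) y = ricC (sgl n) (chartMetric (gbar (tau T s)) b) y :=
    ricC_smul (Real.exp_pos s) (isMetric_chartMetric _ b) hq.2
  simp only [avel, Pi.add_apply, Pi.sub_apply, Pi.smul_apply, smul_eq_mul]
  rw [← h3, h4]
  have h5 : Real.exp s * Real.exp (-s) = 1 := by rw [← Real.exp_add, add_neg_cancel, Real.exp_zero]
  simp only [mtens, amet, Matrix.smul_apply, smul_eq_mul, Matrix.cons_val_zero, Matrix.cons_val_one,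
    Function.comp]
  linear_combination (-2 * ricC (sgl n) (chartMetric (gbar (tau T s)) b) y ![i, j] +
    2 * alpha n * diffSq (chartFun (wbar (tau T s)) b) y ![i, j]) * h5

variable {Θ : Type*} {b : Θ → M} {q : Θ → ℝ × EuclideanSpace ℝ (Fin n)}
  (hq : ∀ θ, q θ ∈ adom n (b θ))
include hq

lemma UL.amb_rm (hg : HasBoundedGeometry g) (k : ℕ) :
    UL (fun θ => lc (adom n (b θ)) (q θ) (ssgl n) fun q => amet T gbar (b θ) q.1 q.2) 1 k
      fun θ => rmC (ssgl n) fun q => amet T gbar (b θ) q.1 q.2 := by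
  have key : ∀ k, ∃ C, ∀ θ, (lc (adom n (b θ)) (q θ) (ssgl n) fun q =>
      amet T gbar (b θ) q.1 q.2).nmIter k (rmC (ssgl n) fun q => amet T gbar (b θ) q.1 q.2) ≤ C := by
    intro k
    obtain ⟨C, -, hC⟩ := hg.curvature_bound k
    exact ⟨C, fun θ => (amb_nmIter_rm hsol (hq θ) k).trans_le (hC _).le⟩
  refine UL.of_nmIter (fun θ => (isMetric_amet hsol (b θ)).good _ (hq θ))
    (fun θ => (isMetric_amet hsol (b θ)).sm_rmC _) (fun j _ => key j) ?_
  simpa using key k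

lemma UL.avel (hg : HasBoundedGeometry g)
    (hw : ∀ j : ℕ, ∃ C' : ℝ, 0 < C' ∧ ∀ p : M, normCovDiffSq g w j p ≤ C') (k : ℕ) :
    UL (fun θ => lc (adom n (b θ)) (q θ) (ssgl n) fun q => amet T gbar (b θ) q.1 q.2) 1 k
      fun θ => avel T gbar wbar (b θ) := by
  have hG : ∀ θ, (lc (adom n (b θ)) (q θ) (ssgl n) fun q => amet T gbar (b θ) q.1 q.2).Good :=
    fun θ => (isMetric_amet hsol (b θ)).good _ (hq θ)
  have key : ∀ k, ∃ C, ∀ θ, (lc (adom n (b θ)) (q θ) (ssgl n) fun q =>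
      amet T gbar (b θ) q.1 q.2).nmIter k
        (fun q => diffSq (chartFun (wbar (tau T q.1)) (b θ)) q.2) ≤ C := by
    intro k
    obtain ⟨C, -, hC⟩ := hw k
    exact ⟨C, fun θ => (amb_nmIter_diffSq hsol (hq θ) k).trans_le (hC _)⟩
  have h1 : UL (fun θ => lc (adom n (b θ)) (q θ) (ssgl n) fun q => amet T gbar (b θ) q.1 q.2) 1 k
      fun θ q => diffSq (chartFun (wbar (tau T q.1)) (b θ)) q.2 :=
    UL.of_nmIter hG (fun θ => sm_adiffSq hsol (b θ)) (fun j _ => key j) (by simpa using key k)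
  have h2 : UL (fun θ => lc (adom n (b θ)) (q θ) (ssgl n) fun q => amet T gbar (b θ) q.1 q.2) 1 k
      fun θ => ricC (ssgl n) fun q => amet T gbar (b θ) q.1 q.2 :=
    (((UL.amb_rm hsol hq hg k).rl hG eqvRic).contr hG).congr hG fun θ y hy =>
      (isMetric_amet hsol (b θ)).ricC_eq hy
  exact ((UL.mtens (fun θ => isMetric_amet hsol (b θ)) hq k).sub hG (h2.smul hG 2)).add hG
    (h1.smul hG (2 * alpha n))

end AmbientBounds

/-! ### The normalized flow as a mean curvature flow in the moving metric -/

section NormalizedFlow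

variable {m : ℕ} {M : Type*} [TopologicalSpace M] [ChartedSpace (EuclideanSpace ℝ (Fin (m + 1))) M]
  [IsManifold (𝓡 (m + 1)) ∞ M] {S : Type*} [TopologicalSpace S]
  [ChartedSpace (EuclideanSpace ℝ (Fin m)) S] [IsManifold (𝓡 m) ∞ S]
  {g : RMetric (m + 1) M} {T : ℝ} {w f : M → ℝ} {ψ : ℝ → M ≃ₘ^∞⟮𝓡 (m + 1), 𝓡 (m + 1)⟯ M}
  {gbar : ℝ → RMetric (m + 1) M} {wbar : ℝ → M → ℝ} {x : ℝ → S → M}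

lemma tau_mem (hT : 0 < T) {s : ℝ} (hs : -Real.log T ≤ s) : tau T s ∈ Ico 0 T := by
  refine ⟨?_, tau_lt T s⟩
  have : Real.exp (-s) ≤ T := by
    conv_rhs => rw [← Real.exp_log hT]
    exact Real.exp_le_exp.2 (by linarith)
  unfold tau
  linarith

lemma tau_mem_Ioo (hT : 0 < T) {s : ℝ} (hs : -Real.log T < s) : tau T s ∈ Ioo 0 T := by
  refine ⟨?_, tau_lt T s⟩
  have : Real.exp (-s) < T := by
    conv_rhs => rw [← Real.exp_log hT]
    exact Real.exp_lt_exp.2 (by linarith)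
  unfold tau
  linarith

variable (hT : 0 < T) (hx : IsMCF T gbar x)
include hT hx

lemma flow_family : ContMDiffOn (𝓘(ℝ, ℝ).prod (𝓡 m)) (𝓡 (m + 1)) ∞
    (fun q : ℝ × S => x (tau T q.1) q.2) (Ici (-Real.log T) ×ˢ univ) :=
  hx.smooth.comp (f := fun q : ℝ × S => (tau T q.1, q.2))
    (((contDiff_tau T).contMDiff.comp contMDiff_fst).prodMk contMDiff_snd).contMDiffOn
    fun _ hq => ⟨tau_mem hT hq.1, mem_univ _⟩

lemma flow_smooth {s : ℝ} (hs : -Real.log T ≤ s) : ContMDiff (𝓡 m) (𝓡 (m + 1)) ∞ (x (tau T s)) :=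
  family_contMDiff (F := fun s => x (tau T s)) (flow_family hT hx) hs

lemma flow_imm {s : ℝ} (hs : -Real.log T ≤ s) (p : S) :
    Function.Injective (mfderiv (𝓡 m) (𝓡 (m + 1)) (x (tau T s)) p) :=
  hx.immersion _ (tau_mem hT hs) p

lemma normalizedFlow_smooth {s : ℝ} (hs : -Real.log T ≤ s) :
    ContMDiff (𝓡 m) (𝓡 (m + 1)) ∞ (normalizedFlow T ψ x s) :=
  (ψ (tau T s)).contMDiff.comp (flow_smooth hT hx hs)

lemma normalizedFlow_imm {s : ℝ} (hs : -Real.log T ≤ s) (p : S) :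
    Function.Injective (mfderiv (𝓡 m) (𝓡 (m + 1)) (normalizedFlow T ψ x s) p) := by
  have h1 : mfderiv (𝓡 m) (𝓡 (m + 1)) (ψ (tau T s) ∘ x (tau T s)) p = _ :=
    mfderiv_comp p ((ψ (tau T s)).contMDiff.mdifferentiableAt (by simp))
      ((flow_smooth hT hx hs).mdifferentiableAt (by simp))
  change Function.Injective (mfderiv (𝓡 m) (𝓡 (m + 1)) (ψ (tau T s) ∘ x (tau T s)) p)
  rw [h1]
  exact (((ψ (tau T s)).mfderivToContinuousLinearEquiv (by simp) _).injective).comp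
    (flow_imm hT hx hs p)

/-- `ψ` is an isometry from the normalized metric to `g`, so the normalized flow may be replaced by
the original immersions in the moving metric, in any charts. -/
lemma normCov_sq (hsol : IsShrinkingSelfSimilar T g w f ψ gbar wbar) {s : ℝ}
    (hs : -Real.log T ≤ s) (k : ℕ) {a : S} {b : M} {y : EuclideanSpace ℝ (Fin m)}
    (hy : y ∈ dom m (m + 1) (x (tau T s)) a b) :
    normCovSecondFund g (normalizedFlow T ψ x s) k ((cht m a).symm y) ^ 2 =
      sffSq (amet T gbar b s) (rep m (m + 1) (x (tau T s)) a b) k y := by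
  have h1 := (hyp_iso (Real.exp_pos s) one_pos (ψ (tau T s)).contMDiff (amet_isom hsol s)
    (flow_smooth hT hx hs) (flow_imm hT hx hs) rfl hy (mem_chart_source _ ((cht m a).symm y))
    (mem_chart_source _ (normalizedFlow T ψ x s ((cht m a).symm y)))).1 k
  rw [normCovSecondFund_sq g (normalizedFlow_smooth hT hx hs) (normalizedFlow_imm hT hx hs)]
  simp only [one_smul] at h1
  exact h1.symm

/-- The type I condition bounds the second fundamental form of the normalized flow. -/
lemma normCov_zero_le (hsol : IsShrinkingSelfSimilar T g w f ψ gbar wbar) (hI : IsTypeI T gbar x) :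
    ∃ C : ℝ, ∀ s : ℝ, -Real.log T ≤ s → ∀ p : S,
      normCovSecondFund g (normalizedFlow T ψ x s) 0 p ≤ C := by
  obtain ⟨C, hC1, hC⟩ := hI
  refine ⟨C, fun s hs p => ?_⟩
  refine le_of_sq_le_sq ?_ (by linarith)
  have hy := ctr_mem_dom (m := m) (x (tau T s)) p
  have h1 := normCov_sq (g := g) hT hx hsol hs 0 hy
  rw [cht_symm_ctr] at h1
  have hG := (isMetric_chartMetric (gbar (tau T s)) (x (tau T s) p)).pos _ (rep_mem hy)
  have hX := flow_smooth hT hx hs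
  have hi := flow_imm hT hx hs
  -- Rescaling the metric by `e^s` gives the factor `e^{-s}`, which cancels the type I bound `C² /
  -- (T - t) = C² e^s`.
  have h2 := sffSq_smul (Real.exp_pos s) hG (inducedMetric_posDef (gbar (tau T s)) hX hi hy)
  have h3 := normCovSecondFund_sq (gbar (tau T s)) hX hi 0 p
  have h4 := hC _ (tau_mem hT hs) p
  rw [h1]
  refine h2.trans_le ?_
  rw [← h3, inv_mul_le_iff₀ (Real.exp_pos s)]
  have h5 : T - tau T s = Real.exp (-s) := by rw [tau, sub_sub_cancel]
  rw [h5] at h4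
  have h6 : (C / Real.sqrt (Real.exp (-s))) ^ 2 = Real.exp s * C ^ 2 := by
    rw [div_pow, Real.sq_sqrt (Real.exp_pos _).le, Real.exp_neg, div_inv_eq_mul, mul_comm]
  rw [← h6]
  exact pow_le_pow_left₀ (Real.sqrt_nonneg _) h4 2

/-- Only times after the initial one are used, so that the domain in space-time is open; the initial
time enters later through continuity alone. -/
lemma isTrack_flow (hsol : IsShrinkingSelfSimilar T g w f ψ gbar wbar) (a : S) (b : M) :
    IsTrack (fdom m (m + 1) (Ioi (-Real.log T)) (fun s => x (tau T s)) a b) (adom (m + 1) b)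
      (amet T gbar b) fun s => rep m (m + 1) (x (tau T s)) a b := by
  have hF : ContMDiffOn (𝓘(ℝ, ℝ).prod (𝓡 m)) (𝓡 (m + 1)) ∞
      (fun q : ℝ × S => x (tau T q.1) q.2) (Ioi (-Real.log T) ×ˢ univ) :=
    (flow_family hT hx).mono (prod_mono Ioi_subset_Ici_self le_rfl)
  exact
  { isOpen := isOpen_fdom (F := fun s => x (tau T s)) hF isOpen_Ioi
    met' := isMetric_amet hsol b
    maps := fun q hq => ⟨mem_univ _, rep_mem hq.2⟩
    sm := sm_fdom (F := fun s => x (tau T s)) hF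
    indep := fun q hq => linearIndependent_rep (flow_smooth hT hx (le_of_lt hq.1))
      (flow_imm hT hx (le_of_lt hq.1) _) hq.2 }

/-- The normalized flow is a mean curvature flow in the normalized ambient metric, in arbitrary
charts. -/
lemma flow_eq (hsol : IsShrinkingSelfSimilar T g w f ψ gbar wbar) {a : S} {b : M}
    {q : ℝ × EuclideanSpace ℝ (Fin m)}
    (hq : q ∈ fdom m (m + 1) (Ioi (-Real.log T)) (fun s => x (tau T s)) a b) :
    fderiv ℝ (fun q : ℝ × EuclideanSpace ℝ (Fin m) => rep m (m + 1) (x (tau T q.1)) a b q.2) q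
      (1, 0) = meanCurv (amet T gbar b q.1) (rep m (m + 1) (x (tau T q.1)) a b) q.2 •
        unitNormal (amet T gbar b q.1) (rep m (m + 1) (x (tau T q.1)) a b) q.2 := by
  have ht := isTrack_flow (ψ := ψ) hT hx hsol a b
  obtain ⟨s, y⟩ := q
  have hs : -Real.log T < s := hq.1
  have hy : y ∈ dom m (m + 1) (x (tau T s)) a b := hq.2
  have hX := flow_smooth hT hx hs.le
  have hi := flow_imm hT hx hs.le
  set p := (cht m a).symm y with hp
  set P := x (tau T s) p with hP
  have hd : DifferentiableAt ℝ (fun q : ℝ × EuclideanSpace ℝ (Fin m) =>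
      rep m (m + 1) (x (tau T q.1)) a b q.2) (s, y) :=
    (ht.sm.contDiffAt (ht.isOpen.mem_nhds hq)).differentiableAt (by simp)
  have h1 : HasDerivAt (fun σ => rep m (m + 1) (x (tau T σ)) a b y) (fderiv ℝ
      (fun q : ℝ × EuclideanSpace ℝ (Fin m) => rep m (m + 1) (x (tau T q.1)) a b q.2) (s, y) (1, 0))
      s := HasFDerivAt.comp_hasDerivAt (f := fun σ : ℝ => (σ, y)) s hd.hasFDerivAt
      ((hasDerivAt_id s).prodMk (hasDerivAt_const s y))
  -- After the initial time the one-sided derivative is two-sided. The chart at the moving point is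
  -- then changed to the fixed chart at `b`.
  have h2 := ((hx.evolution _ (tau_mem hT hs.le) p).hasDerivAt
    (Ico_mem_nhds (tau_mem_Ioo hT hs).1 (tau_mem_Ioo hT hs).2)).scomp s (hasDerivAt_tau T s)
  have hid : ContMDiff (𝓡 (m + 1)) (𝓡 (m + 1)) ∞ (id : M → M) := contMDiff_id
  have hc := ctr_mem_dom (m := m) (x (tau T s)) p
  have hz : ctr (m + 1) P ∈ dom (m + 1) (m + 1) (id : M → M) P b := by
    refine ⟨ctr_mem P, ?_⟩
    change (cht (m + 1) P).symm (ctr (m + 1) P) ∈ (cht (m + 1) b).source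
    rw [cht_symm_ctr]
    exact hy.2
  have h3 : DifferentiableAt ℝ (rep (m + 1) (m + 1) (id : M → M) P b) (ctr (m + 1) P) :=
    ((contDiffOn_rep hid).contDiffAt ((isOpen_dom continuous_id).mem_nhds hz)).differentiableAt
      (by simp)
  have h4 := HasFDerivAt.comp_hasDerivAt (f := (fun t => cht (m + 1) P (x t p)) ∘ tau T) s
    h3.hasFDerivAt h2
  have h5 : (fun σ => rep m (m + 1) (x (tau T σ)) a b y) =ᶠ[𝓝 s]
      rep (m + 1) (m + 1) (id : M → M) P b ∘ ((fun t => cht (m + 1) P (x t p)) ∘ tau T) := by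
    have hF := (isTrack_flow (ψ := ψ) hT hx hsol p P).isOpen
    have hm : (s, ctr m p) ∈ fdom m (m + 1) (Ioi (-Real.log T)) (fun s => x (tau T s)) p P :=
      ⟨hs, hc⟩
    filter_upwards [(hF.preimage (Continuous.prodMk_left (ctr m p))).mem_nhds hm] with σ hσ
    have h6 : x (tau T σ) ((cht m p).symm (ctr m p)) ∈ (cht (m + 1) P).source := hσ.2.2
    rw [cht_symm_ctr] at h6
    change _ = cht (m + 1) b ((cht (m + 1) P).symm (cht (m + 1) P (x (tau T σ) p)))
    rw [(cht (m + 1) P).left_inv h6]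
    rfl
  refine (h1.unique (h4.congr_of_eventuallyEq h5)).trans ?_
  have h7 := (hyp_iso (g₁ := gbar (tau T s)) (g₂ := gbar (tau T s)) one_pos one_pos hid
    (fun p v v' => by rw [mfderiv_id]; rfl) hX hi (X₂ := x (tau T s)) rfl hc (a' := a) (b' := b)
    (by rw [cht_symm_ctr]; exact (cht m a).map_target hy.1)
    (by rw [cht_symm_ctr]; exact hy.2)).2
  simp only [one_smul, cht_symm_ctr] at h7
  have e1 : rep m (m + 1) (x (tau T s)) p P (ctr m p) = ctr (m + 1) P := by
    simp only [rep, cht_symm_ctr]; rfl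
  have e2 : cht m a p = y := (cht m a).right_inv hy.1
  rw [e1, e2] at h7
  -- The factor `e^{-s}` from the derivative of `tau` equals the factor by which the mean curvature
  -- vector changes when the metric is multiplied by `e^s`.
  have h8 := meanCurv_smul (Real.exp_pos s)
    ((isMetric_chartMetric (gbar (tau T s)) b).pos _ (rep_mem hy))
    (inducedMetric_posDef (gbar (tau T s)) hX hi hy)
  rw [map_smul]
  refine Eq.trans ?_ h8.symm
  rw [Real.exp_neg]
  congr 1

end NormalizedFlow

/-- A left local maximum has nonnegative derivative. -/
lemma HasDerivAt.nonneg_of_left_max {u : ℝ → ℝ} {u' a : ℝ} (h : HasDerivAt u u' a)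
    (hmax : ∀ᶠ t in 𝓝[≤] a, u t ≤ u a) : 0 ≤ u' := by
  have h1 : (-1 : ℝ) ∈ posTangentConeAt (Iic a) a :=
    mem_posTangentConeAt_of_segment_subset ((convex_Iic a).segment_subset (mem_Iic.2 le_rfl)
      (by simp))
  have h2 := IsLocalMaxOn.hasFDerivWithinAt_nonpos (f := u) (s := Iic a) hmax
    h.hasFDerivAt.hasFDerivWithinAt h1
  simp at h2
  linarith

/-! ### The induction step on the compact hypersurface -/

section MaximumPrinciple

variable {m : ℕ} {M : Type*} [TopologicalSpace M] [ChartedSpace (EuclideanSpace ℝ (Fin (m + 1))) M]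
  [IsManifold (𝓡 (m + 1)) ∞ M] {S : Type*} [TopologicalSpace S]
  [ChartedSpace (EuclideanSpace ℝ (Fin m)) S] [IsManifold (𝓡 m) ∞ S]
  {g : RMetric (m + 1) M} {T : ℝ} {w f : M → ℝ} {ψ : ℝ → M ≃ₘ^∞⟮𝓡 (m + 1), 𝓡 (m + 1)⟯ M}
  {gbar : ℝ → RMetric (m + 1) M} {wbar : ℝ → M → ℝ} {x : ℝ → S → M}
  (hT : 0 < T) (hx : IsMCF T gbar x) (hsol : IsShrinkingSelfSimilar T g w f ψ gbar wbar)
include hT hx hsol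

/-- Continuity up to the initial time is what provides maxima over closed time intervals. It follows
from smoothness of the coordinate expressions up to the boundary, read in one fixed chart near each
point. -/
lemma continuousOn_normCov_sq (k : ℕ) :
    ContinuousOn (fun q : ℝ × S => normCovSecondFund g (normalizedFlow T ψ x q.1) k q.2 ^ 2)
      (Ici (-Real.log T) ×ˢ univ) := by
  rintro ⟨s, p⟩ ⟨hs, -⟩
  have hF := flow_family hT hx
  set P := x (tau T s) p
  set K := fdom m (m + 1) (Ici (-Real.log T)) (fun s => x (tau T s)) p P with hK
  have hN := isMetric_amet hsol P
  have hsl : Sliced K := sliced_fdom (F := fun s => x (tau T s)) hF (uniqueDiffOn_Ici _)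
  have h1 : ContDiffOn ℝ ∞ (fun q : ℝ × EuclideanSpace ℝ (Fin m) =>
      sffSq (amet T gbar P q.1) (rep m (m + 1) (x (tau T q.1)) p P) k q.2) K :=
    hsl.sm_tensorNorm_sq (K' := adom (m + 1) P) (G := amet T gbar P)
      (ξ := fun s => rep m (m + 1) (x (tau T s)) p P) (Sliced.of_isOpen hN.isOpen)
      (fun i j => hN.sm i j) (fun q hq => hN.pos q hq) (sm_fdom (F := fun s => x (tau T s)) hF)
      (fun q hq => ⟨mem_univ _, rep_mem hq.2⟩) (fun q hq => linearIndependent_rep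
        (flow_smooth hT hx hq.1) (flow_imm hT hx hq.1 _) hq.2) k
  have hm : (s, ctr m p) ∈ K := ⟨hs, ctr_mem_dom (m := m) _ p⟩
  obtain ⟨u, hu, hKu⟩ := fdom_eq (F := fun s => x (tau T s)) hF (a := p) (b := P)
  have hKu : K = (Ici (-Real.log T) ×ˢ (cht m p).target) ∩ u := hKu
  have hc : ContinuousAt (fun q : ℝ × S => (q.1, cht m p q.2)) (s, p) :=
    continuousAt_fst.prodMk (ContinuousAt.comp (g := cht m p) (f := Prod.snd) (x := (s, p))
      ((cht m p).continuousAt (mem_chart_source _ p)) continuousAt_snd)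
  have hsrc : ∀ᶠ q : ℝ × S in 𝓝 (s, p), q.2 ∈ (cht m p).source :=
    continuousAt_snd.eventually ((cht m p).open_source.mem_nhds (mem_chart_source _ p))
  have hK' : ∀ᶠ q : ℝ × S in 𝓝[Ici (-Real.log T) ×ˢ univ] (s, p),
      q.2 ∈ (cht m p).source ∧ (q.1, cht m p q.2) ∈ K := by
    have hmu : (s, ctr m p) ∈ u := (hKu ▸ hm : _ ∈ _ ∩ u).2
    filter_upwards [self_mem_nhdsWithin, nhdsWithin_le_nhds hsrc,
      nhdsWithin_le_nhds (hc.eventually (hu.mem_nhds hmu))] with q hq h2 h3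
    refine ⟨h2, ?_⟩
    rw [hKu]
    exact ⟨⟨hq.1, (cht m p).map_source h2⟩, h3⟩
  have h2 : Tendsto (fun q : ℝ × S => (q.1, cht m p q.2)) (𝓝[Ici (-Real.log T) ×ˢ univ] (s, p))
      (𝓝[K] (s, ctr m p)) :=
    tendsto_nhdsWithin_iff.2 ⟨hc.tendsto.mono_left nhdsWithin_le_nhds, hK'.mono fun _ h => h.2⟩
  have h3 := (h1.continuousOn _ hm).tendsto.comp h2
  have e : ∀ q : ℝ × S, q.2 ∈ (cht m p).source ∧ (q.1, cht m p q.2) ∈ K →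
      sffSq (amet T gbar P q.1) (rep m (m + 1) (x (tau T q.1)) p P) k (cht m p q.2) =
        normCovSecondFund g (normalizedFlow T ψ x q.1) k q.2 ^ 2 := fun q hq => by
    have h4 := normCov_sq hT hx hsol hq.2.1 k hq.2.2
    rw [← h4, (cht m p).left_inv hq.1]
  have e0 := e (s, p) ⟨mem_chart_source _ p, hm⟩
  change Tendsto _ _ (𝓝 (normCovSecondFund g (normalizedFlow T ψ x (s, p).1) k (s, p).2 ^ 2))
  rw [← e0]
  exact h3.congr' (hK'.mono fun q hq => e q hq)

/-- The inductive step: a bound on the derivatives of order at most `k` yields a bound on the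
derivative of order `k + 1`. -/
theorem exists_normCov_succ_le [CompactSpace S] (hg : HasBoundedGeometry g)
    (hw : ∀ j : ℕ, ∃ C' : ℝ, 0 < C' ∧ ∀ p : M, normCovDiffSq g w j p ≤ C') (k : ℕ)
    (ih : ∀ j ≤ k, ∃ C : ℝ, ∀ s : ℝ, -Real.log T ≤ s → ∀ p : S,
      normCovSecondFund g (normalizedFlow T ψ x s) j p ≤ C) :
    ∃ C : ℝ, ∀ s : ℝ, -Real.log T ≤ s → ∀ p : S,
      normCovSecondFund g (normalizedFlow T ψ x s) (k + 1) p ≤ C := by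
  -- The family is indexed by all points of space-time after the initial time, each with its own
  -- charts; bounds for the family are therefore uniform in `s` and in the point.
  let Θ := {θ : ℝ × S // -Real.log T < θ.1}
  let P : Θ → M := fun θ => x (tau T θ.1.1) θ.1.2
  let K : Θ → Set (ℝ × EuclideanSpace ℝ (Fin m)) := fun θ =>
    fdom m (m + 1) (Ioi (-Real.log T)) (fun s => x (tau T s)) θ.1.2 (P θ)
  let ξ : Θ → ℝ → EuclideanSpace ℝ (Fin m) → EuclideanSpace ℝ (Fin (m + 1)) := fun θ s =>
    rep m (m + 1) (x (tau T s)) θ.1.2 (P θ)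
  let I : Θ → Imm (ℝ × EuclideanSpace ℝ (Fin m)) (ℝ × EuclideanSpace ℝ (Fin (m + 1))) (Fin m)
    (Fin (m + 1)) := fun θ => spt (K θ) (θ.1.1, ctr m θ.1.2) (adom (m + 1) (P θ))
      (amet T gbar (P θ)) (ξ θ)
  have hmem : ∀ θ : Θ, (θ.1.1, ctr m θ.1.2) ∈ K θ := fun θ => ⟨θ.2, ctr_mem_dom (m := m) _ _⟩
  have htr : ∀ θ : Θ, IsTrack (K θ) (adom (m + 1) (P θ)) (amet T gbar (P θ)) (ξ θ) := fun θ =>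
    isTrack_flow hT hx hsol _ _
  have hflow : ∀ θ, (I θ).Flow (1, 0) (1, 0) (avel T gbar wbar (P θ)) := fun θ =>
    (htr θ).flow (fun q hq => flow_eq hT hx hsol hq) (fun q hq a b => amet_fderiv hsol hq a b)
      (hmem θ)
  have hG : ∀ θ, (I θ).geo.Good := fun θ => (hflow θ).good.good
  have hsm : ∀ θ, Sm (I θ).geo.Ω (I θ).A := fun θ => (hflow θ).good.sm_A
  have hsq : ∀ θ : Θ, ∀ j, ∀ q ∈ K θ, (I θ).geo.sqIter j (I θ).A q =
      normCovSecondFund g (normalizedFlow T ψ x q.1) j ((cht m θ.1.2).symm q.2) ^ 2 :=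
    fun θ j q hq => ((htr θ).sqIter_eq hq j (hmem θ)).trans
      (normCov_sq hT hx hsol (le_of_lt hq.1) j hq.2).symm
  have hnm : ∀ θ : Θ, ∀ j, (I θ).geo.nmIter j (I θ).A =
      normCovSecondFund g (normalizedFlow T ψ x θ.1.1) j θ.1.2 := fun θ j => by
    refine (sq_eq_sq₀ (Geo.nmIter_nonneg _ _) (show 0 ≤ normCovSecondFund g
      (normalizedFlow T ψ x θ.1.1) j θ.1.2 from Real.sqrt_nonneg _)).1 ?_
    rw [(hG θ).nmIter_sq]
    refine (hsq θ j _ (hmem θ)).trans ?_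
    rw [cht_symm_ctr]
  let b : Θ → ℝ := fun θ => 1 + (I θ).geo.nmIter (k + 1) (I θ).A
  have hb : ∀ θ, 1 ≤ b θ := fun θ => le_add_of_nonneg_right (Geo.nmIter_nonneg _ _)
  -- The inductive hypothesis bounds the orders up to `k`; at the top order the weight `b` was
  -- chosen so that the bound holds with constant `1`.
  have hA : UL (fun θ => (I θ).geo) b (k + 1) fun θ => (I θ).A := by
    refine UL.of_nmIter hG hsm (fun j hj => ?_) ⟨1, fun θ => ?_⟩
    · obtain ⟨C, hC⟩ := ih j (Nat.lt_succ_iff.1 hj)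
      exact ⟨C, fun θ => (hnm θ j).trans_le (hC _ θ.2.le _)⟩
    · rw [one_mul]
      exact le_add_of_nonneg_left zero_le_one
  have hq' : ∀ θ, (I θ).u (I θ).pt ∈ adom (m + 1) (P θ) := fun θ => (htr θ).maps _ (hmem θ)
  obtain ⟨N, C, hN, hNC⟩ := Imm.exists_heat_bound hflow hb hA
    (fun n => UL.amb_rm hsol hq' hg n) (fun n => UL.avel hsol hq' hg hw n) fun θ => rfl
  obtain ⟨Ck, hCk⟩ := ih k le_rfl
  let φ : ℕ → ℝ × S → ℝ := fun j q => normCovSecondFund g (normalizedFlow T ψ x q.1) j q.2 ^ 2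
  -- The multiple `N` of the lower order term supplies the negative multiple of `|∇^{k+1} 𝒜|²`
  -- needed in the evolution inequality.
  let Φ : ℝ × S → ℝ := fun q => φ (k + 1) q + N * φ k q
  have hΦ : ContinuousOn Φ (Ici (-Real.log T) ×ˢ univ) :=
    (continuousOn_normCov_sq hT hx hsol (k + 1)).add
      (continuousOn_const.mul (continuousOn_normCov_sq hT hx hsol k))
  -- Bound at the initial time, by compactness of the hypersurface.
  obtain ⟨B, hB⟩ : ∃ B, ∀ p : S, Φ (-Real.log T, p) ≤ B := by
    have h1 : ContinuousOn (fun p : S => Φ (-Real.log T, p)) univ :=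
      hΦ.comp (Continuous.prodMk_right _).continuousOn fun p _ => ⟨mem_Ici.2 le_rfl, mem_univ p⟩
    obtain ⟨B, hB⟩ := isCompact_univ.bddAbove_image h1
    exact ⟨B, fun p => hB (mem_image_of_mem _ (mem_univ p))⟩
  have key : ∀ s : ℝ, -Real.log T ≤ s → ∀ p : S, Φ (s, p) ≤ max B (C + N * Ck ^ 2) := by
    intro s hs p
    -- The maximum is taken up to the time `s` only; the bound obtained does not involve `s`.
    obtain ⟨⟨s₁, p₁⟩, hm₁, hmax⟩ := (isCompact_Icc.prod isCompact_univ).exists_isMaxOn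
      (s := Icc (-Real.log T) s ×ˢ (univ : Set S)) ⟨(s, p), ⟨hs, le_rfl⟩, mem_univ _⟩
      (hΦ.mono (prod_mono Icc_subset_Ici_self le_rfl))
    have hle : Φ (s, p) ≤ Φ (s₁, p₁) := hmax ⟨⟨hs, le_rfl⟩, mem_univ _⟩
    have hs₁ : s₁ ∈ Icc (-Real.log T) s := hm₁.1
    -- Either the maximum is attained initially, where `B` applies, or later, where the differential
    -- inequality is available.
    rcases hs₁.1.eq_or_lt with h0 | h0
    · subst h0
      exact hle.trans ((hB p₁).trans (le_max_left _ _))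
    refine hle.trans (le_trans ?_ (le_max_right _ _))
    set θ : Θ := ⟨(s₁, p₁), h0⟩ with hθ
    have hsmφ : ∀ j, ContDiffOn ℝ ∞ ((I θ).geo.sqIter j (I θ).A) (I θ).geo.Ω := fun j =>
      (hG θ).sm_sqIter (hsm θ)
    set U : ℝ × EuclideanSpace ℝ (Fin m) → ℝ := fun z =>
      (I θ).geo.sqIter (k + 1) (I θ).A z + N * (I θ).geo.sqIter k (I θ).A z with hU
    have hsmU : ContDiffOn ℝ ∞ U (I θ).geo.Ω := (hsmφ _).add (contDiffOn_const.mul (hsmφ _))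
    have hpt : (I θ).geo.pt = (s₁, ctr m p₁) := rfl
    have hUΦ : ∀ q ∈ K θ, U q = Φ (q.1, (cht m p₁).symm q.2) := fun q hq => by
      simp only [hU, hsq θ _ q hq]
      rfl
    have hU0 : U (s₁, ctr m p₁) = Φ (s₁, p₁) := by rw [hUΦ _ (hmem θ), cht_symm_ctr]
    have hUle : ∀ q ∈ K θ, q.1 ≤ s₁ → U q ≤ U (s₁, ctr m p₁) := fun q hq hq1 => by
      rw [hU0, hUΦ q hq]
      exact hmax ⟨⟨le_of_lt hq.1, hq1.trans hs₁.2⟩, mem_univ _⟩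
    have hd : ∀ j, DifferentiableAt ℝ ((I θ).geo.sqIter j (I θ).A) (s₁, ctr m p₁) := fun j =>
      ((hsmφ j).contDiffAt ((hG θ).isOpen.mem_nhds (hmem θ))).differentiableAt (by simp)
    have hdU : fderiv ℝ U (s₁, ctr m p₁) (1, 0) =
        fderiv ℝ ((I θ).geo.sqIter (k + 1) (I θ).A) (s₁, ctr m p₁) (1, 0) +
          N * fderiv ℝ ((I θ).geo.sqIter k (I θ).A) (s₁, ctr m p₁) (1, 0) := by
      have h1 : HasFDerivAt U _ _ := (hd (k + 1)).hasFDerivAt.add ((hd k).hasFDerivAt.const_mul N)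
      rw [h1.fderiv]
      rfl
    -- The time `s₁` may be the end of the interval, so only earlier times are compared and the
    -- derivative is nonnegative rather than zero.
    have htime : 0 ≤ fderiv ℝ U (s₁, ctr m p₁) (1, 0) := by
      have h1 : HasDerivAt (fun σ => U (σ, ctr m p₁)) (fderiv ℝ U (s₁, ctr m p₁) (1, 0)) s₁ :=
        HasFDerivAt.comp_hasDerivAt (f := fun σ : ℝ => (σ, ctr m p₁)) s₁
          ((hsmU.contDiffAt ((hG θ).isOpen.mem_nhds (hmem θ))).differentiableAt (by simp)).hasFDerivAt
          ((hasDerivAt_id s₁).prodMk (hasDerivAt_const s₁ (ctr m p₁)))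
      refine HasDerivAt.nonneg_of_left_max h1 ?_
      have h2 : ∀ᶠ σ in 𝓝 s₁, (σ, ctr m p₁) ∈ K θ :=
        (((htr θ).isOpen).preimage (Continuous.prodMk_left (ctr m p₁))).mem_nhds (hmem θ)
      filter_upwards [nhdsWithin_le_nhds h2, self_mem_nhdsWithin] with σ hσ hσ'
      exact hUle _ hσ hσ'
    -- Variations along the spatial directions keep the time fixed at `s₁`, so every nearby point is
    -- admissible in the comparison.
    have hlap : (I θ).geo.lapFun U (s₁, ctr m p₁) ≤ 0 := by
      refine (hG θ).lapFun_nonpos hsmU fun c => ?_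
      have h1 : ∀ t : ℝ, (I θ).geo.pt + t • ∑ i, c i • (I θ).geo.d i =
          (s₁, ctr m p₁ + t • WithLp.toLp 2 c) := fun t => by
        change (s₁, ctr m p₁) + t • ∑ i, (WithLp.toLp 2 c : EuclideanSpace ℝ (Fin m)) i • ssgl m i
          = _
        rw [ssgl_sum]
        simp
      have h2 : ContinuousAt (fun t : ℝ => (s₁, ctr m p₁ + t • WithLp.toLp 2 c)) 0 := by fun_prop
      have h3 : ∀ᶠ t : ℝ in 𝓝 0, (s₁, ctr m p₁ + t • WithLp.toLp 2 c) ∈ K θ :=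
        h2.eventually ((htr θ).isOpen.mem_nhds (by simpa using hmem θ))
      filter_upwards [h3] with t ht
      simp only [h1, zero_smul, add_zero]
      exact hUle _ ht le_rfl
    have hlapU : (I θ).geo.lapFun U (s₁, ctr m p₁) = _ :=
      (hG θ).lapFun_add_mul (hsmφ (k + 1)) (hsmφ k) N
    have h1 := hNC θ
    change (fderiv ℝ _ (s₁, ctr m p₁) (1, 0) - (I θ).geo.lapFun _ (s₁, ctr m p₁)) +
      N * (fderiv ℝ _ (s₁, ctr m p₁) (1, 0) - (I θ).geo.lapFun _ (s₁, ctr m p₁)) ≤ _ at h1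
    rw [hpt] at hlapU
    rw [hnm θ] at h1
    -- At the maximum the heat operator applied to `U` is nonnegative, so the inequality leaves
    -- `|∇^{k+1} 𝒜|² ≤ C` there.
    have h2 : normCovSecondFund g (normalizedFlow T ψ x s₁) (k + 1) p₁ ^ 2 ≤ C := by
      change _ ≤ C - normCovSecondFund g (normalizedFlow T ψ x s₁) (k + 1) p₁ ^ 2 at h1
      linarith
    have h3 : φ k (s₁, p₁) ≤ Ck ^ 2 := pow_le_pow_left₀ (show 0 ≤ normCovSecondFund g
      (normalizedFlow T ψ x s₁) k p₁ from Real.sqrt_nonneg _) (hCk s₁ h0.le p₁) 2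
    exact add_le_add h2 (mul_le_mul_of_nonneg_left h3 hN)
  -- The term of order `k` in `Φ` is nonnegative, so `|∇^{k+1} 𝒜|²` is bounded by `Φ`.
  refine ⟨Real.sqrt (max B (C + N * Ck ^ 2)), fun s hs p => Real.le_sqrt_of_sq_le ?_⟩
  refine le_trans ?_ (key s hs p)
  exact le_add_of_nonneg_right (mul_nonneg hN (sq_nonneg _))

end MaximumPrinciple

end ExtRicciMCF

end

theorem proposition3p3 {m : ℕ} (hm : 3 ≤ m + 1)
    {M : Type*} [TopologicalSpace M] [T2Space M] [SecondCountableTopology M]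
    [ChartedSpace (EuclideanSpace ℝ (Fin (m + 1))) M] [IsManifold (𝓡 (m + 1)) ∞ M]
    {S : Type*} [TopologicalSpace S] [T2Space S] [CompactSpace S]
    [ChartedSpace (EuclideanSpace ℝ (Fin m)) S] [IsManifold (𝓡 m) ∞ S]
    (g : RMetric (m + 1) M) (hg : HasBoundedGeometry g)
    (T : ℝ) (hT : 0 < T) (w f : M → ℝ)
    (ψ : ℝ → M ≃ₘ^∞⟮𝓡 (m + 1), 𝓡 (m + 1)⟯ M)
    (gbar : ℝ → RMetric (m + 1) M) (wbar : ℝ → M → ℝ)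
    (hsol : IsShrinkingSelfSimilar T g w f ψ gbar wbar)
    (hw : ∀ j : ℕ, ∃ C' : ℝ, 0 < C' ∧ ∀ p : M, normCovDiffSq g w j p ≤ C')
    (x : ℝ → S → M) (hx : IsMCF T gbar x) (hI : IsTypeI T gbar x) :
    ∀ k : ℕ, ∃ C : ℝ, 0 < C ∧ ∀ s : ℝ, -Real.log T ≤ s → ∀ p : S,
      normCovSecondFund g (normalizedFlow T ψ x s) k p ≤ C := by
  have key : ∀ k : ℕ, ∃ C : ℝ, ∀ s : ℝ, -Real.log T ≤ s → ∀ p : S,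
      normCovSecondFund g (normalizedFlow T ψ x s) k p ≤ C := fun k => by
    -- Strong induction, since the source terms involve all lower orders; order zero is the type I
    -- condition.
    induction k using Nat.strong_induction_on with
    | _ k ih =>
      rcases k with _ | k
      · exact normCov_zero_le hT hx hsol hI
      · exact exists_normCov_succ_le hT hx hsol hg hw k fun j hj => ih j (Nat.lt_succ_of_le hj)
  intro k
  obtain ⟨C, hC⟩ := key k
  exact ⟨max C 1, lt_max_of_lt_right one_pos, fun s hs p => (hC s hs p).trans (le_max_left _ _)⟩
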